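/- Let $\varphi:\mathbb R\to(0,\infty)$ be a measurable, bounded, even probability density with distribution function $\Phi$, such that for every $\varepsilon>0$ there is $c_\varepsilon>0$ with $\varphi(x)\ge c_\varepsilon\Phi(x)^{1+\varepsilon}$ for all $x\le 0$. Let $p\ge 1$, $q>1$, $\alpha\in(0,1)$, $\varepsilon>0$ and let $b\ge 2$ be an integer. **Importance sampling.** For $u\in(0,1/2]$ put $\eta(u)=2^{-p-2}u^{-p-1}\exp(2^p-u^{-p})$, and $\eta(0)=0$. For $\theta\in(0,1/2]$ let $w_\theta$ on $(0,1)$ be $(1-\theta)^{-1}\eta(u/\theta)$ on $(0,\theta/2]$, $(1-\theta)^{-1}(1-\eta(1-u/\theta))$ on $(\theta/2,\theta)$, $(1-\theta)^{-1}$ on $[\theta,1/2]$, and $w_\theta(1-u)$ on $(1/2,1)$; put $T_\theta(u)=\Phi^{-1}\big(\int_0^u w_\theta(t)\,dt\big)$. For $\theta_1,\dots,\theta_s\in(0,1/2]$ and $f:\mathbb R^s\to\mathbb R$ let $f^w(u)=\prod_{j=1}^s w_{\theta_j}(u_j)\, f(T_{\theta_1}(u_1),\dots,T_{\theta_s}(u_s))$.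 **Norms.** Let $W^{1,q}_{\mathrm{mix}}(\mathbb R^s,\varphi)$ be the space of $f$ whose weak mixed derivatives $\partial^v f$, $v\subseteq\{1,\dots,s\}$ (each coordinate in $v$ differentiated once), all lie in $L^q$ of the probability measure $\prod_j\varphi(x_j)\,dx$, with norm $\|f\|_W=\big(\sum_v\int|\partial^vf|^q\prod_j\varphi(x_j)\,dx\big)^{1/q}$. Let $P_j$ integrate out $x_j$ against $\varphi$, $P_u=\prod_{j\in u}P_j$, and let $f_v=\prod_{j\in v}(I-P_j)\,P_{v^c}f$ be the ANOVA terms of $f$. Put $\|f\|_q=\max_v\|f_v\|_W$, and $\gamma_v=\|f_v\|_W/\|f\|_q$ if $\|f\|_q>0$, $\gamma_v=0$ otherwise. **Points.** Let $m\ge1$, $n=b^m$, and let $x_0,\dots,x_{n-1}\in[0,1)^s$ be points whose projection onto the coordinates in $\omega$ is, for every $\emptyset\ne\omega\subseteq\{1,\dots,s\}$, a $(t_\omega,m,|\omega|)$-net in base $b$: $t_\omega\in\{0,\dots,m\}$, and every elementary interval $\prod_{j\in\omega}[a_jb^{-k_j},(a_j+1)b^{-k_j})$ with integers $k_j\ge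 0$, $0\le a_j<b^{k_j}$ and $\sum_{j\in\omega} k_j=m-t_\omega$ contains exactly $b^{t_\omega}$ of the projected points (as for any digital net with quality parameters $t_\omega$). Let $u_0,\dots,u_{n-1}$ be obtained from them by Owen's scrambling in base $b$: the $k$-th base-$b$ digit of each coordinate $j$ is permuted by a random permutation of $\{0,\dots,b-1\}$ attached to $j$ and to the preceding $k-1$ digits, all these permutations being uniform and mutually independent. **Claim.** For every $\lambda\in(0,1)$ there is a constant $C_\lambda$ depending only on $\lambda$, and there is a constant $C_*>0$ depending only on $\varphi,\varepsilon,p,q,b,\alpha$, such that the following holds for all $s$, $m\ge 1$, all points as above, all $\theta_j\in(0,1/2]$ and all $f\in W^{1,q}_{\mathrm{mix}}(\mathbb R^s,\varphi)$. If $t_1,\dots,t_s$ and $\Gamma_1,\dots,\Gamma_s$ are real numbers with $t_\omega\le\sum_{j\in\omega}t_j$ for all nonempty $\omega$ and $\gamma_v\le\prod_{j\in v}\Gamma_j$ for all $v\subseteq\{1,\dots,s\}$, then for every $\lambda\in(0,1)$ $$\mathbb E\Big|\frac1n\sum_{i=0}^{n-1}f^w(u_i)-\int_{\mathbb R^s}f(x)\prod_{j=1}^s\varphi(x_j)\,dx\Big|^2\le\frac{\|f\|_q^2}{n^{1+\alpha}}\exp\big(C_\lambda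 S_\lambda m^\lambda\big),$$ where $S_\lambda=\sum_{j=1}^s\tilde\Gamma_j^\lambda$, $\tilde\Gamma_j=C_*b^{(1+\alpha)t_j}\big(\Gamma_j^2\theta_j^{-\nu_{\alpha,q}-\varepsilon}+\theta_j^{1-\alpha}\big)$ and $\nu_{\alpha,q}=\max(2\alpha/q,\;2/q+\alpha-1)$; the integrals on both sides of the difference exist. Consequently, for all $\lambda\in(0,1)$, $B$ and $\delta>0$ there is a constant $K$, depending only on $\lambda,B,\delta,\varphi,\varepsilon,p,q,b,\alpha$ and in particular not on $s$, such that whenever $S_\lambda\le B$ the mean squared error is at most $K\|f\|_q^2\,n^{-1-\alpha+\delta}$. -/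

import Mathlib

open MeasureTheory ProbabilityTheory
open scoped ContDiff

namespace BDIS

/-! ### The density and its distribution function -/

/-- The cumulative distribution function `Φ` of the density `φ`. -/
noncomputable def cdfOf (φ : ℝ → ℝ) (x : ℝ) : ℝ := ∫ y in Set.Iic x, φ y

/-- The quantile function `Φ⁻¹` on `(0,1)`. -/
noncomputable def quantile (φ : ℝ → ℝ) (u : ℝ) : ℝ := sInf {x : ℝ | u ≤ cdfOf φ x}

/-- `φ` is a strictly positive, symmetric, bounded, light-tailed probability density. -/
structure IsLightTailedDensity (φ : ℝ → ℝ) : Prop where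
  measurable : Measurable φ
  integral_eq_one : ∫ x, φ x = 1
  pos : ∀ x, 0 < φ x
  symm : ∀ x, φ (-x) = φ x
  bounded : BddAbove (Set.range φ)
  light_tail : ∀ ε : ℝ, 0 < ε → ∃ c : ℝ, 0 < c ∧ ∀ x : ℝ, x ≤ 0 → c * cdfOf φ x ^ (1 + ε) ≤ φ x

/-- The product probability measure on `ℝ^s` with density `∏ j, φ (x j)`. -/
noncomputable def prodMeasure (φ : ℝ → ℝ) (s : ℕ) : Measure (Fin s → ℝ) :=
  Measure.pi fun _ => volume.withDensity fun y => ENNReal.ofReal (φ y)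

/-! ### Boundary-damping importance sampling -/

/-- `η_p`, used on `[0, 1/2]`. -/
noncomputable def eta (p u : ℝ) : ℝ :=
  if 0 < u then (2 : ℝ) ^ (-p - 2) * u ^ (-p - 1) * Real.exp ((2 : ℝ) ^ p - u ^ (-p)) else 0

/-- `w_θ` on `(0, 1/2]`. -/
noncomputable def wHalf (p θ u : ℝ) : ℝ :=
  if u ≤ θ / 2 then (1 - θ)⁻¹ * eta p (u / θ)
  else if u < θ then (1 - θ)⁻¹ * (1 - eta p (1 - u / θ))
  else (1 - θ)⁻¹

/-- The one-dimensional weight function `w_θ` on `(0,1)`, symmetric about `1/2`. -/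
noncomputable def wTheta (p θ u : ℝ) : ℝ :=
  if u ≤ 1 / 2 then wHalf p θ u else wHalf p θ (1 - u)

/-- The one-dimensional transport map `T_θ(u) = Φ⁻¹(∫₀ᵘ w_θ)` on `(0,1)`. -/
noncomputable def transport (φ : ℝ → ℝ) (p θ u : ℝ) : ℝ :=
  quantile φ (∫ t in (0 : ℝ)..u, wTheta p θ t)

/-- The transformed integrand `f^w(u) = w(u) f(T(u))`. -/
noncomputable def fW (φ : ℝ → ℝ) (p : ℝ) {s : ℕ} (θ : Fin s → ℝ) (f : (Fin s → ℝ) → ℝ)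
    (u : Fin s → ℝ) : ℝ :=
  (∏ j, wTheta p (θ j) (u j)) * f fun j => transport φ p (θ j) (u j)

/-! ### Weak mixed derivatives and mixed Sobolev norms -/

/-- The classical partial derivative in the direction of coordinate `j`. -/
noncomputable def partialDeriv {s : ℕ} (j : Fin s) (g : (Fin s → ℝ) → ℝ) : (Fin s → ℝ) → ℝ :=
  fun x => fderiv ℝ g x (Pi.single j 1)

/-- The classical mixed derivative `∂^v`, used for test functions. -/
noncomputable def mixedDeriv {s : ℕ} (v : Finset (Fin s)) (g : (Fin s → ℝ) → ℝ) :
    (Fin s → ℝ) → ℝ :=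
  v.sort.foldr partialDeriv g

/-- `g` is a weak mixed derivative `∂^v f` on `ℝ^s`. -/
def HasWeakMixedDeriv {s : ℕ} (v : Finset (Fin s)) (f g : (Fin s → ℝ) → ℝ) : Prop :=
  LocallyIntegrable f ∧ LocallyIntegrable g ∧
    ∀ ψ : (Fin s → ℝ) → ℝ, ContDiff ℝ ∞ ψ → HasCompactSupport ψ →
      ∫ x, f x * mixedDeriv v ψ x = (-1) ^ v.card * ∫ x, g x * ψ x

open Classical in
/-- A chosen version of the weak derivative `∂^v f` (unique almost everywhere). -/
noncomputable def weakDeriv {s : ℕ} (v : Finset (Fin s)) (f : (Fin s → ℝ) → ℝ) :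
    (Fin s → ℝ) → ℝ :=
  if h : ∃ g, HasWeakMixedDeriv v f g then h.choose else 0

/-- `f ∈ W^{1,q}_mix(ℝ^s, φ)`: all weak mixed derivatives `∂^v f` exist and lie in `L^q(ℝ^s, φ)`. -/
def MemWmix (φ : ℝ → ℝ) (q : ℝ) {s : ℕ} (f : (Fin s → ℝ) → ℝ) : Prop :=
  ∀ v : Finset (Fin s), ∃ g, HasWeakMixedDeriv v f g ∧
    MemLp g (ENNReal.ofReal q) (prodMeasure φ s)

/-- The norm of `W^{1,q}_mix(ℝ^s, φ)`. -/
noncomputable def normWmix (φ : ℝ → ℝ) (q : ℝ) {s : ℕ} (f : (Fin s → ℝ) → ℝ) : ℝ :=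
  (∑ v : Finset (Fin s), ∫ x, |weakDeriv v f x| ^ q ∂prodMeasure φ s) ^ (1 / q)

/-! ### ANOVA decomposition -/

/-- `P_v f`: the coordinates in `v` are integrated out against `φ`. (The integral is over all of
`ℝ^s`, but the integrand depends on `y` only through its coordinates in `v`.) -/
noncomputable def partialMean (φ : ℝ → ℝ) {s : ℕ} (v : Finset (Fin s)) (f : (Fin s → ℝ) → ℝ)
    (x : Fin s → ℝ) : ℝ :=
  ∫ y, f (v.piecewise y x) ∂prodMeasure φ s

/-- The ANOVA term `f_v = (∏_{j ∈ v} (I - P_j)) P_{vᶜ} f`, with the product of operators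
multiplied out. -/
noncomputable def anova (φ : ℝ → ℝ) {s : ℕ} (f : (Fin s → ℝ) → ℝ) (v : Finset (Fin s))
    (x : Fin s → ℝ) : ℝ :=
  ∑ w ∈ v.powerset, (-1) ^ (v \ w).card * partialMean φ wᶜ f x

/-- The ANOVA terms satisfy `f_v = P_{vᶜ} f - ∑_{w ⊊ v} f_w`. -/
theorem anova_eq_sub (φ : ℝ → ℝ) {s : ℕ} (f : (Fin s → ℝ) → ℝ) (v : Finset (Fin s))
    (x : Fin s → ℝ) :
    anova φ f v x = partialMean φ vᶜ f x - ∑ w ∈ v.ssubsets, anova φ f w x := by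
  have key : ∑ w ∈ v.powerset, anova φ f w x = partialMean φ vᶜ f x := by
    unfold anova
    rw [Finset.sum_comm' (t' := v.powerset)
      (s' := fun u => v.powerset.filter fun w => u ⊆ w)]
    · rw [Finset.sum_eq_single_of_mem v (by simp)]
      · have : (v.powerset.filter fun w => v ⊆ w) = {v} := by
          ext w
          simp only [Finset.mem_filter, Finset.mem_powerset, Finset.mem_singleton]
          exact ⟨fun h => h.1.antisymm h.2, fun h => by simp [h]⟩
        simp [this]
      · intro u hu huv
        have huv' : u ⊆ v := Finset.mem_powerset.1 hu
        rw [← Finset.sum_mul]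
        have : ∑ w ∈ v.powerset.filter (fun w => u ⊆ w), (-1 : ℝ) ^ (w \ u).card
            = ∑ a ∈ (v \ u).powerset, (-1 : ℝ) ^ a.card := by
          refine Finset.sum_bij' (fun w _ => w \ u) (fun a _ => a ∪ u) ?_ ?_ ?_ ?_ ?_
          · intro w hw
            simp only [Finset.mem_filter, Finset.mem_powerset] at hw ⊢
            exact Finset.sdiff_subset_sdiff hw.1 (le_refl u)
          · intro a ha
            simp only [Finset.mem_filter, Finset.mem_powerset] at ha ⊢
            exact ⟨Finset.union_subset (ha.trans Finset.sdiff_subset) huv',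
              Finset.subset_union_right⟩
          · intro w hw
            simp only [Finset.mem_filter, Finset.mem_powerset] at hw
            exact Finset.sdiff_union_of_subset hw.2
          · intro a ha
            simp only [Finset.mem_powerset] at ha
            ext i
            have := @ha i
            simp only [Finset.mem_sdiff, Finset.mem_union] at this ⊢
            tauto
          · intro w hw
            rfl
        have hne : (v \ u).Nonempty := by
          rw [Finset.sdiff_nonempty]
          exact fun h => huv (huv'.antisymm h)
        have hz := Finset.sum_powerset_neg_one_pow_card_of_nonempty hne
        have hz' : ∑ a ∈ (v \ u).powerset, (-1 : ℝ) ^ a.card = 0 := by exact_mod_cast hz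
        rw [this, hz', zero_mul]
    · intro w u
      simp only [Finset.mem_powerset, Finset.mem_filter]
      exact ⟨fun h => ⟨⟨h.1, h.2⟩, h.2.trans h.1⟩, fun h => ⟨h.1.1, h.1.2⟩⟩
  rw [← key, Finset.ssubsets, ← Finset.add_sum_erase _ _ (Finset.mem_powerset_self v)]
  ring

/-- `‖f‖_q = sup_v ‖f_v‖_{W^{1,q}_mix(ℝ^s, φ)}` (a maximum over finitely many `v`). -/
noncomputable def normQ (φ : ℝ → ℝ) (q : ℝ) {s : ℕ} (f : (Fin s → ℝ) → ℝ) : ℝ :=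
  ⨆ v : Finset (Fin s), normWmix φ q (anova φ f v)

open Classical in
/-- The adjusted norm `γ_v` of the ANOVA term `f_v`. -/
noncomputable def gammaCoef (φ : ℝ → ℝ) (q : ℝ) {s : ℕ} (f : (Fin s → ℝ) → ℝ)
    (v : Finset (Fin s)) : ℝ :=
  if 0 < normQ φ q f then (normQ φ q f)⁻¹ * normWmix φ q (anova φ f v) else 0

/-! ### Scrambled nets -/

/-- The points `x i`, `i < b^m`, form a `(t, m, |ι|)`-net in base `b`: they lie in `[0,1)^ι`, and
every elementary interval of volume `b^(t-m)` contains exactly `b^t` of them. -/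
def IsNet (b t m : ℕ) {ι : Type} [Fintype ι] (x : Fin (b ^ m) → ι → ℝ) : Prop :=
  t ≤ m ∧ (∀ i j, x i j ∈ Set.Ico (0 : ℝ) 1) ∧
    ∀ k a : ι → ℕ, (∑ j, k j) + t = m → (∀ j, a j < b ^ k j) →
      Nat.card {i // ∀ j, (a j : ℝ) / b ^ k j ≤ x i j ∧ x i j < ((a j : ℝ) + 1) / b ^ k j} = b ^ t

/-- The random permutations used by Owen's scrambling in base `b`: one for every coordinate `j` and
every finite string of leading digits, all uniform on the permutations of the digits and mutually
independent. -/
structure IsScrambling {Ω : Type*} [MeasurableSpace Ω] (P : Measure Ω) {s b : ℕ}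
    (perm : Fin s × List (Fin b) → Ω → Equiv.Perm (Fin b)) : Prop where
  measurable : ∀ i σ, MeasurableSet (perm i ⁻¹' {σ})
  uniform : ∀ i σ, P (perm i ⁻¹' {σ}) = ((b.factorial : ENNReal))⁻¹
  indep : iIndepFun (β := fun _ => Equiv.Perm (Fin b)) (m := fun _ => ⊤) perm P

/-- The scrambled point: the `k`-th base-`b` digit of the coordinate `x j` is permuted by the
permutation attached to `j` and the preceding digits of `x j`. -/
noncomputable def scramble {s b : ℕ} [NeZero b] (perm : Fin s × List (Fin b) → Equiv.Perm (Fin b))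
    (x : Fin s → ℝ) (j : Fin s) : ℝ :=
  Real.ofDigits fun k : ℕ =>
    perm (j, List.ofFn fun i : Fin k => Real.digits (x j) b i) (Real.digits (x j) b k)

/-! ### Quantities in the error bound -/

/-- `ν_{α,q}`. -/
noncomputable def nu (α q : ℝ) : ℝ := max (2 * α / q) (2 / q + α - 1)

/-- `Γ̃_j`, in terms of `t_j`, `Γ_j` and `θ_j`. -/
noncomputable def gammaTilde (Cstar : ℝ) (b : ℕ) (α q ε tj Γj θj : ℝ) : ℝ :=
  Cstar * (b : ℝ) ^ ((1 + α) * tj) * (Γj ^ 2 * θj ^ (-nu α q - ε) + θj ^ (1 - α))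

/-- The estimator `n⁻¹ ∑ i, f^w(u_i)` for the points `u_i` obtained by scrambling `x_i`. -/
noncomputable def estimator (φ : ℝ → ℝ) (p : ℝ) {s b m : ℕ} [NeZero b] (θ : Fin s → ℝ)
    (f : (Fin s → ℝ) → ℝ) (x : Fin (b ^ m) → Fin s → ℝ)
    (perm : Fin s × List (Fin b) → Equiv.Perm (Fin b)) : ℝ :=
  ((b : ℝ) ^ m)⁻¹ * ∑ i, fW φ p θ f (scramble perm (x i))

/-- The squared error `|n⁻¹ ∑ i, f^w(u_i) - ∫ f(y) ∏ φ(y_j) dy|²` for given permutations. -/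
noncomputable def sqError (φ : ℝ → ℝ) (p : ℝ) {s b m : ℕ} [NeZero b] (θ : Fin s → ℝ)
    (f : (Fin s → ℝ) → ℝ) (x : Fin (b ^ m) → Fin s → ℝ)
    (perm : Fin s × List (Fin b) → Equiv.Perm (Fin b)) : ℝ :=
  |estimator φ p θ f x perm - ∫ y, f y * ∏ j, φ (y j)| ^ 2

/-- `S_λ = ∑ j, Γ̃_j ^ λ`. -/
noncomputable def sumS (Cstar : ℝ) (b : ℕ) (α q ε : ℝ) {s : ℕ} (tj Γ θ : Fin s → ℝ)
    (lam : ℝ) : ℝ :=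
  ∑ j, gammaTilde Cstar b α q ε (tj j) (Γ j) (θ j) ^ lam

end BDIS

/-! Write `μ` for the probability measure with density `∏ φ`, `Φ` for the distribution function,
`τ(y) = min (Φ y) (1 - Φ y)`, and `ω` for a set of coordinates.

Representation. In one variable a function of mean zero is recovered from its derivative by `g(x) =
∫ k(x,y) g'(y) φ(y) dy`, where `k(x,y) = (Φ(y) - 1[x<y]) / φ(y)`. In `s` variables this gives `f = ∑
f_v` with `f_v(x) = ∫ ∏_{j∈v} k(x_j,y_j) G_v(y) dμ(y)` and `G_v = P_{vᶜ} ∂^v f = ∂^v f_v`. Hence the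
`L^q` norm of `G_v` is at most `‖f_v‖_W = γ_v ‖f‖_q` (`ae_eq_sum_rep`, `anova_eq_rep`,
`exists_anova_rep`). The light-tail condition bounds `|k(x,y)|` by `C τ(x)^(-(1-a/2)) τ(y)^(-a)`,
and Hölder makes all integrals converge as soon as `a q' < 1`.

Expansion of the error. The map `T_θ` carries `w_θ(u) du` to `φ(x) dx`. Writing each weight outside
`v` as `1 + (w_j - 1)` turns `f^w - ∫ f ∏ φ` into a sum, over nonempty `ω` and `v ⊆ ω`, of integrals
against `G_v` of `∏_{j∈v} ψ_j(u_j,y_j) ∏_{j∈ω\v} (w_j(u_j) - 1)`, where `ψ(u,y) = w(u) k(T(u),y)`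
(`fW_sub_integral_eq`). Every factor has mean zero in `u_j`.

Scrambled nets. Scrambling makes each point uniform and treats the coordinates independently, so
terms with different `ω` are uncorrelated. In one coordinate, let `Q_k` be the projection to
functions that are constant on `b`-adic intervals of length `b^(-k)`. The mixed moment of two
scrambled points is a sum over levels `k` of a coefficient depending only on the number of common
digits, times the increment of `⟨Q_k h, Q_k g⟩` (`exists_pair_expansion`). Multiplied over `j ∈ ω`
and summed over pairs of net points, the terms with `∑ (k_j+1) + t_ω ≤ m` cancel exactly. The
remaining terms are bounded by counting points in boxes (`abs_sum_sum_prod_le`). If `‖h - Q_k h‖² ≤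
b^(-αk) A²` in every coordinate, the outcome, divided by `n²`, is `n^(-1-α)` times a product over
`ω` and a power of `b^(t_ω)`.

Size of the factors. The quantity `‖h - Q_k h‖²` is at most the second moment of `h` and at most
`b^(-k)` times its squared variation; interpolation yields the rate `b^(-αk)`. For `w - 1` the
second moment is at most `2θ` and the variation at most `4`, whence the term `θ^(1-α)`. Up to sign
`φ(y) ψ(·,y)` is `w 1_S - τ w`, where `S` is an end interval of `w`-mass `τ = τ(y)`. On `(0,1/2]`
the weight is at most `C (W/θ)^κ` for any `κ` in `[0,1)`, where `W` is its primitive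
(`exists_wTheta_le`). Dividing by `φ(y)²` leaves `θ^(-κ(1+α)) τ^(-2a)` for any `a` with `2a >
(1+α)(1-κ)`. Hölder needs `a < 1 - 1/q`, so `κ(1+α)` has to exceed `2/q + α - 1`: this is the origin
of `ν` (`exists_exponents`).

Summation. The sum over `ω` of `∏_{j∈ω} m Γ̃_j` is at most `∏ (1 + m Γ̃_j) ≤ exp(m^λ S_λ / λ)`, free
of the dimension and with `C_λ = 1/λ`. Since `m^λ = o(m)`, this is at most a constant times `n^δ`
when `S_λ ≤ B`. -/

namespace BDIS

/-! ### The density, as a measure on the line and on the product space -/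

/-- The probability measure on `ℝ` with density `φ`. -/
noncomputable def nuOf (φ : ℝ → ℝ) : Measure ℝ := volume.withDensity fun y => ENNReal.ofReal (φ y)

theorem prodMeasure_eq_pi (φ : ℝ → ℝ) (s : ℕ) :
    prodMeasure φ s = Measure.pi fun _ => nuOf φ := rfl

namespace IsLightTailedDensity

variable {φ : ℝ → ℝ} (hφ : IsLightTailedDensity φ)
include hφ

theorem nonneg (x : ℝ) : 0 ≤ φ x := (hφ.pos x).le

theorem integrable : Integrable φ := integrable_of_integral_eq_one hφ.integral_eq_one

theorem nuOf_apply {S : Set ℝ} (hS : MeasurableSet S) :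
    nuOf φ S = ENNReal.ofReal (∫ x in S, φ x) := by
  rw [nuOf, withDensity_apply _ hS,
    ofReal_integral_eq_lintegral_ofReal hφ.integrable.integrableOn
      (Filter.Eventually.of_forall hφ.nonneg)]

theorem isProbabilityMeasure_nuOf : IsProbabilityMeasure (nuOf φ) :=
  ⟨by rw [hφ.nuOf_apply MeasurableSet.univ]; simp [hφ.integral_eq_one]⟩

theorem integral_nuOf (g : ℝ → ℝ) : ∫ x, g x ∂nuOf φ = ∫ x, φ x * g x := by
  rw [nuOf, integral_withDensity_eq_integral_toReal_smul hφ.measurable.ennreal_ofReal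
    (Filter.Eventually.of_forall fun _ => ENNReal.ofReal_lt_top)]
  simp [ENNReal.toReal_ofReal (hφ.nonneg _)]

theorem prodMeasure_eq_withDensity (s : ℕ) :
    prodMeasure φ s = (volume : Measure (Fin s → ℝ)).withDensity
      fun x => ENNReal.ofReal (∏ j, φ (x j)) := by
  have := hφ.isProbabilityMeasure_nuOf
  rw [prodMeasure_eq_pi]
  refine Measure.pi_eq fun S hS => ?_
  have hint : Integrable fun x : Fin s → ℝ => ∏ j, φ (x j) :=
    Integrable.fintype_prod fun _ => hφ.integrable
  rw [withDensity_apply _ (MeasurableSet.univ_pi hS),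
    ← ofReal_integral_eq_lintegral_ofReal hint.integrableOn
      (Filter.Eventually.of_forall fun x => Finset.prod_nonneg fun j _ => hφ.nonneg _),
    ← integral_indicator (MeasurableSet.univ_pi hS)]
  have : (fun x : Fin s → ℝ => (Set.univ.pi S).indicator (fun x => ∏ j, φ (x j)) x)
      = fun x => ∏ j, (S j).indicator φ (x j) := by
    ext x
    by_cases h : ∀ j, x j ∈ S j
    · rw [Set.indicator_of_mem (by simpa using h)]
      exact Finset.prod_congr rfl fun j _ => (Set.indicator_of_mem (h j) _).symm
    · rw [Set.indicator_of_notMem (by simpa using h)]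
      push Not at h
      obtain ⟨j, hj⟩ := h
      exact (Finset.prod_eq_zero (Finset.mem_univ j) (Set.indicator_of_notMem hj _)).symm
  rw [this, integral_fintype_prod_volume_eq_prod, ENNReal.ofReal_prod_of_nonneg]
  · refine Finset.prod_congr rfl fun j _ => ?_
    rw [integral_indicator (hS j), hφ.nuOf_apply (hS j)]
  · exact fun j _ => integral_nonneg fun x => Set.indicator_nonneg (fun x _ => hφ.nonneg x) _

theorem isProbabilityMeasure_prodMeasure (s : ℕ) : IsProbabilityMeasure (prodMeasure φ s) := by
  have := hφ.isProbabilityMeasure_nuOf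
  rw [prodMeasure_eq_pi]
  infer_instance

theorem measurable_prod (s : ℕ) : Measurable fun x : Fin s → ℝ => ∏ j, φ (x j) :=
  Finset.measurable_prod _ fun j _ => hφ.measurable.comp (measurable_pi_apply j)

theorem integral_prodMeasure {s : ℕ} (g : (Fin s → ℝ) → ℝ) :
    ∫ x, g x ∂prodMeasure φ s = ∫ x, (∏ j, φ (x j)) * g x := by
  rw [hφ.prodMeasure_eq_withDensity, integral_withDensity_eq_integral_toReal_smul
    (hφ.measurable_prod s).ennreal_ofReal
    (Filter.Eventually.of_forall fun _ => ENNReal.ofReal_lt_top)]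
  simp [ENNReal.toReal_ofReal (Finset.prod_nonneg fun j _ => hφ.nonneg _)]

theorem integrable_prodMeasure_iff {s : ℕ} {g : (Fin s → ℝ) → ℝ} :
    Integrable g (prodMeasure φ s) ↔ Integrable fun x => (∏ j, φ (x j)) * g x := by
  rw [hφ.prodMeasure_eq_withDensity, integrable_withDensity_iff_integrable_smul'
    (hφ.measurable_prod s).ennreal_ofReal
    (Filter.Eventually.of_forall fun _ => ENNReal.ofReal_lt_top)]
  simp [ENNReal.toReal_ofReal (Finset.prod_nonneg fun j _ => hφ.nonneg _)]

theorem prodMeasure_absolutelyContinuous (s : ℕ) : prodMeasure φ s ≪ volume := by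
  rw [hφ.prodMeasure_eq_withDensity]
  exact withDensity_absolutelyContinuous _ _

/-- Strict positivity of `φ` is used here; null sets of Lebesgue measure and of the product law
coincide, so almost-everywhere statements pass freely between the two. -/
theorem absolutelyContinuous_prodMeasure (s : ℕ) :
    (volume : Measure (Fin s → ℝ)) ≪ prodMeasure φ s := by
  rw [hφ.prodMeasure_eq_withDensity]
  refine withDensity_absolutelyContinuous' (hφ.measurable_prod s).ennreal_ofReal.aemeasurable
    (Filter.Eventually.of_forall fun x => ?_)
  simpa using Finset.prod_pos fun j _ => hφ.pos (x j)

end IsLightTailedDensity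

/-- Mixing the coordinates of two independent samples of a product measure. -/
theorem measurePreserving_piecewise {s : ℕ} (ν : Measure ℝ) [IsProbabilityMeasure ν]
    (v : Finset (Fin s)) :
    MeasurePreserving (fun z : (Fin s → ℝ) × (Fin s → ℝ) => v.piecewise z.1 z.2)
      ((Measure.pi fun _ => ν).prod (Measure.pi fun _ => ν)) (Measure.pi fun _ => ν) := by
  have hm : Measurable fun z : (Fin s → ℝ) × (Fin s → ℝ) => v.piecewise z.1 z.2 := by
    refine measurable_pi_lambda _ fun j => ?_
    by_cases hj : j ∈ v
    · simp only [Finset.piecewise, hj, if_true]; fun_prop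
    · simp only [Finset.piecewise, hj, if_false]; fun_prop
  refine ⟨hm, (Measure.pi_eq fun S hS => ?_).symm⟩
  rw [Measure.map_apply hm (MeasurableSet.univ_pi hS)]
  have : (fun z : (Fin s → ℝ) × (Fin s → ℝ) => v.piecewise z.1 z.2) ⁻¹' (Set.univ.pi S)
      = (Set.univ.pi fun j => if j ∈ v then S j else Set.univ) ×ˢ
        (Set.univ.pi fun j => if j ∈ v then Set.univ else S j) := by
    ext z
    simp only [Set.mem_preimage, Set.mem_univ_pi, Set.mem_prod, Finset.piecewise]
    rw [← forall_and]
    refine forall_congr' fun j => ?_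
    by_cases hj : j ∈ v <;> simp [hj]
  rw [this, Measure.prod_prod, Measure.pi_pi, Measure.pi_pi, ← Finset.prod_mul_distrib]
  refine Finset.prod_congr rfl fun j _ => ?_
  by_cases hj : j ∈ v <;> simp [hj]

end BDIS

namespace BDIS

/-! ### Weak mixed derivatives tested against products -/

theorem partialDeriv_prod {s : ℕ} (j : Fin s) {χ : Fin s → ℝ → ℝ}
    (hχ : ∀ i, Differentiable ℝ (χ i)) :
    partialDeriv j (fun x => ∏ i, χ i (x i))
      = fun x => ∏ i, if i = j then deriv (χ i) (x i) else χ i (x i) := by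
  ext x
  have h1 : ∀ i ∈ Finset.univ, HasFDerivAt (fun x : Fin s → ℝ => χ i (x i))
      (deriv (χ i) (x i) • (ContinuousLinearMap.proj i : (Fin s → ℝ) →L[ℝ] ℝ)) x := fun i _ =>
    ((hχ i (x i)).hasDerivAt).comp_hasFDerivAt x
      (ContinuousLinearMap.proj (R := ℝ) (φ := fun _ : Fin s => ℝ) i).hasFDerivAt
  unfold partialDeriv
  rw [(HasFDerivAt.finsetProd h1).fderiv]
  simp only [_root_.sum_apply, _root_.smul_apply,
    ContinuousLinearMap.proj_apply, smul_eq_mul]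
  rw [Finset.sum_eq_single j, ← Finset.mul_prod_erase _ _ (Finset.mem_univ j)]
  · simp only [Pi.single_eq_same, mul_one, if_true]
    rw [mul_comm]
    congr 1
    exact Finset.prod_congr rfl fun i hi => by simp [Finset.ne_of_mem_erase hi]
  · intro i _ hi
    simp [Pi.single_eq_of_ne hi]
  · simp

theorem mixedDeriv_prod {s : ℕ} (v : Finset (Fin s)) {χ : Fin s → ℝ → ℝ}
    (hχ : ∀ i, ContDiff ℝ ∞ (χ i)) :
    mixedDeriv v (fun x => ∏ i, χ i (x i))
      = fun x => ∏ i, if i ∈ v then deriv (χ i) (x i) else χ i (x i) := by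
  have key : ∀ l : List (Fin s), l.Nodup → l.foldr partialDeriv (fun x => ∏ i, χ i (x i))
      = fun x => ∏ i, (if i ∈ l then deriv (χ i) else χ i) (x i) := by
    intro l hl
    induction l with
    | nil => simp
    | cons j l ih =>
      rw [List.nodup_cons] at hl
      rw [List.foldr_cons, ih hl.2, partialDeriv_prod]
      · ext x
        refine Finset.prod_congr rfl fun i _ => ?_
        by_cases hij : i = j
        · subst hij; simp [hl.1]
        · simp [hij]
      · intro i
        split_ifs
        · exact ((contDiff_infty_iff_deriv.1 (hχ i)).2).differentiable (by simp)
        · exact (hχ i).differentiable (by simp)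
  unfold mixedDeriv
  rw [key _ (Finset.sort_nodup _ _)]
  ext x
  refine Finset.prod_congr rfl fun i _ => ?_
  by_cases hi : i ∈ v <;> simp [hi]

theorem setIntegral_Iic_eq_intervalIntegral {a : ℝ → ℝ} {R : ℝ}
    (hR : ∀ x, R < |x| → a x = 0) (y : ℝ) :
    ∫ t in Set.Iic y, a t = ∫ t in (-R)..y, a t := by
  rcases le_total (-R) y with h | h
  · rw [intervalIntegral.integral_of_le h]
    refine (setIntegral_eq_of_subset_of_ae_sdiff_eq_zero measurableSet_Iic.nullMeasurableSet
      Set.Ioc_subset_Iic_self ?_)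
    have : ∀ᵐ x : ℝ, x ≠ -R := by simp [ae_iff]
    filter_upwards [this] with x hx hxy
    simp only [Set.mem_sdiff, Set.mem_Iic, Set.mem_Ioc, not_and] at hxy
    have : x < -R := lt_of_le_of_ne (not_lt.1 fun h' => hxy.2 h' hxy.1) hx
    exact hR x (lt_of_lt_of_le (by linarith) (neg_le_abs x))
  · rw [intervalIntegral.integral_of_ge h]
    have h1 : ∫ t in Set.Iic y, a t = 0 := by
      refine setIntegral_eq_zero_of_ae_eq_zero ?_
      have : ∀ᵐ x : ℝ, x ≠ -R := by simp [ae_iff]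
      filter_upwards [this] with x hx hxy
      have : x < -R := lt_of_le_of_ne (le_trans hxy h) hx
      exact hR x (lt_of_lt_of_le (by linarith) (neg_le_abs x))
    have h2 : ∫ t in Set.Ioc y (-R), a t = 0 := by
      refine setIntegral_eq_zero_of_ae_eq_zero ?_
      have : ∀ᵐ x : ℝ, x ≠ -R := by simp [ae_iff]
      filter_upwards [this] with x hx hxy
      have : x < -R := lt_of_le_of_ne hxy.2 hx
      exact hR x (lt_of_lt_of_le (by linarith) (neg_le_abs x))
    rw [h1, h2, neg_zero]

/-- Mean zero is exactly what makes the primitive compactly supported, so that products of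
primitives are admissible test functions. -/
theorem setIntegral_Iic_eq_zero {a : ℝ → ℝ} {R : ℝ} (hR : ∀ x, R < |x| → a x = 0)
    (h0 : ∫ x, a x = 0) {y : ℝ} (hy : R < |y|) : ∫ t in Set.Iic y, a t = 0 := by
  rcases lt_abs.1 hy with h | h
  · rw [← h0, setIntegral_eq_integral_of_forall_compl_eq_zero]
    intro x hx
    exact hR x (h.trans ((not_le.1 hx).trans_le (le_abs_self x)))
  · refine setIntegral_eq_zero_of_forall_eq_zero fun x hx => ?_
    exact hR x (lt_of_lt_of_le (by linarith [Set.mem_Iic.1 hx]) (neg_le_abs x))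

/-- Convolution with bumps of mass one keeps the sup bound and the integral, and enlarges the
support by at most one. Preserving the integral matters: mean-zero factors stay mean-zero. -/
theorem exists_mollify {a : ℝ → ℝ} (ha : Measurable a) {C R : ℝ} (hC : ∀ x, |a x| ≤ C)
    (hR : ∀ x, R < |x| → a x = 0) :
    ∃ A : ℕ → ℝ → ℝ, (∀ n, ContDiff ℝ ∞ (A n)) ∧ (∀ n x, |A n x| ≤ C) ∧
      (∀ n x, R + 1 < |x| → A n x = 0) ∧ (∀ n, ∫ x, A n x = ∫ x, a x) ∧
      ∀ᵐ x, Filter.Tendsto (fun n => A n x) Filter.atTop (nhds (a x)) := by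
  have hint : Integrable a := by
    refine Measure.integrableOn_of_bounded (s := Set.Icc (-R) R) (M := C) ?_
      ha.aestronglyMeasurable (Filter.Eventually.of_forall fun x => hC x) |>.integrable_of_forall_notMem_eq_zero ?_
    · simp
    · intro x hx
      refine hR x (not_le.1 fun h => hx (abs_le.1 h))
  let B : ℕ → ContDiffBump (0 : ℝ) := fun n =>
    ⟨1 / (2 * ((n : ℝ) + 1)), 1 / ((n : ℝ) + 1), by positivity, by
      rw [div_lt_div_iff₀ (by positivity) (by positivity)]; linarith [(Nat.cast_nonneg n : (0:ℝ) ≤ n)]⟩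
  have hB1 : ∀ n, (B n).rOut ≤ 1 := fun n => by
    change 1 / ((n : ℝ) + 1) ≤ 1
    rw [div_le_one (by positivity)]; linarith [(Nat.cast_nonneg n : (0:ℝ) ≤ n)]
  refine ⟨fun n => convolution ((B n).normed volume) a (ContinuousLinearMap.lsmul ℝ ℝ) volume,
    fun n => ?_, fun n x => ?_, fun n x hx => ?_, fun n => ?_, ?_⟩
  · exact (B n).hasCompactSupport_normed.contDiff_convolution_left _ (B n).contDiff_normed
      hint.locallyIntegrable
  · simp only [convolution, ContinuousLinearMap.lsmul_apply, smul_eq_mul]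
    calc |∫ t, (B n).normed volume t * a (x - t)|
        ≤ ∫ t, |(B n).normed volume t * a (x - t)| := abs_integral_le_integral_abs
      _ ≤ ∫ t, (B n).normed volume t * C := by
          refine integral_mono_of_nonneg (Filter.Eventually.of_forall fun t => abs_nonneg _)
            ((B n).integrable_normed.mul_const C) (Filter.Eventually.of_forall fun t => ?_)
          simp only [abs_mul, abs_of_nonneg ((B n).nonneg_normed t)]
          exact mul_le_mul_of_nonneg_left (hC _) ((B n).nonneg_normed t)
      _ = C := by rw [integral_mul_const, (B n).integral_normed, one_mul]
  · simp only [convolution, ContinuousLinearMap.lsmul_apply, smul_eq_mul]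
    refine integral_eq_zero_of_ae (Filter.Eventually.of_forall fun t => ?_)
    by_cases ht : |t| < (B n).rOut
    · have : R < |x - t| := by
        have := abs_sub_abs_le_abs_sub x t
        linarith [hB1 n]
      simp [hR _ this]
    · have : t ∉ Function.support ((B n).normed volume) := by
        rw [(B n).support_normed_eq]; simpa using ht
      simp [Function.notMem_support.1 this]
  · rw [integral_convolution _ (B n).integrable_normed hint]
    simp [(B n).integral_normed]
  -- Almost-everywhere convergence needs the outer radii bounded by a fixed multiple of the inner
  -- ones; the bumps were chosen with ratio 2.
  · refine ContDiffBump.ae_convolution_tendsto_right_of_locallyIntegrable (K := 2) ?_ ?_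
      hint.locallyIntegrable
    · exact tendsto_one_div_add_atTop_nhds_zero_nat
    · refine Filter.Eventually.of_forall fun n => ?_
      change 1 / ((n : ℝ) + 1) ≤ 2 * (1 / (2 * ((n : ℝ) + 1)))
      apply le_of_eq; field_simp

/-- The factor at coordinate `j` of a test function whose mixed derivative `∂^v` is the product of
the `a j`. -/
noncomputable def primFactor {s : ℕ} (v : Finset (Fin s)) (a : Fin s → ℝ → ℝ) (j : Fin s) (y : ℝ) :
    ℝ :=
  if j ∈ v then ∫ t in Set.Iic y, a j t else a j y

theorem contDiff_setIntegral_Iic {a : ℝ → ℝ} {R : ℝ} (hR : ∀ x, R < |x| → a x = 0)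
    (ha : ContDiff ℝ ∞ a) :
    ContDiff ℝ ∞ (fun y => ∫ t in Set.Iic y, a t) ∧ deriv (fun y => ∫ t in Set.Iic y, a t) = a := by
  have h1 : (fun y => ∫ t in Set.Iic y, a t) = fun y => ∫ t in (-R)..y, a t :=
    funext (setIntegral_Iic_eq_intervalIntegral hR)
  have h2 : ∀ y, HasDerivAt (fun y => ∫ t in (-R)..y, a t) (a y) y := fun y =>
    intervalIntegral.integral_hasDerivAt_right (ha.continuous.intervalIntegrable _ _)
      ha.continuous.stronglyMeasurable.stronglyMeasurableAtFilter ha.continuous.continuousAt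
  have h3 : deriv (fun y => ∫ t in Set.Iic y, a t) = a := by
    rw [h1]; exact funext fun y => (h2 y).deriv
  refine ⟨contDiff_infty_iff_deriv.2 ⟨?_, by rw [h3]; exact ha⟩, h3⟩
  rw [h1]
  exact fun y => (h2 y).differentiableAt

theorem hasCompactSupport_prod {s : ℕ} {χ : Fin s → ℝ → ℝ} {R : ℝ}
    (hR : ∀ j x, R < |x| → χ j x = 0) : HasCompactSupport fun x : Fin s → ℝ => ∏ j, χ j (x j) := by
  refine HasCompactSupport.intro
    (isCompact_univ_pi fun _ : Fin s => (isCompact_Icc : IsCompact (Set.Icc (-R) R))) fun x hx => ?_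
  simp only [Set.mem_univ_pi, not_forall] at hx
  obtain ⟨j, hj⟩ := hx
  exact Finset.prod_eq_zero (Finset.mem_univ j) (hR j _ (not_le.1 fun h => hj (abs_le.1 h)))

/-- Integrating the factors in `v` gives a test function whose mixed derivative is the original
product. -/
theorem HasWeakMixedDeriv.integral_prod_smooth {s : ℕ} {v : Finset (Fin s)}
    {f g : (Fin s → ℝ) → ℝ} (h : HasWeakMixedDeriv v f g) {a : Fin s → ℝ → ℝ} {R : ℝ}
    (ha : ∀ j, ContDiff ℝ ∞ (a j)) (hR : ∀ j x, R < |x| → a j x = 0)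
    (h0 : ∀ j ∈ v, ∫ x, a j x = 0) :
    ∫ x, f x * ∏ j, a j (x j) = (-1) ^ v.card * ∫ x, g x * ∏ j, primFactor v a j (x j) := by
  have hs : ∀ j, ContDiff ℝ ∞ (primFactor v a j) := fun j => by
    unfold primFactor
    by_cases hj : j ∈ v
    · simpa [hj] using (contDiff_setIntegral_Iic (hR j) (ha j)).1
    · simpa [hj] using ha j
  have hd : ∀ j ∈ v, deriv (primFactor v a j) = a j := fun j hj => by
    have : primFactor v a j = fun y => ∫ t in Set.Iic y, a j t := by
      ext y; simp [primFactor, hj]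
    rw [this]
    exact (contDiff_setIntegral_Iic (hR j) (ha j)).2
  have hz : ∀ j x, R < |x| → primFactor v a j x = 0 := fun j x hx => by
    unfold primFactor
    by_cases hj : j ∈ v
    · simpa [hj] using setIntegral_Iic_eq_zero (hR j) (h0 j hj) hx
    · simpa [hj] using hR j x hx
  rw [← h.2.2 (fun x => ∏ j, primFactor v a j (x j))
    (contDiff_prod fun j _ => (hs j).comp (contDiff_apply ℝ ℝ j)) (hasCompactSupport_prod hz),
    mixedDeriv_prod v hs]
  refine integral_congr_ae (Filter.Eventually.of_forall fun x => ?_)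
  simp only
  congr 1
  refine Finset.prod_congr rfl fun j _ => ?_
  by_cases hj : j ∈ v
  · simp [hj, hd j hj]
  · simp [hj, primFactor]

theorem abs_setIntegral_Iic_le {a : ℝ → ℝ} {C R : ℝ} (hC : ∀ x, |a x| ≤ C)
    (hR : ∀ x, R < |x| → a x = 0) (hR0 : 0 ≤ R) (y : ℝ) :
    |∫ t in Set.Iic y, a t| ≤ C * (2 * R) := by
  have hC0 : 0 ≤ C := (abs_nonneg _).trans (hC 0)
  calc |∫ t in Set.Iic y, a t| ≤ ∫ t in Set.Iic y, |a t| := abs_integral_le_integral_abs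
    _ ≤ ∫ t, (Set.Icc (-R) R).indicator (fun _ => C) t := by
        have hi : Integrable ((Set.Icc (-R) R).indicator fun _ => C) := by
          rw [integrable_indicator_iff measurableSet_Icc]; simp
        refine (integral_mono_of_nonneg (Filter.Eventually.of_forall fun t => abs_nonneg _)
          hi.integrableOn (Filter.Eventually.of_forall fun t => ?_)).trans
          (setIntegral_le_integral hi (Filter.Eventually.of_forall fun t =>
            Set.indicator_nonneg (fun _ _ => hC0) _))
        by_cases ht : t ∈ Set.Icc (-R) R
        · simpa [ht] using hC t
        · simp [ht, hR t (not_le.1 fun h => ht (abs_le.1 h))]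
    _ = C * (2 * R) := by
        rw [integral_indicator measurableSet_Icc]
        simp [Measure.real]
        rw [ENNReal.toReal_ofReal (by linarith)]; ring

theorem integrable_mul_indicator_box {s : ℕ} {f : (Fin s → ℝ) → ℝ} (hf : LocallyIntegrable f)
    (R M : ℝ) : Integrable fun x : Fin s → ℝ =>
      f x * ∏ j, (Set.Icc (-R) R).indicator (fun _ => M) (x j) := by
  have h1 : Integrable ((Set.univ.pi fun _ : Fin s => Set.Icc (-R) R).indicator fun x => f x * M ^ s) := by
    rw [integrable_indicator_iff (MeasurableSet.univ_pi fun _ => measurableSet_Icc)]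
    exact (hf.integrableOn_isCompact (isCompact_univ_pi fun _ => isCompact_Icc)).mul_const _
  refine h1.congr (Filter.Eventually.of_forall fun x => ?_)
  by_cases hx : ∀ j, x j ∈ Set.Icc (-R) R
  · simp only
    rw [Set.indicator_of_mem (Set.mem_univ_pi.2 hx),
      Finset.prod_congr rfl fun j _ => Set.indicator_of_mem (hx j) _]
    simp
  · simp only
    rw [Set.indicator_of_notMem fun h => hx (Set.mem_univ_pi.1 h)]
    push Not at hx
    obtain ⟨j, hj⟩ := hx
    rw [Finset.prod_eq_zero (Finset.mem_univ j) (Set.indicator_of_notMem hj _), mul_zero]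

/-- Dominated convergence: all factors are bounded and live in one box, on which `f` is integrable.
-/
theorem tendsto_integral_mul_prod {s : ℕ} {f : (Fin s → ℝ) → ℝ} (hf : LocallyIntegrable f)
    {R M : ℝ} {a : Fin s → ℝ → ℝ} {A : ℕ → Fin s → ℝ → ℝ} (hA : ∀ n j, Measurable (A n j))
    (hM : ∀ n j x, |A n j x| ≤ M) (hR : ∀ n j x, R < |x| → A n j x = 0)
    (hlim : ∀ j, ∀ᵐ x, Filter.Tendsto (fun n => A n j x) Filter.atTop (nhds (a j x))) :
    Filter.Tendsto (fun n => ∫ x, f x * ∏ j, A n j (x j)) Filter.atTop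
      (nhds (∫ x, f x * ∏ j, a j (x j))) := by
  refine tendsto_integral_of_dominated_convergence
    (fun x => ‖f x * ∏ j, (Set.Icc (-R) R).indicator (fun _ => M) (x j)‖) (fun n => ?_)
    (integrable_mul_indicator_box hf R M).norm (fun n => Filter.Eventually.of_forall fun x => ?_) ?_
  · exact hf.aestronglyMeasurable.mul (Finset.measurable_prod _ fun j _ =>
      (hA n j).comp (measurable_pi_apply j)).aestronglyMeasurable
  · simp only [norm_mul, norm_prod]
    refine mul_le_mul_of_nonneg_left (Finset.prod_le_prod (fun j _ => norm_nonneg _) fun j _ => ?_)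
      (norm_nonneg _)
    by_cases hx : x j ∈ Set.Icc (-R) R
    · rw [Set.indicator_of_mem hx]
      exact (hM n j _).trans (le_abs_self M)
    · rw [hR n j _ (not_le.1 fun h => hx (abs_le.1 h))]
      simp
  · have : ∀ᵐ x : Fin s → ℝ, ∀ j, Filter.Tendsto (fun n => A n j (x j)) Filter.atTop
        (nhds (a j (x j))) := by
      rw [ae_all_iff]
      exact fun j => (Measure.quasiMeasurePreserving_eval (fun _ : Fin s => (volume : Measure ℝ)) j).ae
        (hlim j)
    filter_upwards [this] with x hx
    exact (tendsto_finsetProd _ fun j _ => hx j).const_mul _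

/-- The defining identity of weak mixed derivatives extends to products of bounded functions. -/
theorem HasWeakMixedDeriv.integral_prod {s : ℕ} {v : Finset (Fin s)}
    {f g : (Fin s → ℝ) → ℝ} (h : HasWeakMixedDeriv v f g) {a : Fin s → ℝ → ℝ} {C R : ℝ}
    (ha : ∀ j, Measurable (a j)) (hC : ∀ j x, |a j x| ≤ C) (hR : ∀ j x, R < |x| → a j x = 0)
    (h0 : ∀ j ∈ v, ∫ x, a j x = 0) :
    ∫ x, f x * ∏ j, a j (x j) = (-1) ^ v.card * ∫ x, g x * ∏ j, primFactor v a j (x j) := by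
  wlog hR0 : 0 ≤ R generalizing R
  · exact this (R := |R|) (fun j x hx => hR j x ((le_abs_self R).trans_lt hx)) (abs_nonneg R)
  choose A hA1 hA2 hA3 hA4 hA5 using fun j => exists_mollify (ha j) (hC j) (hR j)
  have hsm : ∀ n, ∫ x, f x * ∏ j, A j n (x j)
      = (-1) ^ v.card * ∫ x, g x * ∏ j, primFactor v (fun j => A j n) j (x j) := fun n =>
    h.integral_prod_smooth (fun j => hA1 j n) (fun j x hx => hA3 j n x hx)
      fun j hj => by rw [hA4, h0 j hj]
  have hl1 := tendsto_integral_mul_prod h.1 (R := R + 1) (M := C) (A := fun n j => A j n) (a := a)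
    (fun n j => (hA1 j n).continuous.measurable) (fun n j x => hA2 j n x)
    (fun n j x hx => hA3 j n x hx) hA5
  have hcont : ∀ n j, Continuous (primFactor v (fun j => A j n) j) := fun n j => by
    unfold primFactor
    by_cases hj : j ∈ v
    · simpa [hj] using (contDiff_setIntegral_Iic (hA3 j n) (hA1 j n)).1.continuous
    · simpa [hj] using (hA1 j n).continuous
  have hl2 := tendsto_integral_mul_prod h.2.1 (R := R + 1) (M := max C (C * (2 * (R + 1))))
    (A := fun n j => primFactor v (fun j => A j n) j) (a := primFactor v a)
    (fun n j => (hcont n j).measurable) (fun n j x => ?_) (fun n j x hx => ?_) (fun j => ?_)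
  · refine tendsto_nhds_unique hl1 ?_
    simp_rw [hsm]
    exact hl2.const_mul _
  · unfold primFactor
    split_ifs
    · exact (abs_setIntegral_Iic_le (hA2 j n) (hA3 j n) (by linarith) x).trans (le_max_right _ _)
    · exact (hA2 j n x).trans (le_max_left _ _)
  · unfold primFactor
    split_ifs with hj
    · exact setIntegral_Iic_eq_zero (hA3 j n) (by rw [hA4, h0 j hj]) hx
    · exact hA3 j n x hx
  · unfold primFactor
    by_cases hj : j ∈ v
    · simp only [hj, if_true]
      refine Filter.Eventually.of_forall fun y => ?_
      refine tendsto_integral_of_dominated_convergence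
        ((Set.Icc (-(R + 1)) (R + 1)).indicator fun _ => C)
        (fun n => (hA1 j n).continuous.aestronglyMeasurable) ?_
        (fun n => Filter.Eventually.of_forall fun t => ?_) (ae_restrict_of_ae (hA5 j))
      · refine Integrable.integrableOn ?_
        rw [integrable_indicator_iff measurableSet_Icc]; simp
      · by_cases ht : t ∈ Set.Icc (-(R + 1)) (R + 1)
        · rw [Set.indicator_of_mem ht]; exact hA2 j n t
        · rw [Set.indicator_of_notMem ht, hA3 j n t (not_le.1 fun h => ht (abs_le.1 h)), norm_zero]
    · simpa [hj] using hA5 j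

end BDIS

namespace BDIS

/-! ### Product test functions suffice -/

/-- Smooth compactly supported functions. -/
def IsTest {s : ℕ} (ψ : (Fin s → ℝ) → ℝ) : Prop := ContDiff ℝ ∞ ψ ∧ HasCompactSupport ψ

theorem IsTest.partialDeriv {s : ℕ} {ψ : (Fin s → ℝ) → ℝ} (h : IsTest ψ) (j : Fin s) :
    IsTest (partialDeriv j ψ) := by
  refine ⟨(h.1.fderiv_right (m := ∞) (by simp)).clm_apply contDiff_const, ?_⟩
  exact h.2.fderiv_apply (𝕜 := ℝ) _

theorem IsTest.foldr {s : ℕ} {ψ : (Fin s → ℝ) → ℝ} (h : IsTest ψ) (l : List (Fin s)) :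
    IsTest (l.foldr BDIS.partialDeriv ψ) := by
  induction l with
  | nil => exact h
  | cons j l ih => exact ih.partialDeriv j

/-- Convolution of real functions on `ℝ^s`. -/
noncomputable def conv {s : ℕ} (f g : (Fin s → ℝ) → ℝ) : (Fin s → ℝ) → ℝ :=
  convolution f g (ContinuousLinearMap.lsmul ℝ ℝ) volume

theorem conv_apply {s : ℕ} (f g : (Fin s → ℝ) → ℝ) (x : Fin s → ℝ) :
    conv f g x = ∫ t, f t * g (x - t) := by
  simp [conv, convolution]

theorem conv_comm {s : ℕ} (f g : (Fin s → ℝ) → ℝ) : conv f g = conv g f := by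
  ext x
  rw [conv_apply, conv_apply, ← integral_sub_left_eq_self _ volume x]
  simp [mul_comm]

theorem partialDeriv_conv {s : ℕ} {f g : (Fin s → ℝ) → ℝ} (hf : IsTest f) (hg : IsTest g)
    (j : Fin s) : partialDeriv j (conv f g) = conv f (partialDeriv j g) := by
  ext x
  have hfl : LocallyIntegrable f := hf.1.continuous.locallyIntegrable
  unfold partialDeriv conv
  rw [(hg.2.hasFDerivAt_convolution_right _ hfl (hg.1.of_le (by simp)) x).fderiv,
    convolution_precompR_apply _ hfl (hg.2.fderiv (𝕜 := ℝ)) (hg.1.continuous_fderiv (by simp))]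

/-- Commutativity of convolution lets each derivative change sides, so a mixed derivative falling on
an arbitrary test function can be moved to a product mollifier. -/
theorem conv_foldr {s : ℕ} {f g : (Fin s → ℝ) → ℝ} (hf : IsTest f) (hg : IsTest g)
    (l : List (Fin s)) : conv (l.foldr partialDeriv f) g = conv f (l.foldr partialDeriv g) := by
  induction l with
  | nil => rfl
  | cons j l ih =>
    simp only [List.foldr_cons]
    rw [conv_comm, ← partialDeriv_conv hg (hf.foldr l), conv_comm g, ih,
      partialDeriv_conv hf (hg.foldr l)]

theorem IsTest.exists_bound {s : ℕ} {ψ : (Fin s → ℝ) → ℝ} (h : IsTest ψ) :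
    ∃ M, 0 ≤ M ∧ ∀ x, |ψ x| ≤ M := by
  obtain ⟨M, hM⟩ := h.1.continuous.bounded_above_of_compact_support h.2
  exact ⟨M, (norm_nonneg _).trans (hM 0), hM⟩

theorem IsTest.exists_radius {s : ℕ} {ψ : (Fin s → ℝ) → ℝ} (h : IsTest ψ) :
    ∃ R, 0 ≤ R ∧ ∀ x, R < ‖x‖ → ψ x = 0 := by
  obtain ⟨R, hR0, hR⟩ := h.2.exists_pos_le_norm
  exact ⟨R, hR0.le, fun x hx => hR x hx.le⟩

/-- Fubini: pairing `f` with `ψ * Y` is a superposition of pairings of `f` with the translates of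
`Y`. -/
theorem integral_mul_conv {s : ℕ} {f ψ Y : (Fin s → ℝ) → ℝ} (hf : LocallyIntegrable f)
    (hψ : IsTest ψ) (hY : IsTest Y) :
    ∫ z, ψ z * ∫ x, f x * Y (x - z) = ∫ x, f x * conv ψ Y x := by
  obtain ⟨M, hM0, hM⟩ := hY.exists_bound
  obtain ⟨R, hR0, hR⟩ := hY.exists_radius
  obtain ⟨S, hS0, hS⟩ := hψ.exists_radius
  have hint : Integrable (Function.uncurry fun (z x : Fin s → ℝ) => ψ z * (f x * Y (x - z)))
      (volume.prod volume) := by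
    have h1 : Integrable (fun z : (Fin s → ℝ) × (Fin s → ℝ) => ψ z.1 *
        ((Metric.closedBall 0 (R + S)).indicator f z.2 * M)) (volume.prod volume) := by
      refine Integrable.mul_prod (g := fun x => (Metric.closedBall 0 (R + S)).indicator f x * M)
        (hψ.1.continuous.integrable_of_hasCompactSupport hψ.2) ?_
      refine Integrable.mul_const ?_ _
      rw [integrable_indicator_iff Metric.isClosed_closedBall.measurableSet]
      exact hf.integrableOn_isCompact (isCompact_closedBall _ _)
    refine h1.mono ?_ (Filter.Eventually.of_forall fun z => ?_)
    · exact (hψ.1.continuous.comp continuous_fst).aestronglyMeasurable.mul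
        ((hf.aestronglyMeasurable.comp_snd).mul
        (hY.1.continuous.comp (continuous_snd.sub continuous_fst)).aestronglyMeasurable)
    · simp only [Function.uncurry, norm_mul, Real.norm_eq_abs]
      by_cases hz : ψ z.1 = 0
      · simp [hz]
      have hzS : ‖z.1‖ ≤ S := not_lt.1 fun h => hz (hS _ h)
      refine mul_le_mul_of_nonneg_left ?_ (abs_nonneg _)
      by_cases hx : z.2 ∈ Metric.closedBall (0 : Fin s → ℝ) (R + S)
      · rw [Set.indicator_of_mem hx, abs_of_nonneg hM0]
        exact mul_le_mul_of_nonneg_left (hM _) (abs_nonneg _)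
      · have : Y (z.2 - z.1) = 0 := by
          refine hR _ ?_
          have h3 : R + S < ‖z.2‖ := by simpa using hx
          have := norm_sub_norm_le z.2 z.1
          linarith
        simp [this]
        positivity
  calc ∫ z, ψ z * ∫ x, f x * Y (x - z) = ∫ z, ∫ x, ψ z * (f x * Y (x - z)) := by
        simp_rw [integral_const_mul]
    _ = ∫ x, ∫ z, ψ z * (f x * Y (x - z)) := integral_integral_swap hint
    _ = _ := by
        refine integral_congr_ae (Filter.Eventually.of_forall fun x => ?_)
        simp only [conv_apply]
        rw [← integral_const_mul]
        refine integral_congr_ae (Filter.Eventually.of_forall fun z => ?_)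
        simp only; ring

theorem tendsto_integral_mul_conv {s : ℕ} {f ψ : (Fin s → ℝ) → ℝ} (hf : LocallyIntegrable f)
    (hψ : IsTest ψ) {Y : ℕ → (Fin s → ℝ) → ℝ} (hY : ∀ n, IsTest (Y n)) (hY0 : ∀ n x, 0 ≤ Y n x)
    (hY1 : ∀ n, ∫ x, Y n x = 1) (hYs : ∀ (n : ℕ) x, 1 / ((n : ℝ) + 1) < ‖x‖ → Y n x = 0) :
    Filter.Tendsto (fun n => ∫ x, f x * conv ψ (Y n) x) Filter.atTop (nhds (∫ x, f x * ψ x)) := by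
  obtain ⟨M, hM0, hM⟩ := hψ.exists_bound
  obtain ⟨R, hR0, hR⟩ := hψ.exists_radius
  have hbd : ∀ n x, |conv ψ (Y n) x| ≤ M := fun n x => by
    rw [conv_comm, conv_apply]
    calc |∫ t, Y n t * ψ (x - t)| ≤ ∫ t, |Y n t * ψ (x - t)| := abs_integral_le_integral_abs
      _ ≤ ∫ t, Y n t * M := by
          refine integral_mono_of_nonneg (Filter.Eventually.of_forall fun t => abs_nonneg _)
            (((hY n).1.continuous.integrable_of_hasCompactSupport (hY n).2).mul_const M)
            (Filter.Eventually.of_forall fun t => ?_)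
          simp only [abs_mul, abs_of_nonneg (hY0 n t)]
          exact mul_le_mul_of_nonneg_left (hM _) (hY0 n t)
      _ = M := by rw [integral_mul_const, hY1, one_mul]
  have hsupp : ∀ n x, R + 1 < ‖x‖ → conv ψ (Y n) x = 0 := fun n x hx => by
    rw [conv_apply]
    refine integral_eq_zero_of_ae (Filter.Eventually.of_forall fun t => ?_)
    by_cases ht : R < ‖t‖
    · simp [hR t ht]
    · have : Y n (x - t) = 0 := by
        refine hYs n _ ?_
        have h1 : 1 / ((n : ℝ) + 1) ≤ 1 := by
          rw [div_le_one (by positivity)]; linarith [(Nat.cast_nonneg n : (0:ℝ) ≤ n)]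
        have := norm_sub_norm_le x t
        linarith
      simp [this]
  refine tendsto_integral_of_dominated_convergence
    (fun x => ‖(Metric.closedBall 0 (R + 1)).indicator f x * M‖) (fun n => ?_) ?_
    (fun n => Filter.Eventually.of_forall fun x => ?_) (Filter.Eventually.of_forall fun x => ?_)
  · refine hf.aestronglyMeasurable.mul (Continuous.aestronglyMeasurable ?_)
    exact (HasCompactSupport.contDiff_convolution_right (n := 0) _ (hY n).2
      hψ.1.continuous.locallyIntegrable ((hY n).1.of_le (by simp))).continuous
  · refine (Integrable.mul_const ?_ _).norm
    rw [integrable_indicator_iff Metric.isClosed_closedBall.measurableSet]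
    exact hf.integrableOn_isCompact (isCompact_closedBall _ _)
  · by_cases hx : x ∈ Metric.closedBall (0 : Fin s → ℝ) (R + 1)
    · rw [Set.indicator_of_mem hx, norm_mul, norm_mul, Real.norm_of_nonneg hM0]
      exact mul_le_mul_of_nonneg_left (hbd n x) (norm_nonneg _)
    · rw [hsupp n x (by simpa using hx), mul_zero, norm_zero]; exact norm_nonneg _
  · refine Filter.Tendsto.const_mul _ ?_
    simp_rw [conv_comm ψ]
    refine convolution_tendsto_right (g := fun _ => ψ) (k := fun _ => x)
      (Filter.Eventually.of_forall hY0) (Filter.Eventually.of_forall hY1) ?_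
      (Filter.Eventually.of_forall fun _ => hψ.1.continuous.aestronglyMeasurable)
      ((hψ.1.continuous.tendsto x).comp Filter.tendsto_snd) tendsto_const_nhds
    rw [Filter.tendsto_smallSets_iff]
    intro U hU
    obtain ⟨ε, hε, hU⟩ := Metric.nhds_basis_closedBall.mem_iff.1 hU
    filter_upwards [(tendsto_one_div_add_atTop_nhds_zero_nat (𝕜 := ℝ)).eventually
      (gt_mem_nhds hε)] with n hn
    refine fun y hy => hU ?_
    rw [mem_closedBall_zero_iff]
    exact (not_lt.1 fun h => hy (hYs n y h)).trans hn.le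

theorem exists_mollifier : ∃ β : ℕ → ℝ → ℝ, (∀ n, ContDiff ℝ ∞ (β n)) ∧
    (∀ n x, 0 ≤ β n x) ∧ (∀ n, ∫ x, β n x = 1) ∧ (∀ (n : ℕ) x, 1 / ((n : ℝ) + 1) < |x| → β n x = 0) := by
  let B : ℕ → ContDiffBump (0 : ℝ) := fun n =>
    ⟨1 / (2 * ((n : ℝ) + 1)), 1 / ((n : ℝ) + 1), by positivity, by
      rw [div_lt_div_iff₀ (by positivity) (by positivity)]
      linarith [(Nat.cast_nonneg n : (0:ℝ) ≤ n)]⟩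
  refine ⟨fun n => (B n).normed volume, fun n => (B n).contDiff_normed,
    fun n x => (B n).nonneg_normed x, fun n => (B n).integral_normed, fun n x hx => ?_⟩
  rw [← Function.notMem_support, (B n).support_normed_eq]
  simp only [Metric.mem_ball, dist_zero_right, not_lt, Real.norm_eq_abs]
  exact hx.le

/-- Convolve a test function with a product mollifier. The result is a superposition of translated
products, for which the identity is assumed; then the mollifier shrinks to a point. -/
theorem HasWeakMixedDeriv.of_prod {s : ℕ} {v : Finset (Fin s)} {f g : (Fin s → ℝ) → ℝ}
    (hf : LocallyIntegrable f) (hg : LocallyIntegrable g)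
    (h : ∀ χ : Fin s → ℝ → ℝ, (∀ j, ContDiff ℝ ∞ (χ j)) → (∃ R, ∀ j x, R < |x| → χ j x = 0) →
      ∫ x, f x * ∏ j, (if j ∈ v then deriv (χ j) (x j) else χ j (x j))
        = (-1) ^ v.card * ∫ x, g x * ∏ j, χ j (x j)) :
    HasWeakMixedDeriv v f g := by
  refine ⟨hf, hg, fun ψ hψ1 hψ2 => ?_⟩
  have hψ : IsTest ψ := ⟨hψ1, hψ2⟩
  obtain ⟨β, hβ, hβ0, hβ1, hβs⟩ := exists_mollifier
  set Y : ℕ → (Fin s → ℝ) → ℝ := fun n x => ∏ j, β n (x j) with hYdef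
  have hY : ∀ n, IsTest (Y n) := fun n =>
    ⟨contDiff_prod fun j _ => (hβ n).comp (contDiff_apply ℝ ℝ j),
      hasCompactSupport_prod (R := 1 / ((n : ℝ) + 1)) fun j x hx => hβs n x hx⟩
  have hY0 : ∀ n x, 0 ≤ Y n x := fun n x => Finset.prod_nonneg fun j _ => hβ0 n _
  have hY1 : ∀ n, ∫ x, Y n x = 1 := fun n => by
    simp only [hYdef]
    rw [integral_fintype_prod_volume_eq_prod]; simp [hβ1]
  have hYs : ∀ (n : ℕ) x, 1 / ((n : ℝ) + 1) < ‖x‖ → Y n x = 0 := fun n x hx => by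
    obtain ⟨j, hj⟩ : ∃ j, 1 / ((n : ℝ) + 1) < |x j| := by
      by_contra hcon
      push Not at hcon
      exact absurd hx (not_lt.2 ((pi_norm_le_iff_of_nonneg (by positivity)).2 hcon))
    exact Finset.prod_eq_zero (Finset.mem_univ j) (hβs n _ hj)
  have key : ∀ n, ∫ x, f x * conv (mixedDeriv v ψ) (Y n) x
      = (-1) ^ v.card * ∫ x, g x * conv ψ (Y n) x := fun n => by
    unfold mixedDeriv
    rw [conv_foldr hψ (hY n), ← integral_mul_conv hf hψ ((hY n).foldr _),
      ← integral_mul_conv hg hψ (hY n), ← integral_const_mul]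
    refine integral_congr_ae (Filter.Eventually.of_forall fun z => ?_)
    have hz := h (fun j y => β n (y - z j)) (fun j => (hβ n).comp (contDiff_id.sub contDiff_const))
      ⟨‖z‖ + 1 / ((n : ℝ) + 1), fun j x hx => hβs n _ (by
        have h1 := abs_sub_abs_le_abs_sub x (z j)
        have h2 : |z j| ≤ ‖z‖ := norm_le_pi_norm z j
        linarith)⟩
    have hm : (v.sort).foldr partialDeriv (Y n) = fun x => ∏ i, if i ∈ v then deriv (β n) (x i)
        else β n (x i) := mixedDeriv_prod v (χ := fun _ => β n) fun _ => hβ n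
    rw [hm]
    simp only [hYdef, Pi.sub_apply]
    simp only [deriv_comp_sub_const] at hz
    rw [hz]; ring
  have h1 := tendsto_integral_mul_conv hf (hψ.foldr v.sort) hY hY0 hY1 hYs
  have h2 := (tendsto_integral_mul_conv hg hψ hY hY0 hY1 hYs).const_mul ((-1 : ℝ) ^ v.card)
  refine tendsto_nhds_unique h1 (h2.congr fun n => (key n).symm)

/-- A locally integrable function all of whose integrals over cubes vanish is zero. -/
theorem ae_eq_zero_of_cube_integrals {s : ℕ} {h : (Fin s → ℝ) → ℝ} (hh : LocallyIntegrable h)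
    (h0 : ∀ (x : Fin s → ℝ) (r : ℝ), 0 < r →
      ∫ y, h y * ∏ j, (Set.Icc (x j - r) (x j + r)).indicator (fun _ => (1 : ℝ)) (y j) = 0) :
    ∀ᵐ x, h x = 0 := by
  -- Lebesgue differentiation: balls of the sup norm are cubes, so every average tends to the value
  -- of `h` and is zero.
  filter_upwards [IsUnifLocDoublingMeasure.ae_tendsto_average (volume : Measure (Fin s → ℝ)) hh 1]
    with x hx
  have hδ : Filter.Tendsto (fun n : ℕ => 1 / ((n : ℝ) + 1)) Filter.atTop
      (nhdsWithin 0 (Set.Ioi 0)) :=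
    tendsto_nhdsWithin_iff.2 ⟨tendsto_one_div_add_atTop_nhds_zero_nat,
      Filter.Eventually.of_forall fun n => Set.mem_Ioi.2 (by positivity)⟩
  have := hx (fun _ => x) _ hδ (Filter.Eventually.of_forall fun n => by
    simp; positivity)
  refine tendsto_nhds_unique this (tendsto_const_nhds.congr fun n => ?_)
  have hr : (0 : ℝ) < 1 / ((n : ℝ) + 1) := by positivity
  rw [setAverage_eq, ← integral_indicator Metric.isClosed_closedBall.measurableSet]
  have : (fun y => (Metric.closedBall x (1 / ((n : ℝ) + 1))).indicator h y) = fun y =>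
      h y * ∏ j, (Set.Icc (x j - 1 / ((n : ℝ) + 1)) (x j + 1 / ((n : ℝ) + 1))).indicator
        (fun _ => (1 : ℝ)) (y j) := by
    ext y
    rw [closedBall_pi x hr.le]
    simp only [Real.closedBall_eq_Icc]
    by_cases hy : ∀ j, y j ∈ Set.Icc (x j - 1 / ((n : ℝ) + 1)) (x j + 1 / ((n : ℝ) + 1))
    · rw [Set.indicator_of_mem (Set.mem_univ_pi.2 hy),
        Finset.prod_congr rfl fun j _ => Set.indicator_of_mem (hy j) _]
      simp
    · rw [Set.indicator_of_notMem fun h => hy (Set.mem_univ_pi.1 h)]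
      push Not at hy
      obtain ⟨j, hj⟩ := hy
      rw [Finset.prod_eq_zero (Finset.mem_univ j) (Set.indicator_of_notMem hj _), mul_zero]
  rw [this, h0 x _ hr, smul_zero]

end BDIS

namespace BDIS

/-! ### The distribution function, the quantile function and the tail function -/

/-- The smaller of the two tails at `y`. -/
noncomputable def tail (φ : ℝ → ℝ) (y : ℝ) : ℝ := min (cdfOf φ y) (1 - cdfOf φ y)

/-- The kernel recovering a mean-zero function from its derivative. -/
noncomputable def kern (φ : ℝ → ℝ) (x y : ℝ) : ℝ := (cdfOf φ y - if x < y then 1 else 0) / φ y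

namespace IsLightTailedDensity

variable {φ : ℝ → ℝ} (hφ : IsLightTailedDensity φ)
include hφ

theorem cdf_sub_cdf {x y : ℝ} (h : x ≤ y) : cdfOf φ y - cdfOf φ x = ∫ t in Set.Ioc x y, φ t := by
  unfold cdfOf
  rw [← intervalIntegral.integral_of_le h,
    intervalIntegral.integral_Iic_sub_Iic hφ.integrable.integrableOn hφ.integrable.integrableOn]

theorem strictMono_cdf : StrictMono (cdfOf φ) := fun x y h => by
  rw [← sub_pos, hφ.cdf_sub_cdf h.le, setIntegral_pos_iff_support_of_nonneg_ae
    (Filter.Eventually.of_forall hφ.nonneg) hφ.integrable.integrableOn]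
  have : Function.support φ = Set.univ := by
    ext z; simpa using (hφ.pos z).ne'
  simp [this, h]

theorem continuous_cdf : Continuous (cdfOf φ) := by
  have : cdfOf φ = fun x => cdfOf φ 0 + ∫ t in (0 : ℝ)..x, φ t := by
    ext x
    unfold cdfOf
    rw [← intervalIntegral.integral_Iic_sub_Iic hφ.integrable.integrableOn
      hφ.integrable.integrableOn]
    ring
  rw [this]
  exact continuous_const.add (intervalIntegral.continuous_primitive
    (fun a b => hφ.integrable.intervalIntegrable) 0)

theorem cdf_nonneg (x : ℝ) : 0 ≤ cdfOf φ x := setIntegral_nonneg measurableSet_Iic fun _ _ => hφ.nonneg _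

theorem cdf_pos (x : ℝ) : 0 < cdfOf φ x :=
  (hφ.cdf_nonneg (x - 1)).trans_lt (hφ.strictMono_cdf (by linarith))

theorem cdf_neg (x : ℝ) : cdfOf φ (-x) = 1 - cdfOf φ x := by
  unfold cdfOf
  rw [← integral_comp_neg_Ioi, ← hφ.integral_eq_one, ← integral_add_compl measurableSet_Iic
    hφ.integrable (s := Set.Iic x), Set.compl_Iic]
  simp [hφ.symm]

theorem cdf_lt_one (x : ℝ) : cdfOf φ x < 1 := by
  have := hφ.cdf_pos (-x)
  rw [hφ.cdf_neg] at this
  linarith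

theorem nuOf_Iic (x : ℝ) : nuOf φ (Set.Iic x) = ENNReal.ofReal (cdfOf φ x) :=
  hφ.nuOf_apply measurableSet_Iic

theorem nuOf_Iio (x : ℝ) : nuOf φ (Set.Iio x) = ENNReal.ofReal (cdfOf φ x) := by
  rw [hφ.nuOf_apply measurableSet_Iio, ← integral_Iic_eq_integral_Iio, cdfOf]

theorem tendsto_cdf_atBot : Filter.Tendsto (cdfOf φ) Filter.atBot (nhds 0) := by
  have := hφ.isProbabilityMeasure_nuOf
  refine (ProbabilityTheory.tendsto_cdf_atBot (nuOf φ)).congr fun x => ?_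
  rw [ProbabilityTheory.cdf_eq_real, Measure.real, hφ.nuOf_Iic,
    ENNReal.toReal_ofReal (hφ.cdf_nonneg x)]

theorem tendsto_cdf_atTop : Filter.Tendsto (cdfOf φ) Filter.atTop (nhds 1) := by
  have h := hφ.tendsto_cdf_atBot.comp Filter.tendsto_neg_atTop_atBot
  have h2 := (tendsto_const_nhds (x := (1 : ℝ))).sub h
  simp only [sub_zero] at h2
  refine h2.congr fun x => ?_
  simp [hφ.cdf_neg]

theorem exists_cdf_eq {t : ℝ} (ht : t ∈ Set.Ioo (0 : ℝ) 1) : ∃ x, cdfOf φ x = t := by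
  obtain ⟨a, ha⟩ := (hφ.tendsto_cdf_atBot.eventually (gt_mem_nhds ht.1)).exists
  obtain ⟨b, hb⟩ := (hφ.tendsto_cdf_atTop.eventually (lt_mem_nhds ht.2)).exists
  exact mem_range_of_exists_le_of_exists_ge hφ.continuous_cdf ⟨a, ha.le⟩ ⟨b, hb.le⟩

theorem cdf_quantile {t : ℝ} (ht : t ∈ Set.Ioo (0 : ℝ) 1) : cdfOf φ (quantile φ t) = t := by
  obtain ⟨x, rfl⟩ := hφ.exists_cdf_eq ht
  have : {z : ℝ | cdfOf φ x ≤ cdfOf φ z} = Set.Ici x := by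
    ext z; exact hφ.strictMono_cdf.le_iff_le
  rw [quantile, this, csInf_Ici]

theorem quantile_le_iff {t : ℝ} (ht : t ∈ Set.Ioo (0 : ℝ) 1) (a : ℝ) :
    quantile φ t ≤ a ↔ t ≤ cdfOf φ a := by
  rw [← hφ.strictMono_cdf.le_iff_le, hφ.cdf_quantile ht]

theorem quantile_lt_iff {t : ℝ} (ht : t ∈ Set.Ioo (0 : ℝ) 1) (a : ℝ) :
    quantile φ t < a ↔ t < cdfOf φ a := by
  rw [← hφ.strictMono_cdf.lt_iff_lt, hφ.cdf_quantile ht]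

/-- Outside `(0,1)` the defining set is the whole line or empty, and both infima are 0 by
convention. -/
theorem quantile_of_notMem {t : ℝ} (ht : t ∉ Set.Ioo (0 : ℝ) 1) : quantile φ t = 0 := by
  unfold quantile
  rcases le_or_gt t 0 with h | h
  · have : {x : ℝ | t ≤ cdfOf φ x} = Set.univ := by
      ext x; simpa using h.trans (hφ.cdf_nonneg x)
    rw [this, Real.sInf_univ]
  · have : {x : ℝ | t ≤ cdfOf φ x} = ∅ := by
      ext x
      simp only [Set.mem_ofPred_eq, Set.mem_empty_iff_false, iff_false, not_le]
      exact (hφ.cdf_lt_one x).trans_le (not_lt.1 fun h' => ht ⟨h, h'⟩)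
    rw [this, Real.sInf_empty]

theorem measurable_quantile : Measurable (quantile φ) := by
  refine measurable_of_Iic fun a => ?_
  have : quantile φ ⁻¹' Set.Iic a = (Set.Ioo 0 1 ∩ Set.Iic (cdfOf φ a)) ∪
      ((Set.Ioo 0 1)ᶜ ∩ {_t : ℝ | 0 ≤ a}) := by
    ext t
    by_cases ht : t ∈ Set.Ioo (0 : ℝ) 1
    · simp only [Set.mem_preimage, Set.mem_Iic, hφ.quantile_le_iff ht]
      simp [ht]
    · simp only [Set.mem_preimage, Set.mem_Iic, hφ.quantile_of_notMem ht]
      simp [ht]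
  rw [this]
  exact (measurableSet_Ioo.inter measurableSet_Iic).union
    (measurableSet_Ioo.compl.inter (MeasurableSet.const _))

theorem map_quantile : (volume.restrict (Set.Ioo (0 : ℝ) 1)).map (quantile φ) = nuOf φ := by
  have : IsFiniteMeasure ((volume.restrict (Set.Ioo (0 : ℝ) 1)).map (quantile φ)) := inferInstance
  refine Measure.ext_of_Iic _ _ fun a => ?_
  rw [Measure.map_apply hφ.measurable_quantile measurableSet_Iic,
    Measure.restrict_apply (hφ.measurable_quantile measurableSet_Iic), hφ.nuOf_Iic]
  have : quantile φ ⁻¹' Set.Iic a ∩ Set.Ioo 0 1 = Set.Ioc 0 (cdfOf φ a) := by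
    ext t
    constructor
    · rintro ⟨h1, h2⟩
      exact ⟨h2.1, (hφ.quantile_le_iff h2 a).1 h1⟩
    · rintro ⟨h1, h2⟩
      have h3 : t ∈ Set.Ioo (0 : ℝ) 1 := ⟨h1, h2.trans_lt (hφ.cdf_lt_one a)⟩
      exact ⟨(hφ.quantile_le_iff h3 a).2 h2, h3⟩
  rw [this, Real.volume_Ioc, sub_zero]

theorem map_cdf : (nuOf φ).map (cdfOf φ) = volume.restrict (Set.Ioo (0 : ℝ) 1) := by
  rw [← hφ.map_quantile, Measure.map_map hφ.continuous_cdf.measurable hφ.measurable_quantile]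
  conv_rhs => rw [← Measure.map_id (μ := volume.restrict (Set.Ioo (0 : ℝ) 1))]
  refine Measure.map_congr ?_
  filter_upwards [ae_restrict_mem measurableSet_Ioo] with t ht
  exact hφ.cdf_quantile ht

theorem continuous_tail : Continuous (tail φ) :=
  hφ.continuous_cdf.min (continuous_const.sub hφ.continuous_cdf)

theorem tail_pos (y : ℝ) : 0 < tail φ y :=
  lt_min (hφ.cdf_pos y) (sub_pos.2 (hφ.cdf_lt_one y))

theorem tail_le_one (y : ℝ) : tail φ y ≤ 1 := (min_le_left _ _).trans (hφ.cdf_lt_one y).le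

theorem tail_neg (y : ℝ) : tail φ (-y) = tail φ y := by
  unfold tail
  rw [hφ.cdf_neg, sub_sub_cancel, min_comm]

/-- Evenness carries the light-tail condition to the right half-line, with the right tail in place
of the left. -/
theorem exists_tail_le {ε : ℝ} (hε : 0 < ε) : ∃ c, 0 < c ∧ ∀ y, c * tail φ y ^ (1 + ε) ≤ φ y := by
  obtain ⟨c, hc, h⟩ := hφ.light_tail ε hε
  have h' : ∀ y ≤ 0, c * tail φ y ^ (1 + ε) ≤ φ y := fun y hy =>
    (mul_le_mul_of_nonneg_left (Real.rpow_le_rpow (hφ.tail_pos y).le (min_le_left _ _)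
      (by linarith)) hc.le).trans (h y hy)
  refine ⟨c, hc, fun y => ?_⟩
  rcases le_total y 0 with hy | hy
  · exact h' y hy
  · rw [← hφ.symm y, ← hφ.tail_neg y]
    exact h' (-y) (by linarith)

/-- Under the law with density `φ` the variable `Φ` is uniform, so the integrand becomes `min t (1 -
t) ^ (-a)` on `(0,1)`. -/
theorem integrable_tail_rpow {a : ℝ} (ha : a < 1) :
    Integrable (fun y => tail φ y ^ (-a)) (nuOf φ) := by
  have h1 : Integrable (fun t : ℝ => t ^ (-a)) (volume.restrict (Set.Ioo (0 : ℝ) 1)) := by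
    have := (intervalIntegral.intervalIntegrable_rpow' (a := 0) (b := 1) (r := -a) (by linarith))
    rw [intervalIntegrable_iff_integrableOn_Ioo_of_le zero_le_one] at this
    exact this
  have h2 : Integrable (fun t : ℝ => (1 - t) ^ (-a)) (volume.restrict (Set.Ioo (0 : ℝ) 1)) := by
    have := (intervalIntegral.intervalIntegrable_rpow' (a := 0) (b := 1) (r := -a)
      (by linarith)).comp_sub_left 1
    simp only [sub_zero, sub_self] at this
    have := this.symm
    rw [intervalIntegrable_iff_integrableOn_Ioo_of_le zero_le_one] at this
    exact this
  have h3 : Integrable (fun t : ℝ => (min t (1 - t)) ^ (-a)) (volume.restrict (Set.Ioo (0 : ℝ) 1)) := by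
    refine (h1.add h2).mono' (Measurable.pow_const (by fun_prop) _).aestronglyMeasurable ?_
    filter_upwards [ae_restrict_mem measurableSet_Ioo] with t ht
    have h4 : 0 ≤ t ^ (-a) := Real.rpow_nonneg ht.1.le _
    have h5 : 0 ≤ (1 - t) ^ (-a) := Real.rpow_nonneg (by linarith [ht.2]) _
    simp only [Pi.add_apply]
    rcases min_choice t (1 - t) with h | h <;> rw [h, Real.norm_of_nonneg (by assumption)] <;> linarith
  rw [← hφ.map_cdf] at h3
  exact h3.comp_measurable hφ.continuous_cdf.measurable

theorem measurable_kern : Measurable fun z : ℝ × ℝ => kern φ z.1 z.2 := by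
  unfold kern
  refine ((hφ.continuous_cdf.measurable.comp measurable_snd).sub ?_).div
    (hφ.measurable.comp measurable_snd)
  exact Measurable.ite (measurableSet_lt measurable_fst measurable_snd) measurable_const
    measurable_const

/-- The left side is one of the two tails at `y`. If it is the smaller one, it equals `tail φ y`,
which is below the right side because tails and `r` are at most 1. If it is the larger one, then `x`
lies further out than `y` on the other side, so the ratio is at least 1 and the trivial bound 1
suffices. -/
theorem abs_cdf_sub_le {r : ℝ} (h0 : 0 ≤ r) (h1 : r ≤ 1) (x y : ℝ) :
    |cdfOf φ y - if x < y then 1 else 0| ≤ (tail φ y / tail φ x) ^ r := by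
  have hx := hφ.tail_pos x
  have hy := hφ.tail_pos y
  have A : tail φ x ≤ tail φ y → 1 ≤ (tail φ y / tail φ x) ^ r := fun h =>
    Real.one_le_rpow ((one_le_div hx).2 h) h0
  have B : tail φ y ≤ (tail φ y / tail φ x) ^ r := by
    calc tail φ y = tail φ y ^ (1 : ℝ) := (Real.rpow_one _).symm
      _ ≤ tail φ y ^ r := Real.rpow_le_rpow_of_exponent_ge hy (hφ.tail_le_one y) h1
      _ ≤ _ := Real.rpow_le_rpow hy.le ((le_div_iff₀ hx).2 (by nlinarith [hφ.tail_le_one x])) h0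
  split_ifs with h
  · rw [abs_sub_comm, abs_of_nonneg (by linarith [hφ.cdf_lt_one y])]
    by_cases hc : 1 - cdfOf φ y ≤ cdfOf φ y
    · rwa [tail, min_eq_right hc] at B ⊢
    · refine le_trans (by linarith [hφ.cdf_nonneg y]) (A ?_)
      rw [tail, tail, min_eq_left (by linarith : cdfOf φ y ≤ 1 - cdfOf φ y)]
      exact (min_le_left _ _).trans (hφ.strictMono_cdf h).le
  · rw [sub_zero, abs_of_nonneg (hφ.cdf_nonneg y)]
    by_cases hc : cdfOf φ y ≤ 1 - cdfOf φ y
    · rwa [tail, min_eq_left hc] at B ⊢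
    · refine le_trans (hφ.cdf_lt_one y).le (A ?_)
      rw [tail, tail, min_eq_right (by linarith : 1 - cdfOf φ y ≤ cdfOf φ y)]
      exact (min_le_right _ _).trans (by linarith [hφ.strictMono_cdf.monotone (not_lt.1 h)])

/-- Take `r = 1 - a/2` in `abs_cdf_sub_le` and the light-tail condition with `a/2`: the exponent of
`tail φ y` is `(1 - a/2) - (1 + a/2) = -a`, while that of `tail φ x` stays above -1 and is therefore
integrable. -/
theorem exists_kern_bound {a : ℝ} (ha0 : 0 < a) (ha1 : a < 1) :
    ∃ C, 0 < C ∧ ∀ x y, |kern φ x y| ≤ (C * tail φ x ^ (-(1 - a / 2))) * tail φ y ^ (-a) := by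
  obtain ⟨c, hc, h⟩ := hφ.exists_tail_le (ε := a / 2) (by linarith)
  refine ⟨c⁻¹, inv_pos.2 hc, fun x y => ?_⟩
  have hx := hφ.tail_pos x
  have hy := hφ.tail_pos y
  rw [kern, abs_div, abs_of_pos (hφ.pos y), div_le_iff₀ (hφ.pos y)]
  refine (hφ.abs_cdf_sub_le (r := 1 - a / 2) (by linarith) (by linarith) x y).trans ?_
  calc (tail φ y / tail φ x) ^ (1 - a / 2)
      = (c⁻¹ * tail φ x ^ (-(1 - a / 2))) * tail φ y ^ (-a) * (c * tail φ y ^ (1 + a / 2)) := by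
        rw [Real.div_rpow hy.le hx.le, Real.rpow_neg hx.le]
        have : tail φ y ^ (1 - a / 2) = tail φ y ^ (-a) * tail φ y ^ (1 + a / 2) := by
          rw [← Real.rpow_add hy]; congr 1; ring
        rw [this]
        field_simp
    _ ≤ _ := mul_le_mul_of_nonneg_left (h y) (by positivity)

/-- Mean zero in `x` is what makes the functions `rep` behave like ANOVA terms. -/
theorem integral_kern (y : ℝ) : ∫ x, kern φ x y ∂nuOf φ = 0 := by
  have := hφ.isProbabilityMeasure_nuOf
  have h1 : ∀ x, kern φ x y = (cdfOf φ y - (Set.Iio y).indicator (fun _ => (1 : ℝ)) x) / φ y :=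
    fun x => by
      by_cases h : x < y <;> simp [kern, h]
  simp_rw [h1]
  rw [integral_div, integral_sub (integrable_const _)
    ((integrable_indicator_iff measurableSet_Iio).2 (integrable_const _).integrableOn),
    integral_indicator measurableSet_Iio]
  simp [Measure.real, hφ.nuOf_Iio, ENNReal.toReal_ofReal (hφ.cdf_nonneg y)]

end IsLightTailedDensity
end BDIS

namespace BDIS

/-! ### Functions represented by their mixed derivative -/

/-- `c` and `ζ` dominate the kernel `kern φ` by a product. -/
structure KernBound (φ c ζ : ℝ → ℝ) : Prop where
  continuous : Continuous c
  integrable : Integrable c (nuOf φ)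
  nonneg : ∀ x, 0 ≤ c x
  nonneg' : ∀ y, 0 ≤ ζ y
  bound : ∀ x y, |kern φ x y| ≤ c x * ζ y

/-- The function with mixed derivative `D` whose means over the coordinates in `v` vanish. -/
noncomputable def rep (φ : ℝ → ℝ) {s : ℕ} (v : Finset (Fin s)) (D : (Fin s → ℝ) → ℝ)
    (x : Fin s → ℝ) : ℝ :=
  ∫ y, (∏ j ∈ v, kern φ (x j) (y j)) * D y ∂prodMeasure φ s

/-- `D` is measurable and integrable against the weight `∏ ζ`. -/
def Admissible (φ ζ : ℝ → ℝ) {s : ℕ} (v : Finset (Fin s)) (D : (Fin s → ℝ) → ℝ) : Prop :=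
  Measurable D ∧ Integrable (fun y => (∏ j ∈ v, ζ (y j)) * D y) (prodMeasure φ s)

theorem prod_add_eq_sum_ite {ι : Type*} [Fintype ι] [DecidableEq ι] (a b : ι → ℝ) :
    ∏ j, (a j + b j) = ∑ v : Finset ι, ∏ j, if j ∈ v then a j else b j := by
  rw [Finset.prod_add, Finset.powerset_univ]
  refine Finset.sum_congr rfl fun v _ => ?_
  rw [Finset.prod_ite]
  congr 1
  · refine Finset.prod_congr ?_ fun _ _ => rfl
    ext; simp
  · refine Finset.prod_congr ?_ fun _ _ => rfl
    ext; simp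

section

variable {φ c ζ : ℝ → ℝ} (hφ : IsLightTailedDensity φ) (hk : KernBound φ c ζ) {s : ℕ}
  {v : Finset (Fin s)} {D : (Fin s → ℝ) → ℝ}
include hφ hk

omit hφ in
theorem KernBound.abs_prod_le (x y : Fin s → ℝ) :
    |∏ j ∈ v, kern φ (x j) (y j)| ≤ (∏ j ∈ v, c (x j)) * ∏ j ∈ v, ζ (y j) := by
  rw [Finset.abs_prod, ← Finset.prod_mul_distrib]
  exact Finset.prod_le_prod (fun j _ => abs_nonneg _) fun j _ => hk.bound _ _

omit hk in
theorem measurable_prod_kern : Measurable fun z : (Fin s → ℝ) × (Fin s → ℝ) =>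
    ∏ j ∈ v, kern φ (z.1 j) (z.2 j) :=
  Finset.measurable_prod _ fun j _ =>
    hφ.measurable_kern.comp (f := fun z : (Fin s → ℝ) × (Fin s → ℝ) => (z.1 j, z.2 j))
      (by fun_prop)

theorem integrable_rep (hD : Admissible φ ζ v D) (x : Fin s → ℝ) :
    Integrable (fun y => (∏ j ∈ v, kern φ (x j) (y j)) * D y) (prodMeasure φ s) := by
  refine (hD.2.const_mul (∏ j ∈ v, c (x j))).mono ?_ (Filter.Eventually.of_forall fun y => ?_)
  · exact (((measurable_prod_kern hφ).comp (measurable_const.prodMk measurable_id)).mul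
      hD.1).aestronglyMeasurable
  · simp only [norm_mul, Real.norm_eq_abs, ← mul_assoc]
    refine mul_le_mul_of_nonneg_right ?_ (abs_nonneg _)
    rw [abs_of_nonneg (Finset.prod_nonneg fun j _ => hk.nonneg _),
      abs_of_nonneg (Finset.prod_nonneg fun j _ => hk.nonneg' _)]
    exact hk.abs_prod_le x y

theorem abs_rep_le (hD : Admissible φ ζ v D) (x : Fin s → ℝ) :
    |rep φ v D x| ≤ (∏ j ∈ v, c (x j)) * ∫ y, |(∏ j ∈ v, ζ (y j)) * D y| ∂prodMeasure φ s := by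
  rw [← integral_const_mul]
  refine abs_integral_le_integral_abs.trans (integral_mono (integrable_rep hφ hk hD x).abs
    (hD.2.abs.const_mul _) fun y => ?_)
  simp only [abs_mul, ← mul_assoc]
  refine mul_le_mul_of_nonneg_right ?_ (abs_nonneg _)
  rw [abs_of_nonneg (Finset.prod_nonneg fun j _ => hk.nonneg' _ : 0 ≤ ∏ j ∈ v, ζ (y j))]
  exact hk.abs_prod_le x y

omit hk in
theorem measurable_rep (hD : Admissible φ ζ v D) : Measurable (rep φ v D) := by
  have := hφ.isProbabilityMeasure_prodMeasure s
  have h : StronglyMeasurable (Function.uncurry fun (x y : Fin s → ℝ) =>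
      (∏ j ∈ v, kern φ (x j) (y j)) * D y) :=
    ((measurable_prod_kern hφ).mul (hD.1.comp measurable_snd)).stronglyMeasurable
  exact h.integral_prod_right.measurable

theorem locallyIntegrable_rep (hD : Admissible φ ζ v D) : LocallyIntegrable (rep φ v D) := by
  have h : Continuous fun x : Fin s → ℝ => (∏ j ∈ v, c (x j)) *
      ∫ y, |(∏ j ∈ v, ζ (y j)) * D y| ∂prodMeasure φ s :=
    (continuous_finsetProd _ fun j _ => hk.continuous.comp (continuous_apply j)).mul
      continuous_const
  refine h.locallyIntegrable.mono (measurable_rep hφ hD).aestronglyMeasurable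
    (Filter.Eventually.of_forall fun x => ?_)
  exact (abs_rep_le hφ hk hD x).trans (le_abs_self _)

/-- Fubini, justified by the product domination of the kernel; the inner integral then factorises
over the coordinates. -/
theorem integral_prod_mul_rep (hD : Admissible φ ζ v D) {ψ : Fin s → ℝ → ℝ}
    (hψ : ∀ j, Integrable (ψ j)) (hψc : ∀ j, Integrable fun x => ψ j x * c x) :
    ∫ x, rep φ v D x * ∏ j, ψ j (x j) = ∫ y, D y * ∏ j,
      (if j ∈ v then ∫ x, kern φ x (y j) * ψ j x else ∫ x, ψ j x) ∂prodMeasure φ s := by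
  have := hφ.isProbabilityMeasure_prodMeasure s
  have hint : Integrable (Function.uncurry fun (x y : Fin s → ℝ) =>
      ((∏ j ∈ v, kern φ (x j) (y j)) * D y) * ∏ j, ψ j (x j))
      ((volume : Measure (Fin s → ℝ)).prod (prodMeasure φ s)) := by
    have h1 : Integrable fun x : Fin s → ℝ => ∏ j, (if j ∈ v then ψ j (x j) * c (x j) else ψ j (x j)) := by
      refine Integrable.fintype_prod (f := fun j t => if j ∈ v then ψ j t * c t else ψ j t)
        fun j => ?_
      by_cases hj : j ∈ v
      · simpa [hj] using hψc j
      · simpa [hj] using hψ j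
    refine (h1.mul_prod hD.2).mono ?_ (Filter.Eventually.of_forall fun z => ?_)
    · refine AEStronglyMeasurable.mul ((measurable_prod_kern hφ).mul
        (hD.1.comp measurable_snd)).aestronglyMeasurable ?_
      exact (Integrable.fintype_prod hψ).aestronglyMeasurable.comp_fst
    · simp only [Function.uncurry, norm_mul, Real.norm_eq_abs]
      have e : |∏ j, (if j ∈ v then ψ j (z.1 j) * c (z.1 j) else ψ j (z.1 j))|
          = (∏ j ∈ v, c (z.1 j)) * |∏ j, ψ j (z.1 j)| := by
        rw [Finset.abs_prod, Finset.abs_prod, ← Fintype.prod_ite_mem v, ← Finset.prod_mul_distrib]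
        refine Finset.prod_congr rfl fun j _ => ?_
        by_cases hj : j ∈ v
        · simp [hj, abs_mul, abs_of_nonneg (hk.nonneg _), mul_comm]
        · simp [hj]
      rw [e]
      have h2 := hk.abs_prod_le (v := v) z.1 z.2
      rw [abs_of_nonneg (Finset.prod_nonneg fun j _ => hk.nonneg' _ : 0 ≤ ∏ j ∈ v, ζ (z.2 j))]
      calc |∏ j ∈ v, kern φ (z.1 j) (z.2 j)| * |D z.2| * |∏ j, ψ j (z.1 j)|
          ≤ ((∏ j ∈ v, c (z.1 j)) * ∏ j ∈ v, ζ (z.2 j)) * |D z.2| * |∏ j, ψ j (z.1 j)| := by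
            gcongr
        _ = _ := by ring
  unfold rep
  simp_rw [← integral_mul_const]
  rw [integral_integral_swap hint]
  refine integral_congr_ae (Filter.Eventually.of_forall fun y => ?_)
  simp only
  have e : ∀ x : Fin s → ℝ, (∏ j ∈ v, kern φ (x j) (y j)) * D y * ∏ j, ψ j (x j)
      = D y * ∏ j, (if j ∈ v then kern φ (x j) (y j) * ψ j (x j) else ψ j (x j)) := fun x => by
    rw [mul_comm _ (D y), mul_assoc, ← Fintype.prod_ite_mem v, ← Finset.prod_mul_distrib]
    congr 1
    refine Finset.prod_congr rfl fun j _ => ?_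
    by_cases hj : j ∈ v <;> simp [hj]
  simp_rw [e]
  rw [integral_const_mul, integral_fintype_prod_volume_eq_prod
    (f := fun j t => if j ∈ v then kern φ t (y j) * ψ j t else ψ j t)]
  congr 1
  refine Finset.prod_congr rfl fun j _ => ?_
  by_cases hj : j ∈ v <;> simp [hj]

/-- Integrating out a coordinate of `v` kills its kernel factor, by `integral_kern`; coordinates
outside `v` do not enter. -/
theorem partialMean_rep (hD : Admissible φ ζ v D) (w : Finset (Fin s)) (x : Fin s → ℝ) :
    partialMean φ w (rep φ v D) x = if Disjoint v w then rep φ v D x else 0 := by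
  have := hφ.isProbabilityMeasure_prodMeasure s
  have := hφ.isProbabilityMeasure_nuOf
  have hm : Measurable fun z : Fin s → ℝ => w.piecewise z x := by
    refine measurable_pi_lambda _ fun j => ?_
    by_cases hj : j ∈ w
    · simp only [Finset.piecewise, hj, if_true]; fun_prop
    · simp only [Finset.piecewise, hj, if_false]; fun_prop
  have hint : Integrable (Function.uncurry fun (z y : Fin s → ℝ) =>
      (∏ j ∈ v, kern φ (w.piecewise z x j) (y j)) * D y)
      ((prodMeasure φ s).prod (prodMeasure φ s)) := by
    have h1 : Integrable (fun z : Fin s → ℝ => ∏ j, (if j ∈ v then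
        if j ∈ w then c (z j) else c (x j) else 1)) (prodMeasure φ s) := by
      refine Integrable.fintype_prod (f := fun j t => if j ∈ v then
        if j ∈ w then c t else c (x j) else 1) fun j => ?_
      split_ifs
      · exact hk.integrable
      · exact integrable_const (μ := nuOf φ) _
      · exact integrable_const (μ := nuOf φ) _
    refine (h1.mul_prod hD.2).mono ?_ (Filter.Eventually.of_forall fun z => ?_)
    · exact (((measurable_prod_kern hφ).comp ((hm.comp measurable_fst).prodMk
        measurable_snd)).mul (hD.1.comp measurable_snd)).aestronglyMeasurable
    · simp only [Function.uncurry, norm_mul, Real.norm_eq_abs]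
      have h2 := hk.abs_prod_le (v := v) (w.piecewise z.1 x) z.2
      have h3 : (∏ j, (if j ∈ v then if j ∈ w then c (z.1 j) else c (x j) else 1))
          = ∏ j ∈ v, c (w.piecewise z.1 x j) := by
        rw [← Fintype.prod_ite_mem v]
        refine Finset.prod_congr rfl fun j _ => ?_
        by_cases hj : j ∈ v <;> by_cases hw : j ∈ w <;> simp [hj, hw]
      rw [h3, abs_of_nonneg (Finset.prod_nonneg fun j _ => hk.nonneg' _ : 0 ≤ ∏ j ∈ v, ζ (z.2 j)),
        abs_of_nonneg (Finset.prod_nonneg fun j _ => hk.nonneg _), ← mul_assoc]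
      gcongr
  unfold partialMean
  unfold rep
  rw [integral_integral_swap hint]
  have e : ∀ y : Fin s → ℝ, ∫ z, (∏ j ∈ v, kern φ (w.piecewise z x j) (y j)) * D y ∂prodMeasure φ s
      = (if Disjoint v w then (∏ j ∈ v, kern φ (x j) (y j)) * D y else 0) := fun y => by
    rw [integral_mul_const]
    have e1 : ∀ z : Fin s → ℝ, ∏ j ∈ v, kern φ (w.piecewise z x j) (y j)
        = ∏ j, (if j ∈ v then if j ∈ w then kern φ (z j) (y j) else kern φ (x j) (y j) else 1) :=
      fun z => by
        rw [← Fintype.prod_ite_mem v]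
        refine Finset.prod_congr rfl fun j _ => ?_
        by_cases hj : j ∈ v <;> by_cases hw : j ∈ w <;> simp [hj, hw]
    simp_rw [e1]
    rw [prodMeasure_eq_pi, integral_fintype_prod_eq_prod (f := fun j t => if j ∈ v then
      if j ∈ w then kern φ t (y j) else kern φ (x j) (y j) else 1)]
    by_cases hd : Disjoint v w
    · rw [if_pos hd, ← Fintype.prod_ite_mem v]
      congr 1
      refine Finset.prod_congr rfl fun j _ => ?_
      by_cases hj : j ∈ v
      · have hw : j ∉ w := Finset.disjoint_left.1 hd hj
        simp [hj, hw]
      · simp [hj]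
    · rw [if_neg hd]
      obtain ⟨j, hj, hw⟩ := Finset.not_disjoint_iff.1 hd
      rw [Finset.prod_eq_zero (Finset.mem_univ j), zero_mul]
      simp only [hj, hw, if_true]
      exact hφ.integral_kern (y j)
  simp_rw [e]
  split_ifs <;> simp

theorem integrable_rep_piecewise (hD : Admissible φ ζ v D) (w : Finset (Fin s)) (x : Fin s → ℝ) :
    Integrable (fun z => rep φ v D (w.piecewise z x)) (prodMeasure φ s) := by
  have := hφ.isProbabilityMeasure_nuOf
  have hm : Measurable fun z : Fin s → ℝ => w.piecewise z x := by
    refine measurable_pi_lambda _ fun j => ?_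
    by_cases hj : j ∈ w
    · simp only [Finset.piecewise, hj, if_true]; fun_prop
    · simp only [Finset.piecewise, hj, if_false]; fun_prop
  have h1 : Integrable (fun z : Fin s → ℝ => ∏ j, (if j ∈ v then
      if j ∈ w then c (z j) else c (x j) else 1)) (prodMeasure φ s) := by
    refine Integrable.fintype_prod (f := fun j t => if j ∈ v then
      if j ∈ w then c t else c (x j) else 1) fun j => ?_
    split_ifs
    · exact hk.integrable
    · exact integrable_const (μ := nuOf φ) _
    · exact integrable_const (μ := nuOf φ) _
  refine (h1.mul_const (∫ y, |(∏ j ∈ v, ζ (y j)) * D y| ∂prodMeasure φ s)).mono'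
    ((measurable_rep hφ hD).comp hm).aestronglyMeasurable
    (Filter.Eventually.of_forall fun z => ?_)
  refine (abs_rep_le hφ hk hD _).trans (le_of_eq ?_)
  congr 1
  rw [← Fintype.prod_ite_mem v]
  refine Finset.prod_congr rfl fun j _ => ?_
  by_cases hj : j ∈ v <;> by_cases hw : j ∈ w <;> simp [hj, hw]

/-- If `f` is a sum of represented functions, these are its ANOVA terms. -/
theorem anova_eq_rep {f : (Fin s → ℝ) → ℝ} {D : Finset (Fin s) → (Fin s → ℝ) → ℝ}
    (hD : ∀ v, Admissible φ ζ v (D v)) (hf : ∀ᵐ x, f x = ∑ v, rep φ v (D v) x) :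
    ∀ᵐ x, ∀ v, anova φ f v x = rep φ v (D v) x := by
  have := hφ.isProbabilityMeasure_prodMeasure s
  have := hφ.isProbabilityMeasure_nuOf
  have hpm : ∀ᵐ x : Fin s → ℝ, ∀ w : Finset (Fin s), partialMean φ w f x
      = ∑ v, if Disjoint v w then rep φ v (D v) x else 0 := by
    rw [ae_all_iff]
    intro w
    -- The means are integrals over slices, which are null sets. Mixing the coordinates of two
    -- independent samples preserves the law, so by Fubini the identity for `f` holds almost
    -- everywhere on almost every slice.
    have h1 : ∀ᵐ z ∂(prodMeasure φ s).prod (prodMeasure φ s), f (w.piecewise z.1 z.2)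
        = ∑ v, rep φ v (D v) (w.piecewise z.1 z.2) :=
      (measurePreserving_piecewise (nuOf φ) w).quasiMeasurePreserving.ae
        (hφ.prodMeasure_absolutelyContinuous s hf)
    have h2 : ∀ᵐ z ∂(prodMeasure φ s).prod (prodMeasure φ s), f (w.piecewise z.2 z.1)
        = ∑ v, rep φ v (D v) (w.piecewise z.2 z.1) :=
      (Measure.measurePreserving_swap (μ := prodMeasure φ s)
        (ν := prodMeasure φ s)).quasiMeasurePreserving.ae h1
    have h3 := hφ.absolutelyContinuous_prodMeasure s (Measure.ae_ae_of_ae_prod h2)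
    filter_upwards [h3] with x hx
    unfold partialMean
    rw [integral_congr_ae hx, integral_finsetSum _ fun v _ =>
      integrable_rep_piecewise hφ hk (hD v) w x]
    exact Finset.sum_congr rfl fun v _ => partialMean_rep hφ hk (hD v) w x
  filter_upwards [hpm] with x hx v
  induction v using Finset.strongInduction with
  | H v ih =>
    rw [anova_eq_sub, hx, Finset.sum_congr rfl fun w hw => ih w (Finset.mem_ssubsets.1 hw),
      ← Finset.sum_filter]
    have : (Finset.univ.filter fun u : Finset (Fin s) => Disjoint u vᶜ) = v.powerset := by
      ext u
      simp [disjoint_compl_right_iff]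
    rw [this, Finset.ssubsets, ← Finset.add_sum_erase _ _ (Finset.mem_powerset_self v)]
    ring

end
end BDIS

namespace BDIS

/-! ### Functions in the mixed Sobolev space are sums of represented functions -/

/-- Compactly supported densities approximating `φ`, dominated by `2 φ` so that all tails remain
comparable with those of `φ`. -/
theorem IsLightTailedDensity.exists_truncation {φ : ℝ → ℝ} (hφ : IsLightTailedDensity φ) :
    ∃ ρ : ℕ → ℝ → ℝ, (∀ n, Measurable (ρ n)) ∧ (∃ C, ∀ n x, |ρ n x| ≤ C) ∧
      (∀ n, ∃ R, ∀ x, R < |x| → ρ n x = 0) ∧ (∀ n x, 0 ≤ ρ n x) ∧ (∀ n x, ρ n x ≤ 2 * φ x) ∧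
      (∀ n, ∫ x, ρ n x = 1) ∧
      ∀ x, Filter.Tendsto (fun n => ρ n x) Filter.atTop (nhds (φ x)) := by
  obtain ⟨M, hM⟩ := hφ.bounded
  have hM : ∀ x, φ x ≤ M := fun x => hM ⟨x, rfl⟩
  set Z : ℕ → ℝ := fun n => ∫ x in Set.Icc (-(n : ℝ)) n, φ x with hZ
  have hZ1 : Filter.Tendsto Z Filter.atTop (nhds 1) := by
    have := intervalIntegral_tendsto_integral hφ.integrable
      (Filter.tendsto_neg_atTop_atBot.comp tendsto_natCast_atTop_atTop)
      (tendsto_natCast_atTop_atTop (R := ℝ))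
    rw [hφ.integral_eq_one] at this
    refine this.congr fun n => ?_
    simp only [Function.comp_apply, hZ]
    rw [intervalIntegral.integral_of_le (by simp), integral_Icc_eq_integral_Ioc]
  -- Starting the sequence once the truncated mass exceeds 1/2 is the source of the factor 2.
  obtain ⟨N, hN⟩ := Filter.eventually_atTop.1 (hZ1.eventually (lt_mem_nhds (by norm_num : (1 / 2 : ℝ) < 1)))
  have hN' : ∀ n, 1 / 2 < Z (n + N) := fun n => hN _ (by omega)
  refine ⟨fun n x => (Set.Icc (-((n + N : ℕ) : ℝ)) (n + N : ℕ)).indicator φ x / Z (n + N),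
    fun n => (hφ.measurable.indicator measurableSet_Icc).div_const _, ?_⟩
  have h0 : ∀ n x, 0 ≤ (Set.Icc (-((n + N : ℕ) : ℝ)) (n + N : ℕ)).indicator φ x / Z (n + N) :=
    fun n x => div_nonneg (Set.indicator_nonneg (fun x _ => hφ.nonneg x) _) (by linarith [hN' n])
  have h2 : ∀ n x, (Set.Icc (-((n + N : ℕ) : ℝ)) (n + N : ℕ)).indicator φ x / Z (n + N)
      ≤ 2 * φ x := fun n x => by
    rw [div_le_iff₀ (by linarith [hN' n])]
    have : (Set.Icc (-((n + N : ℕ) : ℝ)) (n + N : ℕ)).indicator φ x ≤ φ x :=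
      Set.indicator_le_self' (fun x _ => hφ.nonneg x) x
    nlinarith [hN' n, hφ.nonneg x]
  refine ⟨⟨2 * M, fun n x => ?_⟩, fun n => ⟨(n + N : ℕ), fun x hx => ?_⟩, h0, h2, fun n => ?_,
    fun x => ?_⟩
  · rw [abs_of_nonneg (h0 n x)]
    linarith [h2 n x, hM x]
  · have hx' : x ∉ Set.Icc (-((n + N : ℕ) : ℝ)) (n + N : ℕ) := fun h => (not_le.2 hx) (abs_le.2 h)
    simp only [Set.indicator_of_notMem hx', zero_div]
  · rw [integral_div, integral_indicator measurableSet_Icc]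
    exact div_self (by linarith [hN' n])
  · have h3 : Filter.Tendsto (fun n => φ x / Z (n + N)) Filter.atTop (nhds (φ x / 1)) :=
      tendsto_const_nhds.div (hZ1.comp (Filter.tendsto_add_atTop_nat N)) one_ne_zero
    rw [div_one] at h3
    refine h3.congr' ?_
    obtain ⟨K, hK⟩ := exists_nat_ge |x|
    filter_upwards [Filter.eventually_ge_atTop K] with n hn
    rw [Set.indicator_of_mem]
    refine abs_le.1 (hK.trans ?_)
    exact_mod_cast (by omega : K ≤ n + N)

/-- The primitive of `ψ - (∫ ψ) ρ`, in terms of the distribution function of `ρ`. -/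
theorem setIntegral_Iic_sub {ψ ρ : ℝ → ℝ} (hψ : Integrable ψ) (hρ : Integrable ρ) (y : ℝ) :
    ∫ t in Set.Iic y, (ψ t - (∫ x, ψ x) * ρ t)
      = -∫ x, ((∫ t in Set.Iic y, ρ t) - if x < y then 1 else 0) * ψ x := by
  have h1 : (fun x => ((∫ t in Set.Iic y, ρ t) - if x < y then 1 else 0) * ψ x)
      = fun x => (∫ t in Set.Iic y, ρ t) * ψ x - (Set.Iio y).indicator ψ x := by
    ext x
    by_cases h : x < y <;> simp [h, sub_mul]
  rw [h1, integral_sub hψ.integrableOn (hρ.const_mul _).integrableOn,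
    integral_sub (hψ.const_mul _) (hψ.indicator measurableSet_Iio), integral_const_mul,
    integral_const_mul, integral_indicator measurableSet_Iio, integral_Iic_eq_integral_Iio]
  ring

section

variable {φ c ζ : ℝ → ℝ} (hφ : IsLightTailedDensity φ) (hk : KernBound φ c ζ) {s : ℕ}
include hφ hk

/-- Since `ρ ≤ 2 φ`, both tails of `ρ` are at most twice those of `φ`, so the kernel bound transfers
with a factor 2. The bound does not depend on `ρ`, as dominated convergence requires. -/
theorem abs_setIntegral_Iic_sub_le {ψ ρ : ℝ → ℝ} (hψ : Integrable ψ)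
    (hψc : Integrable fun x => ψ x * c x) (hρm : Measurable ρ) (h0 : ∀ x, 0 ≤ ρ x)
    (h2 : ∀ x, ρ x ≤ 2 * φ x) (h1 : ∫ x, ρ x = 1) (y : ℝ) :
    |∫ t in Set.Iic y, (ψ t - (∫ x, ψ x) * ρ t)| ≤ (2 * ∫ x, |ψ x * c x|) * (ζ y * φ y) := by
  have hρ : Integrable ρ := (hφ.integrable.const_mul 2).mono' hρm.aestronglyMeasurable
    (Filter.Eventually.of_forall fun x => by rw [Real.norm_of_nonneg (h0 x)]; exact h2 x)
  have hK : ∀ x, |(∫ t in Set.Iic y, ρ t) - if x < y then 1 else 0|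
      ≤ 2 * (c x * ζ y * φ y) := fun x => by
    have hb := hk.bound x y
    rw [kern, abs_div, abs_of_pos (hφ.pos y), div_le_iff₀ (hφ.pos y)] at hb
    refine le_trans ?_ (mul_le_mul_of_nonneg_left hb zero_le_two)
    have hA : ∫ t in Set.Iic y, ρ t ≤ 2 * cdfOf φ y := by
      rw [cdfOf, ← integral_const_mul]
      exact integral_mono hρ.integrableOn (hφ.integrable.const_mul 2).integrableOn h2
    have hB : ∫ t in Set.Ioi y, ρ t ≤ 2 * ∫ t in Set.Ioi y, φ t := by
      rw [← integral_const_mul]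
      exact integral_mono hρ.integrableOn (hφ.integrable.const_mul 2).integrableOn h2
    have hA0 : 0 ≤ ∫ t in Set.Iic y, ρ t := setIntegral_nonneg measurableSet_Iic fun _ _ => h0 _
    have hB0 : 0 ≤ ∫ t in Set.Ioi y, ρ t := setIntegral_nonneg measurableSet_Ioi fun _ _ => h0 _
    have hAB := integral_add_compl (measurableSet_Iic (a := y)) hρ
    have hAB' := integral_add_compl (measurableSet_Iic (a := y)) hφ.integrable
    rw [Set.compl_Iic] at hAB hAB'
    rw [h1] at hAB
    rw [hφ.integral_eq_one] at hAB'
    have e : ∫ t in Set.Iic y, φ t = cdfOf φ y := rfl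
    rw [e] at hAB'
    split_ifs
    · rw [abs_of_nonpos (by linarith), abs_of_nonpos (by linarith [hφ.cdf_lt_one y])]
      linarith
    · rw [sub_zero, sub_zero, abs_of_nonneg hA0, abs_of_nonneg (hφ.cdf_nonneg y)]
      exact hA
  rw [setIntegral_Iic_sub hψ hρ, abs_neg]
  calc _ ≤ ∫ x, |((∫ t in Set.Iic y, ρ t) - if x < y then 1 else 0) * ψ x| :=
        abs_integral_le_integral_abs
    _ ≤ ∫ x, |ψ x * c x| * (2 * (ζ y * φ y)) := by
        refine integral_mono_of_nonneg (Filter.Eventually.of_forall fun x => abs_nonneg _)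
          (hψc.abs.mul_const _) (Filter.Eventually.of_forall fun x => ?_)
        simp only [abs_mul, abs_of_nonneg (hk.nonneg x)]
        calc _ ≤ 2 * (c x * ζ y * φ y) * |ψ x| :=
              mul_le_mul_of_nonneg_right (hK x) (abs_nonneg _)
          _ = _ := by ring
    _ = _ := by rw [integral_mul_const]; ring

omit hk in
theorem tendsto_setIntegral_Iic_sub {ψ : ℝ → ℝ} {ρ : ℕ → ℝ → ℝ} (hψ : Integrable ψ)
    (hρm : ∀ n, Measurable (ρ n)) (h0 : ∀ n x, 0 ≤ ρ n x)
    (h2 : ∀ n x, ρ n x ≤ 2 * φ x)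
    (hlim : ∀ x, Filter.Tendsto (fun n => ρ n x) Filter.atTop (nhds (φ x))) (y : ℝ) :
    Filter.Tendsto (fun n => ∫ t in Set.Iic y, (ψ t - (∫ x, ψ x) * ρ n t)) Filter.atTop
      (nhds (-(φ y * ∫ x, kern φ x y * ψ x))) := by
  have hρ : ∀ n, Integrable (ρ n) := fun n =>
    (hφ.integrable.const_mul 2).mono' (hρm n).aestronglyMeasurable
    (Filter.Eventually.of_forall fun x => by rw [Real.norm_of_nonneg (h0 n x)]; exact h2 n x)
  have e : -(φ y * ∫ x, kern φ x y * ψ x) = (∫ t in Set.Iic y, ψ t) - (∫ x, ψ x) * cdfOf φ y := by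
    have := setIntegral_Iic_sub hψ hφ.integrable y
    rw [integral_sub hψ.integrableOn (hφ.integrable.const_mul _).integrableOn,
      integral_const_mul] at this
    rw [← integral_const_mul]
    change _ = _ - _ * ∫ t in Set.Iic y, φ t
    rw [this]
    congr 1
    refine integral_congr_ae (Filter.Eventually.of_forall fun x => ?_)
    simp only [kern, cdfOf]
    field_simp [(hφ.pos y).ne']
  rw [e]
  have e2 : ∀ n, ∫ t in Set.Iic y, (ψ t - (∫ x, ψ x) * ρ n t)
      = (∫ t in Set.Iic y, ψ t) - (∫ x, ψ x) * ∫ t in Set.Iic y, ρ n t := fun n => by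
    rw [integral_sub hψ.integrableOn ((hρ n).const_mul _).integrableOn, integral_const_mul]
  simp_rw [e2]
  refine tendsto_const_nhds.sub (Filter.Tendsto.const_mul _ ?_)
  exact tendsto_integral_of_dominated_convergence (fun x => 2 * φ x)
    (fun n => (hρm n).aestronglyMeasurable) (hφ.integrable.const_mul 2).integrableOn
    (fun n => Filter.Eventually.of_forall fun x => by
      rw [Real.norm_of_nonneg (h0 n x)]; exact h2 n x)
    (Filter.Eventually.of_forall hlim)

/-- Split each `ψ j` into a mean-zero part and a multiple of a truncated density, expand the product
over subsets `v`, and integrate by parts in the coordinates of `v`. As the truncation is removed,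
the primitive of the mean-zero part tends to `-φ(y) ∫ kern φ t y * ψ j t`; the signs cancel `(-1) ^
v.card` and Fubini recognises `rep`. -/
theorem integral_prod_eq_sum_rep {f : (Fin s → ℝ) → ℝ} {D : Finset (Fin s) → (Fin s → ℝ) → ℝ}
    (hw : ∀ v, HasWeakMixedDeriv v f (D v)) (hD : ∀ v, Admissible φ ζ v (D v))
    {ψ : Fin s → ℝ → ℝ} {C R : ℝ}
    (hψm : ∀ j, Measurable (ψ j)) (hψC : ∀ j x, |ψ j x| ≤ C) (hψR : ∀ j x, R < |x| → ψ j x = 0)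
    (hψ : ∀ j, Integrable (ψ j)) (hψc : ∀ j, Integrable fun x => ψ j x * c x) :
    ∫ x, f x * ∏ j, ψ j (x j) = ∑ v, ∫ x, rep φ v (D v) x * ∏ j, ψ j (x j) := by
  obtain ⟨ρ, hρm, ⟨M, hρC⟩, hρR, hρ0, hρ2, hρ1, hρl⟩ := hφ.exists_truncation
  choose S hS using hρR
  set k : Fin s → ℝ := fun j => ∫ x, ψ j x with hkdef
  obtain ⟨B, hB0, hB⟩ : ∃ B, 0 ≤ B ∧ ∀ j, |k j| ≤ B := by
    refine ⟨∑ j, |k j|, Finset.sum_nonneg fun j _ => abs_nonneg _, fun j =>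
      Finset.single_le_sum (f := fun j => |k j|) (fun j _ => abs_nonneg _) (Finset.mem_univ j)⟩
  have hC0 : ∀ _j : Fin s, 0 ≤ C := fun j => (abs_nonneg _).trans (hψC j 0)
  have hM0 : 0 ≤ M := (abs_nonneg _).trans (hρC 0 0)
  have hρint : ∀ n, Integrable (ρ n) := fun n =>
    (hφ.integrable.const_mul 2).mono' (hρm n).aestronglyMeasurable
    (Filter.Eventually.of_forall fun x => by rw [Real.norm_of_nonneg (hρ0 n x)]; exact hρ2 n x)
  set a : ℕ → Finset (Fin s) → Fin s → ℝ → ℝ := fun n v j t =>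
    if j ∈ v then ψ j t - k j * ρ n t else k j * ρ n t with ha
  have hfa : ∀ n v, ∫ x, f x * ∏ j, a n v j (x j)
      = (-1) ^ v.card * ∫ x, D v x * ∏ j, primFactor v (a n v) j (x j) := fun n v => by
    refine (hw v).integral_prod (C := |C| + B * M) (R := max R (S n)) (fun j => ?_) (fun j x => ?_)
      (fun j x hx => ?_) fun j hj => ?_
    · by_cases hj : j ∈ v
      · simp only [ha, hj, if_true]; exact (hψm j).sub ((hρm n).const_mul _)
      · simpa [ha, hj] using (hρm n).const_mul _
    · have h1 : |k j * ρ n x| ≤ B * M := by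
        rw [abs_mul]; exact mul_le_mul (hB j) (hρC n x) (abs_nonneg _) hB0
      simp only [ha]
      split_ifs
      · exact (abs_sub _ _).trans (add_le_add ((hψC j x).trans (le_abs_self C)) h1)
      · exact h1.trans (by linarith [abs_nonneg C])
    · have h1 := hψR j x ((le_max_left _ _).trans_lt hx)
      have h2 := hS n x ((le_max_right _ _).trans_lt hx)
      simp [ha, h1, h2]
    · simp only [ha, hj, if_true]
      rw [integral_sub (hψ j) ((hρint n).const_mul _), integral_const_mul, hρ1, mul_one, hkdef,
        sub_self]
  have hlim : ∀ v, Filter.Tendsto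
      (fun n => ∫ x, D v x * ∏ j, primFactor v (a n v) j (x j)) Filter.atTop
      (nhds (∫ x, D v x * ∏ j, (if j ∈ v then -(φ (x j) * ∫ t, kern φ t (x j) * ψ j t)
        else k j * φ (x j)))) := fun v => by
    obtain ⟨E, hE0, hE1, hE2⟩ : ∃ E : ℝ, 0 ≤ E ∧ 2 * B ≤ E ∧ ∀ j, 2 * ∫ x, |ψ j x * c x| ≤ E := by
      refine ⟨max (2 * B) (∑ j, 2 * ∫ x, |ψ j x * c x|), le_max_of_le_left (by linarith),
        le_max_left _ _, fun j => le_max_of_le_right ?_⟩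
      exact Finset.single_le_sum (f := fun j => 2 * ∫ x, |ψ j x * c x|)
        (fun j _ => mul_nonneg zero_le_two (integral_nonneg fun x => abs_nonneg _))
        (Finset.mem_univ j)
    -- Each factor is at most `E ζ φ` on `v` and `E φ` off `v`, so admissibility of `D v` is
    -- precisely the integrability of the dominating function.
    have hdom := ((hφ.integrable_prodMeasure_iff).1 (hD v).2).norm.mul_const (E ^ s)
    refine tendsto_integral_of_dominated_convergence _ (fun n => ?_) hdom
      (fun n => Filter.Eventually.of_forall fun x => ?_) (Filter.Eventually.of_forall fun x => ?_)
    · refine (hD v).1.aestronglyMeasurable.mul (Finset.measurable_prod _ fun j _ =>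
        Measurable.comp (g := primFactor v (a n v) j) ?_ (measurable_pi_apply j)).aestronglyMeasurable
      unfold primFactor
      by_cases hj : j ∈ v
      · have hint : Integrable (fun t => ψ j t - k j * ρ n t) :=
          (hψ j).sub ((hρint n).const_mul _)
        have : (fun y => ∫ t in Set.Iic y, (ψ j t - k j * ρ n t)) = fun y =>
            (∫ t in Set.Iic 0, (ψ j t - k j * ρ n t)) + ∫ t in (0 : ℝ)..y, (ψ j t - k j * ρ n t) := by
          ext y
          rw [← intervalIntegral.integral_Iic_sub_Iic hint.integrableOn hint.integrableOn]
          ring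
        simp only [ha, hj, if_true]
        rw [this]
        exact (continuous_const.add (intervalIntegral.continuous_primitive
          (fun a b => hint.intervalIntegrable) 0)).measurable
      · simpa [ha, hj] using (hρm n).const_mul _
    · have hp : ∀ j, |primFactor v (a n v) j (x j)| ≤ (if j ∈ v then ζ (x j) else 1) * φ (x j) * E :=
        fun j => by
          unfold primFactor
          split_ifs with hj
          · simp only [ha, hj, if_true]
            refine (abs_setIntegral_Iic_sub_le hφ hk (hψ j) (hψc j) (hρm n) (hρ0 n) (hρ2 n) (hρ1 n)
              (x j)).trans ?_
            rw [mul_comm]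
            exact mul_le_mul_of_nonneg_left (hE2 j) (mul_nonneg (hk.nonneg' _) (hφ.nonneg _))
          · simp only [ha, hj, if_false, abs_mul, one_mul, abs_of_nonneg (hρ0 n _)]
            calc |k j| * ρ n (x j) ≤ B * (2 * φ (x j)) :=
                  mul_le_mul (hB j) (hρ2 n _) (hρ0 n _) hB0
              _ = φ (x j) * (2 * B) := by ring
              _ ≤ _ := mul_le_mul_of_nonneg_left hE1 (hφ.nonneg _)
      rw [norm_mul, norm_mul, norm_mul, Real.norm_eq_abs, Real.norm_eq_abs, Real.norm_eq_abs,
        Real.norm_eq_abs, Finset.abs_prod]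
      calc |D v x| * ∏ j, |primFactor v (a n v) j (x j)|
          ≤ |D v x| * ∏ j, ((if j ∈ v then ζ (x j) else 1) * φ (x j) * E) :=
            mul_le_mul_of_nonneg_left (Finset.prod_le_prod (fun j _ => abs_nonneg _)
              fun j _ => hp j) (abs_nonneg _)
        _ = _ := by
            rw [Finset.prod_mul_distrib, Finset.prod_mul_distrib, Finset.prod_const,
              Finset.card_univ, Fintype.card_fin, Fintype.prod_ite_mem,
              abs_of_nonneg (Finset.prod_nonneg fun j _ => hφ.nonneg _),
              abs_of_nonneg (Finset.prod_nonneg fun j _ => hk.nonneg' _ : 0 ≤ ∏ j ∈ v, ζ (x j))]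
            ring
    · refine (tendsto_finsetProd _ fun j _ => ?_).const_mul _
      by_cases hj : j ∈ v
      · simp only [primFactor, ha, hj, if_true]
        exact tendsto_setIntegral_Iic_sub hφ (hψ j) hρm hρ0 hρ2 hρl (x j)
      · simp only [primFactor, ha, hj, if_false]
        exact (hρl _).const_mul _
  have hsum : ∀ n, ∫ x, f x * ∏ j, ψ j (x j) = ∑ v, ∫ x, f x * ∏ j, a n v j (x j) := fun n => by
    rw [← integral_finsetSum]
    · refine integral_congr_ae (Filter.Eventually.of_forall fun x => ?_)
      simp only [ha]
      rw [← Finset.mul_sum, ← prod_add_eq_sum_ite]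
      simp
    · intro v _
      refine Integrable.mono (integrable_mul_indicator_box (hw ∅).1 (max R (S n)) (|C| + B * M)) ?_
        (Filter.Eventually.of_forall fun x => ?_)
      · refine (hw ∅).1.aestronglyMeasurable.mul (Finset.measurable_prod _ fun j _ =>
          Measurable.comp (g := a n v j) ?_ (measurable_pi_apply j)).aestronglyMeasurable
        by_cases hj : j ∈ v
        · simp only [ha, hj, if_true]; exact (hψm j).sub ((hρm n).const_mul _)
        · simpa [ha, hj] using (hρm n).const_mul _
      · rw [norm_mul, norm_mul, norm_prod, norm_prod]
        refine mul_le_mul_of_nonneg_left (Finset.prod_le_prod (fun j _ => norm_nonneg _)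
          fun j _ => ?_) (norm_nonneg _)
        by_cases hx : x j ∈ Set.Icc (-(max R (S n))) (max R (S n))
        · rw [Set.indicator_of_mem hx, Real.norm_eq_abs]
          refine le_trans ?_ (le_abs_self _)
          have h1 : |k j * ρ n (x j)| ≤ B * M := by
            rw [abs_mul]; exact mul_le_mul (hB j) (hρC n _) (abs_nonneg _) hB0
          simp only [ha]
          split_ifs
          · exact (abs_sub _ _).trans (add_le_add ((hψC j _).trans (le_abs_self C)) h1)
          · exact h1.trans (by linarith [abs_nonneg C])
        · have hx : max R (S n) < |x j| := not_le.1 fun h => hx (abs_le.1 h)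
          have h1 := hψR j (x j) ((le_max_left _ _).trans_lt hx)
          have h2 := hS n (x j) ((le_max_right _ _).trans_lt hx)
          simp [ha, h1, h2]
  have hlim2 : Filter.Tendsto (fun _ : ℕ => ∫ x, f x * ∏ j, ψ j (x j)) Filter.atTop
      (nhds (∑ v, (-1) ^ v.card * ∫ x, D v x * ∏ j, (if j ∈ v then
        -(φ (x j) * ∫ t, kern φ t (x j) * ψ j t) else k j * φ (x j)))) := by
    refine (tendsto_finsetSum Finset.univ fun v _ => (hlim v).const_mul ((-1 : ℝ) ^ v.card)).congr
      fun n => ?_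
    rw [hsum n]
    exact Finset.sum_congr rfl fun v _ => (hfa n v).symm
  refine (tendsto_nhds_unique tendsto_const_nhds hlim2).trans (Finset.sum_congr rfl fun v _ => ?_)
  rw [integral_prod_mul_rep hφ hk (hD v) hψ hψc, hφ.integral_prodMeasure, ← integral_const_mul]
  refine integral_congr_ae (Filter.Eventually.of_forall fun x => ?_)
  simp only
  rw [mul_left_comm, mul_left_comm (∏ j, φ (x j)), ← Finset.prod_mul_distrib]
  congr 1
  have : ((-1 : ℝ)) ^ v.card = ∏ j, if j ∈ v then (-1 : ℝ) else 1 := by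
    rw [Fintype.prod_ite_mem, Finset.prod_const]
  rw [this, ← Finset.prod_mul_distrib]
  refine Finset.prod_congr rfl fun j _ => ?_
  by_cases hj : j ∈ v <;> simp [hj, hkdef, mul_comm]

/-- Both sides have the same integrals over all cubes, by `integral_prod_eq_sum_rep` with indicators
of intervals. -/
theorem ae_eq_sum_rep {f : (Fin s → ℝ) → ℝ} {D : Finset (Fin s) → (Fin s → ℝ) → ℝ}
    (hw : ∀ v, HasWeakMixedDeriv v f (D v)) (hD : ∀ v, Admissible φ ζ v (D v)) :
    ∀ᵐ x, f x = ∑ v, rep φ v (D v) x := by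
  have hsum : LocallyIntegrable fun x => ∑ v, rep φ v (D v) x :=
    locallyIntegrable_finsetSum _ fun v _ => locallyIntegrable_rep hφ hk (hD v)
  have := ae_eq_zero_of_cube_integrals ((hw ∅).1.sub hsum) fun x r hr => ?_
  · filter_upwards [this] with x hx
    exact sub_eq_zero.1 hx
  set ψ : Fin s → ℝ → ℝ := fun j => (Set.Icc (x j - r) (x j + r)).indicator fun _ => (1 : ℝ) with hψ
  have hψm : ∀ j, Measurable (ψ j) := fun j => measurable_const.indicator measurableSet_Icc
  have hψC : ∀ j t, |ψ j t| ≤ 1 := fun j t => by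
    simp only [hψ, Set.indicator]; split_ifs <;> simp
  have hψR : ∀ j t, ‖x‖ + r < |t| → ψ j t = 0 := fun j t ht => by
    simp only [hψ]
    refine Set.indicator_of_notMem (fun h => ?_) _
    have h1 : |x j| ≤ ‖x‖ := norm_le_pi_norm x j
    have h2 : |t| ≤ |x j| + r := by
      rw [abs_le]
      constructor
      · linarith [h.1, neg_abs_le (x j)]
      · linarith [h.2, le_abs_self (x j)]
    linarith
  have hψi : ∀ (g : ℝ → ℝ), Continuous g → ∀ j, Integrable fun t => ψ j t * g t := fun g hg j => by
    have : (fun t => ψ j t * g t) = (Set.Icc (x j - r) (x j + r)).indicator g := by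
      ext t; by_cases ht : t ∈ Set.Icc (x j - r) (x j + r) <;> simp only [hψ]
      · rw [Set.indicator_of_mem ht, Set.indicator_of_mem ht, one_mul]
      · rw [Set.indicator_of_notMem ht, Set.indicator_of_notMem ht, zero_mul]
    rw [this, integrable_indicator_iff measurableSet_Icc]
    exact hg.continuousOn.integrableOn_Icc
  have hb : ∀ g : (Fin s → ℝ) → ℝ, LocallyIntegrable g → Integrable fun y => g y * ∏ j, ψ j (y j) :=
    fun g hg => by
      refine Integrable.mono (integrable_mul_indicator_box hg (‖x‖ + r) 1) ?_
        (Filter.Eventually.of_forall fun y => ?_)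
      · exact hg.aestronglyMeasurable.mul (Finset.measurable_prod _ fun j _ =>
          (hψm j).comp (measurable_pi_apply j)).aestronglyMeasurable
      · rw [norm_mul, norm_mul, norm_prod, norm_prod]
        refine mul_le_mul_of_nonneg_left (Finset.prod_le_prod (fun j _ => norm_nonneg _)
          fun j _ => ?_) (norm_nonneg _)
        by_cases hx : y j ∈ Set.Icc (-(‖x‖ + r)) (‖x‖ + r)
        · rw [Set.indicator_of_mem hx]; simpa using hψC j (y j)
        · rw [hψR j _ (not_le.1 fun h => hx (abs_le.1 h)), norm_zero]; exact norm_nonneg _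
  have key := integral_prod_eq_sum_rep hφ hk hw hD hψm hψC hψR
    (fun j => by simpa using hψi (fun _ => 1) continuous_const j) (hψi c hk.continuous)
  change ∫ y, (f y - ∑ v, rep φ v (D v) y) * ∏ j, ψ j (y j) = 0
  simp_rw [sub_mul]
  rw [integral_sub (hb f (hw ∅).1) (hb _ hsum), key, sub_eq_zero]
  simp_rw [Finset.sum_mul]
  rw [integral_finsetSum _ fun v _ => hb _ (locallyIntegrable_rep hφ hk (hD v))]

end
end BDIS

namespace BDIS

/-! ### The ANOVA terms of a function in the mixed Sobolev space -/

theorem locallyIntegrable_congr_ae {s : ℕ} {f g : (Fin s → ℝ) → ℝ} (hf : LocallyIntegrable f)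
    (h : ∀ᵐ x, f x = g x) : LocallyIntegrable g :=
  hf.mono (hf.aestronglyMeasurable.congr h) (h.mono fun x hx => by rw [hx])

theorem HasWeakMixedDeriv.congr {s : ℕ} {v : Finset (Fin s)} {f f' g g' : (Fin s → ℝ) → ℝ}
    (h : HasWeakMixedDeriv v f g) (hf : ∀ᵐ x, f x = f' x) (hg : ∀ᵐ x, g x = g' x) :
    HasWeakMixedDeriv v f' g' := by
  refine ⟨locallyIntegrable_congr_ae h.1 hf, locallyIntegrable_congr_ae h.2.1 hg, fun ψ h1 h2 => ?_⟩
  have e1 : ∫ x, f' x * mixedDeriv v ψ x = ∫ x, f x * mixedDeriv v ψ x :=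
    integral_congr_ae (hf.mono fun x hx => by simp only [hx])
  have e2 : ∫ x, g' x * ψ x = ∫ x, g x * ψ x :=
    integral_congr_ae (hg.mono fun x hx => by simp only [hx])
  rw [e1, e2, h.2.2 ψ h1 h2]

theorem HasWeakMixedDeriv.unique {s : ℕ} {v : Finset (Fin s)} {f g g' : (Fin s → ℝ) → ℝ}
    (h : HasWeakMixedDeriv v f g) (h' : HasWeakMixedDeriv v f g') : ∀ᵐ x, g x = g' x := by
  refine ae_eq_of_integral_contDiff_smul_eq h.2.1 h'.2.1 fun ψ h1 h2 => ?_
  have e := (h.2.2 ψ h1 h2).symm.trans (h'.2.2 ψ h1 h2)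
  have := mul_left_cancel₀ (pow_ne_zero _ (by norm_num)) e
  simpa [smul_eq_mul, mul_comm] using this

theorem HasWeakMixedDeriv.weakDeriv_ae_eq {s : ℕ} {v : Finset (Fin s)} {f g : (Fin s → ℝ) → ℝ}
    (h : HasWeakMixedDeriv v f g) : ∀ᵐ x, weakDeriv v f x = g x := by
  have hex : ∃ g, HasWeakMixedDeriv v f g := ⟨g, h⟩
  rw [weakDeriv, dif_pos hex]
  exact hex.choose_spec.unique h

section

variable {φ : ℝ → ℝ} (hφ : IsLightTailedDensity φ)
include hφ

theorem IsLightTailedDensity.exists_kernBound {a : ℝ} (ha0 : 0 < a) (ha1 : a < 1) :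
    ∃ c, KernBound φ c fun y => tail φ y ^ (-a) := by
  obtain ⟨C, hC, h⟩ := hφ.exists_kern_bound ha0 ha1
  refine ⟨fun x => C * tail φ x ^ (-(1 - a / 2)), ?_, ?_, fun x => ?_, fun y => ?_, h⟩
  · exact continuous_const.mul (hφ.continuous_tail.rpow_const fun x => Or.inl (hφ.tail_pos x).ne')
  · exact (hφ.integrable_tail_rpow (by linarith)).const_mul C
  · exact mul_nonneg hC.le (Real.rpow_nonneg (hφ.tail_pos x).le _)
  · exact Real.rpow_nonneg (hφ.tail_pos y).le _

/-- A positive measurable density need not be bounded below on compact sets, but the light-tail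
condition puts it above a positive continuous function. -/
theorem IsLightTailedDensity.locallyIntegrable_of_integrable {s : ℕ} {g : (Fin s → ℝ) → ℝ}
    (hg : Integrable g (prodMeasure φ s)) : LocallyIntegrable g := by
  obtain ⟨c, hc, h⟩ := hφ.exists_tail_le one_pos
  have h1 := (hφ.integrable_prodMeasure_iff.1 hg).locallyIntegrable
  have hcont : Continuous fun x : Fin s → ℝ => ∏ j, (c * tail φ (x j) ^ (1 + 1 : ℝ))⁻¹ := by
    refine continuous_finsetProd _ fun j _ => Continuous.inv₀ ?_ fun x =>
      (mul_pos hc (Real.rpow_pos_of_pos (hφ.tail_pos _) _)).ne'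
    exact continuous_const.mul ((hφ.continuous_tail.comp (continuous_apply j)).rpow_const
      fun x => Or.inl (hφ.tail_pos _).ne')
  have h2 : LocallyIntegrable fun x => (∏ j, (c * tail φ (x j) ^ (1 + 1 : ℝ))⁻¹) *
      ((∏ j, φ (x j)) * g x) := by
    rw [← locallyIntegrableOn_univ] at h1 ⊢
    exact h1.continuousOn_mul hcont.continuousOn isOpen_univ.isLocallyClosed
  refine h2.mono (hg.1.mono_ac (hφ.absolutelyContinuous_prodMeasure s))
    (Filter.Eventually.of_forall fun x => ?_)
  rw [norm_mul, norm_mul, ← mul_assoc]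
  refine le_mul_of_one_le_left (norm_nonneg _) ?_
  rw [norm_prod, norm_prod, ← Finset.prod_mul_distrib]
  refine Finset.one_le_prod fun j => ?_
  rw [Real.norm_of_nonneg (hφ.nonneg _), norm_inv,
    Real.norm_of_nonneg (mul_nonneg hc.le (Real.rpow_nonneg (hφ.tail_pos _).le _)),
    inv_mul_eq_div, one_le_div (mul_pos hc (Real.rpow_pos_of_pos (hφ.tail_pos _) _))]
  exact fun _ => h _

theorem memLp_prod_tail {a q' : ℝ} (hq' : 0 < q') (ha : a * q' < 1) {s : ℕ} (v : Finset (Fin s)) :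
    MemLp (fun y : Fin s → ℝ => ∏ j ∈ v, tail φ (y j) ^ (-a)) (ENNReal.ofReal q')
        (prodMeasure φ s) ∧
      ∫ y, (∏ j ∈ v, tail φ (y j) ^ (-a)) ^ q' ∂prodMeasure φ s
        = (∫ y, tail φ y ^ (-(a * q')) ∂nuOf φ) ^ v.card := by
  have := hφ.isProbabilityMeasure_nuOf
  have e : ∀ y : Fin s → ℝ, (∏ j ∈ v, tail φ (y j) ^ (-a)) ^ q'
      = ∏ j, if j ∈ v then tail φ (y j) ^ (-(a * q')) else 1 := fun y => by
    rw [Fintype.prod_ite_mem, ← Real.finsetProd_rpow _ _ fun j _ =>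
      Real.rpow_nonneg (hφ.tail_pos _).le _]
    refine Finset.prod_congr rfl fun j _ => ?_
    rw [← Real.rpow_mul (hφ.tail_pos _).le, neg_mul]
  constructor
  · rw [← integrable_norm_rpow_iff (Measurable.aestronglyMeasurable ?_) (by simpa using hq')
      (by simp)]
    · rw [ENNReal.toReal_ofReal hq'.le]
      simp_rw [Real.norm_of_nonneg (Finset.prod_nonneg fun j _ =>
        Real.rpow_nonneg (hφ.tail_pos _).le _), e]
      refine Integrable.fintype_prod (f := fun j t => if j ∈ v then tail φ t ^ (-(a * q')) else 1)
        fun j => ?_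
      split_ifs
      · exact hφ.integrable_tail_rpow ha
      · exact integrable_const (μ := nuOf φ) _
    · exact Finset.measurable_prod _ fun j _ =>
        (hφ.continuous_tail.measurable.comp (measurable_pi_apply j)).pow_const _
  · simp_rw [e]
    rw [prodMeasure_eq_pi, integral_fintype_prod_eq_prod
      (f := fun j t => if j ∈ v then tail φ t ^ (-(a * q')) else 1)]
    rw [← Finset.prod_const, ← Fintype.prod_ite_mem v]
    refine Finset.prod_congr rfl fun j _ => ?_
    by_cases hj : j ∈ v <;> simp [hj]

theorem admissible_of_memLp {a q q' : ℝ} (hq : q.HolderConjugate q') (ha : a * q' < 1) {s : ℕ}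
    {v : Finset (Fin s)} {D : (Fin s → ℝ) → ℝ} (hm : Measurable D)
    (hD : MemLp D (ENNReal.ofReal q) (prodMeasure φ s)) :
    Admissible φ (fun y => tail φ y ^ (-a)) v D := by
  refine ⟨hm, ?_⟩
  have : ENNReal.HolderConjugate (ENNReal.ofReal q') (ENNReal.ofReal q) := hq.symm.ennrealOfReal
  exact (memLp_prod_tail hφ hq.symm.pos ha v).1.integrable_mul hD

/-- Hölder; the norm of the product weight factorises, giving one constant for each coordinate of
`v`. -/
theorem integral_prod_tail_mul_le {a q q' : ℝ} (hq : q.HolderConjugate q') (ha : a * q' < 1) {s : ℕ}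
    (v : Finset (Fin s)) {D : (Fin s → ℝ) → ℝ}
    (hD : MemLp D (ENNReal.ofReal q) (prodMeasure φ s)) :
    ∫ y, (∏ j ∈ v, tail φ (y j) ^ (-a)) * |D y| ∂prodMeasure φ s
      ≤ ((∫ y, tail φ y ^ (-(a * q')) ∂nuOf φ) ^ (1 / q')) ^ v.card *
        (∫ y, |D y| ^ q ∂prodMeasure φ s) ^ (1 / q) := by
  obtain ⟨h1, h2⟩ := memLp_prod_tail hφ hq.symm.pos ha v
  refine (integral_mul_le_Lp_mul_Lq_of_nonneg hq.symm (Filter.Eventually.of_forall fun y =>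
    Finset.prod_nonneg fun j _ => Real.rpow_nonneg (hφ.tail_pos _).le _)
    (Filter.Eventually.of_forall fun y => abs_nonneg _) h1 hD.abs).trans (le_of_eq ?_)
  rw [h2, ← Real.rpow_natCast, ← Real.rpow_natCast, ← Real.rpow_mul, ← Real.rpow_mul, mul_comm (1 / q')]
  · exact integral_nonneg fun y => Real.rpow_nonneg (hφ.tail_pos _).le _
  · exact integral_nonneg fun y => Real.rpow_nonneg (hφ.tail_pos _).le _

omit hφ in
-- The derivative integrates to 0 over the line and to `χ y` over the half-line ending at `y`; only
-- the indicator in the kernel contributes.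
theorem integral_deriv_mul_kern {χ : ℝ → ℝ} (hχ : ContDiff ℝ ∞ χ) {R : ℝ}
    (hR : ∀ x, R < |x| → χ x = 0) (y : ℝ) :
    ∫ x, kern φ x y * deriv χ x = -(χ y / φ y) := by
  have hcs : HasCompactSupport χ := HasCompactSupport.intro (isCompact_Icc (a := -R) (b := R))
    fun x hx => hR x (not_le.1 fun h => hx (abs_le.1 h))
  have hd : Continuous (deriv χ) := hχ.continuous_deriv (by simp)
  have hint : Integrable (deriv χ) := hd.integrable_of_hasCompactSupport hcs.deriv
  have e : (fun x => kern φ x y * deriv χ x)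
      = fun x => (cdfOf φ y * deriv χ x - (Set.Iio y).indicator (deriv χ) x) / φ y := by
    ext x
    by_cases h : x < y <;> simp [kern, h] <;> ring
  rw [e, integral_div, integral_sub (hint.const_mul _) (hint.indicator measurableSet_Iio),
    integral_const_mul, integral_indicator measurableSet_Iio, ← integral_Iic_eq_integral_Iio,
    ← integral_add_compl (measurableSet_Iic (a := y)) hint, Set.compl_Iic,
    hcs.integral_Iic_deriv_eq (hχ.of_le (by simp)), hcs.integral_Ioi_deriv_eq (hχ.of_le (by simp))]
  ring

/-- Tested against a product, the coordinates in `v` give `-χ/φ` by `integral_deriv_mul_kern` and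
the others give `∫ χ`. As `D` depends only on the coordinates in `v`, the same splitting occurs on
the side of `D`. -/
theorem hasWeakMixedDeriv_rep {c ζ : ℝ → ℝ} (hk : KernBound φ c ζ) {s : ℕ} {v : Finset (Fin s)}
    {D : (Fin s → ℝ) → ℝ} (hD : Admissible φ ζ v D) (hDi : Integrable D (prodMeasure φ s))
    (hv : ∀ z y, D (v.piecewise z y) = D z) : HasWeakMixedDeriv v (rep φ v D) D := by
  have := hφ.isProbabilityMeasure_prodMeasure s
  have := hφ.isProbabilityMeasure_nuOf
  refine HasWeakMixedDeriv.of_prod (locallyIntegrable_rep hφ hk hD)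
    (hφ.locallyIntegrable_of_integrable hDi) fun χ hχ ⟨R, hR⟩ => ?_
  have hcs : ∀ j, HasCompactSupport (χ j) := fun j =>
    HasCompactSupport.intro (isCompact_Icc (a := -R) (b := R))
      fun x hx => hR j x (not_le.1 fun h => hx (abs_le.1 h))
  have hd : ∀ j, Continuous (deriv (χ j)) := fun j => (hχ j).continuous_deriv (by simp)
  have h1 := integral_prod_mul_rep hφ hk hD (ψ := fun j => if j ∈ v then deriv (χ j) else χ j)
    (fun j => by
      by_cases hj : j ∈ v
      · simpa only [hj, if_true] using (hd j).integrable_of_hasCompactSupport (hcs j).deriv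
      · simpa only [hj, if_false] using (hχ j).continuous.integrable_of_hasCompactSupport (hcs j))
    (fun j => by
      by_cases hj : j ∈ v
      · simp only [hj, if_true]
        exact ((hd j).mul hk.continuous).integrable_of_hasCompactSupport
          (hcs j).deriv.mul_right
      · simp only [hj, if_false]
        exact ((hχ j).continuous.mul hk.continuous).integrable_of_hasCompactSupport (hcs j).mul_right)
  have e1 : ∀ x : Fin s → ℝ, ∏ j, (if j ∈ v then deriv (χ j) (x j) else χ j (x j))
      = ∏ j, (if j ∈ v then deriv (χ j) else χ j) (x j) := fun x =>
    Finset.prod_congr rfl fun j _ => by split_ifs <;> rfl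
  simp_rw [e1]
  rw [h1]
  have e2 : ∀ y : Fin s → ℝ, (∏ j, if j ∈ v then
        ∫ x, kern φ x (y j) * (if j ∈ v then deriv (χ j) else χ j) x
        else ∫ x, (if j ∈ v then deriv (χ j) else χ j) x)
      = ((-1) ^ v.card * ∏ j ∈ v, χ j (y j) / φ (y j)) * ∏ j ∈ vᶜ, ∫ x, χ j x := fun y => by
    rw [← Finset.prod_mul_prod_compl v, ← Finset.prod_const, ← Finset.prod_mul_distrib]
    congr 1
    · refine Finset.prod_congr rfl fun j hj => ?_
      simp only [hj, if_true]
      rw [integral_deriv_mul_kern (hχ j) (hR j)]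
      ring
    · refine Finset.prod_congr rfl fun j hj => ?_
      simp only [Finset.mem_compl.1 hj, if_false]
  simp_rw [e2]
  have e3 : ∫ x, D x * ∏ j, χ j (x j)
      = ∫ x, D x * ∏ j, (χ j (x j) / φ (x j)) ∂prodMeasure φ s := by
    rw [hφ.integral_prodMeasure]
    refine integral_congr_ae (Filter.Eventually.of_forall fun x => ?_)
    simp only
    rw [mul_left_comm, ← Finset.prod_mul_distrib]
    congr 1
    exact Finset.prod_congr rfl fun j _ => by rw [mul_div_cancel₀ _ (hφ.pos _).ne']
  have hmp := measurePreserving_piecewise (nuOf φ) v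
  rw [← prodMeasure_eq_pi] at hmp
  have hmeas : Measurable fun x : Fin s → ℝ => D x * ∏ j, (χ j (x j) / φ (x j)) :=
    hD.1.mul (Finset.measurable_prod _ fun j _ =>
      ((hχ j).continuous.measurable.comp (measurable_pi_apply j)).div
        (hφ.measurable.comp (measurable_pi_apply j)))
  rw [e3]
  conv_rhs => rw [← hmp.map_eq]
  rw [integral_map hmp.measurable.aemeasurable hmeas.aestronglyMeasurable]
  have e4 : ∀ z : (Fin s → ℝ) × (Fin s → ℝ), D (v.piecewise z.1 z.2) *
      ∏ j, (χ j (v.piecewise z.1 z.2 j) / φ (v.piecewise z.1 z.2 j))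
      = (D z.1 * ∏ j ∈ v, (χ j (z.1 j) / φ (z.1 j))) * ∏ j ∈ vᶜ, (χ j (z.2 j) / φ (z.2 j)) :=
    fun z => by
      rw [hv, ← Finset.prod_mul_prod_compl v, ← mul_assoc]
      congr 1
      · congr 1
        exact Finset.prod_congr rfl fun j hj => by simp [hj]
      · exact Finset.prod_congr rfl fun j hj => by simp [Finset.mem_compl.1 hj]
  simp_rw [e4]
  rw [integral_prod_mul (fun z : Fin s → ℝ => D z * ∏ j ∈ v, (χ j (z j) / φ (z j)))
    (fun z : Fin s → ℝ => ∏ j ∈ vᶜ, (χ j (z j) / φ (z j)))]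
  have e5 : ∫ z, ∏ j ∈ vᶜ, (χ j (z j) / φ (z j)) ∂prodMeasure φ s = ∏ j ∈ vᶜ, ∫ x, χ j x := by
    simp_rw [← Fintype.prod_ite_mem vᶜ]
    rw [prodMeasure_eq_pi, integral_fintype_prod_eq_prod
      (f := fun j t => if j ∈ vᶜ then χ j t / φ t else 1)]
    refine Finset.prod_congr rfl fun j _ => ?_
    by_cases hj : j ∈ vᶜ
    · simp only [hj, if_true]
      rw [hφ.integral_nuOf]
      refine integral_congr_ae (Filter.Eventually.of_forall fun x => ?_)
      simp only
      rw [mul_div_cancel₀ _ (hφ.pos _).ne']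
    · simp [hj]
  rw [e5, ← mul_assoc, ← integral_const_mul, ← integral_mul_const]
  refine integral_congr_ae (Filter.Eventually.of_forall fun x => ?_)
  simp only
  ring

/-- `P_{vᶜ} D`, as a function of the coordinates in `v`. -/
noncomputable def avgCompl (φ : ℝ → ℝ) {s : ℕ} (v : Finset (Fin s)) (D : (Fin s → ℝ) → ℝ)
    (z : Fin s → ℝ) : ℝ :=
  ∫ y, D (v.piecewise z y) ∂prodMeasure φ s

omit hφ in
theorem avgCompl_piecewise {s : ℕ} (v : Finset (Fin s)) (D : (Fin s → ℝ) → ℝ) (z y : Fin s → ℝ) :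
    avgCompl φ v D (v.piecewise z y) = avgCompl φ v D z := by
  simp [avgCompl]

theorem measurable_avgCompl {s : ℕ} (v : Finset (Fin s)) {D : (Fin s → ℝ) → ℝ}
    (hD : Measurable D) : Measurable (avgCompl φ v D) := by
  have := hφ.isProbabilityMeasure_prodMeasure s
  have := hφ.isProbabilityMeasure_nuOf
  have h : StronglyMeasurable (Function.uncurry fun (z y : Fin s → ℝ) => D (v.piecewise z y)) :=
    (hD.comp (measurePreserving_piecewise (nuOf φ) v).measurable).stronglyMeasurable
  exact h.integral_prod_right.measurable

/-- Jensen on each slice, followed by Fubini. -/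
theorem memLp_avgCompl {q : ℝ} (hq : 1 < q) {s : ℕ} (v : Finset (Fin s)) {D : (Fin s → ℝ) → ℝ}
    (hDm : Measurable D) (hD : MemLp D (ENNReal.ofReal q) (prodMeasure φ s)) :
    MemLp (avgCompl φ v D) (ENNReal.ofReal q) (prodMeasure φ s) := by
  have := hφ.isProbabilityMeasure_prodMeasure s
  have := hφ.isProbabilityMeasure_nuOf
  have hmp := measurePreserving_piecewise (nuOf φ) v
  rw [← prodMeasure_eq_pi] at hmp
  have hq0 : ENNReal.ofReal q ≠ 0 := by simpa using (by linarith : 0 < q)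
  have hqr : (ENNReal.ofReal q).toReal = q := ENNReal.toReal_ofReal (by linarith)
  refine ⟨(measurable_avgCompl hφ v hDm).aestronglyMeasurable, ?_⟩
  rw [eLpNorm_lt_top_iff_lintegral_rpow_enorm_lt_top hq0 ENNReal.ofReal_ne_top, hqr]
  have h1 := hD.2
  rw [eLpNorm_lt_top_iff_lintegral_rpow_enorm_lt_top hq0 ENNReal.ofReal_ne_top, hqr,
    ← hmp.lintegral_comp (hDm.enorm.pow_const q)] at h1
  rw [lintegral_prod (fun z : (Fin s → ℝ) × (Fin s → ℝ) => ‖D (v.piecewise z.1 z.2)‖ₑ ^ q)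
    ((hDm.enorm.pow_const q).comp hmp.measurable).aemeasurable] at h1
  refine lt_of_le_of_lt (lintegral_mono fun z => ?_) h1
  have hmz : Measurable fun y => D (v.piecewise z y) :=
    hDm.comp (hmp.measurable.comp (measurable_const.prodMk measurable_id))
  have h2 : ‖avgCompl φ v D z‖ₑ ≤ eLpNorm (fun y => D (v.piecewise z y)) (ENNReal.ofReal q)
      (prodMeasure φ s) := by
    refine (enorm_integral_le_lintegral_enorm _).trans ?_
    rw [← eLpNorm_one_eq_lintegral_enorm]
    exact eLpNorm_le_eLpNorm_of_exponent_le (by simpa using ENNReal.ofReal_le_ofReal hq.le)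
      hmz.aestronglyMeasurable
  refine (ENNReal.rpow_le_rpow h2 (by linarith : (0:ℝ) ≤ q)).trans (le_of_eq ?_)
  rw [eLpNorm_eq_lintegral_rpow_enorm_toReal hq0 ENNReal.ofReal_ne_top, hqr, ← ENNReal.rpow_mul,
    one_div_mul_cancel (by linarith), ENNReal.rpow_one]

/-- The kernels involve only coordinates in `v`, so the others may be averaged out of `D`
beforehand. -/
theorem rep_avgCompl {c ζ : ℝ → ℝ} (hk : KernBound φ c ζ) {s : ℕ} {v : Finset (Fin s)}
    {D : (Fin s → ℝ) → ℝ} (hD : Admissible φ ζ v D) (x : Fin s → ℝ) :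
    rep φ v (avgCompl φ v D) x = rep φ v D x := by
  have := hφ.isProbabilityMeasure_prodMeasure s
  have := hφ.isProbabilityMeasure_nuOf
  have hmp := measurePreserving_piecewise (nuOf φ) v
  rw [← prodMeasure_eq_pi] at hmp
  have hint := integrable_rep hφ hk hD x
  have e : ∀ z : (Fin s → ℝ) × (Fin s → ℝ), (∏ j ∈ v, kern φ (x j) (v.piecewise z.1 z.2 j)) *
      D (v.piecewise z.1 z.2) = (∏ j ∈ v, kern φ (x j) (z.1 j)) * D (v.piecewise z.1 z.2) :=
    fun z => by
      congr 1
      exact Finset.prod_congr rfl fun j hj => by simp [hj]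
  have hint2 := (hmp.integrable_comp hint.1).2 hint
  simp only [Function.comp_def, e] at hint2
  symm
  unfold rep
  conv_lhs => rw [← hmp.map_eq]
  rw [integral_map hmp.measurable.aemeasurable (by rw [hmp.map_eq]; exact hint.1)]
  simp_rw [e]
  rw [integral_prod _ hint2]
  refine integral_congr_ae (Filter.Eventually.of_forall fun z => ?_)
  simp only [avgCompl]
  rw [integral_const_mul]

/-- The choice `G v = P_{vᶜ} ∂^v f` makes `G v` the actual weak derivative `∂^v` of the ANOVA term,
so its `L^q` norm is one of the summands of `‖f_v‖_W`. With the unaveraged derivative this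
comparison would not be available. -/
theorem exists_anova_rep {a q q' : ℝ} (hq : q.HolderConjugate q') (ha0 : 0 < a) (ha : a * q' < 1)
    {s : ℕ} {f : (Fin s → ℝ) → ℝ} (hf : MemWmix φ q f) :
    ∃ G : Finset (Fin s) → (Fin s → ℝ) → ℝ, (∀ v, Measurable (G v)) ∧
      (∀ v, MemLp (G v) (ENNReal.ofReal q) (prodMeasure φ s)) ∧
      (∀ v, (∫ y, |G v y| ^ q ∂prodMeasure φ s) ^ (1 / q) ≤ normWmix φ q (anova φ f v)) ∧
      ∀ᵐ x, f x = ∑ v, rep φ v (G v) x := by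
  have := hφ.isProbabilityMeasure_prodMeasure s
  have ha1 : a < 1 := by nlinarith [hq.symm.lt]
  obtain ⟨c, hk⟩ := hφ.exists_kernBound ha0 ha1
  have hex : ∀ v : Finset (Fin s), ∃ D, Measurable D ∧ HasWeakMixedDeriv v f D ∧
      MemLp D (ENNReal.ofReal q) (prodMeasure φ s) := fun v => by
    obtain ⟨g, hg, hgm⟩ := hf v
    refine ⟨hgm.1.mk, hgm.1.measurable_mk, hg.congr (Filter.Eventually.of_forall fun _ => rfl)
      (hφ.absolutelyContinuous_prodMeasure s hgm.1.ae_eq_mk), hgm.ae_eq hgm.1.ae_eq_mk⟩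
  choose D hDm hDw hDl using hex
  have hDa : ∀ v, Admissible φ _ v (D v) := fun v => admissible_of_memLp hφ hq ha (hDm v) (hDl v)
  have hGm : ∀ v, Measurable (avgCompl φ v (D v)) := fun v => measurable_avgCompl hφ v (hDm v)
  have hGl := fun v => memLp_avgCompl hφ hq.lt v (hDm v) (hDl v)
  have hGa : ∀ v, Admissible φ _ v (avgCompl φ v (D v)) := fun v =>
    admissible_of_memLp hφ hq ha (hGm v) (hGl v)
  have hsum : ∀ᵐ x, f x = ∑ v, rep φ v (avgCompl φ v (D v)) x := by
    filter_upwards [ae_eq_sum_rep hφ hk hDw hDa] with x hx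
    rw [hx]
    exact Finset.sum_congr rfl fun v _ => (rep_avgCompl hφ hk (hDa v) x).symm
  refine ⟨fun v => avgCompl φ v (D v), hGm, hGl, fun v => ?_, hsum⟩
  have h1 : HasWeakMixedDeriv v (anova φ f v) (avgCompl φ v (D v)) := by
    refine (hasWeakMixedDeriv_rep hφ hk (hGa v) ((hGl v).integrable ?_)
      (avgCompl_piecewise v (D v))).congr ?_ (Filter.Eventually.of_forall fun _ => rfl)
    · simpa using ENNReal.ofReal_le_ofReal hq.lt.le
    · filter_upwards [anova_eq_rep hφ hk hGa hsum] with x hx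
      exact (hx v).symm
  have h2 : ∀ᵐ x ∂prodMeasure φ s, weakDeriv v (anova φ f v) x = avgCompl φ v (D v) x :=
    hφ.prodMeasure_absolutelyContinuous s h1.weakDeriv_ae_eq
  unfold normWmix
  refine Real.rpow_le_rpow (integral_nonneg fun y => Real.rpow_nonneg (abs_nonneg _) _) ?_
    (by have := hq.pos; positivity)
  refine le_trans (le_of_eq ?_) (Finset.single_le_sum (f := fun v =>
    ∫ x, |weakDeriv v (anova φ f _) x| ^ q ∂prodMeasure φ s) (fun u _ => integral_nonneg fun y =>
      Real.rpow_nonneg (abs_nonneg _) _) (Finset.mem_univ v))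
  exact integral_congr_ae (h2.mono fun x hx => by simp only [hx])

end
end BDIS

namespace BDIS

/-! ### The damping function `η` -/

theorem eta_of_pos {p u : ℝ} (hu : 0 < u) :
    eta p u = (2 : ℝ) ^ (-p - 2) * u ^ (-p - 1) * Real.exp ((2 : ℝ) ^ p - u ^ (-p)) := if_pos hu

theorem eta_of_nonpos {p u : ℝ} (hu : u ≤ 0) : eta p u = 0 := if_neg hu.not_gt

theorem eta_pos {p u : ℝ} (hu : 0 < u) : 0 < eta p u := by
  rw [eta_of_pos hu]; positivity

theorem eta_nonneg (p u : ℝ) : 0 ≤ eta p u := by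
  rcases lt_or_ge 0 u with h | h
  · exact (eta_pos h).le
  · rw [eta_of_nonpos h]

/-- The factor `2 ^ (-p - 2)` is chosen for this value; it makes the branches `η` and `1 - η` of the
weight meet at `θ / 2`. -/
theorem eta_half (p : ℝ) : eta p (1 / 2) = 1 / 2 := by
  have h2 : (0 : ℝ) < 2 := by norm_num
  have h (r : ℝ) : (1 / 2 : ℝ) ^ r = 2 ^ (-r) := by
    rw [one_div, Real.inv_rpow h2.le, Real.rpow_neg h2.le]
  rw [eta_of_pos (by norm_num), h, h, neg_neg, sub_self, Real.exp_zero, mul_one,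
    ← Real.rpow_add h2, show -p - 2 + -(-p - 1) = (-1 : ℝ) by ring, Real.rpow_neg_one]
  norm_num

theorem measurable_eta (p : ℝ) : Measurable (eta p) := by
  unfold eta
  refine Measurable.ite measurableSet_Ioi ?_ measurable_const
  fun_prop

theorem two_le_rpow_neg {p u : ℝ} (hp : 1 ≤ p) (hu : 0 < u) (hu' : u ≤ 1 / 2) :
    2 ≤ u ^ (-p) := by
  have h : (2 : ℝ) ≤ u⁻¹ := by
    rw [le_inv_comm₀ (by norm_num) hu]; linarith
  calc (2 : ℝ) = 2 ^ (1 : ℝ) := by simp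
    _ ≤ 2 ^ p := Real.rpow_le_rpow_of_exponent_le (by norm_num) hp
    _ ≤ u⁻¹ ^ p := Real.rpow_le_rpow (by norm_num) h (by linarith)
    _ = u ^ (-p) := by rw [Real.inv_rpow hu.le, Real.rpow_neg hu.le]

theorem hasDerivAt_exp_rpow_neg {p u : ℝ} (hu : 0 < u) :
    HasDerivAt (fun r : ℝ => Real.exp ((2 : ℝ) ^ p - r ^ (-p)))
      (Real.exp ((2 : ℝ) ^ p - u ^ (-p)) * (p * u ^ (-p - 1))) u := by
  have h := ((Real.hasDerivAt_rpow_const (x := u) (p := -p) (Or.inl hu.ne')).const_sub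
    ((2 : ℝ) ^ p)).exp
  convert h using 1
  ring

/-- The derivative has the sign of `p u^(-p) - (p + 1)`, and `u^(-p) ≥ 2` on `(0,1/2]`; so `p ≥ 1`
suffices. -/
theorem monotoneOn_eta {p : ℝ} (hp : 1 ≤ p) : MonotoneOn (eta p) (Set.Iic (1 / 2)) := by
  have h1 : MonotoneOn (fun u : ℝ => u ^ (-p - 1) * Real.exp ((2 : ℝ) ^ p - u ^ (-p)))
      (Set.Ioc 0 (1 / 2)) := by
    have hd (u : ℝ) (hu : 0 < u) := (Real.hasDerivAt_rpow_const (x := u) (p := -p - 1)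
      (Or.inl hu.ne')).mul (hasDerivAt_exp_rpow_neg (p := p) hu)
    refine monotoneOn_of_deriv_nonneg (convex_Ioc 0 (1 / 2))
      (fun u hu => (hd u hu.1).continuousAt.continuousWithinAt)
      (fun u hu => ?_) (fun u hu => ?_)
    · rw [interior_Ioc] at hu
      exact (hd u hu.1).differentiableAt.differentiableWithinAt
    · rw [interior_Ioc] at hu
      have h := (hd u hu.1).deriv
      rw [show deriv (fun u : ℝ => u ^ (-p - 1) * Real.exp ((2 : ℝ) ^ p - u ^ (-p))) u = _ from h]
      have e1 : u ^ (-p - 1) = u ^ (-p - 1 - 1) * u := by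
        rw [← Real.rpow_add_one hu.1.ne']; ring_nf
      have e2 : u * u ^ (-p - 1) = u ^ (-p) := by
        rw [mul_comm, ← Real.rpow_add_one hu.1.ne']; ring_nf
      have e3 : 0 ≤ p * u ^ (-p) - (p + 1) := by
        nlinarith [two_le_rpow_neg hp hu.1 hu.2.le]
      have : (-p - 1) * u ^ (-p - 1 - 1) * Real.exp (2 ^ p - u ^ (-p)) +
          u ^ (-p - 1) * (Real.exp (2 ^ p - u ^ (-p)) * (p * u ^ (-p - 1)))
          = u ^ (-p - 1 - 1) * Real.exp (2 ^ p - u ^ (-p)) * (p * u ^ (-p) - (p + 1)) := by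
        nth_rewrite 2 [e1]
        rw [← e2]; ring
      rw [this]
      have := hu.1
      positivity
  intro x hx y hy hxy
  rcases lt_or_ge 0 x with h | h
  · rw [eta_of_pos h, eta_of_pos (h.trans_le hxy), mul_assoc, mul_assoc]
    exact mul_le_mul_of_nonneg_left (h1 ⟨h, hx⟩ ⟨h.trans_le hxy, hy⟩ hxy) (by positivity)
  · rw [eta_of_nonpos h]; exact eta_nonneg _ _

theorem eta_le_half {p u : ℝ} (hp : 1 ≤ p) (hu : u ≤ 1 / 2) : eta p u ≤ 1 / 2 :=
  (monotoneOn_eta hp hu Set.self_mem_Iic hu).trans (eta_half p).le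

/-- The primitive of `η`. -/
noncomputable def etaPrim (p u : ℝ) : ℝ :=
  (2 : ℝ) ^ (-p - 2) / p * Real.exp ((2 : ℝ) ^ p - u ^ (-p))

theorem integral_eta {p r : ℝ} (hp : 1 ≤ p) (hr : 0 < r) (hr' : r ≤ 1 / 2) :
    ∫ u in (0 : ℝ)..r, eta p u = etaPrim p r := by
  have hp0 : p ≠ 0 := by linarith
  have hint : IntervalIntegrable (eta p) volume 0 r := by
    refine MonotoneOn.intervalIntegrable ((monotoneOn_eta hp).mono fun x hx => ?_)
    rw [Set.uIcc_of_le hr.le] at hx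
    exact hx.2.trans hr'
  have hd (u : ℝ) (hu : 0 < u) : HasDerivAt (etaPrim p) (eta p u) u := by
    have h : HasDerivAt (etaPrim p) _ u :=
      (hasDerivAt_exp_rpow_neg (p := p) hu).const_mul ((2 : ℝ) ^ (-p - 2) / p)
    rw [eta_of_pos hu]
    convert h using 1
    field_simp
  -- In Lean `0 ^ (-p)` is 0, so `etaPrim p 0` is not the limit at 0; the one-sided limit, which is
  -- 0, is used instead.
  have h := intervalIntegral.integral_eq_sub_of_hasDerivAt_of_tendsto (f := etaPrim p)
    (fa := 0) (fb := etaPrim p r) hr (fun u hu => hd u hu.1) hint ?_ ?_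
  · simpa using h
  · unfold etaPrim
    have h0 : Filter.Tendsto (fun u : ℝ => (2 : ℝ) ^ p - u ^ (-p))
        (nhdsWithin 0 (Set.Ioi 0)) Filter.atBot := by
      have := tendsto_rpow_neg_nhdsGT_zero (y := -p) (by linarith)
      exact Filter.Tendsto.congr (fun u => (sub_eq_add_neg ((2 : ℝ) ^ p) (u ^ (-p))).symm)
        (tendsto_const_nhds.add_atBot (Filter.tendsto_neg_atTop_atBot.comp this))
    have := (Real.tendsto_exp_atBot.comp h0).const_mul ((2 : ℝ) ^ (-p - 2) / p)
    simpa using this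
  · exact ((hd r hr).continuousAt.tendsto).mono_left nhdsWithin_le_nhds

/-- Light tails of `η`: it is dominated by any power less than one of its primitive. -/
theorem exists_eta_le {p κ : ℝ} (hp : 1 ≤ p) (hκ : κ < 1) :
    ∃ c : ℝ, 0 ≤ c ∧ ∀ r, 0 < r → r ≤ 1 / 2 → eta p r ≤ c * etaPrim p r ^ κ := by
  have hp0 : 0 < p := by linarith
  set A : ℝ := (2 : ℝ) ^ (-p - 2) with hA
  have hApos : 0 < A := by positivity
  set M : ℝ := (2 : ℝ) ^ p with hM
  have hδ : 0 < 1 - κ := by linarith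
  refine ⟨A * (Real.exp M * (2 / (1 - κ) ^ 2)) / ((A / p) ^ κ * Real.exp M ^ κ), by positivity,
    fun r hr hr' => ?_⟩
  set z : ℝ := r ^ (-p) with hz
  have hz2 : 2 ≤ z := two_le_rpow_neg hp hr hr'
  -- Up to constants `η` is at most `z² e^(-z)`, whereas the power of the primitive is `e^(-κz)`;
  -- the spare factor `e^(-(1-κ)z)` absorbs the polynomial.
  have h1 : r ^ (-p - 1) ≤ z ^ 2 := by
    have : r ^ (-p - 1) = z * r⁻¹ := by
      rw [Real.rpow_sub hr, Real.rpow_one, div_eq_mul_inv]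
    rw [this, sq]
    refine mul_le_mul_of_nonneg_left ?_ (by linarith)
    calc r⁻¹ = r⁻¹ ^ (1 : ℝ) := by simp
      _ ≤ r⁻¹ ^ p := Real.rpow_le_rpow_of_exponent_le
          (by rw [le_inv_comm₀ one_pos hr]; linarith) hp
      _ = z := by rw [Real.inv_rpow hr.le, hz, Real.rpow_neg hr.le]
  have h2 : z ^ 2 ≤ 2 / (1 - κ) ^ 2 * Real.exp ((1 - κ) * z) := by
    have := Real.quadratic_le_exp_of_nonneg (x := (1 - κ) * z) (by positivity)
    rw [div_mul_eq_mul_div, le_div_iff₀ (by positivity)]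
    nlinarith [mul_nonneg hδ.le (by linarith : 0 ≤ z)]
  have hE : etaPrim p r = A / p * (Real.exp M * Real.exp (-z)) := by
    unfold etaPrim; rw [sub_eq_add_neg (_ ^ p), Real.exp_add]
  have hEk : etaPrim p r ^ κ = (A / p) ^ κ * Real.exp M ^ κ * Real.exp (-z * κ) := by
    rw [hE, Real.mul_rpow (by positivity) (by positivity),
      Real.mul_rpow (by positivity) (by positivity), Real.exp_mul (-z) κ]; ring
  have hden : (A / p) ^ κ * Real.exp M ^ κ ≠ 0 := by positivity
  rw [eta_of_pos hr, hEk, ← mul_assoc, div_mul_cancel₀ _ hden]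
  rw [sub_eq_add_neg M, Real.exp_add]
  calc A * r ^ (-p - 1) * (Real.exp M * Real.exp (-z))
      ≤ A * (2 / (1 - κ) ^ 2 * Real.exp ((1 - κ) * z)) * (Real.exp M * Real.exp (-z)) := by
        gcongr; exact h1.trans h2
    _ = A * (Real.exp M * (2 / (1 - κ) ^ 2)) * (Real.exp ((1 - κ) * z) * Real.exp (-z)) := by ring
    _ = _ := by rw [← Real.exp_add]; congr 2; ring

theorem etaPrim_pos {p : ℝ} (hp : 1 ≤ p) (u : ℝ) : 0 < etaPrim p u := by
  unfold etaPrim; positivity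

/-! ### The weight function -/

section weight

variable {p θ : ℝ} (hp : 1 ≤ p) (hθ : 0 < θ) (hθ' : θ ≤ 1 / 2)

theorem wTheta_of_le {u : ℝ} (hu : u ≤ 1 / 2) : wTheta p θ u = wHalf p θ u := if_pos hu

theorem wTheta_one_sub (u : ℝ) : wTheta p θ (1 - u) = wTheta p θ u := by
  unfold wTheta
  rcases lt_trichotomy u (1 / 2) with h | h | h
  · rw [if_neg (by linarith), if_pos h.le, sub_sub_cancel]
  · rw [h]; norm_num
  · rw [if_pos (by linarith), if_neg (by linarith)]

theorem measurable_wHalf : Measurable (wHalf p θ) := by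
  unfold wHalf
  refine Measurable.ite measurableSet_Iic ?_ (Measurable.ite measurableSet_Iio ?_ measurable_const)
  · exact ((measurable_eta p).comp (measurable_id.div_const θ)).const_mul _
  · exact (((measurable_eta p).comp ((measurable_id.div_const θ).const_sub 1)).const_sub 1).const_mul
      _

theorem measurable_wTheta : Measurable (wTheta p θ) := by
  unfold wTheta
  exact Measurable.ite measurableSet_Iic measurable_wHalf
    (measurable_wHalf.comp (measurable_id.const_sub 1))

include hp hθ hθ' in
theorem wHalf_nonneg (u : ℝ) : 0 ≤ wHalf p θ u := by
  have h1 : 0 < (1 - θ)⁻¹ := inv_pos.2 (by linarith)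
  unfold wHalf
  split_ifs with h h'
  · exact mul_nonneg h1.le (eta_nonneg _ _)
  · refine mul_nonneg h1.le (sub_nonneg.2 ?_)
    have : 1 - u / θ ≤ 1 / 2 := by
      have : 1 / 2 ≤ u / θ := by rw [le_div_iff₀ hθ]; linarith
      linarith
    linarith [eta_le_half hp this]
  · exact h1.le

include hp hθ hθ' in
theorem wHalf_le (u : ℝ) : wHalf p θ u ≤ (1 - θ)⁻¹ := by
  have h1 : 0 < (1 - θ)⁻¹ := inv_pos.2 (by linarith)
  unfold wHalf
  split_ifs with h h'
  · refine mul_le_of_le_one_right h1.le ?_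
    have : u / θ ≤ 1 / 2 := by rw [div_le_iff₀ hθ]; linarith
    linarith [eta_le_half hp this]
  · exact mul_le_of_le_one_right h1.le (by linarith [eta_nonneg p (1 - u / θ)])
  · exact le_rfl

include hp hθ hθ' in
theorem wHalf_pos {u : ℝ} (hu : 0 < u) : 0 < wHalf p θ u := by
  have h1 : 0 < (1 - θ)⁻¹ := inv_pos.2 (by linarith)
  unfold wHalf
  split_ifs with h h'
  · exact mul_pos h1 (eta_pos (by positivity))
  · refine mul_pos h1 (sub_pos.2 ?_)
    have : 1 - u / θ ≤ 1 / 2 := by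
      have : 1 / 2 ≤ u / θ := by rw [le_div_iff₀ hθ]; linarith
      linarith
    linarith [eta_le_half hp this]
  · exact h1

include hp hθ hθ' in
theorem monotone_wHalf : Monotone (wHalf p θ) := by
  have h1 : 0 < (1 - θ)⁻¹ := inv_pos.2 (by linarith)
  have ha {u : ℝ} (h : u ≤ θ / 2) : u / θ ≤ 1 / 2 := by rw [div_le_iff₀ hθ]; linarith
  have hb {u : ℝ} (h : ¬ u ≤ θ / 2) : 1 - u / θ ≤ 1 / 2 := by
    have : 1 / 2 ≤ u / θ := by rw [le_div_iff₀ hθ]; linarith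
    linarith
  intro x y hxy
  have hdiv : x / θ ≤ y / θ := by gcongr
  by_cases hy : θ ≤ y
  · rw [show wHalf p θ y = (1 - θ)⁻¹ by
      unfold wHalf; rw [if_neg (by linarith), if_neg (by linarith)]]
    exact wHalf_le hp hθ hθ' x
  · unfold wHalf
    by_cases hx2 : x ≤ θ / 2
    · rw [if_pos hx2]
      by_cases hy2 : y ≤ θ / 2
      · rw [if_pos hy2]
        exact mul_le_mul_of_nonneg_left (monotoneOn_eta hp (ha hx2) (ha hy2) hdiv) h1.le
      · rw [if_neg hy2, if_pos (by linarith)]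
        refine mul_le_mul_of_nonneg_left ?_ h1.le
        linarith [eta_le_half hp (ha hx2), eta_le_half hp (hb hy2)]
    · rw [if_neg hx2, if_pos (by linarith), if_neg (by linarith), if_pos (by linarith)]
      refine mul_le_mul_of_nonneg_left (sub_le_sub_left ?_ _) h1.le
      exact monotoneOn_eta hp (hb (by linarith)) (hb hx2) (by linarith)

include hp hθ hθ' in
theorem wTheta_nonneg (u : ℝ) : 0 ≤ wTheta p θ u := by
  unfold wTheta; split_ifs <;> exact wHalf_nonneg hp hθ hθ' _

include hp hθ hθ' in
theorem wTheta_le (u : ℝ) : wTheta p θ u ≤ (1 - θ)⁻¹ := by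
  unfold wTheta; split_ifs <;> exact wHalf_le hp hθ hθ' _

include hp hθ hθ' in
theorem wTheta_le_two (u : ℝ) : wTheta p θ u ≤ 2 :=
  (wTheta_le hp hθ hθ' u).trans (by
    rw [inv_le_comm₀ (by linarith) (by norm_num)]; linarith)

include hp hθ hθ' in
theorem wTheta_pos {u : ℝ} (hu : u ∈ Set.Ioo (0 : ℝ) 1) : 0 < wTheta p θ u := by
  unfold wTheta
  split_ifs
  · exact wHalf_pos hp hθ hθ' hu.1
  · exact wHalf_pos hp hθ hθ' (by linarith [hu.2])

include hp hθ hθ' in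
theorem wTheta_le_of_le {u v : ℝ} (huv : u ≤ v) (hv : v ≤ 1 / 2) : wTheta p θ u ≤ wTheta p θ v := by
  rw [wTheta_of_le hv, wTheta_of_le (huv.trans hv)]
  exact monotone_wHalf hp hθ hθ' huv

include hp hθ hθ' in
theorem wTheta_le_of_ge {u v : ℝ} (hu : 1 / 2 ≤ u) (huv : u ≤ v) : wTheta p θ v ≤ wTheta p θ u := by
  rw [← wTheta_one_sub u, ← wTheta_one_sub v]
  exact wTheta_le_of_le hp hθ hθ' (by linarith) (by linarith)

include hp hθ hθ' in
theorem integrable_wTheta (μ : Measure ℝ) [IsFiniteMeasure μ] : Integrable (wTheta p θ) μ :=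
  Integrable.of_bound measurable_wTheta.aestronglyMeasurable 2 (ae_of_all _ fun u => by
    rw [Real.norm_of_nonneg (wTheta_nonneg hp hθ hθ' u)]; exact wTheta_le_two hp hθ hθ' u)

include hp hθ hθ' in
theorem intervalIntegrable_wTheta (a b : ℝ) : IntervalIntegrable (wTheta p θ) volume a b :=
  ⟨integrable_wTheta hp hθ hθ' _, integrable_wTheta hp hθ hθ' _⟩

include hp hθ in
theorem integral_wTheta_zero_of_le {u : ℝ} (hu : 0 < u) (hu' : u ≤ θ / 2) (hθ' : θ ≤ 1 / 2) :
    ∫ t in (0 : ℝ)..u, wTheta p θ t = (1 - θ)⁻¹ * θ * etaPrim p (u / θ) := by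
  have h1 : ∫ t in (0 : ℝ)..u, wTheta p θ t = ∫ t in (0 : ℝ)..u, (1 - θ)⁻¹ * eta p (t / θ) := by
    refine intervalIntegral.integral_congr fun t ht => ?_
    rw [Set.uIcc_of_le hu.le] at ht
    rw [wTheta_of_le (by linarith [ht.2]), wHalf, if_pos (ht.2.trans hu')]
  rw [h1, intervalIntegral.integral_const_mul, intervalIntegral.integral_comp_div _ hθ.ne', zero_div,
    integral_eta hp (by positivity) (by rw [div_le_iff₀ hθ]; linarith), smul_eq_mul, mul_assoc]

include hp hθ hθ' in
-- The reflection `t ↦ θ - t` turns `w` into `(1-θ)⁻¹ - w` on `(0,θ)`, so the damped part has mass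
-- `(1-θ)⁻¹ θ/2`; together with the flat part this is 1/2.
theorem integral_wTheta_half : ∫ t in (0 : ℝ)..(1 / 2), wTheta p θ t = 1 / 2 := by
  have hne : (1 - θ) ≠ 0 := by linarith
  have hI := intervalIntegrable_wTheta (p := p) hp hθ hθ'
  have e1 : ∫ t in (θ / 2)..θ, wTheta p θ t
      = (1 - θ)⁻¹ * (θ / 2) - ∫ t in (0 : ℝ)..(θ / 2), wTheta p θ t := by
    have : ∫ t in (θ / 2)..θ, wTheta p θ t
        = ∫ t in (θ / 2)..θ, ((1 - θ)⁻¹ - wTheta p θ (θ - t)) := by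
      refine intervalIntegral.integral_congr_ae (Filter.eventually_of_mem
        (U := {θ / 2, θ}ᶜ) ((Set.toFinite _).measure_zero volume |> compl_mem_ae_iff.2) ?_)
      intro t htc ht
      rw [Set.uIoc_of_le (by linarith)] at ht
      have htθ : t < θ := lt_of_le_of_ne ht.2 fun h => htc (by simp [h])
      rw [wTheta_of_le (by linarith), wTheta_of_le (by linarith [ht.1]), wHalf,
        if_neg (by linarith [ht.1]), if_pos htθ, wHalf, if_pos (by linarith [ht.1]),
        sub_div, div_self hθ.ne']
      ring
    rw [this, intervalIntegral.integral_sub intervalIntegrable_const, intervalIntegral.integral_const,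
      intervalIntegral.integral_comp_sub_left (fun t => wTheta p θ t) θ, sub_self, smul_eq_mul]
    · ring_nf
    · exact ((hI (θ - θ / 2) (θ - θ)).comp_sub_left θ).trans (by simp) |> fun h => by simpa using h
  have e2 : ∫ t in θ..(1 / 2), wTheta p θ t = (1 - θ)⁻¹ * (1 / 2 - θ) := by
    have : ∫ t in θ..(1 / 2), wTheta p θ t = ∫ t in θ..(1 / 2), (1 - θ)⁻¹ := by
      refine intervalIntegral.integral_congr fun t ht => ?_
      rw [Set.uIcc_of_le hθ'] at ht
      rw [wTheta_of_le ht.2, wHalf, if_neg (by linarith [ht.1]), if_neg (by linarith [ht.1])]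
    rw [this, intervalIntegral.integral_const, smul_eq_mul]; ring
  rw [← intervalIntegral.integral_add_adjacent_intervals (hI 0 (θ / 2)) (hI (θ / 2) (1 / 2)),
    ← intervalIntegral.integral_add_adjacent_intervals (hI (θ / 2) θ) (hI θ (1 / 2)), e1, e2]
  field_simp
  ring

/-- The distribution function `∫₀ᵘ w_θ`. -/
noncomputable def wCdf (p θ u : ℝ) : ℝ := ∫ t in (0 : ℝ)..u, wTheta p θ t

include hp hθ hθ' in
theorem integral_wTheta_one : ∫ t in (0 : ℝ)..1, wTheta p θ t = 1 := by
  have hI := intervalIntegrable_wTheta (p := p) hp hθ hθ'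
  rw [← intervalIntegral.integral_add_adjacent_intervals (hI 0 (1 / 2)) (hI (1 / 2) 1)]
  have : ∫ t in (1 / 2 : ℝ)..1, wTheta p θ t = ∫ t in (0 : ℝ)..(1 / 2), wTheta p θ t := by
    have := intervalIntegral.integral_comp_sub_left (fun t => wTheta p θ t) (1 : ℝ)
      (a := 1 / 2) (b := 1)
    simp only [wTheta_one_sub] at this
    rw [this]; norm_num
  rw [this, integral_wTheta_half hp hθ hθ']; norm_num

include hp hθ hθ' in
theorem wCdf_one_sub (u : ℝ) : wCdf p θ (1 - u) = 1 - wCdf p θ u := by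
  have hI := intervalIntegrable_wTheta (p := p) hp hθ hθ'
  have := intervalIntegral.integral_comp_sub_left (fun t => wTheta p θ t) (1 : ℝ)
    (a := 0) (b := u)
  simp only [wTheta_one_sub, sub_zero] at this
  unfold wCdf
  rw [this, eq_sub_iff_add_eq, intervalIntegral.integral_add_adjacent_intervals (hI _ _) (hI _ _),
    integral_wTheta_one hp hθ hθ']

include hp hθ hθ' in
theorem continuous_wCdf : Continuous (wCdf p θ) :=
  intervalIntegral.continuous_primitive (intervalIntegrable_wTheta hp hθ hθ') 0

include hp hθ hθ' in
theorem wCdf_sub (u v : ℝ) : wCdf p θ v - wCdf p θ u = ∫ t in u..v, wTheta p θ t :=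
  intervalIntegral.integral_interval_sub_left (intervalIntegrable_wTheta hp hθ hθ' _ _)
    (intervalIntegrable_wTheta hp hθ hθ' _ _)

include hp hθ hθ' in
theorem strictMonoOn_wCdf : StrictMonoOn (wCdf p θ) (Set.Icc 0 1) := by
  intro u hu v hv huv
  rw [← sub_pos, wCdf_sub hp hθ hθ']
  exact intervalIntegral.intervalIntegral_pos_of_pos_on (intervalIntegrable_wTheta hp hθ hθ' _ _)
    (fun t ht => wTheta_pos hp hθ hθ' ⟨hu.1.trans_lt ht.1, ht.2.trans_le hv.2⟩) huv

theorem wCdf_zero : wCdf p θ 0 = 0 := intervalIntegral.integral_same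

include hp hθ hθ' in
theorem wCdf_one : wCdf p θ 1 = 1 := integral_wTheta_one hp hθ hθ'

include hp hθ hθ' in
theorem wCdf_mem {u : ℝ} (hu : u ∈ Set.Ioo (0 : ℝ) 1) : wCdf p θ u ∈ Set.Ioo (0 : ℝ) 1 := by
  constructor
  · rw [← wCdf_zero (p := p) (θ := θ)]
    exact strictMonoOn_wCdf hp hθ hθ' (by simp) ⟨hu.1.le, hu.2.le⟩ hu.1
  · rw [← wCdf_one hp hθ hθ']
    exact strictMonoOn_wCdf hp hθ hθ' ⟨hu.1.le, hu.2.le⟩ (by simp) hu.2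

include hp hθ hθ' in
theorem exists_wCdf_eq {τ : ℝ} (hτ : τ ∈ Set.Ioo (0 : ℝ) 1) :
    ∃ u ∈ Set.Ioo (0 : ℝ) 1, wCdf p θ u = τ := by
  have := intermediate_value_Ioo (zero_le_one) (continuous_wCdf hp hθ hθ').continuousOn
  rw [wCdf_zero, wCdf_one hp hθ hθ'] at this
  exact this hτ

end weight

/-- `w_θ` is dominated by powers less than one of its primitive, uniformly in `θ`. -/
theorem exists_wTheta_le {p κ : ℝ} (hp : 1 ≤ p) (hκ0 : 0 ≤ κ) (hκ : κ < 1) :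
    ∃ c : ℝ, 0 < c ∧ ∀ θ u, 0 < θ → θ ≤ 1 / 2 → 0 < u → u ≤ 1 / 2 →
      wTheta p θ u ≤ c * (wCdf p θ u / θ) ^ κ := by
  obtain ⟨c, hc, hle⟩ := exists_eta_le hp hκ
  have hE := etaPrim_pos hp (1 / 2)
  refine ⟨max (2 * c) (2 / etaPrim p (1 / 2) ^ κ), by positivity, fun θ u hθ hθ' hu hu' => ?_⟩
  have hinv : 1 ≤ (1 - θ)⁻¹ := by rw [le_inv_comm₀ one_pos (by linarith)]; linarith
  have hinv2 : (1 - θ)⁻¹ ≤ 2 := by rw [inv_le_comm₀ (by linarith) (by norm_num)]; linarith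
  have hval {v : ℝ} (hv : 0 < v) (hv' : v ≤ θ / 2) : etaPrim p (v / θ) ≤ wCdf p θ v / θ := by
    unfold wCdf
    rw [integral_wTheta_zero_of_le hp hθ hv hv' hθ', le_div_iff₀ hθ]
    nlinarith [mul_pos hθ (etaPrim_pos hp (v / θ))]
  rcases le_or_gt u (θ / 2) with h | h
  · have hr : u / θ ≤ 1 / 2 := by rw [div_le_iff₀ hθ]; linarith
    have h1 := hle (u / θ) (by positivity) hr
    rw [wTheta_of_le hu', wHalf, if_pos h]
    calc (1 - θ)⁻¹ * eta p (u / θ) ≤ 2 * (c * etaPrim p (u / θ) ^ κ) := by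
          gcongr; exact eta_nonneg _ _
      _ = 2 * c * etaPrim p (u / θ) ^ κ := by ring
      _ ≤ _ := by
          have := etaPrim_pos hp (u / θ)
          gcongr
          · exact le_max_left _ _
          · exact hval hu h
  · have h1 : etaPrim p (1 / 2) ≤ wCdf p θ u / θ := by
      have h2 := hval (v := θ / 2) (by positivity) le_rfl
      rw [show θ / 2 / θ = 1 / 2 by field_simp] at h2
      refine h2.trans ?_
      gcongr
      exact (strictMonoOn_wCdf hp hθ hθ' ⟨by positivity, by linarith⟩ ⟨hu.le, by linarith⟩ h).le
    calc wTheta p θ u ≤ 2 := wTheta_le_two hp hθ hθ' u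
      _ = 2 / etaPrim p (1 / 2) ^ κ * etaPrim p (1 / 2) ^ κ := by
          rw [div_mul_cancel₀ _ (by positivity)]
      _ ≤ _ := by
          gcongr
          exact le_max_right _ _

end BDIS

/-! ### Variation on the unit interval, the transport map and the weighted kernel -/

namespace BDIS

/-- The uniform distribution on the unit interval. -/
noncomputable abbrev unif : Measure ℝ := volume.restrict (Set.Ioo (0 : ℝ) 1)

instance : IsProbabilityMeasure unif := ⟨by simp⟩

theorem ae_unif_mem : ∀ᵐ u ∂unif, u ∈ Set.Ioo (0 : ℝ) 1 := ae_restrict_mem measurableSet_Ioo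

theorem integral_unif (h : ℝ → ℝ) : ∫ u, h u ∂unif = ∫ u in (0 : ℝ)..1, h u := by
  rw [intervalIntegral.integral_of_le zero_le_one, integral_Ioc_eq_integral_Ioo]

/-- The variation of `h` on the unit interval is controlled by the growth of some function, by
at most `V` in total. -/
def VarLE (h : ℝ → ℝ) (V : ℝ) : Prop :=
  ∃ G : ℝ → ℝ, (∀ x y, 0 ≤ x → x ≤ y → y ≤ 1 → |h x - h y| ≤ G y - G x) ∧ G 1 - G 0 ≤ V

theorem VarLE.nonneg {h : ℝ → ℝ} {V : ℝ} (hV : VarLE h V) : 0 ≤ V := by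
  obtain ⟨G, h1, h2⟩ := hV
  have := (abs_nonneg _).trans (h1 0 1 le_rfl zero_le_one le_rfl)
  linarith

theorem VarLE.mono {h : ℝ → ℝ} {V V' : ℝ} (hV : VarLE h V) (hle : V ≤ V') : VarLE h V' := by
  obtain ⟨G, h1, h2⟩ := hV
  exact ⟨G, h1, h2.trans hle⟩

theorem VarLE.const (c : ℝ) : VarLE (fun _ => c) 0 := ⟨fun _ => 0, by simp, by simp⟩

theorem VarLE.add {h g : ℝ → ℝ} {V V' : ℝ} (hV : VarLE h V) (hV' : VarLE g V') :
    VarLE (fun x => h x + g x) (V + V') := by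
  obtain ⟨G, h1, h2⟩ := hV
  obtain ⟨G', h1', h2'⟩ := hV'
  refine ⟨fun x => G x + G' x, fun x y hx hxy hy => ?_, by linarith⟩
  have := abs_add_le (h x - h y) (g x - g y)
  rw [show h x + g x - (h y + g y) = h x - h y + (g x - g y) by ring]
  linarith [h1 x y hx hxy hy, h1' x y hx hxy hy]

theorem VarLE.const_mul {h : ℝ → ℝ} {V : ℝ} (hV : VarLE h V) (c : ℝ) :
    VarLE (fun x => c * h x) (|c| * V) := by
  obtain ⟨G, h1, h2⟩ := hV
  refine ⟨fun x => |c| * G x, fun x y hx hxy hy => ?_, ?_⟩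
  · rw [← mul_sub, abs_mul, ← mul_sub]
    exact mul_le_mul_of_nonneg_left (h1 x y hx hxy hy) (abs_nonneg c)
  · rw [← mul_sub]
    exact mul_le_mul_of_nonneg_left h2 (abs_nonneg c)

theorem VarLE.congr {h g : ℝ → ℝ} {V : ℝ} (hV : VarLE h V) (hg : ∀ x, 0 ≤ x → x ≤ 1 → g x = h x) :
    VarLE g V := by
  obtain ⟨G, h1, h2⟩ := hV
  exact ⟨G, fun x y hx hxy hy => by
    rw [hg x hx (hxy.trans hy), hg y (hx.trans hxy) hy]; exact h1 x y hx hxy hy, h2⟩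

section weight

variable {p θ : ℝ} (hp : 1 ≤ p) (hθ : 0 < θ) (hθ' : θ ≤ 1 / 2)

theorem wTheta_zero : wTheta p θ 0 = 0 ∨ θ < 0 := by
  rcases lt_or_ge θ 0 with h | h
  · exact Or.inr h
  · left
    rw [wTheta_of_le (by norm_num), wHalf, if_pos (by linarith), zero_div, eta_of_nonpos le_rfl,
      mul_zero]

include hp hθ hθ' in
theorem integral_wTheta_unif : ∫ u, wTheta p θ u ∂unif = 1 := by
  rw [integral_unif, integral_wTheta_one hp hθ hθ']

include hp hθ hθ' in
-- The weight has mean 1 and maximum `(1-θ)⁻¹`, so its second moment is at most `(1-θ)⁻¹` and its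
-- variance at most `(1-θ)⁻¹ - 1 ≤ 2θ`.
theorem integral_sq_wTheta_sub_one_le : ∫ u, (wTheta p θ u - 1) ^ 2 ∂unif ≤ 2 * θ := by
  have hi := integrable_wTheta (p := p) hp hθ hθ' unif
  have hinv2 : (1 - θ)⁻¹ ≤ 1 + 2 * θ := by
    rw [inv_le_iff_one_le_mul₀ (by linarith)]; nlinarith
  calc ∫ u, (wTheta p θ u - 1) ^ 2 ∂unif
      ≤ ∫ u, ((((1 - θ)⁻¹ - 2) * wTheta p θ u) + 1) ∂unif := by
        refine integral_mono_of_nonneg (ae_of_all _ fun u => sq_nonneg _)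
          ((hi.const_mul _).add (integrable_const _)) (ae_of_all _ fun u => ?_)
        simp only
        nlinarith [wTheta_nonneg hp hθ hθ' u, wTheta_le hp hθ hθ' u]
    _ = (1 - θ)⁻¹ - 1 := by
        rw [integral_add (hi.const_mul _) (integrable_const _), integral_const_mul,
          integral_wTheta_unif hp hθ hθ']
        simp; ring
    _ ≤ _ := by linarith

include hp hθ hθ' in
-- The weight increases up to 1/2 and decreases afterwards, with maximum at most 2.
theorem varLE_wTheta : VarLE (wTheta p θ) 4 := by
  have h2 := wTheta_le_two hp hθ hθ' (1 / 2)
  have h0 := wTheta_nonneg hp hθ hθ'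
  refine ⟨fun u => if u ≤ 1 / 2 then wTheta p θ u else 2 * wTheta p θ (1 / 2) - wTheta p θ u,
    fun x y hx hxy hy => ?_, ?_⟩
  · simp only
    split_ifs with hy' hx' hx'
    · have := wTheta_le_of_le hp hθ hθ' hxy hy'
      rw [abs_of_nonpos (by linarith)]; linarith
    · linarith
    · have h3 := wTheta_le_of_le hp hθ hθ' hx' le_rfl
      have h4 := wTheta_le_of_ge hp hθ hθ' le_rfl (not_le.1 hy').le
      rw [abs_le]; constructor <;> linarith
    · have := wTheta_le_of_ge hp hθ hθ' (not_le.1 hx').le hxy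
      rw [abs_of_nonneg (by linarith)]; linarith
  · simp only
    rw [if_neg (by norm_num), if_pos (by norm_num)]
    linarith [h0 0, h0 1]

include hp hθ hθ' in
-- The truncated weight rises to at most `w(c)` and then drops to 0.
theorem varLE_wTheta_left {c : ℝ} (hc : c ∈ Set.Ioc (0 : ℝ) (1 / 2)) :
    VarLE (fun u => if u < c then wTheta p θ u else 0) (2 * wTheta p θ c) := by
  have h0 := wTheta_nonneg hp hθ hθ'
  refine ⟨fun u => if u < c then wTheta p θ u else 2 * wTheta p θ c, fun x y hx hxy hy => ?_, ?_⟩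
  · simp only
    split_ifs with hx' hy' hy'
    · have := wTheta_le_of_le hp hθ hθ' hxy (hy'.le.trans hc.2)
      rw [abs_of_nonpos (by linarith)]; linarith
    · have := wTheta_le_of_le hp hθ hθ' hx'.le hc.2
      rw [sub_zero, abs_of_nonneg (h0 x)]; linarith
    · linarith
    · simp
  · simp only
    rw [if_neg (by linarith [hc.2]), if_pos hc.1]
    linarith [h0 0]

include hp hθ hθ' in
theorem varLE_wTheta_right {c : ℝ} (hc : c ∈ Set.Ico (1 / 2 : ℝ) 1) :
    VarLE (fun u => if u < c then 0 else wTheta p θ u) (2 * wTheta p θ c) := by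
  have h0 := wTheta_nonneg hp hθ hθ'
  refine ⟨fun u => if u < c then 0 else 2 * wTheta p θ c - wTheta p θ u,
    fun x y hx hxy hy => ?_, ?_⟩
  · simp only
    split_ifs with hx' hy' hy'
    · simp
    · have := wTheta_le_of_ge hp hθ hθ' hc.1 (not_lt.1 hy')
      rw [zero_sub, abs_neg, abs_of_nonneg (h0 y)]; linarith
    · linarith
    · have := wTheta_le_of_ge hp hθ hθ' (hc.1.trans (not_lt.1 hx')) hxy
      rw [abs_of_nonneg (by linarith)]; linarith
  · simp only
    rw [if_neg (by linarith [hc.2]), if_pos (by linarith [hc.1])]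
    linarith [h0 1]

include hp hθ hθ' in
theorem wCdf_lt_iff {u c : ℝ} (hu : u ∈ Set.Icc (0 : ℝ) 1) (hc : c ∈ Set.Ioo (0 : ℝ) 1) :
    wCdf p θ u < wCdf p θ c ↔ u < c :=
  (strictMonoOn_wCdf hp hθ hθ').lt_iff_lt hu ⟨hc.1.le, hc.2.le⟩

/-! ### The transport map -/

variable {φ : ℝ → ℝ} (hφ : IsLightTailedDensity φ)

include hp hθ hθ' hφ

theorem measurable_transport : Measurable (transport φ p θ) :=
  hφ.measurable_quantile.comp (continuous_wCdf hp hθ hθ').measurable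

theorem transport_lt_iff {u : ℝ} (hu : u ∈ Set.Ioo (0 : ℝ) 1) (y : ℝ) :
    transport φ p θ u < y ↔ wCdf p θ u < cdfOf φ y :=
  hφ.quantile_lt_iff (wCdf_mem hp hθ hθ' hu) y

theorem transport_le_iff {u : ℝ} (hu : u ∈ Set.Ioo (0 : ℝ) 1) (y : ℝ) :
    transport φ p θ u ≤ y ↔ wCdf p θ u ≤ cdfOf φ y :=
  hφ.quantile_le_iff (wCdf_mem hp hθ hθ' hu) y

/-- Half-lines determine the law: the preimage of `Iic a` is `Ioc 0 c`, where `c` is the point at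
which the primitive of the weight equals `Φ(a)`. -/
theorem map_transport :
    (unif.withDensity fun u => ENNReal.ofReal (wTheta p θ u)).map (transport φ p θ) = nuOf φ := by
  have := hφ.isProbabilityMeasure_nuOf
  have hT := measurable_transport hp hθ hθ' hφ
  have hi := integrable_wTheta (p := p) hp hθ hθ'
  have : IsFiniteMeasure (unif.withDensity fun u => ENNReal.ofReal (wTheta p θ u)) :=
    isFiniteMeasure_withDensity_ofReal (hi unif).2
  refine Measure.ext_of_Iic _ _ fun a => ?_
  obtain ⟨c, hc, hca⟩ := exists_wCdf_eq hp hθ hθ' ⟨hφ.cdf_pos a, hφ.cdf_lt_one a⟩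
  have hset : transport φ p θ ⁻¹' Set.Iic a ∩ Set.Ioo 0 1 = Set.Ioc 0 c := by
    ext u
    simp only [Set.mem_inter_iff, Set.mem_preimage, Set.mem_Iic, Set.mem_Ioo, Set.mem_Ioc]
    constructor
    · rintro ⟨h, hu⟩
      rw [transport_le_iff hp hθ hθ' hφ hu, ← hca,
        (strictMonoOn_wCdf hp hθ hθ').le_iff_le ⟨hu.1.le, hu.2.le⟩ ⟨hc.1.le, hc.2.le⟩] at h
      exact ⟨hu.1, h⟩
    · rintro ⟨h, hu⟩
      have hu' : u ∈ Set.Ioo (0 : ℝ) 1 := ⟨h, hu.trans_lt hc.2⟩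
      refine ⟨?_, hu'⟩
      rw [transport_le_iff hp hθ hθ' hφ hu', ← hca,
        (strictMonoOn_wCdf hp hθ hθ').le_iff_le ⟨hu'.1.le, hu'.2.le⟩ ⟨hc.1.le, hc.2.le⟩]
      exact hu
  rw [Measure.map_apply hT measurableSet_Iic, withDensity_apply _ (hT measurableSet_Iic),
    Measure.restrict_restrict (hT measurableSet_Iic), hset, hφ.nuOf_Iic,
    ← ofReal_integral_eq_lintegral_ofReal _ (ae_of_all _ (wTheta_nonneg hp hθ hθ')), ← hca, wCdf,
    intervalIntegral.integral_of_le hc.1.le]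
  exact (intervalIntegrable_wTheta hp hθ hθ' 0 c).1

end weight

/-- The weighted kernel `w_θ(u) k(T_θ(u), y)`. -/
noncomputable def psi (φ : ℝ → ℝ) (p θ u y : ℝ) : ℝ := wTheta p θ u * kern φ (transport φ p θ u) y

theorem measurable_psi {φ : ℝ → ℝ} (hφ : IsLightTailedDensity φ) {p θ : ℝ} (hp : 1 ≤ p)
    (hθ : 0 < θ) (hθ' : θ ≤ 1 / 2) : Measurable fun z : ℝ × ℝ => psi φ p θ z.1 z.2 :=
  (measurable_wTheta.comp measurable_fst).mul (hφ.measurable_kern.comp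
    (((measurable_transport hp hθ hθ' hφ).comp measurable_fst).prodMk measurable_snd))

/-- Up to sign, the weighted kernel in `u` is `(w 1_S - τ w) / φ`, with `S` the smaller of the two
intervals into which the unit interval is cut. -/
theorem exists_psi_eq {φ : ℝ → ℝ} (hφ : IsLightTailedDensity φ) {p κ : ℝ} (hp : 1 ≤ p)
    (hκ0 : 0 ≤ κ) (hκ : κ < 1) :
    ∃ C : ℝ, 1 ≤ C ∧ ∀ θ y, 0 < θ → θ ≤ 1 / 2 → ∃ (h : ℝ → ℝ) (r : ℝ), Measurable h ∧
      |r| * φ y = 1 ∧ (∀ u ∈ Set.Icc (0 : ℝ) 1, psi φ p θ u y = r * (h u - tail φ y * wTheta p θ u)) ∧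
      (∀ u ∈ Set.Icc (0 : ℝ) 1, h u = 0 ∨ h u = wTheta p θ u) ∧
      (∀ u ∈ Set.Icc (0 : ℝ) 1, 0 ≤ h u ∧ h u ≤ C * (tail φ y / θ) ^ κ) ∧
      ∫ u, h u ∂unif = tail φ y ∧ VarLE h (2 * (C * (tail φ y / θ) ^ κ)) := by
  obtain ⟨c, hc, hw⟩ := exists_wTheta_le hp hκ0 hκ
  refine ⟨max c 1, le_max_right _ _, fun θ y hθ hθ' => ?_⟩
  have h0 := wTheta_nonneg hp hθ hθ'
  have hpos := hφ.pos y
  have hw' (u : ℝ) (hu : 0 < u) (hu' : u ≤ 1 / 2) :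
      wTheta p θ u ≤ max c 1 * (wCdf p θ u / θ) ^ κ := by
    refine (hw θ u hθ hθ' hu hu').trans ?_
    have := (wCdf_mem (p := p) hp hθ hθ' ⟨hu, by linarith⟩).1
    gcongr
    exact le_max_left _ _
  obtain ⟨u₀, hu₀, hτ⟩ := exists_wCdf_eq hp hθ hθ' ⟨hφ.cdf_pos y, hφ.cdf_lt_one y⟩
  have hz0 : wTheta p θ 0 = 0 := wTheta_zero.resolve_right (by linarith)
  have hz1 : wTheta p θ 1 = 0 := by rw [← wTheta_one_sub, sub_self, hz0]
  have hpsi (u : ℝ) (hu : u ∈ Set.Icc (0 : ℝ) 1) : psi φ p θ u y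
      = (φ y)⁻¹ * (cdfOf φ y * wTheta p θ u - if u < u₀ then wTheta p θ u else 0) := by
    unfold psi kern
    rcases eq_or_lt_of_le hu.1 with h | h
    · rw [← h, hz0]; simp
    rcases eq_or_lt_of_le hu.2 with h' | h'
    · rw [h', hz1]; simp
    have : (transport φ p θ u < y) ↔ u < u₀ := by
      rw [transport_lt_iff hp hθ hθ' hφ ⟨h, h'⟩, ← hτ, wCdf_lt_iff hp hθ hθ' hu hu₀]
    simp only [this]
    split_ifs <;> ring
  have hint : ∫ u, (if u < u₀ then wTheta p θ u else 0) ∂unif = cdfOf φ y := by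
    have : (fun u => if u < u₀ then wTheta p θ u else 0)
        = (Set.Iio u₀).indicator (wTheta p θ) := by
      ext u; simp [Set.indicator_apply]
    rw [this, integral_indicator measurableSet_Iio, Measure.restrict_restrict measurableSet_Iio,
      ← hτ, wCdf, intervalIntegral.integral_of_le hu₀.1.le, integral_Ioc_eq_integral_Ioo]
    congr 2
    ext u
    simp only [Set.mem_inter_iff, Set.mem_Iio, Set.mem_Ioo]
    exact ⟨fun h => ⟨h.2.1, h.1⟩, fun h => ⟨h.2, h.1, h.2.trans hu₀.2⟩⟩
  have hm : Measurable fun u => if u < u₀ then wTheta p θ u else 0 :=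
    Measurable.ite measurableSet_Iio measurable_wTheta measurable_const
  have hhalf : wCdf p θ (1 / 2) = 1 / 2 := integral_wTheta_half hp hθ hθ'
  have hmono := strictMonoOn_wCdf (p := p) hp hθ hθ'
  -- The primitive is 1/2 at 1/2, so the side on which `u₀` lies decides which tail is smaller. In
  -- the right half one passes to the complement: `Φ w - w 1[u<u₀] = w 1[u≥u₀] - (1-Φ) w`.
  rcases le_or_gt u₀ (1 / 2) with hle | hgt
  · have htail : tail φ y = cdfOf φ y := by
      refine min_eq_left ?_
      have := (hmono.le_iff_le ⟨hu₀.1.le, hu₀.2.le⟩ (by norm_num)).2 hle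
      linarith
    have hb := hw' u₀ hu₀.1 hle
    rw [hτ, ← htail] at hb
    refine ⟨fun u => if u < u₀ then wTheta p θ u else 0, -(φ y)⁻¹, hm, ?_, fun u hu => ?_,
      fun u hu => ?_, fun u hu => ?_, hint.trans htail.symm, ?_⟩
    · rw [abs_neg, abs_of_pos (inv_pos.2 hpos), inv_mul_cancel₀ hpos.ne']
    · rw [hpsi u hu, htail]; ring
    · simp only; split_ifs <;> simp
    · simp only
      split_ifs with h
      · exact ⟨h0 u, (wTheta_le_of_le hp hθ hθ' h.le hle).trans hb⟩
      · exact ⟨le_rfl, (h0 u₀).trans hb⟩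
    · exact (varLE_wTheta_left hp hθ hθ' ⟨hu₀.1, hle⟩).mono (by linarith)
  · have htail : tail φ y = 1 - cdfOf φ y := by
      refine min_eq_right ?_
      have := (hmono.lt_iff_lt (by norm_num) ⟨hu₀.1.le, hu₀.2.le⟩).2 hgt
      linarith
    have hb := hw' (1 - u₀) (by linarith [hu₀.2]) (by linarith)
    rw [wTheta_one_sub, wCdf_one_sub hp hθ hθ', hτ, ← htail] at hb
    refine ⟨fun u => if u < u₀ then 0 else wTheta p θ u, (φ y)⁻¹,
      Measurable.ite measurableSet_Iio measurable_const measurable_wTheta, ?_, fun u hu => ?_,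
      fun u hu => ?_, fun u hu => ?_, ?_, ?_⟩
    · rw [abs_of_pos (inv_pos.2 hpos), inv_mul_cancel₀ hpos.ne']
    · rw [hpsi u hu, htail]; simp only; split_ifs <;> ring
    · simp only; split_ifs <;> simp
    · simp only
      split_ifs with h
      · exact ⟨le_rfl, (h0 u₀).trans hb⟩
      · exact ⟨h0 u, (wTheta_le_of_ge hp hθ hθ' hgt.le (not_lt.1 h)).trans hb⟩
    · have : (fun u => if u < u₀ then 0 else wTheta p θ u)
          = fun u => wTheta p θ u - if u < u₀ then wTheta p θ u else 0 := by
        ext u; split_ifs <;> simp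
      have hiw := integrable_wTheta (p := p) hp hθ hθ' unif
      rw [this, integral_sub hiw, hint, integral_wTheta_unif hp hθ hθ', htail]
      refine hiw.mono' hm.aestronglyMeasurable (ae_of_all _ fun u => ?_)
      split_ifs
      · rw [Real.norm_of_nonneg (h0 u)]
      · simpa using h0 u
    · exact (varLE_wTheta_right hp hθ hθ' ⟨hgt.le, hu₀.2⟩).mono (by linarith)

/-- Size, mean, second moment and variation of the weighted kernel. -/
theorem exists_psi_bounds {φ : ℝ → ℝ} (hφ : IsLightTailedDensity φ) {p κ : ℝ} (hp : 1 ≤ p)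
    (hκ0 : 0 ≤ κ) (hκ : κ < 1) :
    ∃ C : ℝ, 1 ≤ C ∧ ∀ θ y, 0 < θ → θ ≤ 1 / 2 →
      (∀ u ∈ Set.Icc (0 : ℝ) 1, |φ y * psi φ p θ u y| ≤ C * (tail φ y / θ) ^ κ) ∧
      ∫ u, psi φ p θ u y ∂unif = 0 ∧
      ∫ u, (φ y * psi φ p θ u y) ^ 2 ∂unif ≤ 2 * (C * (tail φ y / θ) ^ κ) * tail φ y ∧
      VarLE (fun u => φ y * psi φ p θ u y) (4 * (C * (tail φ y / θ) ^ κ)) := by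
  obtain ⟨C, hC, hex⟩ := exists_psi_eq hφ hp hκ0 hκ
  refine ⟨C, hC, fun θ y hθ hθ' => ?_⟩
  obtain ⟨h, r, hm, hr, hpsi, h01, hb, hint, hvar⟩ := hex θ y hθ hθ'
  set τ := tail φ y with hτdef
  set M := C * (τ / θ) ^ κ with hM
  have hτ : 0 < τ := hφ.tail_pos y
  have hpos := hφ.pos y
  have hτ2 : τ ≤ 1 / 2 := by
    have h1 : τ ≤ cdfOf φ y := min_le_left _ _
    have h2 : τ ≤ 1 - cdfOf φ y := min_le_right _ _
    linarith
  have hw0 := wTheta_nonneg hp hθ hθ'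
  have hw2 := wTheta_le_two hp hθ hθ'
  -- As `τ` and `θ` are at most 1/2, `τ/θ ≥ 2τ`. This lets `M` absorb the contribution of `τ w`,
  -- where `w ≤ 2`.
  have hMτ : 2 * τ ≤ M := by
    have : 2 * τ ≤ (τ / θ) ^ κ := by
      have h2 : 2 * τ ≤ τ / θ := by rw [le_div_iff₀ hθ]; nlinarith
      rcases le_or_gt (τ / θ) 1 with h | h
      · exact h2.trans (Real.self_le_rpow_of_le_one (by positivity) h hκ.le)
      · exact (by linarith : 2 * τ ≤ 1).trans (Real.one_le_rpow h.le hκ0)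
    nlinarith [this, hτ]
  have hφr : (φ y * r) ^ 2 = 1 := by
    rw [← sq_abs, abs_mul, abs_of_pos hpos, mul_comm, hr, one_pow]
  have habs : |φ y * r| = 1 := by rw [abs_mul, abs_of_pos hpos, mul_comm, hr]
  have heq (u : ℝ) (hu : u ∈ Set.Icc (0 : ℝ) 1) :
      φ y * psi φ p θ u y = φ y * r * (h u - τ * wTheta p θ u) := by rw [hpsi u hu]; ring
  have hae : ∀ᵐ u ∂unif, u ∈ Set.Icc (0 : ℝ) 1 := ae_unif_mem.mono fun u hu => ⟨hu.1.le, hu.2.le⟩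
  have hhint : Integrable h unif :=
    Integrable.of_bound hm.aestronglyMeasurable M (hae.mono fun u hu => by
      rw [Real.norm_of_nonneg (hb u hu).1]; exact (hb u hu).2)
  have hwint := integrable_wTheta (p := p) hp hθ hθ' unif
  refine ⟨fun u hu => ?_, ?_, ?_, ?_⟩
  · rw [heq u hu, abs_mul, habs, one_mul, abs_le]
    have := hb u hu
    have h1 := mul_le_mul_of_nonneg_left (hw2 u) hτ.le
    have h3 := mul_nonneg hτ.le (hw0 u)
    constructor <;> linarith
  · rw [integral_congr_ae (hae.mono fun u hu => hpsi u hu), integral_const_mul,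
      integral_sub hhint (hwint.const_mul _), integral_const_mul, integral_wTheta_unif hp hθ hθ',
      hint]
    simp
  -- Pointwise the square is at most `2τ² w` where `h = 0`, and at most `w² ≤ M w` where `h = w`;
  -- the integrals of `h` and `w` are `τ` and 1.
  · calc ∫ u, (φ y * psi φ p θ u y) ^ 2 ∂unif
        ≤ ∫ u, (M * h u + 2 * τ ^ 2 * wTheta p θ u) ∂unif := by
          refine integral_mono_of_nonneg (ae_of_all _ fun u => sq_nonneg _)
            ((hhint.const_mul _).add (hwint.const_mul _)) (hae.mono fun u hu => ?_)
          simp only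
          rw [heq u hu, mul_pow, hφr, one_mul]
          have h3 := mul_nonneg (sq_nonneg τ) (hw0 u)
          rcases h01 u hu with h' | h'
          · rw [h']
            nlinarith [mul_le_mul_of_nonneg_left (hw2 u) h3]
          · have h4 := (hb u hu).2
            rw [h'] at h4 ⊢
            have h5 : (1 - τ) ^ 2 ≤ 1 := by nlinarith
            have h6 := mul_le_mul_of_nonneg_left h4 (hw0 u)
            nlinarith [mul_le_mul_of_nonneg_left h5 (sq_nonneg (wTheta p θ u))]
      _ = M * τ + 2 * τ ^ 2 := by
          rw [integral_add (hhint.const_mul _) (hwint.const_mul _), integral_const_mul,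
            integral_const_mul, integral_wTheta_unif hp hθ hθ', hint, mul_one]
      _ ≤ 2 * M * τ := by nlinarith
  · have h1 := (hvar.add ((varLE_wTheta hp hθ hθ').const_mul (-τ))).const_mul (φ y * r)
    rw [habs, one_mul, abs_neg, abs_of_pos hτ] at h1
    exact (h1.mono (by linarith)).congr fun u hu hu' => by rw [heq u ⟨hu, hu'⟩]; ring

end BDIS

namespace BDIS

/-! ### Cauchy–Schwarz -/

theorem abs_integral_mul_le {Ω : Type*} [MeasurableSpace Ω] {P : Measure Ω} {f g : Ω → ℝ}
    (hf : Integrable (fun x => f x ^ 2) P) (hg : Integrable (fun x => g x ^ 2) P)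
    (hfg : Integrable (fun x => f x * g x) P) :
    |∫ x, f x * g x ∂P| ≤ √(∫ x, f x ^ 2 ∂P) * √(∫ x, g x ^ 2 ∂P) := by
  rw [← Real.sqrt_mul (integral_nonneg fun x => sq_nonneg _)]
  refine Real.abs_le_sqrt ?_
  have h (t : ℝ) : 0 ≤ (∫ x, g x ^ 2 ∂P) * (t * t) + 2 * (∫ x, f x * g x ∂P) * t
      + ∫ x, f x ^ 2 ∂P := by
    have h0 : 0 ≤ ∫ x, (f x + t * g x) ^ 2 ∂P := integral_nonneg fun x => sq_nonneg _
    have : ∫ x, (f x + t * g x) ^ 2 ∂P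
        = ∫ x, (f x ^ 2 + (2 * t) * (f x * g x) + t ^ 2 * g x ^ 2) ∂P := by
      congr 1; ext x; ring
    have hi : Integrable (fun x => f x ^ 2 + (2 * t) * (f x * g x)) P := hf.add (hfg.const_mul _)
    rw [this, integral_add hi (hg.const_mul _), integral_add hf (hfg.const_mul _), integral_const_mul, integral_const_mul] at h0
    linarith
  have := discrim_le_zero h
  unfold discrim at this
  linarith

/-- Measurable functions that are bounded on the unit interval. -/
def BddMeas (h : ℝ → ℝ) : Prop := Measurable h ∧ ∃ M, ∀ u ∈ Set.Icc (0 : ℝ) 1, |h u| ≤ M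

namespace BddMeas

variable {h g : ℝ → ℝ}

theorem integrable_comp (hh : BddMeas h) {Ω : Type*} [MeasurableSpace Ω] {P : Measure Ω}
    [IsFiniteMeasure P] {U : Ω → ℝ} (hU : Measurable U) (hU' : ∀ᵐ o ∂P, U o ∈ Set.Icc (0 : ℝ) 1) :
    Integrable (fun o => h (U o)) P := by
  obtain ⟨hm, M, hM⟩ := hh
  exact Integrable.of_bound (hm.comp hU).aestronglyMeasurable M (hU'.mono fun o ho => hM _ ho)

theorem ae_mem : ∀ᵐ u ∂unif, u ∈ Set.Icc (0 : ℝ) 1 :=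
  ae_unif_mem.mono fun _ hu => ⟨hu.1.le, hu.2.le⟩

theorem integrable (hh : BddMeas h) : Integrable h unif := hh.integrable_comp measurable_id ae_mem

theorem mul (hh : BddMeas h) (hg : BddMeas g) : BddMeas fun u => h u * g u := by
  obtain ⟨hm, M, hM⟩ := hh
  obtain ⟨hm', M', hM'⟩ := hg
  refine ⟨hm.mul hm', M * M', fun u hu => ?_⟩
  rw [abs_mul]
  exact mul_le_mul (hM u hu) (hM' u hu) (abs_nonneg _) ((abs_nonneg _).trans (hM u hu))

theorem sub_const (hh : BddMeas h) (c : ℝ) : BddMeas fun u => h u - c := by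
  obtain ⟨hm, M, hM⟩ := hh
  exact ⟨hm.sub_const c, M + |c|, fun u hu => (abs_sub _ _).trans (by linarith [hM u hu])⟩

theorem sq (hh : BddMeas h) : BddMeas fun u => h u ^ 2 := by simpa only [pow_two] using hh.mul hh

end BddMeas

/-! ### Digit-wise subdivision of the unit interval -/

section digits

variable {b : ℕ}

/-- The function `h` on the `d`-th of the `b` subintervals, rescaled. -/
noncomputable def subFun (b : ℕ) (d : Fin b) (h : ℝ → ℝ) (u : ℝ) : ℝ := h ((d + u) / b)

theorem subFun_mem (d : Fin b) {u : ℝ} (hu : u ∈ Set.Icc (0 : ℝ) 1) :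
    ((d : ℝ) + u) / b ∈ Set.Icc (0 : ℝ) 1 := by
  have hb : (0 : ℝ) < b := by exact_mod_cast d.pos
  have hd : (d : ℝ) + 1 ≤ b := by exact_mod_cast d.isLt
  have := hu.1
  exact ⟨by positivity, by rw [div_le_one hb]; linarith [hu.2]⟩

theorem BddMeas.subFun {h : ℝ → ℝ} (hh : BddMeas h) (d : Fin b) : BddMeas (subFun b d h) := by
  obtain ⟨hm, M, hM⟩ := hh
  exact ⟨hm.comp ((measurable_const.add measurable_id).div_const _), M,
    fun u hu => hM _ (subFun_mem d hu)⟩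

theorem integral_eq_sum_subFun (hb : 0 < b) {h : ℝ → ℝ} (hh : BddMeas h) :
    ∫ u, h u ∂unif = (b : ℝ)⁻¹ * ∑ d : Fin b, ∫ u, subFun b d h u ∂unif := by
  have hb0 : (b : ℝ) ≠ 0 := by positivity
  have e (d : ℕ) : ∫ u in (0 : ℝ)..1, h (((d : ℝ) + u) / b)
      = b * ∫ u in ((d : ℝ) / b)..(((d + 1 : ℕ) : ℝ) / b), h u := by
    have := intervalIntegral.integral_comp_div_add (a := 0) (b := 1) h hb0 ((d : ℝ) / b)
    simp only [zero_div, zero_add, smul_eq_mul] at this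
    rw [show (((d + 1 : ℕ) : ℝ) / b) = 1 / b + d / b by push_cast; ring, ← this]
    congr 1; ext u; congr 1; ring
  simp only [integral_unif, subFun]
  rw [Fin.sum_univ_eq_sum_range (fun d => ∫ u in (0 : ℝ)..1, h (((d : ℝ) + u) / b)) b]
  simp only [e]
  rw [← Finset.mul_sum, intervalIntegral.sum_integral_adjacent_intervals, ← mul_assoc,
    inv_mul_cancel₀ hb0, one_mul]
  · simp [hb0]
  · intro d hd
    have hI : IntervalIntegrable h volume 0 1 := by
      rw [intervalIntegrable_iff, Set.uIoc_of_le zero_le_one, integrableOn_Ioc_iff_integrableOn_Ioo]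
      exact hh.integrable
    refine hI.mono_set ?_
    rw [Set.uIcc_of_le zero_le_one, Set.uIcc_of_le (by gcongr; simp)]
    have : ((d + 1 : ℕ) : ℝ) ≤ b := by exact_mod_cast hd
    exact Set.Icc_subset_Icc (by positivity) ((div_le_one (by positivity)).2 this)

/-- The inner product of the projections of two functions to the functions that are piecewise
constant on intervals of length `b^(-k)`. -/
noncomputable def haarInner (b : ℕ) : ℕ → (ℝ → ℝ) → (ℝ → ℝ) → ℝ
  | 0, h, g => (∫ u, h u ∂unif) * ∫ u, g u ∂unif
  | k + 1, h, g => (b : ℝ)⁻¹ * ∑ d : Fin b, haarInner b k (subFun b d h) (subFun b d g)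

/-- The squared distance of a function from its projection to the functions that are piecewise
constant on intervals of length `b^(-k)`. -/
noncomputable def haarDist (b : ℕ) : ℕ → (ℝ → ℝ) → ℝ
  | 0, h => ∫ u, (h u - ∫ v, h v ∂unif) ^ 2 ∂unif
  | k + 1, h => (b : ℝ)⁻¹ * ∑ d : Fin b, haarDist b k (subFun b d h)

theorem haarDist_nonneg (k : ℕ) : ∀ h : ℝ → ℝ, 0 ≤ haarDist b k h := by
  induction k with
  | zero => exact fun h => integral_nonneg fun u => sq_nonneg _
  | succ k ih =>
    exact fun h => mul_nonneg (by positivity) (Finset.sum_nonneg fun d _ => ih _)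

theorem integral_sq_sub_const {h : ℝ → ℝ} (hh : BddMeas h) (c : ℝ) :
    ∫ u, (h u - c) ^ 2 ∂unif = ∫ u, h u ^ 2 ∂unif - 2 * c * ∫ u, h u ∂unif + c ^ 2 := by
  have : (fun u => (h u - c) ^ 2) = fun u => h u ^ 2 - 2 * c * h u + c ^ 2 := by ext u; ring
  have hi : Integrable (fun u => h u ^ 2 - 2 * c * h u) unif :=
    hh.sq.integrable.sub (hh.integrable.const_mul _)
  rw [this, integral_add hi (integrable_const _), integral_sub hh.sq.integrable (hh.integrable.const_mul _), integral_const_mul]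
  simp

theorem haarDist_le_integral_sq (hb : 0 < b) (k : ℕ) : ∀ {h : ℝ → ℝ}, BddMeas h →
    haarDist b k h ≤ ∫ u, h u ^ 2 ∂unif := by
  induction k with
  | zero =>
    intro h hh
    rw [haarDist, integral_sq_sub_const hh]
    nlinarith [sq_nonneg (∫ v, h v ∂unif)]
  | succ k ih =>
    intro h hh
    rw [haarDist, integral_eq_sum_subFun hb hh.sq]
    exact mul_le_mul_of_nonneg_left (Finset.sum_le_sum fun d _ => ih (hh.subFun d)) (by positivity)

/-- On each cell the distance from the mean is at most the variation there. The variations of the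
cells add up to at most `V`, so their squares add up to at most `V ^ 2`, and each cell has length
`b^(-k)`. -/
theorem haarDist_le_var (hb : 0 < b) (k : ℕ) : ∀ {h : ℝ → ℝ} {V : ℝ}, BddMeas h → VarLE h V →
    haarDist b k h ≤ ((b : ℝ) ^ k)⁻¹ * V ^ 2 := by
  have hb0 : (0 : ℝ) < b := by exact_mod_cast hb
  induction k with
  | zero =>
    intro h V hh hV
    have hV0 := hV.nonneg
    obtain ⟨G, h1, h2⟩ := hV
    have hmono (x y : ℝ) (hx : 0 ≤ x) (hxy : x ≤ y) (hy : y ≤ 1) : G x ≤ G y := by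
      linarith [(abs_nonneg _).trans (h1 x y hx hxy hy)]
    have hosc (x y : ℝ) (hx : x ∈ Set.Icc (0 : ℝ) 1) (hy : y ∈ Set.Icc (0 : ℝ) 1) :
        |h x - h y| ≤ V := by
      rcases le_total x y with h | h
      · linarith [h1 x y hx.1 h hy.2, hmono y 1 hy.1 hy.2 le_rfl, hmono 0 x le_rfl hx.1 hx.2]
      · rw [abs_sub_comm]
        linarith [h1 y x hy.1 h hx.2, hmono x 1 hx.1 hx.2 le_rfl, hmono 0 y le_rfl hy.1 hy.2]
    have hmean (x : ℝ) (hx : x ∈ Set.Icc (0 : ℝ) 1) : |h x - ∫ v, h v ∂unif| ≤ V := by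
      have : h x - ∫ v, h v ∂unif = ∫ v, (h x - h v) ∂unif := by
        rw [integral_sub (integrable_const _) hh.integrable]; simp
      rw [this]
      have := norm_integral_le_of_norm_le_const (μ := unif) (f := fun v => h x - h v) (C := V)
        (BddMeas.ae_mem.mono fun v hv => hosc x v hx hv)
      simpa using this
    rw [haarDist, pow_zero, inv_one, one_mul]
    calc ∫ u, (h u - ∫ v, h v ∂unif) ^ 2 ∂unif ≤ ∫ u, V ^ 2 ∂unif := by
          refine integral_mono_ae (hh.sub_const _).sq.integrable (integrable_const _)
            (BddMeas.ae_mem.mono fun u hu => ?_)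
          simp only
          exact sq_le_sq' (abs_le.1 (hmean u hu)).1 (abs_le.1 (hmean u hu)).2
      _ = V ^ 2 := by simp
  | succ k ih =>
    intro h V hh hV
    obtain ⟨G, h1, h2⟩ := hV
    have hsub (d : Fin b) : VarLE (subFun b d h) (G (((d : ℕ) + 1 : ℕ) / b) - G ((d : ℕ) / b)) := by
      refine ⟨fun x => G ((d + x) / b), fun x y hx hxy hy => ?_, ?_⟩
      · exact h1 _ _ (subFun_mem d ⟨hx, hxy.trans hy⟩).1 (by gcongr)
          (subFun_mem d ⟨hx.trans hxy, hy⟩).2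
      · simp
    have hn (d : Fin b) := (hsub d).nonneg
    have htel : ∑ d : Fin b, (G (((d : ℕ) + 1 : ℕ) / b) - G ((d : ℕ) / b)) = G 1 - G 0 := by
      rw [Fin.sum_univ_eq_sum_range (fun d : ℕ => G ((d + 1 : ℕ) / b) - G (d / b)) b,
        Finset.sum_range_sub (fun d : ℕ => G (d / b))]
      simp [hb0.ne']
    rw [haarDist, pow_succ, mul_inv, mul_comm ((b : ℝ) ^ k)⁻¹, mul_assoc]
    refine mul_le_mul_of_nonneg_left ?_ (by positivity)
    calc ∑ d, haarDist b k (subFun b d h)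
        ≤ ∑ d : Fin b, ((b : ℝ) ^ k)⁻¹ * (G (((d : ℕ) + 1 : ℕ) / b) - G ((d : ℕ) / b)) ^ 2 :=
          Finset.sum_le_sum fun d _ => ih (hh.subFun d) (hsub d)
      _ ≤ ((b : ℝ) ^ k)⁻¹ * (∑ d : Fin b, (G (((d : ℕ) + 1 : ℕ) / b) - G ((d : ℕ) / b))) ^ 2 := by
          rw [← Finset.mul_sum]
          exact mul_le_mul_of_nonneg_left
            (Finset.sum_sq_le_sq_sum_of_nonneg fun d _ => hn d) (by positivity)
      _ ≤ _ := by
          rw [htel]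
          have : 0 ≤ G 1 - G 0 := by rw [← htel]; exact Finset.sum_nonneg fun d _ => hn d
          gcongr

theorem avg_sqrt_mul_sqrt_le (hb : 0 < b) {x y : Fin b → ℝ} (hx : ∀ i, 0 ≤ x i)
    (hy : ∀ i, 0 ≤ y i) : (b : ℝ)⁻¹ * ∑ i, √(x i) * √(y i)
      ≤ √((b : ℝ)⁻¹ * ∑ i, x i) * √((b : ℝ)⁻¹ * ∑ i, y i) := by
  have hb0 : (0 : ℝ) ≤ (b : ℝ)⁻¹ := by positivity
  rw [Real.sqrt_mul hb0, Real.sqrt_mul hb0, mul_mul_mul_comm, Real.mul_self_sqrt hb0]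
  exact mul_le_mul_of_nonneg_left (Real.sum_sqrt_mul_sqrt_le _ hx hy) hb0

/-- The increment is the inner product of the differences of consecutive projections, and such a
difference is no longer than the distance to the coarser projection. On one cell this is
Cauchy–Schwarz; averaging over cells uses it again. -/
theorem abs_haarInner_succ_sub_le (hb : 0 < b) (k : ℕ) : ∀ {h g : ℝ → ℝ}, BddMeas h → BddMeas g →
    |haarInner b (k + 1) h g - haarInner b k h g| ≤ √(haarDist b k h) * √(haarDist b k g) := by
  have hb0 : (0 : ℝ) < b := by exact_mod_cast hb
  induction k with
  | zero =>
    intro h g hh hg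
    set m := fun h : ℝ → ℝ => ∫ u, h u ∂unif with hm
    have key {h : ℝ → ℝ} (hh : BddMeas h) :
        (b : ℝ)⁻¹ * ∑ d : Fin b, (m (subFun b d h) - m h) ^ 2 ≤ haarDist b 0 h := by
      rw [haarDist, integral_eq_sum_subFun hb (hh.sub_const _).sq]
      refine mul_le_mul_of_nonneg_left (Finset.sum_le_sum fun d _ => ?_) (by positivity)
      have := integral_sq_sub_const (hh.subFun d) (m h)
      have h2 := integral_sq_sub_const (hh.subFun d) (m (subFun b d h))
      have h3 : 0 ≤ ∫ u, (subFun b d h u - m (subFun b d h)) ^ 2 ∂unif :=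
        integral_nonneg fun u => sq_nonneg _
      change _ ≤ ∫ u, (subFun b d h u - m h) ^ 2 ∂unif
      rw [this]
      change _ = _ - 2 * m (subFun b d h) * m (subFun b d h) + _ at h2
      change _ ≤ _ - 2 * m h * m (subFun b d h) + _
      nlinarith
    have e : haarInner b (0 + 1) h g - haarInner b 0 h g
        = (b : ℝ)⁻¹ * ∑ d : Fin b, (m (subFun b d h) - m h) * (m (subFun b d g) - m g) := by
      have h1 : m h = (b : ℝ)⁻¹ * ∑ d : Fin b, m (subFun b d h) := integral_eq_sum_subFun hb hh
      have h2 : m g = (b : ℝ)⁻¹ * ∑ d : Fin b, m (subFun b d g) := integral_eq_sum_subFun hb hg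
      have h3 : ∑ d : Fin b, (m (subFun b d h) - m h) * (m (subFun b d g) - m g)
          = ∑ d : Fin b, m (subFun b d h) * m (subFun b d g) - (∑ d : Fin b, m (subFun b d h)) * m g
            - m h * (∑ d : Fin b, m (subFun b d g)) + b * (m h * m g) := by
        rw [Finset.sum_mul, Finset.mul_sum, ← Finset.sum_sub_distrib, ← Finset.sum_sub_distrib]
        rw [show (b : ℝ) * (m h * m g) = ∑ _d : Fin b, m h * m g by simp, ← Finset.sum_add_distrib]
        exact Finset.sum_congr rfl fun d _ => by ring
      have h4 : ∑ d : Fin b, m (subFun b d h) = b * m h := by rw [h1]; field_simp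
      have h5 : ∑ d : Fin b, m (subFun b d g) = b * m g := by rw [h2]; field_simp
      rw [h3, h4, h5]
      change (b : ℝ)⁻¹ * ∑ d : Fin b, m (subFun b d h) * m (subFun b d g) - m h * m g = _
      field_simp
      ring
    rw [e, abs_mul, abs_of_nonneg (by positivity : (0 : ℝ) ≤ (b : ℝ)⁻¹)]
    calc (b : ℝ)⁻¹ * |∑ d : Fin b, (m (subFun b d h) - m h) * (m (subFun b d g) - m g)|
        ≤ (b : ℝ)⁻¹ * ∑ d : Fin b, √((m (subFun b d h) - m h) ^ 2) * √((m (subFun b d g) - m g) ^ 2) := by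
          refine mul_le_mul_of_nonneg_left ((Finset.abs_sum_le_sum_abs _ _).trans_eq ?_)
            (by positivity)
          exact Finset.sum_congr rfl fun d _ => by rw [abs_mul, Real.sqrt_sq_eq_abs, Real.sqrt_sq_eq_abs]
      _ ≤ _ := avg_sqrt_mul_sqrt_le hb (fun d => sq_nonneg _) fun d => sq_nonneg _
      _ ≤ _ := mul_le_mul (Real.sqrt_le_sqrt (key hh)) (Real.sqrt_le_sqrt (key hg))
          (Real.sqrt_nonneg _) (Real.sqrt_nonneg _)
  | succ k ih =>
    intro h g hh hg
    rw [haarInner, haarInner, ← mul_sub, ← Finset.sum_sub_distrib, abs_mul,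
      abs_of_nonneg (by positivity : (0 : ℝ) ≤ (b : ℝ)⁻¹)]
    calc _ ≤ (b : ℝ)⁻¹ * ∑ d : Fin b, √(haarDist b k (subFun b d h)) * √(haarDist b k (subFun b d g)) :=
          mul_le_mul_of_nonneg_left ((Finset.abs_sum_le_sum_abs _ _).trans
            (Finset.sum_le_sum fun d _ => ih (hh.subFun d) (hg.subFun d))) (by positivity)
      _ ≤ _ := avg_sqrt_mul_sqrt_le hb (fun d => haarDist_nonneg _ _) fun d => haarDist_nonneg _ _

theorem haarDist_const_mul (k : ℕ) : ∀ (h : ℝ → ℝ) (c : ℝ),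
    haarDist b k (fun u => c * h u) = c ^ 2 * haarDist b k h := by
  induction k with
  | zero =>
    intro h c
    have (m : ℝ) : (fun u => (c * h u - c * m) ^ 2) = fun u => c ^ 2 * (h u - m) ^ 2 := by
      ext u; ring
    rw [haarDist, haarDist, integral_const_mul, this, integral_const_mul]
  | succ k ih =>
    intro h c
    rw [haarDist, haarDist, mul_left_comm, Finset.mul_sum (a := c ^ 2)]
    congr 1
    exact Finset.sum_congr rfl fun d _ => ih (subFun b d h) c

/-- Interpolation between the second moment and the variation. -/
theorem haarDist_le_interp (hb : 0 < b) (k : ℕ) {h : ℝ → ℝ} {V A α : ℝ} (hh : BddMeas h)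
    (hV : VarLE h V) (hA : ∫ u, h u ^ 2 ∂unif ≤ A) (hα0 : 0 ≤ α) (hα : α ≤ 1) :
    haarDist b k h ≤ ((b : ℝ) ^ k) ^ (-α) * (A ^ (1 - α) * (V ^ 2) ^ α) := by
  have hb0 : (0 : ℝ) < b := by exact_mod_cast hb
  have h0 := haarDist_nonneg (b := b) k h
  have h1 := (haarDist_le_integral_sq hb k hh).trans hA
  have h2 := haarDist_le_var hb k hh hV
  calc haarDist b k h = haarDist b k h ^ (1 - α) * haarDist b k h ^ α := by
        rw [← Real.rpow_add_of_nonneg h0 (by linarith) hα0]; simp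
    _ ≤ A ^ (1 - α) * (((b : ℝ) ^ k)⁻¹ * V ^ 2) ^ α := by
        have hA0 := h0.trans h1
        gcongr
    _ = _ := by
        rw [Real.mul_rpow (by positivity) (sq_nonneg V), Real.inv_rpow (by positivity),
          ← Real.rpow_neg (by positivity)]
        ring

end digits

end BDIS

namespace BDIS

/-! ### Independence of blocks -/

theorem comap_pi_eq_iSup {Ω ι κ : Type*} {E : Type*} [MeasurableSpace E] (X : ι → Ω → E)
    (e : κ → ι) : MeasurableSpace.comap (fun o k => X (e k) o) MeasurableSpace.pi
      = ⨆ k, MeasurableSpace.comap (X (e k)) inferInstance := by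
  unfold MeasurableSpace.pi
  simp only [MeasurableSpace.comap_iSup, MeasurableSpace.comap_comp]
  rfl

/-- Subfamilies of an independent family with disjoint index sets are independent. -/
theorem _root_.ProbabilityTheory.iIndepFun.indepFun_of_disjoint {Ω ι κ κ' : Type*}
    [MeasurableSpace Ω] {P : Measure Ω} {E : Type*} [MeasurableSpace E] {X : ι → Ω → E}
    (hX : iIndepFun X P) (hm : ∀ i, Measurable (X i)) {e : κ → ι} {e' : κ' → ι}
    (he : ∀ k k', e k ≠ e' k') :
    IndepFun (fun o k => X (e k) o) (fun o k => X (e' k) o) P := by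
  rw [IndepFun_iff_Indep, comap_pi_eq_iSup, comap_pi_eq_iSup]
  have h := indep_iSup_of_disjoint (fun i => (hm i).comap_le) hX.iIndep
    (S := Set.range e) (T := Set.range e') (by
      rw [Set.disjoint_iff_forall_ne]
      rintro _ ⟨k, rfl⟩ _ ⟨k', rfl⟩
      exact he k k')
  rw [iSup_range, iSup_range] at h
  exact h

/-! ### Scrambling of one coordinate -/

instance permMeasurableSpace (b : ℕ) : MeasurableSpace (Equiv.Perm (Fin b)) := ⊤

instance (b : ℕ) : DiscreteMeasurableSpace (Equiv.Perm (Fin b)) := ⟨fun _ => trivial⟩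

/-- The permutations that scramble a single coordinate. -/
structure IsCoordScrambling {Ω : Type*} [MeasurableSpace Ω] (P : Measure Ω) {b : ℕ}
    (perm : List (Fin b) → Ω → Equiv.Perm (Fin b)) : Prop where
  measurable : ∀ l, Measurable (perm l)
  uniform : ∀ l σ, P (perm l ⁻¹' {σ}) = ((b.factorial : ENNReal))⁻¹
  indep : iIndepFun perm P

/-- The scrambled number with original digits `a`. -/
noncomputable def scramblePoint {b : ℕ} (a : ℕ → Fin b) (perm : List (Fin b) → Equiv.Perm (Fin b)) :
    ℝ :=
  Real.ofDigits fun k : ℕ => perm (List.ofFn fun i : Fin k => a i) (a k)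

variable {b : ℕ}

/-- The endpoint 1 occurs when all permuted digits are `b - 1`; for this reason functions are
controlled on the closed interval. -/
theorem scramblePoint_mem (a : ℕ → Fin b) (perm : List (Fin b) → Equiv.Perm (Fin b)) :
    scramblePoint a perm ∈ Set.Icc (0 : ℝ) 1 := ⟨Real.ofDigits_nonneg _, Real.ofDigits_le_one _⟩

theorem measurable_scramblePoint (a : ℕ → Fin b) : Measurable (scramblePoint a) := by
  unfold scramblePoint
  refine Real.continuous_ofDigits.measurable.comp (measurable_pi_lambda _ fun k => ?_)
  exact (measurable_of_countable fun σ : Equiv.Perm (Fin b) => σ (a k)).comp (measurable_pi_apply _)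

/-- The self-similarity behind all inductions below: after the first digit, the remaining digits are
scrambled by the permutations of the subtree under `a 0`, which is again a scrambling. -/
theorem scramblePoint_eq (a : ℕ → Fin b) (perm : List (Fin b) → Equiv.Perm (Fin b)) :
    scramblePoint a perm
      = ((perm [] (a 0) : ℕ) + scramblePoint (fun k => a (k + 1)) (fun l => perm (a 0 :: l))) / b := by
  unfold scramblePoint
  rw [Real.ofDigits_eq_sum_add_ofDigits _ 1]
  simp only [Finset.range_one, Finset.sum_singleton, Real.ofDigitsTerm, List.ofFn_zero, zero_add,
    pow_one, List.ofFn_succ, Fin.val_zero, Fin.val_succ]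
  rw [add_div, div_eq_mul_inv, div_eq_inv_mul]

namespace IsCoordScrambling

variable {Ω : Type*} [MeasurableSpace Ω] {P : Measure Ω} [IsProbabilityMeasure P]
  {perm : List (Fin b) → Ω → Equiv.Perm (Fin b)} (hS : IsCoordScrambling P perm)
include hS

omit [IsProbabilityMeasure P] in
theorem cons (c : Fin b) : IsCoordScrambling P fun l => perm (c :: l) where
  measurable _ := hS.measurable _
  uniform _ σ := hS.uniform _ σ
  indep := hS.indep.precomp (g := fun l => c :: l) (List.cons_injective)

omit [IsProbabilityMeasure P] in
theorem measurable_family : Measurable fun o l => perm l o := measurable_pi_lambda _ hS.measurable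

omit [IsProbabilityMeasure P] in
theorem measurable_point (a : ℕ → Fin b) : Measurable fun o => scramblePoint a fun l => perm l o :=
  (measurable_scramblePoint a).comp hS.measurable_family

theorem integrable_comp (a : ℕ → Fin b) {h : ℝ → ℝ} (hh : BddMeas h) :
    Integrable (fun o => h (scramblePoint a fun l => perm l o)) P :=
  hh.integrable_comp (hS.measurable_point a) (ae_of_all _ fun _ => scramblePoint_mem _ _)

theorem integrable_mul (a a' : ℕ → Fin b) {h g : ℝ → ℝ} (hh : BddMeas h) (hg : BddMeas g) :
    Integrable (fun o => h (scramblePoint a fun l => perm l o) *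
      g (scramblePoint a' fun l => perm l o)) P := by
  obtain ⟨M, hM⟩ := hg.2
  refine (hS.integrable_comp a hh).mul_bdd (c := M)
    (hg.1.comp (hS.measurable_point a')).aestronglyMeasurable
    (ae_of_all _ fun o => hM _ (scramblePoint_mem _ _))

omit [IsProbabilityMeasure P] in
/-- Conditioning on the first permutation. -/
theorem integral_root {E : Type*} [MeasurableSpace E] {Y : Ω → E} (hY : Measurable Y)
    (hind : IndepFun (perm []) Y P) {F : Equiv.Perm (Fin b) → E → ℝ} (hF : ∀ σ, Measurable (F σ))
    (hint : ∀ σ, Integrable (fun o => F σ (Y o)) P) :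
    ∫ o, F (perm [] o) (Y o) ∂P = (b.factorial : ℝ)⁻¹ * ∑ σ, ∫ o, F σ (Y o) ∂P := by
  classical
  have e : (fun o => F (perm [] o) (Y o))
      = fun o => ∑ σ, ({σ} : Set (Equiv.Perm (Fin b))).indicator (fun _ => (1 : ℝ)) (perm [] o)
          * F σ (Y o) := by
    ext o
    rw [Finset.sum_eq_single (perm [] o)]
    · simp
    · intro σ _ hσ
      simp [hσ.symm]
    · simp
  have hm (σ : Equiv.Perm (Fin b)) :
      Measurable fun τ => ({σ} : Set (Equiv.Perm (Fin b))).indicator (fun _ => (1 : ℝ)) τ :=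
    measurable_of_countable _
  rw [e, integral_finsetSum, Finset.mul_sum]
  -- The event that the root permutation equals `σ` is independent of `Y` and has probability
  -- `1/b!`.
  · refine Finset.sum_congr rfl fun σ _ => ?_
    refine ((hind.comp (hm σ) (hF σ)).integral_fun_mul_eq_mul_integral
      ((hm σ).comp (hS.measurable [])).aestronglyMeasurable
      ((hF σ).comp hY).aestronglyMeasurable).trans ?_
    congr 1
    have : (fun o => ({σ} : Set (Equiv.Perm (Fin b))).indicator (fun _ => (1 : ℝ)) (perm [] o))
        = (perm [] ⁻¹' {σ}).indicator fun _ => 1 := by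
      ext o; simp [Set.indicator_apply]
    change ∫ o, ({σ} : Set (Equiv.Perm (Fin b))).indicator (fun _ => (1 : ℝ)) (perm [] o) ∂P = _
    rw [this, integral_indicator (hS.measurable [] (MeasurableSet.singleton σ))]
    simp [Measure.real, hS.uniform]
  · intro σ _
    refine (hint σ).bdd_mul (c := 1) ((hm σ).comp (hS.measurable [])).aestronglyMeasurable
      (ae_of_all _ fun o => ?_)
    by_cases h : perm [] o = σ <;> simp [h]

omit [IsProbabilityMeasure P] in
theorem indepFun_root {κ : Type*} (e : κ → List (Fin b)) (he : ∀ k, e k ≠ []) :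
    IndepFun (perm []) (fun o k => perm (e k) o) P := by
  have h := hS.indep.indepFun_of_disjoint hS.measurable (e := fun _ : Unit => []) (e' := e)
    fun _ k => (he k).symm
  exact h.comp (φ := fun f : Unit → Equiv.Perm (Fin b) => f ()) (ψ := id) (measurable_pi_apply _)
    measurable_id

end IsCoordScrambling

/-! ### Averages over permutations -/

theorem sum_perm_apply (c : Fin b) (H : Fin b → ℝ) :
    (b : ℝ) * ∑ σ : Equiv.Perm (Fin b), H (σ c) = b.factorial * ∑ d, H d := by
  have h (c' : Fin b) : ∑ σ : Equiv.Perm (Fin b), H (σ c') = ∑ σ : Equiv.Perm (Fin b), H (σ c) := by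
    rw [← Equiv.sum_comp (Equiv.mulRight (Equiv.swap c c'))]
    refine Finset.sum_congr rfl fun σ _ => ?_
    simp
  calc (b : ℝ) * ∑ σ : Equiv.Perm (Fin b), H (σ c)
      = ∑ c' : Fin b, ∑ σ : Equiv.Perm (Fin b), H (σ c') := by simp [h]
    _ = ∑ σ : Equiv.Perm (Fin b), ∑ c', H (σ c') := Finset.sum_comm
    _ = _ := by
      simp_rw [Equiv.sum_comp _ H]
      simp [Fintype.card_perm]

theorem avg_perm_apply (c : Fin b) (H : Fin b → ℝ) :
    (b.factorial : ℝ)⁻¹ * ∑ σ : Equiv.Perm (Fin b), H (σ c) = (b : ℝ)⁻¹ * ∑ d, H d := by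
  have hb : (b : ℝ) ≠ 0 := by exact_mod_cast c.pos.ne'
  have hf : (b.factorial : ℝ) ≠ 0 := by exact_mod_cast b.factorial_ne_zero
  have := sum_perm_apply c H
  field_simp
  linarith

/-- For `c ≠ c'` the pair `(σ c, σ c')` is uniform over ordered pairs of distinct digits. The
symmetry in `c'` comes from composing with transpositions that fix `c`. -/
theorem avg_perm_apply_mul {c c' : Fin b} (hc : c ≠ c') (hb : 2 ≤ b) (H G : Fin b → ℝ) :
    (b.factorial : ℝ)⁻¹ * ∑ σ : Equiv.Perm (Fin b), H (σ c) * G (σ c')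
      = ((b : ℝ)⁻¹ * ((∑ d, H d) * ∑ d, G d) - (b : ℝ)⁻¹ * ∑ d, H d * G d) / (b - 1) := by
  have hb' : (b : ℝ) - 1 ≠ 0 := by
    have : (2 : ℝ) ≤ b := by exact_mod_cast hb
    linarith
  have h (c₂ : Fin b) (h2 : c₂ ≠ c) : ∑ σ : Equiv.Perm (Fin b), H (σ c) * G (σ c₂)
      = ∑ σ : Equiv.Perm (Fin b), H (σ c) * G (σ c') := by
    rw [← Equiv.sum_comp (Equiv.mulRight (Equiv.swap c' c₂))]
    refine Finset.sum_congr rfl fun σ _ => ?_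
    simp [Equiv.swap_apply_of_ne_of_ne hc h2.symm]
  have h1 : ((b : ℝ) - 1) * ∑ σ : Equiv.Perm (Fin b), H (σ c) * G (σ c')
      = ∑ σ : Equiv.Perm (Fin b), H (σ c) * (∑ d, G d - G (σ c)) := by
    calc ((b : ℝ) - 1) * ∑ σ : Equiv.Perm (Fin b), H (σ c) * G (σ c')
        = ∑ c₂ ∈ Finset.univ.erase c, ∑ σ : Equiv.Perm (Fin b), H (σ c) * G (σ c₂) := by
          rw [Finset.sum_congr rfl fun c₂ h2 => h c₂ (Finset.ne_of_mem_erase h2),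
            Finset.sum_const, Finset.card_erase_of_mem (Finset.mem_univ _), nsmul_eq_mul]
          simp [Nat.cast_sub (show 1 ≤ b by omega)]
      _ = ∑ σ : Equiv.Perm (Fin b), H (σ c) * ∑ c₂ ∈ Finset.univ.erase c, G (σ c₂) := by
          rw [Finset.sum_comm]
          exact Finset.sum_congr rfl fun σ _ => by rw [Finset.mul_sum]
      _ = _ := by
          refine Finset.sum_congr rfl fun σ _ => ?_
          rw [← Equiv.sum_comp σ G, ← Finset.sum_erase_eq_sub (Finset.mem_univ c)]
  rw [eq_div_iff hb', mul_assoc, mul_comm _ ((b : ℝ) - 1), h1,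
    avg_perm_apply c (fun d => H d * (∑ d, G d - G d)), ← mul_sub]
  congr 1
  simp only [mul_sub, Finset.sum_sub_distrib, ← Finset.sum_mul]

/-! ### Uniformity and second moments of scrambled points -/

namespace IsCoordScrambling

variable {Ω : Type*} [MeasurableSpace Ω] {P : Measure Ω} [IsProbabilityMeasure P]

theorem integral_step {perm : List (Fin b) → Ω → Equiv.Perm (Fin b)}
    (hS : IsCoordScrambling P perm) (a : ℕ → Fin b) {h : ℝ → ℝ} (hh : BddMeas h) :
    ∫ o, h (scramblePoint a fun l => perm l o) ∂P = (b : ℝ)⁻¹ * ∑ d : Fin b,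
      ∫ o, subFun b d h (scramblePoint (fun k => a (k + 1)) fun l => perm (a 0 :: l) o) ∂P := by
  have h1 := (hS.cons (a 0)).measurable_family
  have h2 : ∫ o, subFun b (perm [] o (a 0)) h
      (scramblePoint (fun k => a (k + 1)) fun l => perm (a 0 :: l) o) ∂P = _ :=
    hS.integral_root h1 (hS.indepFun_root (fun l => a 0 :: l) (by simp))
    (F := fun σ π => subFun b (σ (a 0)) h (scramblePoint (fun k => a (k + 1)) π))
    (fun σ => (hh.subFun _).1.comp (measurable_scramblePoint _))
    (fun σ => (hS.cons (a 0)).integrable_comp _ (hh.subFun _))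
  rw [avg_perm_apply (a 0) (fun d => ∫ o, subFun b d h
    (scramblePoint (fun k => a (k + 1)) fun l => perm (a 0 :: l) o) ∂P)] at h2
  rw [← h2]
  refine integral_congr_ae (ae_of_all _ fun o => ?_)
  simp only [subFun]
  rw [scramblePoint_eq]

/-- A uniform digit splits both integrals into the same `b` pieces. After `k` digits each piece
lives on an interval of length `b^(-k)`, where `h` oscillates by at most `ε`. -/
theorem abs_integral_sub_le (k : ℕ) : ∀ {perm : List (Fin b) → Ω → Equiv.Perm (Fin b)},
    IsCoordScrambling P perm → ∀ (a : ℕ → Fin b) {h : ℝ → ℝ} {ε : ℝ}, BddMeas h →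
    (∀ x ∈ Set.Icc (0 : ℝ) 1, ∀ y ∈ Set.Icc (0 : ℝ) 1, |x - y| ≤ ((b : ℝ) ^ k)⁻¹ →
      |h x - h y| ≤ ε) →
    |∫ o, h (scramblePoint a fun l => perm l o) ∂P - ∫ u, h u ∂unif| ≤ ε := by
  induction k with
  | zero =>
    intro perm hS a h ε hh hε
    have hε' (x : ℝ) (hx : x ∈ Set.Icc (0 : ℝ) 1) (y : ℝ) (hy : y ∈ Set.Icc (0 : ℝ) 1) :
        |h x - h y| ≤ ε := by
      refine hε x hx y hy ?_
      rw [pow_zero, inv_one, abs_le]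
      constructor <;> linarith [hx.1, hx.2, hy.1, hy.2]
    have hmean (x : ℝ) (hx : x ∈ Set.Icc (0 : ℝ) 1) : |h x - ∫ v, h v ∂unif| ≤ ε := by
      have : h x - ∫ v, h v ∂unif = ∫ v, (h x - h v) ∂unif := by
        rw [integral_sub (integrable_const _) hh.integrable]; simp
      rw [this]
      have := norm_integral_le_of_norm_le_const (μ := unif) (f := fun v => h x - h v) (C := ε)
        (BddMeas.ae_mem.mono fun v hv => hε' x hx v hv)
      simpa using this
    have e : ∫ o, h (scramblePoint a fun l => perm l o) ∂P - ∫ u, h u ∂unif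
        = ∫ o, (h (scramblePoint a fun l => perm l o) - ∫ u, h u ∂unif) ∂P := by
      rw [integral_sub (hS.integrable_comp a hh) (integrable_const _)]; simp
    rw [e]
    have := norm_integral_le_of_norm_le_const (μ := P) (C := ε)
      (f := fun o => h (scramblePoint a fun l => perm l o) - ∫ u, h u ∂unif)
      (ae_of_all _ fun o => hmean _ (scramblePoint_mem _ _))
    simpa using this
  | succ k ih =>
    intro perm hS a h ε hh hε
    have hb : 0 < b := (a 0).pos
    have hb0 : (0 : ℝ) < b := by exact_mod_cast hb
    rw [hS.integral_step a hh, integral_eq_sum_subFun hb hh, ← mul_sub, ← Finset.sum_sub_distrib,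
      abs_mul, abs_of_nonneg (by positivity : (0 : ℝ) ≤ (b : ℝ)⁻¹), inv_mul_le_iff₀ hb0]
    refine (Finset.abs_sum_le_sum_abs _ _).trans ((Finset.sum_le_sum (g := fun _ => ε)
      fun d _ => ?_).trans (by simp))
    refine ih (hS.cons (a 0)) _ (hh.subFun d) fun x hx y hy hxy => ?_
    refine hε _ (subFun_mem d hx) _ (subFun_mem d hy) ?_
    rw [← sub_div, add_sub_add_left_eq_sub, abs_div, abs_of_pos hb0, div_le_iff₀ hb0, pow_succ,
      mul_inv, mul_assoc, inv_mul_cancel₀ hb0.ne', mul_one]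
    exact hxy

/-- Bounded continuous functions determine the law, and by uniform continuity `abs_integral_sub_le`
applies with every positive `ε`. -/
theorem map_scramblePoint (hb : 2 ≤ b) {perm : List (Fin b) → Ω → Equiv.Perm (Fin b)}
    (hS : IsCoordScrambling P perm) (a : ℕ → Fin b) :
    P.map (fun o => scramblePoint a fun l => perm l o) = unif := by
  have hm := hS.measurable_point a
  have : IsProbabilityMeasure (P.map fun o => scramblePoint a fun l => perm l o) :=
    Measure.isProbabilityMeasure_map hm.aemeasurable
  refine ext_of_forall_integral_eq_of_IsFiniteMeasure fun f => ?_
  rw [integral_map hm.aemeasurable f.continuous.measurable.aestronglyMeasurable]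
  refine eq_of_abs_sub_le_all fun ε hε => ?_
  have hf : BddMeas f := ⟨f.continuous.measurable, ‖f‖, fun u _ => f.norm_coe_le_norm u⟩
  have huc := (isCompact_Icc (a := (0 : ℝ)) (b := 1)).uniformContinuousOn_of_continuous
    f.continuous.continuousOn
  obtain ⟨δ, hδ, h⟩ := Metric.uniformContinuousOn_iff.1 huc ε hε
  have hb1 : (1 : ℝ) < b := by exact_mod_cast (by omega : 1 < b)
  obtain ⟨k, hk⟩ := exists_pow_lt_of_lt_one hδ (inv_lt_one_of_one_lt₀ hb1)
  refine hS.abs_integral_sub_le k a hf fun x hx y hy hxy => ?_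
  rw [← inv_pow] at hxy
  exact (h x hx y hy (hxy.trans_lt hk)).le

theorem integral_comp (hb : 2 ≤ b) {perm : List (Fin b) → Ω → Equiv.Perm (Fin b)}
    (hS : IsCoordScrambling P perm) (a : ℕ → Fin b) {h : ℝ → ℝ} (hh : Measurable h) :
    ∫ o, h (scramblePoint a fun l => perm l o) ∂P = ∫ u, h u ∂unif := by
  rw [← hS.map_scramblePoint hb a,
    integral_map (hS.measurable_point a).aemeasurable hh.aestronglyMeasurable]

theorem integral_mul_step {perm : List (Fin b) → Ω → Equiv.Perm (Fin b)}
    (hS : IsCoordScrambling P perm) {a a' : ℕ → Fin b} (ha : a 0 = a' 0) {h g : ℝ → ℝ}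
    (hh : BddMeas h) (hg : BddMeas g) :
    ∫ o, h (scramblePoint a fun l => perm l o) * g (scramblePoint a' fun l => perm l o) ∂P
      = (b : ℝ)⁻¹ * ∑ d : Fin b,
      ∫ o, subFun b d h (scramblePoint (fun k => a (k + 1)) fun l => perm (a 0 :: l) o) *
        subFun b d g (scramblePoint (fun k => a' (k + 1)) fun l => perm (a 0 :: l) o) ∂P := by
  have h1 := (hS.cons (a 0)).measurable_family
  have h2 : ∫ o, subFun b (perm [] o (a 0)) h
      (scramblePoint (fun k => a (k + 1)) fun l => perm (a 0 :: l) o) *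
      subFun b (perm [] o (a 0)) g
      (scramblePoint (fun k => a' (k + 1)) fun l => perm (a 0 :: l) o) ∂P = _ :=
    hS.integral_root h1 (hS.indepFun_root (fun l => a 0 :: l) (by simp))
    (F := fun σ π => subFun b (σ (a 0)) h (scramblePoint (fun k => a (k + 1)) π) *
      subFun b (σ (a 0)) g (scramblePoint (fun k => a' (k + 1)) π))
    (fun σ => ((hh.subFun _).1.comp (measurable_scramblePoint _)).mul
      ((hg.subFun _).1.comp (measurable_scramblePoint _)))
    (fun σ => (hS.cons (a 0)).integrable_mul _ _ (hh.subFun _) (hg.subFun _))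
  rw [avg_perm_apply (a 0) (fun d => ∫ o, subFun b d h
    (scramblePoint (fun k => a (k + 1)) fun l => perm (a 0 :: l) o) * subFun b d g
    (scramblePoint (fun k => a' (k + 1)) fun l => perm (a 0 :: l) o) ∂P)] at h2
  rw [← h2]
  refine integral_congr_ae (ae_of_all _ fun o => ?_)
  simp only [subFun]
  rw [scramblePoint_eq, scramblePoint_eq a', ← ha]

/-- The mixed moment of two scrambled points whose digits agree up to position `r` exactly. -/
theorem integral_mul_of_ne (hb : 2 ≤ b) (r : ℕ) :
    ∀ {perm : List (Fin b) → Ω → Equiv.Perm (Fin b)}, IsCoordScrambling P perm →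
    ∀ {a a' : ℕ → Fin b}, (∀ k < r, a k = a' k) → a r ≠ a' r → ∀ {h g : ℝ → ℝ}, BddMeas h →
    BddMeas g →
    ∫ o, h (scramblePoint a fun l => perm l o) * g (scramblePoint a' fun l => perm l o) ∂P
      = (b * haarInner b r h g - haarInner b (r + 1) h g) / (b - 1) := by
  have hb0 : (b : ℝ) ≠ 0 := by positivity
  induction r with
  | zero =>
    intro perm hS a a' _ hne h g hh hg
    have hm1 := (hS.cons (a 0)).measurable_family
    have hm2 := (hS.cons (a' 0)).measurable_family
    have hind := (hS.indepFun_root (κ := List (Fin b) ⊕ List (Fin b))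
      (Sum.elim (fun l => a 0 :: l) (fun l => a' 0 :: l)) (by rintro (l | l) <;> simp)).comp
      (φ := id) (ψ := fun π : List (Fin b) ⊕ List (Fin b) → Equiv.Perm (Fin b) =>
        ((fun l => π (Sum.inl l)), fun l => π (Sum.inr l))) measurable_id
        (Measurable.prodMk (measurable_pi_lambda _ fun l => measurable_pi_apply (Sum.inl l))
          (measurable_pi_lambda _ fun l => measurable_pi_apply (Sum.inr l)))
    -- Different first digits lead to disjoint subtrees of permutations, so the two remainders are
    -- independent; each is uniform. Only the average over the root permutation is left.
    have hind2 : IndepFun (fun o l => perm (a 0 :: l) o) (fun o l => perm (a' 0 :: l) o) P :=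
      hS.indep.indepFun_of_disjoint hS.measurable (by simp [hne])
    have hms (σ : Equiv.Perm (Fin b)) :=
      (hh.subFun (σ (a 0))).1.comp (measurable_scramblePoint fun k => a (k + 1))
    have hms' (σ : Equiv.Perm (Fin b)) :=
      (hg.subFun (σ (a' 0))).1.comp (measurable_scramblePoint fun k => a' (k + 1))
    have hprod (σ : Equiv.Perm (Fin b)) : ∫ o, subFun b (σ (a 0)) h (scramblePoint (fun k => a (k + 1))
        fun l => perm (a 0 :: l) o) * subFun b (σ (a' 0)) g (scramblePoint (fun k => a' (k + 1))
        fun l => perm (a' 0 :: l) o) ∂P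
        = (∫ u, subFun b (σ (a 0)) h u ∂unif) * ∫ u, subFun b (σ (a' 0)) g u ∂unif := by
      rw [← (hS.cons (a 0)).integral_comp hb (fun k => a (k + 1)) (hh.subFun _).1,
        ← (hS.cons (a' 0)).integral_comp hb (fun k => a' (k + 1)) (hg.subFun _).1]
      exact (hind2.comp (hms σ) (hms' σ)).integral_fun_mul_eq_mul_integral
        ((hms σ).comp hm1).aestronglyMeasurable ((hms' σ).comp hm2).aestronglyMeasurable
    have h2 : ∫ o, subFun b (perm [] o (a 0)) h
        (scramblePoint (fun k => a (k + 1)) fun l => perm (a 0 :: l) o) *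
        subFun b (perm [] o (a' 0)) g
        (scramblePoint (fun k => a' (k + 1)) fun l => perm (a' 0 :: l) o) ∂P = _ :=
      hS.integral_root (hm1.prodMk hm2) hind
      (F := fun σ π => subFun b (σ (a 0)) h (scramblePoint (fun k => a (k + 1)) π.1) *
        subFun b (σ (a' 0)) g (scramblePoint (fun k => a' (k + 1)) π.2))
      (fun σ => ((hms σ).comp measurable_fst).mul ((hms' σ).comp measurable_snd))
      (fun σ => by
        obtain ⟨M, hM⟩ := (hg.subFun (σ (a' 0))).2
        exact ((hS.cons (a 0)).integrable_comp _ (hh.subFun _)).mul_bdd (c := M)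
          ((hms' σ).comp hm2).aestronglyMeasurable
          (ae_of_all _ fun o => hM _ (scramblePoint_mem _ _)))
    simp only [hprod] at h2
    rw [avg_perm_apply_mul hne hb (fun d => ∫ u, subFun b d h u ∂unif)
      (fun d => ∫ u, subFun b d g u ∂unif)] at h2
    have h3 : ∫ o, h (scramblePoint a fun l => perm l o) * g (scramblePoint a' fun l => perm l o) ∂P
        = _ := Eq.trans (by
          refine integral_congr_ae (ae_of_all _ fun o => ?_)
          simp only [subFun]
          rw [scramblePoint_eq, scramblePoint_eq a']) h2
    rw [h3]
    simp only [haarInner]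
    rw [integral_eq_sum_subFun (b := b) (by omega) hh, integral_eq_sum_subFun (b := b) (by omega) hg]
    congr 2
    field_simp
  | succ r ih =>
    intro perm hS a a' ha hne h g hh hg
    have ha0 := ha 0 (Nat.succ_pos r)
    rw [hS.integral_mul_step ha0 hh hg]
    have (d : Fin b) := ih (hS.cons (a 0)) (a := fun k => a (k + 1)) (a' := fun k => a' (k + 1))
      (fun k hk => ha (k + 1) (by omega)) hne (hh.subFun d) (hg.subFun d)
    simp only [this]
    rw [← Finset.sum_div, Finset.sum_sub_distrib, ← Finset.mul_sum, haarInner, haarInner]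
    ring

/-- The mixed moment of two scrambled points whose first `m` digits agree. -/
theorem abs_integral_mul_sub_le (hb : 2 ≤ b) (m : ℕ) :
    ∀ {perm : List (Fin b) → Ω → Equiv.Perm (Fin b)}, IsCoordScrambling P perm →
    ∀ {a a' : ℕ → Fin b}, (∀ k < m, a k = a' k) → ∀ {h g : ℝ → ℝ}, BddMeas h → BddMeas g →
    |∫ o, h (scramblePoint a fun l => perm l o) * g (scramblePoint a' fun l => perm l o) ∂P
      - haarInner b m h g| ≤ √(haarDist b m h) * √(haarDist b m g) := by
  have hb0 : 0 < b := by omega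
  induction m with
  | zero =>
    intro perm hS a a' _ h g hh hg
    set m₁ := ∫ u, h u ∂unif with hm1
    set m₂ := ∫ u, g u ∂unif with hm2
    have e : ∫ o, h (scramblePoint a fun l => perm l o) * g (scramblePoint a' fun l => perm l o) ∂P
        - haarInner b 0 h g = ∫ o, (h (scramblePoint a fun l => perm l o) - m₁) *
          (g (scramblePoint a' fun l => perm l o) - m₂) ∂P := by
      have : (fun o => (h (scramblePoint a fun l => perm l o) - m₁) *
          (g (scramblePoint a' fun l => perm l o) - m₂))
          = fun o => h (scramblePoint a fun l => perm l o) * g (scramblePoint a' fun l => perm l o)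
            - m₁ * (g (scramblePoint a' fun l => perm l o) - m₂)
            - m₂ * h (scramblePoint a fun l => perm l o) := by ext o; ring
      have hi := hS.integrable_mul a a' hh hg
      have hi1 := (hS.integrable_comp a' (hg.sub_const m₂)).const_mul m₁
      have hi2 : Integrable (fun o => h (scramblePoint a fun l => perm l o) *
        g (scramblePoint a' fun l => perm l o) -
        m₁ * (g (scramblePoint a' fun l => perm l o) - m₂)) P := hi.sub hi1
      rw [this, integral_sub hi2 ((hS.integrable_comp a hh).const_mul m₂),
        integral_sub hi hi1, integral_const_mul, integral_const_mul,
        hS.integral_comp hb a' (hg.sub_const m₂).1, hS.integral_comp hb a hh.1,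
        integral_sub hg.integrable (integrable_const _), haarInner]
      simp [← hm1, ← hm2]
      ring
    -- No information on the joint law is available here, only the uniform marginals; Cauchy–Schwarz
    -- for the centred functions suffices.
    rw [e, haarDist, haarDist, ← hS.integral_comp hb a (hh.sub_const _).sq.1,
      ← hS.integral_comp hb a' (hg.sub_const _).sq.1]
    exact abs_integral_mul_le (hS.integrable_comp a (hh.sub_const _).sq)
      (hS.integrable_comp a' (hg.sub_const _).sq)
      (hS.integrable_mul a a' (hh.sub_const _) (hg.sub_const _))
  | succ m ih =>
    intro perm hS a a' ha h g hh hg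
    rw [hS.integral_mul_step (ha 0 (Nat.succ_pos m)) hh hg, haarInner, ← mul_sub,
      ← Finset.sum_sub_distrib, abs_mul, abs_of_nonneg (by positivity : (0 : ℝ) ≤ (b : ℝ)⁻¹)]
    calc _ ≤ (b : ℝ)⁻¹ * ∑ d : Fin b, √(haarDist b m (subFun b d h)) * √(haarDist b m (subFun b d g)) :=
          mul_le_mul_of_nonneg_left ((Finset.abs_sum_le_sum_abs _ _).trans
            (Finset.sum_le_sum fun d _ => ih (hS.cons (a 0)) (fun k hk => ha (k + 1) (by omega))
              (hh.subFun d) (hg.subFun d))) (by positivity)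
      _ ≤ _ := avg_sqrt_mul_sqrt_le hb0 (fun d => haarDist_nonneg _ _) fun d => haarDist_nonneg _ _

end IsCoordScrambling

end BDIS

namespace BDIS

/-! ### Counting points of a net in boxes -/

theorem floor_pow_succ_div {b : ℕ} (hb : 0 < b) (k : ℕ) (x : ℝ) :
    ⌊(b : ℝ) ^ (k + 1) * x⌋₊ / b = ⌊(b : ℝ) ^ k * x⌋₊ := by
  rw [pow_succ', mul_assoc]
  exact Nat.cast_mul_floor_div_cancel (a := (b : ℝ) ^ k * x) hb.ne'

theorem floor_pow_lt {b : ℕ} (hb : 0 < b) (k : ℕ) {x : ℝ} (hx : x ∈ Set.Ico (0 : ℝ) 1) :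
    ⌊(b : ℝ) ^ k * x⌋₊ < b ^ k := by
  have h : (0 : ℝ) < (b : ℝ) ^ k := by positivity
  rw [Nat.floor_lt (mul_nonneg h.le hx.1)]
  push_cast
  nlinarith [hx.2]

theorem mem_box_iff {b : ℕ} (hb : 0 < b) (k a : ℕ) {x : ℝ} (hx : 0 ≤ x) :
    ((a : ℝ) / b ^ k ≤ x ∧ x < ((a : ℝ) + 1) / b ^ k) ↔ ⌊(b : ℝ) ^ k * x⌋₊ = a := by
  have h : (0 : ℝ) < (b : ℝ) ^ k := by positivity
  rw [Nat.floor_eq_iff (by positivity), div_le_iff₀ h, lt_div_iff₀ h, mul_comm x]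

/-- The number of points in an elementary interval. -/
noncomputable def boxCount (b : ℕ) {N : ℕ} {ι : Type} [Fintype ι] (x : Fin N → ι → ℝ)
    (k a : ι → ℕ) : ℕ :=
  (Finset.univ.filter fun i => ∀ j, ⌊(b : ℝ) ^ k j * x i j⌋₊ = a j).card

namespace IsNet

variable {b t m : ℕ} {ι : Type} [Fintype ι] {x : Fin (b ^ m) → ι → ℝ} (hx : IsNet b t m x)
  (hb : 0 < b)
include hx hb

theorem boxCount_eq_pow {k a : ι → ℕ} (hk : ∑ j, k j + t = m) (ha : ∀ j, a j < b ^ k j) :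
    boxCount b x k a = b ^ t := by
  rw [← hx.2.2 k a hk ha, Nat.card_eq_fintype_card, Fintype.card_subtype, boxCount]
  congr 1
  ext i
  simp only [Finset.mem_filter, Finset.mem_univ, true_and]
  exact forall_congr' fun j => (mem_box_iff hb _ _ (hx.2.1 i j).1).symm

/-- A box is the disjoint union of `b` boxes that are one digit finer in a chosen coordinate; induct
on the excess volume. -/
theorem boxCount_eq [Nonempty ι] (r : ℕ) : ∀ {k a : ι → ℕ}, ∑ j, k j + t + r = m →
    (∀ j, a j < b ^ k j) → boxCount b x k a = b ^ (t + r) := by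
  classical
  induction r with
  | zero => exact fun hk ha => hx.boxCount_eq_pow hb hk ha
  | succ r ih =>
    intro k a hk ha
    obtain ⟨j₀⟩ := ‹Nonempty ι›
    set k' := Function.update k j₀ (k j₀ + 1) with hk'
    have hsum : ∑ j, k' j = ∑ j, k j + 1 := by
      rw [hk', Finset.sum_update_of_mem (Finset.mem_univ _), ← Finset.sum_sdiff
        (Finset.subset_univ {j₀}), Finset.sum_singleton]
      ring
    have key : boxCount b x k a
        = ∑ d : Fin b, boxCount b x k' (Function.update a j₀ (b * a j₀ + d)) := by
      simp only [boxCount]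
      rw [← Finset.card_biUnion]
      · congr 1
        ext i
        simp only [Finset.mem_filter, Finset.mem_univ, true_and, Finset.mem_biUnion]
        constructor
        · intro h
          refine ⟨⟨⌊(b : ℝ) ^ (k j₀ + 1) * x i j₀⌋₊ % b, Nat.mod_lt _ hb⟩, fun j => ?_⟩
          by_cases hj : j = j₀
          · subst hj
            simp only [hk', Function.update_self]
            rw [← h j, ← floor_pow_succ_div hb (k j), Nat.div_add_mod]
          · simp only [hk', Function.update_of_ne hj]
            exact h j
        · rintro ⟨d, h⟩ j
          by_cases hj : j = j₀
          · subst hj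
            have := h j
            simp only [hk', Function.update_self] at this
            rw [← floor_pow_succ_div hb, this, Nat.mul_add_div hb, Nat.div_eq_of_lt d.isLt, add_zero]
          · have := h j
            simpa only [hk', Function.update_of_ne hj] using this
      · intro d _ d' _ hdd
        refine Finset.disjoint_left.2 fun i h h' => hdd ?_
        simp only [Finset.mem_filter, Finset.mem_univ, true_and] at h h'
        have := (h j₀).symm.trans (h' j₀)
        simp only [Function.update_self] at this
        exact Fin.ext (by omega)
    have hd (d : Fin b) : boxCount b x k' (Function.update a j₀ (b * a j₀ + d)) = b ^ (t + r) := by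
      refine ih (by omega) fun j => ?_
      by_cases hj : j = j₀
      · subst hj
        simp only [hk', Function.update_self]
        have h1 := ha j
        have h2 := d.isLt
        calc b * a j + d < b * a j + b := by omega
          _ = b * (a j + 1) := by ring
          _ ≤ b * b ^ k j := Nat.mul_le_mul_left _ h1
          _ = b ^ (k j + 1) := by ring
      · simp only [hk', Function.update_of_ne hj]
        exact ha j
    rw [key]
    simp only [hd, Finset.sum_const, Finset.card_univ, Fintype.card_fin, smul_eq_mul]
    ring

/-- Dropping one digit encloses the box in a larger one; repeat until the net property applies. -/
theorem boxCount_le (r : ℕ) : ∀ {k a : ι → ℕ}, ∑ j, k j + t = m + r → (∀ j, a j < b ^ k j) →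
    boxCount b x k a ≤ b ^ t := by
  classical
  induction r with
  | zero => exact fun hk ha => (hx.boxCount_eq_pow hb hk ha).le
  | succ r ih =>
    intro k a hk ha
    have htm := hx.1
    obtain ⟨j₀, -, hj₀⟩ := Finset.exists_ne_zero_of_sum_ne_zero
      (s := Finset.univ) (f := k) (by omega)
    obtain ⟨n, hn⟩ := Nat.exists_eq_succ_of_ne_zero hj₀
    set k' := Function.update k j₀ n with hk'
    have hsum : ∑ j, k' j + 1 = ∑ j, k j := by
      rw [hk', Finset.sum_update_of_mem (Finset.mem_univ _), ← Finset.sum_sdiff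
        (Finset.subset_univ {j₀}) (f := k), Finset.sum_singleton, hn]
      omega
    refine le_trans (Finset.card_le_card fun i hi => ?_)
      (ih (k := k') (a := Function.update a j₀ (a j₀ / b)) (by omega) fun j => ?_)
    · simp only [Finset.mem_filter, Finset.mem_univ, true_and] at hi ⊢
      intro j
      by_cases hj : j = j₀
      · subst hj
        simp only [hk', Function.update_self]
        rw [← hi j, hn, floor_pow_succ_div hb]
      · simp only [hk', Function.update_of_ne hj]
        exact hi j
    · by_cases hj : j = j₀
      · subst hj
        simp only [hk', Function.update_self]
        have := ha j
        rw [hn, Nat.succ_eq_add_one, pow_succ] at this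
        exact Nat.div_lt_of_lt_mul (by linarith)
      · simp only [hk', Function.update_of_ne hj]
        exact ha j

end IsNet

/-! ### Pairs of points with common leading digits -/

/-- The first `k` digits of `x` and `y` agree. -/
def Agree (b : ℕ) [NeZero b] (k : ℕ) (x y : ℝ) : Prop :=
  ∀ r < k, Real.digits x b r = Real.digits y b r

/-- The leading `k` digits are those of the integer `⌊b^k x⌋`, and dropping its last digit is
division by `b`. Having no integer part is needed already for `k = 0`. -/
theorem agree_iff {b : ℕ} [NeZero b] (k : ℕ) {x y : ℝ} (hx : x ∈ Set.Ico (0 : ℝ) 1)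
    (hy : y ∈ Set.Ico (0 : ℝ) 1) :
    Agree b k x y ↔ ⌊(b : ℝ) ^ k * x⌋₊ = ⌊(b : ℝ) ^ k * y⌋₊ := by
  have hb := NeZero.pos b
  induction k with
  | zero => simp [Agree, Nat.floor_eq_zero.2 hx.2, Nat.floor_eq_zero.2 hy.2]
  | succ k ih =>
    have h1 : Agree b (k + 1) x y ↔ Agree b k x y ∧ Real.digits x b k = Real.digits y b k := by
      refine ⟨fun h => ⟨fun r hr => h r (by omega), h k (by omega)⟩, fun h r hr => ?_⟩
      rcases Nat.lt_succ_iff_lt_or_eq.1 hr with h' | h'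
      · exact h.1 r h'
      · rw [h']; exact h.2
    have h2 : Real.digits x b k = Real.digits y b k ↔
        ⌊(b : ℝ) ^ (k + 1) * x⌋₊ % b = ⌊(b : ℝ) ^ (k + 1) * y⌋₊ % b := by
      simp only [Real.digits, Fin.ext_iff, Fin.val_ofNat, mul_comm x, mul_comm y]
    refine h1.trans ((and_congr ih h2).trans ?_)
    rw [← floor_pow_succ_div hb k x, ← floor_pow_succ_div hb k y]
    refine ⟨fun h => ?_, fun h => by rw [h]; exact ⟨rfl, rfl⟩⟩
    rw [← Nat.div_add_mod ⌊(b : ℝ) ^ (k + 1) * x⌋₊ b, h.1, h.2, Nat.div_add_mod]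

open Classical in
/-- The indicator of common leading digits. -/
noncomputable def agreeInd (b : ℕ) [NeZero b] (k : ℕ) (x y : ℝ) : ℝ := if Agree b k x y then 1 else 0

theorem agreeInd_nonneg (b : ℕ) [NeZero b] (k : ℕ) (x y : ℝ) : 0 ≤ agreeInd b k x y := by
  unfold agreeInd; split_ifs <;> norm_num

section pairs

variable {b t m : ℕ} [NeZero b] {ι : Type} [Fintype ι] {x : Fin (b ^ m) → ι → ℝ}

/-- Points sharing the prescribed leading digits with `x i` are the points in the elementary box
around it. -/
theorem sum_prod_agreeInd (hx : IsNet b t m x) (k : ι → ℕ) (i : Fin (b ^ m)) :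
    ∑ i', ∏ j, agreeInd b (k j) (x i' j) (x i j)
      = boxCount b x k fun j => ⌊(b : ℝ) ^ k j * x i j⌋₊ := by
  classical
  rw [boxCount, Finset.card_filter, Nat.cast_sum]
  refine Finset.sum_congr rfl fun i' _ => ?_
  have h (j : ι) := agree_iff (b := b) (k j) (hx.2.1 i' j) (hx.2.1 i j)
  by_cases hall : ∀ j, ⌊(b : ℝ) ^ k j * x i' j⌋₊ = ⌊(b : ℝ) ^ k j * x i j⌋₊
  · rw [if_pos hall, Nat.cast_one]
    exact Finset.prod_eq_one fun j _ => if_pos ((h j).2 (hall j))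
  · rw [if_neg hall, Nat.cast_zero]
    push Not at hall
    obtain ⟨j, hj⟩ := hall
    exact Finset.prod_eq_zero (Finset.mem_univ j) (if_neg fun h' => hj ((h j).1 h'))

theorem sum_sum_prod_agreeInd [Nonempty ι] (hx : IsNet b t m x) (k : ι → ℕ)
    (hk : ∑ j, k j + t ≤ m) :
    ∑ i, ∑ i', ∏ j, agreeInd b (k j) (x i' j) (x i j)
      = (b : ℝ) ^ m * (b : ℝ) ^ m * ∏ j, ((b : ℝ) ^ k j)⁻¹ := by
  have hb := NeZero.pos b
  have hb0 : (b : ℝ) ≠ 0 := by exact_mod_cast hb.ne'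
  obtain ⟨r, hr⟩ := Nat.exists_eq_add_of_le hk
  have h (i : Fin (b ^ m)) := hx.boxCount_eq hb r hr.symm
    fun j => floor_pow_lt hb (k j) (hx.2.1 i j)
  simp only [sum_prod_agreeInd hx, h]
  rw [Finset.prod_inv_distrib, Finset.prod_pow_eq_pow_sum]
  have : (b : ℝ) ^ m = (b : ℝ) ^ (t + r) * (b : ℝ) ^ (∑ j, k j) := by
    rw [← pow_add]; congr 1; omega
  simp only [Finset.sum_const, Finset.card_univ, Fintype.card_fin, nsmul_eq_mul]
  push_cast
  rw [mul_assoc]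
  congr 1
  rw [this, mul_assoc, mul_inv_cancel₀ (by positivity), mul_one]

/-- Whether the box is coarser or finer than those of the net property, it contains at most
`b^(t+c)` points. -/
theorem sum_sum_prod_agreeInd_le [Nonempty ι] (hx : IsNet b t m x) (k : ι → ℕ) (c : ℕ)
    (hk : m ≤ ∑ j, k j + t + c) :
    ∑ i, ∑ i', ∏ j, agreeInd b (k j) (x i' j) (x i j) ≤ (b : ℝ) ^ m * (b : ℝ) ^ (t + c) := by
  have hb := NeZero.pos b
  have hb1 : 1 ≤ b := hb
  have h (i : Fin (b ^ m)) :
      boxCount b x k (fun j => ⌊(b : ℝ) ^ k j * x i j⌋₊) ≤ b ^ (t + c) := by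
    have hfl := fun j => floor_pow_lt hb (k j) (hx.2.1 i j)
    rcases le_total (∑ j, k j + t) m with h | h
    · obtain ⟨r, hr⟩ := Nat.exists_eq_add_of_le h
      rw [hx.boxCount_eq hb r hr.symm hfl]
      exact Nat.pow_le_pow_right hb (by omega)
    · obtain ⟨r, hr⟩ := Nat.exists_eq_add_of_le h
      exact (hx.boxCount_le hb r hr hfl).trans (Nat.pow_le_pow_right hb (by omega))
  simp only [sum_prod_agreeInd hx]
  calc ∑ i : Fin (b ^ m), (boxCount b x k (fun j => ⌊(b : ℝ) ^ k j * x i j⌋₊) : ℝ)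
      ≤ ∑ _i : Fin (b ^ m), (b : ℝ) ^ (t + c) :=
        Finset.sum_le_sum fun i _ => by exact_mod_cast h i
    _ = _ := by simp

/-- The coefficient of a pair of points in the Haar expansion of a scrambled pair. -/
noncomputable def pairCoef (b : ℕ) [NeZero b] (k : ℕ) (x y : ℝ) : ℝ :=
  (b * agreeInd b (k + 1) x y - agreeInd b k x y) / (b - 1)

theorem agreeInd_succ_le (b : ℕ) [NeZero b] (k : ℕ) (x y : ℝ) :
    agreeInd b (k + 1) x y ≤ agreeInd b k x y := by
  unfold agreeInd
  split_ifs with h h'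
  · exact le_rfl
  · exact absurd (fun r hr => h r (by omega)) h'
  · exact zero_le_one
  · exact le_rfl

theorem abs_pairCoef_le (hb : 2 ≤ b) (k : ℕ) (x y : ℝ) : |pairCoef b k x y| ≤ agreeInd b k x y := by
  have hb' : (1 : ℝ) ≤ b - 1 := by
    have : (2 : ℝ) ≤ b := by exact_mod_cast hb
    linarith
  have h1 := agreeInd_succ_le b k x y
  have h0 := agreeInd_nonneg b (k + 1) x y
  rw [pairCoef, abs_div, abs_of_pos (by linarith : (0 : ℝ) < b - 1), div_le_iff₀ (by linarith), abs_le]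
  constructor <;> nlinarith

/-- Low-frequency terms cancel exactly over a net. -/
theorem sum_sum_prod_pairCoef [Nonempty ι] (hx : IsNet b t m x) (k : ι → ℕ)
    (hk : ∑ j, (k j + 1) + t ≤ m) :
    ∑ i, ∑ i', ∏ j, pairCoef b (k j) (x i' j) (x i j) = 0 := by
  classical
  have hb := NeZero.pos b
  have hb0 : (b : ℝ) ≠ 0 := by exact_mod_cast hb.ne'
  -- Expand according to the set `v` of coordinates taken at level `k j + 1`; each resulting product
  -- of indicators is counted exactly by the net property.
  have e (i i' : Fin (b ^ m)) : ∏ j, pairCoef b (k j) (x i' j) (x i j)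
      = (∏ _j : ι, ((b : ℝ) - 1)⁻¹) * ∑ v : Finset ι,
        (∏ j, if j ∈ v then (b : ℝ) else -1) *
          ∏ j, agreeInd b (if j ∈ v then k j + 1 else k j) (x i' j) (x i j) := by
    have (v : Finset ι) : (∏ j, if j ∈ v then (b : ℝ) else -1) *
          ∏ j, agreeInd b (if j ∈ v then k j + 1 else k j) (x i' j) (x i j)
        = ∏ j, if j ∈ v then b * agreeInd b (k j + 1) (x i' j) (x i j)
          else -agreeInd b (k j) (x i' j) (x i j) := by
      rw [← Finset.prod_mul_distrib]
      refine Finset.prod_congr rfl fun j _ => ?_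
      split_ifs <;> ring
    simp only [this]
    rw [← prod_add_eq_sum_ite, ← Finset.prod_mul_distrib]
    refine Finset.prod_congr rfl fun j _ => ?_
    rw [pairCoef]; ring
  simp only [e]
  simp only [← Finset.mul_sum]
  rw [mul_eq_zero]
  right
  have hswap : ∑ i, ∑ i', ∑ v : Finset ι, (∏ j, if j ∈ v then (b : ℝ) else -1) *
          ∏ j, agreeInd b (if j ∈ v then k j + 1 else k j) (x i' j) (x i j)
      = ∑ v : Finset ι, (∏ j, if j ∈ v then (b : ℝ) else -1) * ∑ i, ∑ i',
          ∏ j, agreeInd b (if j ∈ v then k j + 1 else k j) (x i' j) (x i j) := by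
    simp only [Finset.mul_sum]
    rw [Finset.sum_congr rfl fun i _ => Finset.sum_comm, Finset.sum_comm]
  rw [hswap]
  have hN (v : Finset ι) := sum_sum_prod_agreeInd hx (fun j => if j ∈ v then k j + 1 else k j)
    (le_trans (by gcongr with j; split_ifs <;> omega) hk)
  simp only [hN]
  have hfac (v : Finset ι) : (∏ j, if j ∈ v then (b : ℝ) else -1) *
      ((b : ℝ) ^ m * (b : ℝ) ^ m * ∏ j, ((b : ℝ) ^ (if j ∈ v then k j + 1 else k j))⁻¹)
      = (b : ℝ) ^ m * (b : ℝ) ^ m * ∏ j, if j ∈ v then b * ((b : ℝ) ^ (k j + 1))⁻¹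
        else -((b : ℝ) ^ k j)⁻¹ := by
    rw [mul_left_comm, ← Finset.prod_mul_distrib]
    congr 1
    refine Finset.prod_congr rfl fun j _ => ?_
    split_ifs <;> ring
  simp only [hfac]
  -- The counts have product form, so the sum over `v` folds back into a product with factors `b *
  -- b^(-(k+1)) - b^(-k) = 0`.
  rw [← Finset.mul_sum, ← prod_add_eq_sum_ite]
  obtain ⟨j₀⟩ := ‹Nonempty ι›
  rw [Finset.prod_eq_zero (Finset.mem_univ j₀), mul_zero]
  rw [pow_succ]
  field_simp
  ring

/-- Summing expansions over all pairs of points of a net. -/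
theorem abs_sum_sum_prod_le [Nonempty ι] (hb : 2 ≤ b) (hx : IsNet b t m x)
    (E : Fin (b ^ m) → Fin (b ^ m) → ι → ℝ) (T : Fin (b ^ m) → Fin (b ^ m) → ι → ℕ → ℝ)
    (D : ι → ℕ → ℝ) (c : ι → ℝ) {α : ℝ} (hα : 0 ≤ α) (hc : ∀ j, 0 ≤ c j)
    (hE : ∀ i i' j, E i i' j = ∑ k ∈ Finset.range (m + 1), T i i' j k)
    (hT : ∀ i i' j, ∀ k < m, T i i' j k = pairCoef b k (x i' j) (x i j) * D j k)
    (hle : ∀ i i' j, ∀ k ≤ m,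
      |T i i' j k| ≤ agreeInd b k (x i' j) (x i j) * (((b : ℝ) ^ k) ^ (-α) * c j)) :
    |∑ i, ∑ i', ∏ j, E i i' j| ≤ ((m : ℝ) + 1) ^ Fintype.card ι *
      ((b : ℝ) ^ m * (b : ℝ) ^ (t + Fintype.card ι) *
        ((b : ℝ) ^ (α * (t + Fintype.card ι)) * (b : ℝ) ^ (-α * m)) * ∏ j, c j) := by
  classical
  have hb0 : (0 : ℝ) < b := by exact_mod_cast (by omega : 0 < b)
  have hb1 : (1 : ℝ) ≤ b := by exact_mod_cast (by omega : 1 ≤ b)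
  set K := Fintype.piFinset fun _ : ι => Finset.range (m + 1) with hK
  have e : ∑ i, ∑ i', ∏ j, E i i' j = ∑ k ∈ K, ∑ i, ∑ i', ∏ j, T i i' j (k j) := by
    simp only [hE, Finset.prod_univ_sum]
    rw [Finset.sum_congr rfl fun i _ => Finset.sum_comm, Finset.sum_comm]
  have hcard : (K.card : ℝ) = ((m : ℝ) + 1) ^ Fintype.card ι := by
    rw [hK, Fintype.card_piFinset]
    simp
  rw [e, ← hcard, ← nsmul_eq_mul]
  refine (Finset.abs_sum_le_sum_abs _ _).trans (Finset.sum_le_card_nsmul _ _ _ fun k hk => ?_)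
  have hkm (j : ι) : k j ≤ m := by
    have := Fintype.mem_piFinset.1 hk j
    simp only [Finset.mem_range] at this
    omega
  have hcpos : 0 ≤ ∏ j, c j := Finset.prod_nonneg fun j _ => hc j
  have hsum : ∑ j, (k j + 1) = ∑ j, k j + Fintype.card ι := by
    simp [Finset.sum_add_distrib]
  -- In the first case no `k j` equals `m`, so the remainder terms, which have no exact form, do not
  -- occur. In the second case `∑ k j` exceeds `m - t - |ι|`, which bounds both the counts and the
  -- decay factor.
  rcases le_or_gt (∑ j, (k j + 1) + t) m with h | h
  · have hlt (j : ι) : k j < m := by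
      have := Finset.single_le_sum (f := fun j => k j + 1) (fun j _ => Nat.zero_le _)
        (Finset.mem_univ j)
      omega
    have : ∑ i, ∑ i', ∏ j, T i i' j (k j) = 0 := by
      have e2 (i i' : Fin (b ^ m)) : ∏ j, T i i' j (k j)
          = (∏ j, pairCoef b (k j) (x i' j) (x i j)) * ∏ j, D j (k j) := by
        rw [← Finset.prod_mul_distrib]
        exact Finset.prod_congr rfl fun j _ => hT i i' j _ (hlt j)
      simp only [e2, ← Finset.sum_mul]
      rw [sum_sum_prod_pairCoef hx k h, zero_mul]
    rw [this, abs_zero]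
    positivity
  · have hN := sum_sum_prod_agreeInd_le hx k (Fintype.card ι) (by omega)
    calc |∑ i, ∑ i', ∏ j, T i i' j (k j)|
        ≤ ∑ i, ∑ i', ∏ j, (agreeInd b (k j) (x i' j) (x i j) * (((b : ℝ) ^ k j) ^ (-α) * c j)) := by
          refine (Finset.abs_sum_le_sum_abs _ _).trans (Finset.sum_le_sum fun i _ =>
            (Finset.abs_sum_le_sum_abs _ _).trans (Finset.sum_le_sum fun i' _ => ?_))
          rw [Finset.abs_prod]
          exact Finset.prod_le_prod (fun j _ => abs_nonneg _) fun j _ => hle i i' j _ (hkm j)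
      _ = (∑ i, ∑ i', ∏ j, agreeInd b (k j) (x i' j) (x i j)) *
            ((∏ j, ((b : ℝ) ^ k j) ^ (-α)) * ∏ j, c j) := by
          simp only [Finset.prod_mul_distrib, ← Finset.sum_mul]
      _ ≤ (b : ℝ) ^ m * (b : ℝ) ^ (t + Fintype.card ι) *
            (((b : ℝ) ^ (α * (t + Fintype.card ι)) * (b : ℝ) ^ (-α * m)) * ∏ j, c j) := by
          have h2 : ∏ j, ((b : ℝ) ^ k j) ^ (-α)
              ≤ (b : ℝ) ^ (α * (t + Fintype.card ι)) * (b : ℝ) ^ (-α * m) := by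
            rw [Real.finsetProd_rpow _ _ (fun j _ => by positivity), Finset.prod_pow_eq_pow_sum,
              ← Real.rpow_natCast, ← Real.rpow_mul hb0.le, ← Real.rpow_add hb0]
            refine Real.rpow_le_rpow_of_exponent_le hb1 ?_
            have h3 : (m : ℝ) ≤ (∑ j, k j : ℕ) + Fintype.card ι + t := by
              exact_mod_cast (by omega : m ≤ ∑ j, k j + Fintype.card ι + t)
            nlinarith
          gcongr
      _ = _ := by ring

/-- The Haar expansion of the mixed moment of a scrambled pair. -/
theorem exists_pair_expansion {Ω : Type*} [MeasurableSpace Ω] {P : Measure Ω}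
    [IsProbabilityMeasure P] (hb : 2 ≤ b) {perm : List (Fin b) → Ω → Equiv.Perm (Fin b)}
    (hS : IsCoordScrambling P perm) (m : ℕ) {h g : ℝ → ℝ} (hh : BddMeas h) (hg : BddMeas g)
    (hh0 : ∫ u, h u ∂unif = 0) {α A B : ℝ} (hA : 0 ≤ A)
    (hhA : ∀ k, haarDist b k h ≤ ((b : ℝ) ^ k) ^ (-α) * A ^ 2) (hB : 0 ≤ B)
    (hgB : ∀ k, haarDist b k g ≤ ((b : ℝ) ^ k) ^ (-α) * B ^ 2) (x y : ℝ) :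
    ∃ T : ℕ → ℝ, ∫ o, h (scramblePoint (Real.digits x b) fun l => perm l o) *
        g (scramblePoint (Real.digits y b) fun l => perm l o) ∂P
        = ∑ k ∈ Finset.range (m + 1), T k ∧
      (∀ k < m, T k = pairCoef b k x y * (haarInner b (k + 1) h g - haarInner b k h g)) ∧
      ∀ k ≤ m, |T k| ≤ agreeInd b k x y * (((b : ℝ) ^ k) ^ (-α) * (A * B)) := by
  classical
  set E := ∫ o, h (scramblePoint (Real.digits x b) fun l => perm l o) *
        g (scramblePoint (Real.digits y b) fun l => perm l o) ∂P with hE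
  have hb' : (b : ℝ) - 1 ≠ 0 := by
    have : (2 : ℝ) ≤ b := by exact_mod_cast hb
    linarith
  have hdist (k : ℕ) : √(haarDist b k h) * √(haarDist b k g) ≤ ((b : ℝ) ^ k) ^ (-α) * (A * B) := by
    have hpos : 0 ≤ ((b : ℝ) ^ k) ^ (-α) := by positivity
    calc √(haarDist b k h) * √(haarDist b k g)
        ≤ √(((b : ℝ) ^ k) ^ (-α) * A ^ 2) * √(((b : ℝ) ^ k) ^ (-α) * B ^ 2) :=
          mul_le_mul (Real.sqrt_le_sqrt (hhA k)) (Real.sqrt_le_sqrt (hgB k)) (Real.sqrt_nonneg _)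
            (Real.sqrt_nonneg _)
      _ = _ := by
          rw [Real.sqrt_mul hpos, Real.sqrt_mul hpos, Real.sqrt_sq hA, Real.sqrt_sq hB,
            mul_mul_mul_comm, Real.mul_self_sqrt hpos]
  have h00 : haarInner b 0 h g = 0 := by rw [haarInner, hh0, zero_mul]
  have hlow (k : ℕ) : |pairCoef b k x y * (haarInner b (k + 1) h g - haarInner b k h g)|
      ≤ agreeInd b k x y * (((b : ℝ) ^ k) ^ (-α) * (A * B)) := by
    rw [abs_mul]
    exact mul_le_mul (abs_pairCoef_le hb k x y)
      ((abs_haarInner_succ_sub_le (by omega) k hh hg).trans (hdist k)) (abs_nonneg _)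
      (agreeInd_nonneg _ _ _ _)
  -- Level `m` collects everything that the first `m` digits do not resolve; it is nonzero only for
  -- pairs agreeing in all of them.
  refine ⟨fun k => if k < m then pairCoef b k x y * (haarInner b (k + 1) h g - haarInner b k h g)
    else agreeInd b m x y * (E - haarInner b m h g), ?_, fun k hk => if_pos hk, fun k hk => ?_⟩
  · rw [Finset.sum_range_succ, if_neg (lt_irrefl m),
      Finset.sum_congr rfl fun k hk => if_pos (Finset.mem_range.1 hk)]
    by_cases hag : Agree b m x y
    · have h1 (k : ℕ) (hk : k ≤ m) : agreeInd b k x y = 1 :=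
        if_pos fun r hr => hag r (by omega)
      have h2 : ∑ k ∈ Finset.range m, pairCoef b k x y *
          (haarInner b (k + 1) h g - haarInner b k h g)
          = ∑ k ∈ Finset.range m, (haarInner b (k + 1) h g - haarInner b k h g) := by
        refine Finset.sum_congr rfl fun k hk => ?_
        have := Finset.mem_range.1 hk
        rw [pairCoef, h1 _ (by omega), h1 _ (by omega), mul_one, div_self hb', one_mul]
      rw [h2, Finset.sum_range_sub (fun k => haarInner b k h g), h1 m le_rfl, h00]
      ring
    · have hex : ∃ r, r < m ∧ Real.digits x b r ≠ Real.digits y b r := by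
        unfold Agree at hag
        push Not at hag
        exact hag
      -- At the first differing digit `r` the coefficients are 1 below `r`, `-1/(b-1)` at `r` and 0
      -- beyond; the sum telescopes to the formula of `integral_mul_of_ne`.
      set r := Nat.find hex with hr
      obtain ⟨hrm, hrne⟩ := Nat.find_spec hex
      have hlt (k : ℕ) (hk : k < r) : Real.digits x b k = Real.digits y b k := by
        by_contra hne
        exact Nat.find_min hex hk ⟨by omega, hne⟩
      have h1 (k : ℕ) (hk : k ≤ r) : agreeInd b k x y = 1 :=
        if_pos fun i hi => hlt i (by omega)
      have h2 (k : ℕ) (hk : r < k) : agreeInd b k x y = 0 :=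
        if_neg fun h' => hrne (h' r hk)
      have h3 : ∑ k ∈ Finset.range m, pairCoef b k x y *
          (haarInner b (k + 1) h g - haarInner b k h g)
          = ∑ k ∈ Finset.range (r + 1), pairCoef b k x y *
          (haarInner b (k + 1) h g - haarInner b k h g) := by
        symm
        refine Finset.sum_subset (Finset.range_mono hrm) fun k _ hk => ?_
        have : r < k := by simpa using hk
        rw [pairCoef, h2 _ (by omega), h2 _ this]
        simp
      have h4 : ∑ k ∈ Finset.range r, pairCoef b k x y *
          (haarInner b (k + 1) h g - haarInner b k h g)
          = ∑ k ∈ Finset.range r, (haarInner b (k + 1) h g - haarInner b k h g) := by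
        refine Finset.sum_congr rfl fun k hk => ?_
        have := Finset.mem_range.1 hk
        rw [pairCoef, h1 _ (by omega), h1 _ (by omega), mul_one, div_self hb', one_mul]
      rw [h3, Finset.sum_range_succ, h4, Finset.sum_range_sub (fun k => haarInner b k h g), h2 m hrm, h00, pairCoef,
        h1 r le_rfl, h2 (r + 1) (by omega), hE, hS.integral_mul_of_ne hb r hlt hrne hh hg]
      field_simp
      ring
  · rcases lt_or_eq_of_le hk with h | h
    · simp only [if_pos h]
      exact hlow k
    · subst h
      simp only [if_neg (lt_irrefl k)]
      rw [abs_mul, abs_of_nonneg (agreeInd_nonneg _ _ _ _)]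
      by_cases hag : Agree b k x y
      · exact mul_le_mul_of_nonneg_left
          ((hS.abs_integral_mul_sub_le hb k hag hh hg).trans (hdist k)) (agreeInd_nonneg _ _ _ _)
      · rw [show agreeInd b k x y = 0 from if_neg hag]
        simp

end pairs

end BDIS

/-! ### Scrambling of all coordinates and mixed moments over a net -/

namespace BDIS

namespace IsScrambling

variable {Ω : Type*} [MeasurableSpace Ω] {P : Measure Ω} {s b : ℕ}
  {perm : Fin s × List (Fin b) → Ω → Equiv.Perm (Fin b)} (hS : IsScrambling P perm)
include hS

theorem measurable_perm (i : Fin s × List (Fin b)) : Measurable (perm i) :=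
  measurable_to_countable' fun σ => hS.measurable i σ

theorem coord (j : Fin s) : IsCoordScrambling P fun l => perm (j, l) where
  measurable _ := hS.measurable_perm _
  uniform _ σ := hS.uniform _ σ
  indep := (show iIndepFun perm P from hS.indep).precomp (g := fun l => (j, l))
    (Prod.mk_right_injective j)

/-- Different coordinates are scrambled independently. -/
theorem integral_prod [IsProbabilityMeasure P] (A : Finset (Fin s))
    {F : Fin s → (List (Fin b) → Equiv.Perm (Fin b)) → ℝ} (hF : ∀ j, Measurable (F j)) :
    ∫ o, ∏ j ∈ A, F j (fun l => perm (j, l) o) ∂P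
      = ∏ j ∈ A, ∫ o, F j (fun l => perm (j, l) o) ∂P := by
  classical
  induction A using Finset.induction_on with
  | empty => simp
  | insert j A hj ih =>
    have hind := (show iIndepFun perm P from hS.indep).indepFun_of_disjoint hS.measurable_perm
      (e := fun l : List (Fin b) => (j, l))
      (e' := fun il : A × List (Fin b) => ((il.1 : Fin s), il.2))
      (fun l il h => hj (by
        have h' : j = il.1 := congrArg Prod.fst h
        rw [h']; exact il.1.2))
    have hψ : Measurable fun π : A × List (Fin b) → Equiv.Perm (Fin b) =>
        ∏ i : A, F i (fun l => π (i, l)) :=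
      Finset.measurable_prod _ fun i _ => (hF i).comp
        (measurable_pi_lambda _ fun l => measurable_pi_apply _)
    have hm1 : Measurable fun o => fun l => perm (j, l) o := (hS.coord j).measurable_family
    have hm2 : Measurable fun o => fun il : A × List (Fin b) => perm ((il.1 : Fin s), il.2) o :=
      measurable_pi_lambda _ fun il => hS.measurable_perm _
    have h := (hind.comp (hF j) hψ).integral_fun_mul_eq_mul_integral
      ((hF j).comp hm1).aestronglyMeasurable (hψ.comp hm2).aestronglyMeasurable
    rw [Finset.prod_insert hj, ← ih]
    simp only [Finset.prod_insert hj]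
    have e (o : Ω) : ∏ i ∈ A, F i (fun l => perm (i, l) o)
        = ∏ i : A, F i (fun l => perm ((i : Fin s), l) o) := by
      rw [← Finset.prod_attach]; rfl
    simp only [e]
    exact h

end IsScrambling

section moments

variable {Ω : Type*} [MeasurableSpace Ω] {P : Measure Ω} [IsProbabilityMeasure P] {s b m : ℕ}
  [NeZero b] {perm : Fin s × List (Fin b) → Ω → Equiv.Perm (Fin b)} (hS : IsScrambling P perm)

theorem scramble_mem (perm : Fin s × List (Fin b) → Equiv.Perm (Fin b)) (x : Fin s → ℝ) (j : Fin s) :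
    scramble perm x j ∈ Set.Icc (0 : ℝ) 1 := scramblePoint_mem _ fun l => perm (j, l)

theorem scramble_eq (perm : Fin s × List (Fin b) → Equiv.Perm (Fin b)) (x : Fin s → ℝ) (j : Fin s) :
    scramble perm x j = scramblePoint (Real.digits (x j) b) fun l => perm (j, l) := rfl

include hS

omit [IsProbabilityMeasure P] in
theorem measurable_scramble (x : Fin s → ℝ) :
    Measurable fun o => scramble (fun i => perm i o) x :=
  measurable_pi_lambda _ fun j => (hS.coord j).measurable_point _

/-- Each scrambled point is uniformly distributed on the unit cube. -/
theorem map_scramble (hb : 2 ≤ b) (x : Fin s → ℝ) :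
    P.map (fun o => scramble (fun i => perm i o) x) = Measure.pi fun _ => unif := by
  classical
  have hm := measurable_scramble hS x
  symm
  refine Measure.pi_eq fun S hSm => ?_
  have h1 : P.map (fun o => scramble (fun i => perm i o) x) (Set.univ.pi S)
      = ENNReal.ofReal (∏ j, ∫ o, (S j).indicator (fun _ => (1 : ℝ))
        (scramblePoint (Real.digits (x j) b) fun l => perm (j, l) o) ∂P) := by
    rw [← hS.integral_prod Finset.univ (F := fun j π => (S j).indicator (fun _ => (1 : ℝ))
      (scramblePoint (Real.digits (x j) b) π)) fun j =>
        (measurable_const.indicator (hSm j)).comp (measurable_scramblePoint _)]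
    have e : (fun o => ∏ j, (S j).indicator (fun _ => (1 : ℝ))
        (scramblePoint (Real.digits (x j) b) fun l => perm (j, l) o))
        = ((fun o => scramble (fun i => perm i o) x) ⁻¹' Set.univ.pi S).indicator fun _ => 1 := by
      ext o
      by_cases h : ∀ j, scramble (fun i => perm i o) x j ∈ S j
      · rw [Set.indicator_of_mem (by simpa using h)]
        exact Finset.prod_eq_one fun j _ => Set.indicator_of_mem (h j) _
      · rw [Set.indicator_of_notMem (by simpa using h)]
        push Not at h
        obtain ⟨j, hj⟩ := h
        exact Finset.prod_eq_zero (Finset.mem_univ j) (Set.indicator_of_notMem hj _)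
    rw [e, integral_indicator (hm (MeasurableSet.univ_pi hSm)),
      Measure.map_apply hm (MeasurableSet.univ_pi hSm)]
    simp [Measure.real]
  rw [h1, ENNReal.ofReal_prod_of_nonneg fun j _ => integral_nonneg fun o =>
    Set.indicator_nonneg (fun _ _ => zero_le_one) _]
  refine Finset.prod_congr rfl fun j _ => ?_
  rw [(hS.coord j).integral_comp hb _ (measurable_const.indicator (hSm j)),
    integral_indicator (hSm j), setIntegral_const, smul_eq_mul, mul_one, Measure.real,
    ENNReal.ofReal_toReal (measure_ne_top _ _)]

/-- A coordinate in exactly one of the two sets contributes a factor of mean zero, independent of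
all the others. -/
theorem integral_prod_mul_prod_eq_zero (hb : 2 ≤ b) {w w' : Finset (Fin s)} (hw : w ≠ w')
    {h g : Fin s → ℝ → ℝ} (hh : ∀ j, Measurable (h j)) (hg : ∀ j, Measurable (g j))
    (hh0 : ∀ j, ∫ u, h j u ∂unif = 0) (hg0 : ∀ j, ∫ u, g j u ∂unif = 0) (x y : Fin s → ℝ) :
    ∫ o, (∏ j ∈ w, h j (scramble (fun i => perm i o) x j)) *
      ∏ j ∈ w', g j (scramble (fun i => perm i o) y j) ∂P = 0 := by
  classical
  set F : Fin s → (List (Fin b) → Equiv.Perm (Fin b)) → ℝ := fun j π =>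
    (if j ∈ w then h j (scramblePoint (Real.digits (x j) b) π) else 1) *
      if j ∈ w' then g j (scramblePoint (Real.digits (y j) b) π) else 1 with hF
  have e (o : Ω) : (∏ j ∈ w, h j (scramble (fun i => perm i o) x j)) *
      ∏ j ∈ w', g j (scramble (fun i => perm i o) y j) = ∏ j, F j fun l => perm (j, l) o := by
    rw [hF, Finset.prod_mul_distrib, Finset.prod_ite_mem, Finset.prod_ite_mem, Finset.univ_inter,
      Finset.univ_inter]
    rfl
  have hFm (j : Fin s) : Measurable (F j) := by
    have h1 := (hh j).comp (measurable_scramblePoint (Real.digits (x j) b))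
    have h2 := (hg j).comp (measurable_scramblePoint (Real.digits (y j) b))
    refine Measurable.mul ?_ ?_
    · split_ifs
      · exact h1
      · exact measurable_const
    · split_ifs
      · exact h2
      · exact measurable_const
  simp only [e]
  rw [hS.integral_prod Finset.univ hFm]
  have hex : ∃ j, ¬(j ∈ w ↔ j ∈ w') := by
    by_contra hall
    push Not at hall
    exact hw (Finset.ext hall)
  obtain ⟨j, hj⟩ := hex
  refine Finset.prod_eq_zero (Finset.mem_univ j) ?_
  by_cases hjw : j ∈ w
  · have hjw' : j ∉ w' := fun h => hj ⟨fun _ => h, fun _ => hjw⟩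
    simp only [hF, if_pos hjw, if_neg hjw', mul_one]
    rw [(hS.coord j).integral_comp hb _ (hh j), hh0]
  · have hjw' : j ∈ w' := by
      by_contra h
      exact hj ⟨fun h' => absurd h' hjw, fun h' => absurd h' h⟩
    simp only [hF, if_neg hjw, if_pos hjw', one_mul]
    rw [(hS.coord j).integral_comp hb _ (hg j), hg0]

/-- The factor by which mixed moments over a net are bounded. -/
noncomputable def netFactor (b m t n : ℕ) (α : ℝ) : ℝ :=
  ((m : ℝ) + 1) ^ n * ((b : ℝ) ^ m * (b : ℝ) ^ (t + n) *
    ((b : ℝ) ^ (α * (t + n)) * (b : ℝ) ^ (-α * m)))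

/-- Mixed moments of a product function, summed over pairs of scrambled net points. -/
theorem abs_sum_integral_prod_mul_prod_le (hb : 2 ≤ b) {w : Finset (Fin s)} (hw : w.Nonempty)
    {t : ℕ} {x : Fin (b ^ m) → Fin s → ℝ} (hx : IsNet b t m fun i (j : w) => x i j)
    {h g : Fin s → ℝ → ℝ} (hh : ∀ j, BddMeas (h j)) (hg : ∀ j, BddMeas (g j))
    (hh0 : ∀ j, ∫ u, h j u ∂unif = 0) {α : ℝ} (hα : 0 ≤ α) {A B : Fin s → ℝ} (hA : ∀ j, 0 ≤ A j)
    (hhA : ∀ j k, haarDist b k (h j) ≤ ((b : ℝ) ^ k) ^ (-α) * A j ^ 2) (hB : ∀ j, 0 ≤ B j)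
    (hgB : ∀ j k, haarDist b k (g j) ≤ ((b : ℝ) ^ k) ^ (-α) * B j ^ 2) :
    |∑ i, ∑ i', ∫ o, (∏ j ∈ w, h j (scramble (fun l => perm l o) (x i') j)) *
      ∏ j ∈ w, g j (scramble (fun l => perm l o) (x i) j) ∂P|
      ≤ netFactor b m t w.card α * ((∏ j ∈ w, A j) * ∏ j ∈ w, B j) := by
  classical
  have : Nonempty w := hw.to_subtype
  choose T hT1 hT2 hT3 using fun (i i' : Fin (b ^ m)) (j : w) =>
    exists_pair_expansion hb (hS.coord j) m (hh j) (hg j) (hh0 j) (hA j) (hhA j) (hB j) (hgB j)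
      (x i' j) (x i j)
  have hmain := abs_sum_sum_prod_le hb hx _ T
    (fun j k => haarInner b (k + 1) (h j) (g j) - haarInner b k (h j) (g j))
    (fun j => A j * B j) hα (fun j => mul_nonneg (hA j) (hB j)) hT1 hT2 hT3
  rw [Fintype.card_coe] at hmain
  have e (i i' : Fin (b ^ m)) : ∫ o, (∏ j ∈ w, h j (scramble (fun l => perm l o) (x i') j)) *
      ∏ j ∈ w, g j (scramble (fun l => perm l o) (x i) j) ∂P
      = ∏ j : w, ∫ o, h j (scramblePoint (Real.digits (x i' j) b) fun l => perm (j, l) o) *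
        g j (scramblePoint (Real.digits (x i j) b) fun l => perm (j, l) o) ∂P := by
    simp only [← Finset.prod_mul_distrib, scramble_eq]
    rw [hS.integral_prod w (F := fun j π => h j (scramblePoint (Real.digits (x i' j) b) π) *
      g j (scramblePoint (Real.digits (x i j) b) π)) fun j =>
        ((hh j).1.comp (measurable_scramblePoint _)).mul ((hg j).1.comp (measurable_scramblePoint _)),
      ← Finset.prod_attach]
    rfl
  simp only [e]
  refine hmain.trans_eq ?_
  rw [netFactor, ← Finset.prod_mul_distrib, ← Finset.prod_attach w]
  simp only [Finset.univ_eq_attach]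
  ring

end moments

end BDIS

/-! ### Second moments for integrals of product kernels -/

namespace BDIS

section abstractBound

variable {s : ℕ} {μ : Measure (Fin s → ℝ)}
  {h : Finset (Fin s) → Fin s → ℝ → ℝ → ℝ} {G : Finset (Fin s) → (Fin s → ℝ) → ℝ}

/-- The contribution of the coordinates in `w` and the derivative `G v`. -/
noncomputable def errTerm (μ : Measure (Fin s → ℝ)) (h : Finset (Fin s) → Fin s → ℝ → ℝ → ℝ)
    (G : Finset (Fin s) → (Fin s → ℝ) → ℝ) (w v : Finset (Fin s)) (u : Fin s → ℝ) : ℝ :=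
  ∫ y, (∏ j ∈ w, h v j (u j) (y j)) * G v y ∂μ

/-- Measurable product kernels of mean zero, and bounds for their Haar coefficients. -/
structure IsErrKernel (b : ℕ) (α M : ℝ) (h : Finset (Fin s) → Fin s → ℝ → ℝ → ℝ)
    (A : Finset (Fin s) → Fin s → ℝ → ℝ) : Prop where
  measurable : ∀ v j, Measurable fun z : ℝ × ℝ => h v j z.1 z.2
  integral_eq_zero : ∀ v j y, ∫ u, h v j u y ∂unif = 0
  bound_nonneg : ∀ v j y, 0 ≤ A v j y
  haarDist_le : ∀ v j y k, haarDist b k (fun u => h v j u y) ≤ ((b : ℝ) ^ k) ^ (-α) * A v j y ^ 2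
  abs_le : ∀ v j y, ∀ u ∈ Set.Icc (0 : ℝ) 1, |h v j u y| ≤ M * A v j y

variable {b : ℕ} {α M : ℝ} {A : Finset (Fin s) → Fin s → ℝ → ℝ}

namespace IsErrKernel

variable (hK : IsErrKernel b α M h A)
include hK

theorem measurable_left (v : Finset (Fin s)) (j : Fin s) (y : ℝ) : Measurable fun u => h v j u y :=
  (hK.measurable v j).comp (measurable_id.prodMk measurable_const)

theorem bddMeas (v : Finset (Fin s)) (j : Fin s) (y : ℝ) : BddMeas fun u => h v j u y :=
  ⟨hK.measurable_left v j y, _, hK.abs_le v j y⟩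

theorem measurable_prod (w v : Finset (Fin s)) :
    Measurable fun z : (Fin s → ℝ) × (Fin s → ℝ) => ∏ j ∈ w, h v j (z.1 j) (z.2 j) :=
  Finset.measurable_prod _ fun j _ => show Measurable ((fun z : ℝ × ℝ => h v j z.1 z.2) ∘
    fun z : (Fin s → ℝ) × (Fin s → ℝ) => (z.1 j, z.2 j)) from (hK.measurable v j).comp
    (((measurable_pi_apply j).comp measurable_fst).prodMk
      ((measurable_pi_apply j).comp measurable_snd))

theorem abs_prod_le (w v : Finset (Fin s)) {u : Fin s → ℝ} (hu : ∀ j, u j ∈ Set.Icc (0 : ℝ) 1)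
    (y : Fin s → ℝ) : |∏ j ∈ w, h v j (u j) (y j)| ≤ M ^ w.card * ∏ j ∈ w, A v j (y j) := by
  rw [Finset.abs_prod, ← Finset.prod_const, ← Finset.prod_mul_distrib]
  exact Finset.prod_le_prod (fun j _ => abs_nonneg _) fun j _ => hK.abs_le v j _ _ (hu j)

variable (hGm : ∀ v, Measurable (G v))
  (hG : ∀ w v, v ⊆ w → Integrable (fun y => (∏ j ∈ w, A v j (y j)) * |G v y|) μ)
include hGm

theorem measurable_errTerm [SFinite μ] (w v : Finset (Fin s)) : Measurable (errTerm μ h G w v) := by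
  have : Measurable fun z : (Fin s → ℝ) × (Fin s → ℝ) =>
      (∏ j ∈ w, h v j (z.1 j) (z.2 j)) * G v z.2 :=
    (hK.measurable_prod w v).mul ((hGm v).comp measurable_snd)
  exact this.stronglyMeasurable.integral_prod_right.measurable

include hG

omit hGm in
theorem abs_errTerm_le {w v : Finset (Fin s)} (hv : v ⊆ w) {u : Fin s → ℝ}
    (hu : ∀ j, u j ∈ Set.Icc (0 : ℝ) 1) :
    |errTerm μ h G w v u| ≤ M ^ w.card * ∫ y, (∏ j ∈ w, A v j (y j)) * |G v y| ∂μ := by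
  rw [← integral_const_mul]
  refine (abs_integral_le_integral_abs).trans (integral_mono_of_nonneg
    (ae_of_all _ fun y => abs_nonneg _) ((hG w v hv).const_mul _) (ae_of_all _ fun y => ?_))
  simp only
  rw [abs_mul, ← mul_assoc]
  exact mul_le_mul_of_nonneg_right (hK.abs_prod_le w v hu y) (abs_nonneg _)

variable [IsFiniteMeasure μ] {Ω : Type*} [MeasurableSpace Ω] {P : Measure Ω}
  [IsProbabilityMeasure P]

/-- The constant `M` only serves to justify Fubini; it does not enter any final estimate. -/
theorem integrable_cross {w v w' v' : Finset (Fin s)} (hv : v ⊆ w) (hv' : v' ⊆ w')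
    {U U' : Ω → Fin s → ℝ} (hU : Measurable U) (hU' : Measurable U')
    (hUm : ∀ o j, U o j ∈ Set.Icc (0 : ℝ) 1) (hUm' : ∀ o j, U' o j ∈ Set.Icc (0 : ℝ) 1) :
    Integrable (fun q : Ω × ((Fin s → ℝ) × (Fin s → ℝ)) =>
      ((∏ j ∈ w, h v j (U q.1 j) (q.2.1 j)) * G v q.2.1) *
        ((∏ j ∈ w', h v' j (U' q.1 j) (q.2.2 j)) * G v' q.2.2)) (P.prod (μ.prod μ)) := by
  have hdom : Integrable (fun q : Ω × ((Fin s → ℝ) × (Fin s → ℝ)) =>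
      (M ^ w.card * ((∏ j ∈ w, A v j (q.2.1 j)) * |G v q.2.1|)) *
        (M ^ w'.card * ((∏ j ∈ w', A v' j (q.2.2 j)) * |G v' q.2.2|))) (P.prod (μ.prod μ)) :=
    (((hG w v hv).const_mul (M ^ w.card)).mul_prod
      ((hG w' v' hv').const_mul (M ^ w'.card))).comp_snd P
  refine hdom.mono' (Measurable.aestronglyMeasurable ?_) (ae_of_all _ fun q => ?_)
  · refine Measurable.mul (Measurable.mul ?_ ?_) (Measurable.mul ?_ ?_)
    · exact (hK.measurable_prod w v).comp
        ((hU.comp measurable_fst).prodMk (measurable_fst.comp measurable_snd))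
    · exact (hGm v).comp (measurable_fst.comp measurable_snd)
    · exact (hK.measurable_prod w' v').comp
        ((hU'.comp measurable_fst).prodMk (measurable_snd.comp measurable_snd))
    · exact (hGm v').comp (measurable_snd.comp measurable_snd)
  · rw [Real.norm_eq_abs, abs_mul, abs_mul, abs_mul, ← mul_assoc (M ^ w.card),
      ← mul_assoc (M ^ w'.card)]
    have h1 := hK.abs_prod_le w v (hUm q.1) q.2.1
    have h2 := hK.abs_prod_le w' v' (hUm' q.1) q.2.2
    exact mul_le_mul (mul_le_mul_of_nonneg_right h1 (abs_nonneg _))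
      (mul_le_mul_of_nonneg_right h2 (abs_nonneg _)) (by positivity)
      (mul_nonneg ((abs_nonneg _).trans h1) (abs_nonneg _))

/-- Fubini brings the expectation inside, next to pure products of one-dimensional functions, where
independence of the coordinates can be used. -/
theorem integral_cross {w v w' v' : Finset (Fin s)} (hv : v ⊆ w) (hv' : v' ⊆ w')
    {U U' : Ω → Fin s → ℝ} (hU : Measurable U) (hU' : Measurable U')
    (hUm : ∀ o j, U o j ∈ Set.Icc (0 : ℝ) 1) (hUm' : ∀ o j, U' o j ∈ Set.Icc (0 : ℝ) 1) :
    ∫ o, errTerm μ h G w v (U o) * errTerm μ h G w' v' (U' o) ∂P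
      = ∫ z, G v z.1 * G v' z.2 * (∫ o, (∏ j ∈ w, h v j (U o j) (z.1 j)) *
        ∏ j ∈ w', h v' j (U' o j) (z.2 j) ∂P) ∂μ.prod μ := by
  have e (o : Ω) : errTerm μ h G w v (U o) * errTerm μ h G w' v' (U' o)
      = ∫ z, ((∏ j ∈ w, h v j (U o j) (z.1 j)) * G v z.1) *
        ((∏ j ∈ w', h v' j (U' o j) (z.2 j)) * G v' z.2) ∂μ.prod μ :=
    (integral_prod_mul (fun y => (∏ j ∈ w, h v j (U o j) (y j)) * G v y)
      fun y => (∏ j ∈ w', h v' j (U' o j) (y j)) * G v' y).symm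
  simp only [e]
  rw [integral_integral_swap (hK.integrable_cross hGm hG hv hv' hU hU' hUm hUm')]
  refine integral_congr_ae (ae_of_all _ fun z => ?_)
  simp only
  rw [← integral_const_mul]
  refine integral_congr_ae (ae_of_all _ fun o => ?_)
  simp only
  ring

theorem integrable_cross_right {w v w' v' : Finset (Fin s)} (hv : v ⊆ w) (hv' : v' ⊆ w')
    {U U' : Ω → Fin s → ℝ} (hU : Measurable U) (hU' : Measurable U')
    (hUm : ∀ o j, U o j ∈ Set.Icc (0 : ℝ) 1) (hUm' : ∀ o j, U' o j ∈ Set.Icc (0 : ℝ) 1) :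
    Integrable (fun z => G v z.1 * G v' z.2 * (∫ o, (∏ j ∈ w, h v j (U o j) (z.1 j)) *
        ∏ j ∈ w', h v' j (U' o j) (z.2 j) ∂P)) (μ.prod μ) := by
  have hi := (hK.integrable_cross (P := P) hGm hG hv hv' hU hU' hUm hUm').integral_prod_right
  refine hi.congr (ae_of_all _ fun z => ?_)
  simp only
  rw [← integral_const_mul]
  refine integral_congr_ae (ae_of_all _ fun o => ?_)
  simp only
  ring

theorem integrable_errTerm_mul {w v w' v' : Finset (Fin s)} (hv : v ⊆ w) (hv' : v' ⊆ w')
    {U U' : Ω → Fin s → ℝ} (hU : Measurable U) (hU' : Measurable U')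
    (hUm : ∀ o j, U o j ∈ Set.Icc (0 : ℝ) 1) (hUm' : ∀ o j, U' o j ∈ Set.Icc (0 : ℝ) 1) :
    Integrable (fun o => errTerm μ h G w v (U o) * errTerm μ h G w' v' (U' o)) P := by
  refine Integrable.mul_bdd
    (c := M ^ w'.card * ∫ y, (∏ j ∈ w', A v' j (y j)) * |G v' y| ∂μ)
    (Integrable.of_bound ((hK.measurable_errTerm hGm w v).comp hU).aestronglyMeasurable
    _ (ae_of_all _ fun o => hK.abs_errTerm_le hG hv (hUm o)))
    ((hK.measurable_errTerm hGm w' v').comp hU').aestronglyMeasurable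
    (ae_of_all _ fun o => hK.abs_errTerm_le hG hv' (hUm' o))

variable [NeZero b] {m : ℕ} {perm : Fin s × List (Fin b) → Ω → Equiv.Perm (Fin b)}
  (hS : IsScrambling P perm) (hb : 2 ≤ b) (hα : 0 ≤ α)
include hS hb

/-- Contributions of different sets of coordinates are uncorrelated. -/
theorem integral_sum_mul_sum_eq_zero {w v w' v' : Finset (Fin s)} (hv : v ⊆ w) (hv' : v' ⊆ w')
    (hw : w ≠ w') (x : Fin (b ^ m) → Fin s → ℝ) :
    ∫ o, (∑ i, errTerm μ h G w v (scramble (fun l => perm l o) (x i))) *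
      (∑ i, errTerm μ h G w' v' (scramble (fun l => perm l o) (x i))) ∂P = 0 := by
  have hm := fun i => measurable_scramble hS (x i)
  have hc := fun i o => scramble_mem (fun l => perm l o) (x i)
  simp only [Finset.sum_mul_sum]
  rw [integral_finsetSum _ fun i _ => integrable_finsetSum _ fun i' _ =>
    hK.integrable_errTerm_mul hGm hG hv hv' (hm i) (hm i') (hc i) (hc i')]
  refine Finset.sum_eq_zero fun i _ => ?_
  rw [integral_finsetSum _ fun i' _ =>
    hK.integrable_errTerm_mul hGm hG hv hv' (hm i) (hm i') (hc i) (hc i')]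
  refine Finset.sum_eq_zero fun i' _ => ?_
  rw [hK.integral_cross hGm hG hv hv' (hm i) (hm i') (hc i) (hc i')]
  have (z : (Fin s → ℝ) × (Fin s → ℝ)) :=
    integral_prod_mul_prod_eq_zero hS hb hw (h := fun j u => h v j u (z.1 j))
      (g := fun j u => h v' j u (z.2 j)) (fun j => hK.measurable_left _ _ _)
      (fun j => hK.measurable_left _ _ _) (fun j => hK.integral_eq_zero _ _ _)
      (fun j => hK.integral_eq_zero _ _ _) (x i) (x i')
  simp only [this, mul_zero, integral_zero]

include hα

/-- For fixed `y` and `y'` the moment of the kernels is at most the net factor times the products of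
the bounds `A`; integration against `|G v|` and `|G v'|` then factorises. Absolute values are taken
only after summing over pairs of points, which retains the cancellation over the net. -/
theorem integral_sum_mul_sum_le {w v v' : Finset (Fin s)} (hv : v ⊆ w) (hv' : v' ⊆ w)
    (hw : w.Nonempty) {t : ℕ} {x : Fin (b ^ m) → Fin s → ℝ}
    (hx : IsNet b t m fun i (j : w) => x i j) :
    ∫ o, (∑ i, errTerm μ h G w v (scramble (fun l => perm l o) (x i))) *
      (∑ i, errTerm μ h G w v' (scramble (fun l => perm l o) (x i))) ∂P
      ≤ netFactor b m t w.card α * ((∫ y, (∏ j ∈ w, A v j (y j)) * |G v y| ∂μ) *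
        ∫ y, (∏ j ∈ w, A v' j (y j)) * |G v' y| ∂μ) := by
  have hm := fun i => measurable_scramble hS (x i)
  have hc := fun i o => scramble_mem (fun l => perm l o) (x i)
  have e : ∫ o, (∑ i, errTerm μ h G w v (scramble (fun l => perm l o) (x i))) *
      (∑ i, errTerm μ h G w v' (scramble (fun l => perm l o) (x i))) ∂P
      = ∫ z, G v z.1 * G v' z.2 * ∑ i, ∑ i', ∫ o,
        (∏ j ∈ w, h v j (scramble (fun l => perm l o) (x i') j) (z.1 j)) *
        ∏ j ∈ w, h v' j (scramble (fun l => perm l o) (x i) j) (z.2 j) ∂P ∂μ.prod μ := by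
    have hi (i i' : Fin (b ^ m)) := hK.integrable_cross_right (P := P) hGm hG hv hv' (hm i') (hm i)
      (hc i') (hc i)
    have hL (o : Ω) : (∑ i, errTerm μ h G w v (scramble (fun l => perm l o) (x i))) *
        (∑ i, errTerm μ h G w v' (scramble (fun l => perm l o) (x i)))
        = ∑ i, ∑ i', errTerm μ h G w v (scramble (fun l => perm l o) (x i')) *
          errTerm μ h G w v' (scramble (fun l => perm l o) (x i)) := by
      rw [Finset.sum_mul_sum, Finset.sum_comm]
    simp only [hL, Finset.mul_sum]
    rw [integral_finsetSum _ fun i _ => integrable_finsetSum _ fun i' _ => hi i i',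
      integral_finsetSum _ fun i _ => integrable_finsetSum _ fun i' _ =>
      hK.integrable_errTerm_mul hGm hG hv hv' (hm i') (hm i) (hc i') (hc i)]
    refine Finset.sum_congr rfl fun i _ => ?_
    rw [integral_finsetSum _ fun i' _ => hK.integrable_errTerm_mul hGm hG hv hv' (hm i') (hm i)
      (hc i') (hc i), integral_finsetSum _ fun i' _ => hi i i']
    exact Finset.sum_congr rfl fun i' _ =>
      hK.integral_cross hGm hG hv hv' (hm i') (hm i) (hc i') (hc i)
  rw [e, ← integral_prod_mul, ← integral_const_mul]
  refine (le_abs_self _).trans ((abs_integral_le_integral_abs).trans (integral_mono_of_nonneg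
    (ae_of_all _ fun z => abs_nonneg _) (((hG w v hv).mul_prod (hG w v' hv')).const_mul _)
    (ae_of_all _ fun z => ?_)))
  simp only
  have := abs_sum_integral_prod_mul_prod_le hS hb hw hx (h := fun j u => h v j u (z.1 j))
      (g := fun j u => h v' j u (z.2 j)) (fun j => hK.bddMeas _ _ _)
      (fun j => hK.bddMeas _ _ _) (fun j => hK.integral_eq_zero _ _ _) hα
      (A := fun j => A v j (z.1 j)) (B := fun j => A v' j (z.2 j))
      (fun j => hK.bound_nonneg _ _ _) (fun j k => hK.haarDist_le _ _ _ _)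
      (fun j => hK.bound_nonneg _ _ _) (fun j k => hK.haarDist_le _ _ _ _)
  rw [abs_mul, abs_mul]
  refine (mul_le_mul_of_nonneg_left this (by positivity)).trans_eq ?_
  ring

/-- The second moment of the total error. -/
theorem integral_sq_sum_le {t : Finset (Fin s) → ℕ} {x : Fin (b ^ m) → Fin s → ℝ}
    (hx : ∀ w : Finset (Fin s), w.Nonempty → IsNet b (t w) m fun i (j : w) => x i j) :
    ∫ o, (∑ i, ∑ w : Finset (Fin s) with w.Nonempty, ∑ v ∈ w.powerset,
      errTerm μ h G w v (scramble (fun l => perm l o) (x i))) ^ 2 ∂P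
      ≤ ∑ w : Finset (Fin s) with w.Nonempty, netFactor b m (t w) w.card α *
        (∑ v ∈ w.powerset, ∫ y, (∏ j ∈ w, A v j (y j)) * |G v y| ∂μ) ^ 2 := by
  classical
  have hm := fun i => measurable_scramble hS (x i)
  have hc := fun i o => scramble_mem (fun l => perm l o) (x i)
  set W := Finset.univ.filter fun w : Finset (Fin s) => w.Nonempty with hW
  set X : Finset (Fin s) → Finset (Fin s) → ℝ :=
    fun w v => ∫ y, (∏ j ∈ w, A v j (y j)) * |G v y| ∂μ with hX
  set Z : Finset (Fin s) → Finset (Fin s) → Ω → ℝ :=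
    fun w v o => ∑ i, errTerm μ h G w v (scramble (fun l => perm l o) (x i)) with hZ
  have hint {w v w' v' : Finset (Fin s)} (hv : v ⊆ w) (hv' : v' ⊆ w') :
      Integrable (fun o => Z w v o * Z w' v' o) P := by
    simp only [hZ, Finset.sum_mul_sum]
    exact integrable_finsetSum _ fun i _ => integrable_finsetSum _ fun i' _ =>
      hK.integrable_errTerm_mul hGm hG hv hv' (hm i) (hm i') (hc i) (hc i')
  have e (o : Ω) : (∑ i, ∑ w ∈ W, ∑ v ∈ w.powerset,
      errTerm μ h G w v (scramble (fun l => perm l o) (x i))) ^ 2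
      = ∑ w ∈ W, ∑ w' ∈ W, ∑ v ∈ w.powerset, ∑ v' ∈ w'.powerset, Z w v o * Z w' v' o := by
    have : ∑ i, ∑ w ∈ W, ∑ v ∈ w.powerset,
        errTerm μ h G w v (scramble (fun l => perm l o) (x i)) = ∑ w ∈ W, ∑ v ∈ w.powerset, Z w v o := by
      rw [Finset.sum_comm]
      exact Finset.sum_congr rfl fun w _ => Finset.sum_comm
    rw [this, sq, Finset.sum_mul_sum]
    exact Finset.sum_congr rfl fun w _ => Finset.sum_congr rfl fun w' _ => Finset.sum_mul_sum ..
  simp only [e]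
  have hi4 {w w' v v' : Finset (Fin s)} (hv : v ∈ w.powerset) (hv' : v' ∈ w'.powerset) :=
    hint (Finset.mem_powerset.1 hv) (Finset.mem_powerset.1 hv')
  have hi3 {w w' v : Finset (Fin s)} (hv : v ∈ w.powerset) :=
    integrable_finsetSum w'.powerset fun v' hv' => hi4 (v' := v') hv hv'
  have hi2 (w w' : Finset (Fin s)) :=
    integrable_finsetSum w.powerset fun v hv => hi3 (w' := w') (v := v) hv
  rw [integral_finsetSum _ fun w _ => integrable_finsetSum _ fun w' _ => hi2 w w']
  refine Finset.sum_le_sum fun w hw => ?_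
  rw [integral_finsetSum _ fun w' _ => hi2 w w']
  have hterm (w' : Finset (Fin s)) :
      ∫ o, ∑ v ∈ w.powerset, ∑ v' ∈ w'.powerset, Z w v o * Z w' v' o ∂P
        = ∑ v ∈ w.powerset, ∑ v' ∈ w'.powerset, ∫ o, Z w v o * Z w' v' o ∂P := by
    rw [integral_finsetSum _ fun v hv => hi3 hv]
    exact Finset.sum_congr rfl fun v hv => integral_finsetSum _ fun v' hv' => hi4 hv hv'
  rw [Finset.sum_eq_single_of_mem w hw]
  · rw [hterm, sq, Finset.sum_mul_sum, Finset.mul_sum]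
    refine Finset.sum_le_sum fun v hv => ?_
    rw [Finset.mul_sum]
    refine Finset.sum_le_sum fun v' hv' => ?_
    have hne : w.Nonempty := (Finset.mem_filter.1 hw).2
    exact hK.integral_sum_mul_sum_le hGm hG hS hb hα (Finset.mem_powerset.1 hv)
      (Finset.mem_powerset.1 hv') hne (hx w hne)
  · intro w' _ hne
    rw [hterm]
    refine Finset.sum_eq_zero fun v hv => Finset.sum_eq_zero fun v' hv' => ?_
    exact hK.integral_sum_mul_sum_eq_zero hGm hG hS hb (Finset.mem_powerset.1 hv)
      (Finset.mem_powerset.1 hv') hne.symm x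

end IsErrKernel

end abstractBound

end BDIS

namespace BDIS

/-! ### The kernels of the importance sampling estimator -/

/-- The one-dimensional factors of the error terms. -/
noncomputable def errKernel (φ : ℝ → ℝ) (p : ℝ) {s : ℕ} (θ : Fin s → ℝ) (v : Finset (Fin s))
    (j : Fin s) (u y : ℝ) : ℝ :=
  if j ∈ v then psi φ p (θ j) u y else wTheta p (θ j) u - 1

/-- Bounds for the Haar coefficients of `errKernel`. -/
noncomputable def errBound (φ : ℝ → ℝ) (c κ a α : ℝ) {s : ℕ} (θ : Fin s → ℝ) (v : Finset (Fin s))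
    (j : Fin s) (y : ℝ) : ℝ :=
  if j ∈ v then c * (θ j ^ (-(κ * (1 + α)) / 2) * tail φ y ^ (-a))
  else √(32 * θ j ^ (1 - α))

/-- Interpolation between second moment `2θ` and variation 4; the factor 32 absorbs `2^(1-α) *
16^α`. -/
theorem haarDist_wTheta_sub_one_le {p θ α : ℝ} {b : ℕ} (hb : 0 < b) (hp : 1 ≤ p) (hθ : 0 < θ)
    (hθ' : θ ≤ 1 / 2) (hα0 : 0 ≤ α) (hα : α ≤ 1) (k : ℕ) :
    haarDist b k (fun u => wTheta p θ u - 1) ≤ ((b : ℝ) ^ k) ^ (-α) * (32 * θ ^ (1 - α)) := by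
  have hw : BddMeas (wTheta p θ) := ⟨measurable_wTheta, 2, fun u _ => by
    rw [abs_of_nonneg (wTheta_nonneg hp hθ hθ' u)]; exact wTheta_le_two hp hθ hθ' u⟩
  have hV : VarLE (fun u => wTheta p θ u - 1) 4 := by
    have := (varLE_wTheta hp hθ hθ').add (VarLE.const (-1))
    simpa [sub_eq_add_neg] using this
  refine (haarDist_le_interp hb k (hw.sub_const 1) hV (integral_sq_wTheta_sub_one_le hp hθ hθ')
    hα0 hα).trans (mul_le_mul_of_nonneg_left ?_ (by positivity))
  rw [Real.mul_rpow (by norm_num) hθ.le]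
  have h1 : (2 : ℝ) ^ (1 - α) ≤ 2 := by
    simpa using Real.rpow_le_rpow_of_exponent_le (x := 2) (by norm_num) (show 1 - α ≤ 1 by linarith)
  have h2 : ((4 : ℝ) ^ 2) ^ α ≤ 16 := by
    have := Real.rpow_le_rpow_of_exponent_le (x := 16) (by norm_num) hα
    norm_num at this ⊢
    exact this
  calc (2 : ℝ) ^ (1 - α) * θ ^ (1 - α) * ((4 : ℝ) ^ 2) ^ α ≤ 2 * θ ^ (1 - α) * 16 := by gcongr
    _ = _ := by ring

/-- With `W = C (τ/θ)^κ`, interpolation bounds the distance for `φ ψ` by a multiple of `(Wτ)^(1-α)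
W^(2α) = W^(1+α) τ^(1-α)`. Dividing by `φ(y)²` with the light-tail bound gives the powers of `θ` and
`τ` on the right. -/
theorem exists_haarDist_psi_le {φ : ℝ → ℝ} (hφ : IsLightTailedDensity φ) {p κ α a : ℝ} (hp : 1 ≤ p)
    (hκ0 : 0 ≤ κ) (hκ : κ < 1) (hα0 : 0 ≤ α) (hα : α ≤ 1) (ha : (1 + α) * (1 - κ) < 2 * a) :
    ∃ c : ℝ, 0 < c ∧ ∀ (b : ℕ) (θ y : ℝ) (k : ℕ), 0 < b → 0 < θ → θ ≤ 1 / 2 →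
      haarDist b k (fun u => psi φ p θ u y) ≤ ((b : ℝ) ^ k) ^ (-α) *
        (c * (θ ^ (-(κ * (1 + α)) / 2) * tail φ y ^ (-a))) ^ 2 := by
  obtain ⟨C, hC, hbd⟩ := exists_psi_bounds hφ hp hκ0 hκ
  -- Chosen so that `κ(1+α) + (1-α) - 2(1+ε) = -2a`.
  set ε := (2 * a - (1 + α) * (1 - κ)) / 2 with hε
  obtain ⟨c, hc, htail⟩ := hφ.exists_tail_le (ε := ε) (by rw [hε]; linarith)
  have hC0 : 0 < C := by linarith
  refine ⟨√(32 * C ^ (1 + α)) / c, by positivity, fun b θ y k hb hθ hθ' => ?_⟩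
  obtain ⟨h1, -, h3, h4⟩ := hbd θ y hθ hθ'
  set τ := tail φ y
  have hτ : 0 < τ := hφ.tail_pos y
  set W := C * (τ / θ) ^ κ with hW
  have hW0 : 0 < W := by positivity
  have hpos := hφ.pos y
  have hmeas : BddMeas fun u => φ y * psi φ p θ u y :=
    ⟨((measurable_psi hφ hp hθ hθ').comp (measurable_id.prodMk measurable_const)).const_mul _,
      W, h1⟩
  have h5 := haarDist_le_interp hb k hmeas h4 h3 hα0 hα
  rw [haarDist_const_mul] at h5
  clear_value W
  have h6 : (2 * W * τ) ^ (1 - α) * ((4 * W) ^ 2) ^ α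
      ≤ 32 * C ^ (1 + α) * (θ ^ (-(κ * (1 + α))) * τ ^ (κ * (1 + α) + (1 - α))) := by
    have e1 : (2 : ℝ) ^ (1 - α) ≤ 2 := by
      simpa using
        Real.rpow_le_rpow_of_exponent_le (x := 2) (by norm_num) (show 1 - α ≤ 1 by linarith)
    have e2 : (16 : ℝ) ^ α ≤ 16 := by
      simpa using Real.rpow_le_rpow_of_exponent_le (x := 16) (by norm_num) hα
    have e3 : W ^ (1 + α) = C ^ (1 + α) * (θ ^ (-(κ * (1 + α))) * τ ^ (κ * (1 + α))) := by
      rw [hW, Real.mul_rpow hC0.le (by positivity), ← Real.rpow_mul (by positivity),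
        Real.div_rpow hτ.le hθ.le, Real.rpow_neg hθ.le, div_eq_mul_inv]
      ring
    calc (2 * W * τ) ^ (1 - α) * ((4 * W) ^ 2) ^ α
        = (2 : ℝ) ^ (1 - α) * 16 ^ α * (W ^ (1 + α) * τ ^ (1 - α)) := by
          rw [Real.mul_rpow (by positivity) hτ.le, Real.mul_rpow (by norm_num) hW0.le, mul_pow,
            Real.mul_rpow (by norm_num) (by positivity), ← Real.rpow_natCast W 2,
            ← Real.rpow_mul hW0.le,
            show 1 + α = (1 - α) + ((2 : ℕ) : ℝ) * α by push_cast; ring, Real.rpow_add hW0]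
          norm_num
          ring
      _ ≤ 2 * 16 * (W ^ (1 + α) * τ ^ (1 - α)) := by gcongr
      _ = _ := by
          rw [e3, Real.rpow_add hτ]; ring
  have h7 : haarDist b k (fun u => psi φ p θ u y) ≤ ((b : ℝ) ^ k) ^ (-α) *
      (32 * C ^ (1 + α) * (θ ^ (-(κ * (1 + α))) * τ ^ (κ * (1 + α) + (1 - α)))) / φ y ^ 2 := by
    rw [le_div_iff₀ (by positivity), mul_comm]
    exact h5.trans (by gcongr)
  refine h7.trans ?_
  have hlow : (c * τ ^ (1 + ε)) ^ 2 ≤ φ y ^ 2 := by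
    have := htail y
    gcongr
  refine (div_le_div_of_nonneg_left (by positivity) (by positivity) hlow).trans (le_of_eq ?_)
  have e4 : (θ ^ (-(κ * (1 + α)) / 2)) ^ 2 = θ ^ (-(κ * (1 + α))) := by
    rw [← Real.rpow_natCast, ← Real.rpow_mul hθ.le]; congr 1; push_cast; ring
  have e5 : (τ ^ (-a)) ^ 2 = τ ^ (κ * (1 + α) + (1 - α)) / (τ ^ (1 + ε)) ^ 2 := by
    rw [← Real.rpow_natCast, ← Real.rpow_natCast, ← Real.rpow_mul hτ.le, ← Real.rpow_mul hτ.le,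
      ← Real.rpow_sub hτ]
    congr 1; rw [hε]; push_cast; ring
  rw [mul_pow, mul_pow, mul_pow, e4, e5, div_pow, Real.sq_sqrt (by positivity)]
  field_simp

/-- Purely qualitative: the constant may depend on `θ`, since it is needed for integrability only.
-/
theorem exists_abs_psi_le {φ : ℝ → ℝ} (hφ : IsLightTailedDensity φ) {p a : ℝ} (hp : 1 ≤ p)
    (ha : 0 < a) {θ : ℝ} (hθ : 0 < θ) (hθ' : θ ≤ 1 / 2) :
    ∃ c : ℝ, ∀ y, ∀ u ∈ Set.Icc (0 : ℝ) 1, |psi φ p θ u y| ≤ c * tail φ y ^ (-a) := by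
  set κ := max 0 (1 - a / 2) with hκ
  obtain ⟨C, hC, hbd⟩ := exists_psi_bounds hφ hp (κ := κ) (le_max_left _ _)
    (max_lt zero_lt_one (by linarith))
  obtain ⟨c, hc, htail⟩ := hφ.exists_tail_le (half_pos ha)
  refine ⟨C * θ ^ (-κ) / c, fun y u hu => ?_⟩
  have h1 := (hbd θ y hθ hθ').1 u hu
  set τ := tail φ y
  have hτ : 0 < τ := hφ.tail_pos y
  have hpos := hφ.pos y
  rw [abs_mul, abs_of_pos hpos, mul_comm, ← le_div_iff₀ hpos] at h1
  refine h1.trans ((div_le_div_of_nonneg_left (by positivity) (by positivity) (htail y)).trans ?_)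
  have e : τ ^ κ ≤ τ ^ (-a) * τ ^ (1 + a / 2) := by
    rw [← Real.rpow_add hτ]
    refine Real.rpow_le_rpow_of_exponent_ge hτ (hφ.tail_le_one y) ?_
    linarith [le_max_right 0 (1 - a / 2)]
  rw [Real.div_rpow hτ.le hθ.le, Real.rpow_neg hθ.le, div_le_iff₀ (by positivity)]
  calc C * (τ ^ κ / θ ^ κ) ≤ C * (τ ^ (-a) * τ ^ (1 + a / 2) / θ ^ κ) := by gcongr
    _ = C * (θ ^ κ)⁻¹ / c * τ ^ (-a) * (c * τ ^ (1 + a / 2)) := by field_simp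

theorem exists_isErrKernel {φ : ℝ → ℝ} (hφ : IsLightTailedDensity φ) {p κ α a : ℝ} (hp : 1 ≤ p)
    (hκ0 : 0 ≤ κ) (hκ : κ < 1) (hα0 : 0 ≤ α) (hα : α ≤ 1) (ha0 : 0 < a)
    (ha : (1 + α) * (1 - κ) < 2 * a) :
    ∃ c : ℝ, 0 < c ∧ ∀ (b s : ℕ) (θ : Fin s → ℝ), 0 < b → (∀ j, 0 < θ j ∧ θ j ≤ 1 / 2) →
      ∃ M, IsErrKernel b α M (errKernel φ p θ) (errBound φ c κ a α θ) := by
  obtain ⟨c, hc, hdist⟩ := exists_haarDist_psi_le hφ hp hκ0 hκ hα0 hα ha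
  refine ⟨c, hc, fun b s θ hb hθ => ?_⟩
  choose D hD using fun j => exists_abs_psi_le hφ hp ha0 (hθ j).1 (hθ j).2
  have hpos1 (j : Fin s) : 0 < c * θ j ^ (-(κ * (1 + α)) / 2) := by
    have := (hθ j).1
    positivity
  have hpos2 (j : Fin s) : 0 < √(32 * θ j ^ (1 - α)) := by
    have := (hθ j).1
    positivity
  -- There are finitely many coordinates, so a single `M` serves them all; it may depend on `s` and
  -- `θ`.
  obtain ⟨M₁, hM₁⟩ := Finite.bddAbove_range fun j => D j / (c * θ j ^ (-(κ * (1 + α)) / 2))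
  obtain ⟨M₂, hM₂⟩ := Finite.bddAbove_range fun j => 1 / √(32 * θ j ^ (1 - α))
  have hw0 (j : Fin s) := wTheta_nonneg hp (hθ j).1 (hθ j).2
  have hw2 (j : Fin s) := wTheta_le_two hp (hθ j).1 (hθ j).2
  refine ⟨max M₁ M₂, ⟨fun v j => ?_, fun v j y => ?_, fun v j y => ?_,
    fun v j y k => ?_, fun v j y u hu => ?_⟩⟩
  · unfold errKernel
    split_ifs
    · exact measurable_psi hφ hp (hθ j).1 (hθ j).2
    · exact (measurable_wTheta.comp measurable_fst).sub_const 1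
  · unfold errKernel
    split_ifs
    · obtain ⟨_, _, hbd⟩ := exists_psi_bounds hφ hp hκ0 hκ
      exact (hbd (θ j) y (hθ j).1 (hθ j).2).2.1
    · rw [integral_sub (integrable_wTheta hp (hθ j).1 (hθ j).2 unif) (integrable_const _),
        integral_wTheta_unif hp (hθ j).1 (hθ j).2]
      simp
  · unfold errBound
    have := (hθ j).1
    have := hφ.tail_pos y
    split_ifs <;> positivity
  · unfold errKernel errBound
    split_ifs
    · exact hdist b (θ j) y k hb (hθ j).1 (hθ j).2
    · have := (hθ j).1
      rw [Real.sq_sqrt (by positivity)]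
      exact haarDist_wTheta_sub_one_le hb hp (hθ j).1 (hθ j).2 hα0 hα k
  · unfold errKernel errBound
    have hτ := hφ.tail_pos y
    split_ifs
    · refine (hD j y u hu).trans ?_
      rw [← mul_assoc c, ← mul_assoc]
      refine mul_le_mul_of_nonneg_right ?_ (by positivity)
      rw [← div_le_iff₀ (hpos1 j)]
      exact (hM₁ (Set.mem_range_self j)).trans (le_max_left _ _)
    · have h1 : |wTheta p (θ j) u - 1| ≤ 1 := by
        rw [abs_le]; constructor <;> linarith [hw0 j u, hw2 j u]
      refine h1.trans ?_
      rw [← div_le_iff₀ (hpos2 j)]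
      exact (hM₂ (Set.mem_range_self j)).trans (le_max_right _ _)

/-! ### Product densities -/

/-- A product of measures with densities has the product density. -/
theorem pi_withDensity_ofReal {ι : Type*} [Fintype ι] {μ : ι → Measure ℝ} [∀ j, SigmaFinite (μ j)]
    {g : ι → ℝ → ℝ} (hg0 : ∀ j x, 0 ≤ g j x) (hg : ∀ j, Integrable (g j) (μ j)) :
    Measure.pi (fun j => (μ j).withDensity fun x => ENNReal.ofReal (g j x))
      = (Measure.pi μ).withDensity fun x => ENNReal.ofReal (∏ j, g j (x j)) := by
  have hfin (j : ι) : IsFiniteMeasure ((μ j).withDensity fun x => ENNReal.ofReal (g j x)) :=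
    isFiniteMeasure_withDensity_ofReal (hg j).2
  refine Measure.pi_eq fun S hS => ?_
  have hint : Integrable (fun x : ι → ℝ => ∏ j, g j (x j)) (Measure.pi μ) :=
    Integrable.fintype_prod_dep hg
  rw [withDensity_apply _ (MeasurableSet.univ_pi hS),
    ← ofReal_integral_eq_lintegral_ofReal hint.integrableOn
      (ae_of_all _ fun x => Finset.prod_nonneg fun j _ => hg0 j _),
    ← integral_indicator (MeasurableSet.univ_pi hS)]
  have : (fun x : ι → ℝ => (Set.univ.pi S).indicator (fun x => ∏ j, g j (x j)) x)
      = fun x => ∏ j, (S j).indicator (g j) (x j) := by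
    ext x
    by_cases h : ∀ j, x j ∈ S j
    · rw [Set.indicator_of_mem (by simpa using h)]
      exact Finset.prod_congr rfl fun j _ => (Set.indicator_of_mem (h j) _).symm
    · rw [Set.indicator_of_notMem (by simpa using h)]
      push Not at h
      obtain ⟨j, hj⟩ := h
      exact (Finset.prod_eq_zero (Finset.mem_univ j) (Set.indicator_of_notMem hj _)).symm
  rw [this, integral_fintype_prod_eq_prod (fun j => (S j).indicator (g j)),
    ENNReal.ofReal_prod_of_nonneg]
  · refine Finset.prod_congr rfl fun j _ => ?_
    rw [integral_indicator (hS j), withDensity_apply _ (hS j),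
      ofReal_integral_eq_lintegral_ofReal (hg j).integrableOn (ae_of_all _ (hg0 j))]
  · exact fun j _ => integral_nonneg fun x => Set.indicator_nonneg (fun x _ => hg0 j x) _

/-- The transport map pulls null sets back to null sets. -/
theorem ae_transport {φ : ℝ → ℝ} (hφ : IsLightTailedDensity φ) {p : ℝ} (hp : 1 ≤ p) {s : ℕ}
    {θ : Fin s → ℝ} (hθ : ∀ j, 0 < θ j ∧ θ j ≤ 1 / 2) {Q : (Fin s → ℝ) → Prop}
    (hQ : ∀ᵐ x, Q x) :
    ∀ᵐ u ∂(Measure.pi fun _ : Fin s => unif), Q fun j => transport φ p (θ j) (u j) := by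
  have hT (j : Fin s) := measurable_transport hp (hθ j).1 (hθ j).2 hφ
  set m : Fin s → Measure ℝ := fun j => unif.withDensity fun u => ENNReal.ofReal (wTheta p (θ j) u)
    with hm
  have hfin (j : Fin s) : IsFiniteMeasure (m j) :=
    isFiniteMeasure_withDensity_ofReal (integrable_wTheta hp (hθ j).1 (hθ j).2 unif).2
  have hmap (j : Fin s) : (m j).map (transport φ p (θ j)) = nuOf φ :=
    map_transport hp (hθ j).1 (hθ j).2 hφ
  have := hφ.isProbabilityMeasure_nuOf
  have hsig (j : Fin s) : SigmaFinite ((m j).map (transport φ p (θ j))) := by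
    rw [hmap]; infer_instance
  have hpi : (Measure.pi m).map (fun u j => transport φ p (θ j) (u j)) = prodMeasure φ s := by
    rw [Measure.pi_map_pi fun j => (hT j).aemeasurable]
    simp only [hmap]
    rfl
  have hTm : Measurable fun (u : Fin s → ℝ) j => transport φ p (θ j) (u j) :=
    measurable_pi_lambda _ fun j => (hT j).comp (measurable_pi_apply j)
  have h1 : ∀ᵐ x ∂prodMeasure φ s, Q x := (hφ.prodMeasure_absolutelyContinuous s).ae_le hQ
  rw [← hpi] at h1
  have h2 := ae_of_ae_map hTm.aemeasurable h1
  refine Measure.AbsolutelyContinuous.ae_le ?_ h2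
  rw [hm, pi_withDensity_ofReal (fun j => wTheta_nonneg hp (hθ j).1 (hθ j).2)
    fun j => integrable_wTheta hp (hθ j).1 (hθ j).2 unif]
  refine withDensity_absolutelyContinuous' (Finset.measurable_prod _ fun j _ =>
    measurable_wTheta.comp (measurable_pi_apply j)).ennreal_ofReal.aemeasurable ?_
  have hae : ∀ᵐ u ∂(Measure.pi fun _ : Fin s => unif), ∀ j, u j ∈ Set.Ioo (0 : ℝ) 1 := by
    rw [ae_all_iff]
    exact fun j => (Measure.quasiMeasurePreserving_eval _ j).ae ae_unif_mem
  refine hae.mono fun u hu => ?_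
  simpa using Finset.prod_pos fun j _ => wTheta_pos hp (hθ j).1 (hθ j).2 (hu j)

end BDIS

/-! ### Expansion of the error and Hölder bounds for its terms -/

namespace BDIS

theorem IsErrKernel.integrable_integrand {s b : ℕ} {α M : ℝ} {μ : Measure (Fin s → ℝ)}
    {h : Finset (Fin s) → Fin s → ℝ → ℝ → ℝ} {G : Finset (Fin s) → (Fin s → ℝ) → ℝ}
    {A : Finset (Fin s) → Fin s → ℝ → ℝ} (hK : IsErrKernel b α M h A)
    (hGm : ∀ v, Measurable (G v))
    (hG : ∀ w v, v ⊆ w → Integrable (fun y => (∏ j ∈ w, A v j (y j)) * |G v y|) μ)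
    {w v : Finset (Fin s)} (hv : v ⊆ w) {u : Fin s → ℝ} (hu : ∀ j, u j ∈ Set.Icc (0 : ℝ) 1) :
    Integrable (fun y => (∏ j ∈ w, h v j (u j) (y j)) * G v y) μ := by
  refine ((hG w v hv).const_mul (M ^ w.card)).mono' (Measurable.aestronglyMeasurable
    (((hK.measurable_prod w v).comp (measurable_const.prodMk measurable_id)).mul (hGm v)))
    (ae_of_all _ fun y => ?_)
  rw [Real.norm_eq_abs, abs_mul, ← mul_assoc]
  exact mul_le_mul_of_nonneg_right (hK.abs_prod_le w v hu y) (abs_nonneg _)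

/-- Write the factor at `j ∉ v` as `(a j - 1) + 1` and the one at `j ∈ v` as `a j * k j + 0`, and
expand; the zeros remove every `w` not containing `v`. -/
theorem prod_mul_prod_eq_sum {ι : Type*} [Fintype ι] [DecidableEq ι] (v : Finset ι) (a k : ι → ℝ) :
    (∏ j, a j) * ∏ j ∈ v, k j
      = ∑ w : Finset ι, if v ⊆ w then ∏ j ∈ w, (if j ∈ v then a j * k j else a j - 1) else 0 := by
  have e : (∏ j, a j) * ∏ j ∈ v, k j
      = ∏ j, ((if j ∈ v then a j * k j else a j - 1) + if j ∈ v then 0 else 1) := by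
    rw [← Finset.univ_inter v, ← Finset.prod_ite_mem, Finset.univ_inter, ← Finset.prod_mul_distrib]
    refine Finset.prod_congr rfl fun j _ => ?_
    split_ifs <;> ring
  rw [e, prod_add_eq_sum_ite]
  refine Finset.sum_congr rfl fun w _ => ?_
  split_ifs with h
  · rw [← Finset.univ_inter w, ← Finset.prod_ite_mem, Finset.univ_inter]
    refine Finset.prod_congr rfl fun j _ => ?_
    by_cases hj : j ∈ w
    · simp [hj]
    · have : j ∉ v := fun hjv => hj (h hjv)
      simp [hj, this]
  · obtain ⟨j, hjv, hjw⟩ := Finset.not_subset.1 h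
    exact Finset.prod_eq_zero (Finset.mem_univ j) (by simp [hjv, hjw])

section representation

variable {φ : ℝ → ℝ} (hφ : IsLightTailedDensity φ) {s : ℕ} {f : (Fin s → ℝ) → ℝ}
  {G : Finset (Fin s) → (Fin s → ℝ) → ℝ} {c ζ : ℝ → ℝ} (hk : KernBound φ c ζ)
  (hadm : ∀ v, Admissible φ ζ v (G v)) (hf : ∀ᵐ x, f x = ∑ v, rep φ v (G v) x)
include hφ hk hadm

theorem integrable_rep_prodMeasure (v : Finset (Fin s)) :
    Integrable (rep φ v (G v)) (prodMeasure φ s) := by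
  have := integrable_rep_piecewise hφ hk (hadm v) Finset.univ 0
  simpa only [Finset.piecewise_univ] using this

theorem integral_rep (v : Finset (Fin s)) :
    ∫ x, rep φ v (G v) x ∂prodMeasure φ s = if v = ∅ then ∫ y, G ∅ y ∂prodMeasure φ s else 0 := by
  have h := partialMean_rep hφ hk (hadm v) Finset.univ 0
  simp only [partialMean, Finset.piecewise_univ] at h
  rw [h]
  by_cases hv : v = ∅
  · subst hv; simp [rep]
  · rw [if_neg hv, if_neg]
    obtain ⟨j, hj⟩ := Finset.nonempty_iff_ne_empty.2 hv
    exact fun hd => Finset.disjoint_left.1 hd hj (Finset.mem_univ j)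

include hf

theorem integrable_prodMeasure_of_rep : Integrable f (prodMeasure φ s) := by
  have h : ∀ᵐ x ∂prodMeasure φ s, f x = ∑ v, rep φ v (G v) x :=
    (hφ.prodMeasure_absolutelyContinuous s).ae_le hf
  exact (integrable_finsetSum Finset.univ fun v _ => integrable_rep_prodMeasure hφ hk hadm v).congr
    (h.mono fun x hx => hx.symm)

theorem integrable_mul_prod_density : Integrable fun y => f y * ∏ j, φ (y j) := by
  have := hφ.integrable_prodMeasure_iff.1 (integrable_prodMeasure_of_rep hφ hk hadm hf)
  simpa only [mul_comm] using this

theorem integral_mul_prod_density :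
    ∫ y, f y * ∏ j, φ (y j) = ∫ y, G ∅ y ∂prodMeasure φ s := by
  have h : ∀ᵐ x ∂prodMeasure φ s, f x = ∑ v, rep φ v (G v) x :=
    (hφ.prodMeasure_absolutelyContinuous s).ae_le hf
  have h1 : ∫ y, f y * ∏ j, φ (y j) = ∫ y, f y ∂prodMeasure φ s := by
    rw [hφ.integral_prodMeasure]; simp only [mul_comm]
  rw [h1, integral_congr_ae h,
    integral_finsetSum _ fun v _ => integrable_rep_prodMeasure hφ hk hadm v]
  simp [integral_rep hφ hk hadm]

/-- The error of the transformed integrand, as a sum over sets of coordinates. -/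
theorem fW_sub_integral_eq {p : ℝ} (hp : 1 ≤ p) {θ : Fin s → ℝ}
    (hθ : ∀ j, 0 < θ j ∧ θ j ≤ 1 / 2) {b : ℕ} {α M : ℝ} {A : Finset (Fin s) → Fin s → ℝ → ℝ}
    (hK : IsErrKernel b α M (errKernel φ p θ) A)
    (hG : ∀ w v, v ⊆ w → Integrable (fun y => (∏ j ∈ w, A v j (y j)) * |G v y|)
      (prodMeasure φ s)) :
    ∀ᵐ u ∂(Measure.pi fun _ : Fin s => unif), fW φ p θ f u - ∫ y, f y * ∏ j, φ (y j)
      = ∑ w : Finset (Fin s) with w.Nonempty, ∑ v ∈ w.powerset,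
        errTerm (prodMeasure φ s) (errKernel φ p θ) G w v u := by
  have hae : ∀ᵐ u ∂(Measure.pi fun _ : Fin s => unif), ∀ j, u j ∈ Set.Icc (0 : ℝ) 1 := by
    rw [ae_all_iff]
    exact fun j => (Measure.quasiMeasurePreserving_eval _ j).ae BddMeas.ae_mem
  filter_upwards [ae_transport hφ hp hθ hf, hae] with u hu hcube
  have hI := integral_mul_prod_density hφ hk hadm hf
  have hmain (v : Finset (Fin s)) : (∏ j, wTheta p (θ j) (u j)) *
      rep φ v (G v) (fun j => transport φ p (θ j) (u j))
      = ∑ w : Finset (Fin s), if v ⊆ w then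
        errTerm (prodMeasure φ s) (errKernel φ p θ) G w v u else 0 := by
    have e (y : Fin s → ℝ) : (∏ j, wTheta p (θ j) (u j)) *
        ((∏ j ∈ v, kern φ (transport φ p (θ j) (u j)) (y j)) * G v y)
        = ∑ w : Finset (Fin s), if v ⊆ w then
          (∏ j ∈ w, errKernel φ p θ v j (u j) (y j)) * G v y else 0 := by
      rw [← mul_assoc, prod_mul_prod_eq_sum, Finset.sum_mul]
      refine Finset.sum_congr rfl fun w _ => ?_
      rw [ite_mul, zero_mul]
      rfl
    rw [rep, ← integral_const_mul]
    simp only [e]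
    rw [integral_finsetSum]
    · refine Finset.sum_congr rfl fun w _ => ?_
      split_ifs
      · rfl
      · simp
    · intro w _
      split_ifs with hvw
      · exact hK.integrable_integrand (fun v => (hadm v).1) hG hvw hcube
      · exact integrable_zero _ _ _
  have hsum : fW φ p θ f u = ∑ w : Finset (Fin s), ∑ v ∈ w.powerset,
      errTerm (prodMeasure φ s) (errKernel φ p θ) G w v u := by
    rw [fW, hu, Finset.mul_sum]
    simp only [hmain]
    rw [Finset.sum_comm]
    refine Finset.sum_congr rfl fun w _ => ?_
    rw [← Finset.sum_filter]
    refine Finset.sum_congr ?_ fun _ _ => rfl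
    ext v
    simp
  have hfil : Finset.univ.filter (fun w : Finset (Fin s) => w.Nonempty) = Finset.univ.erase ∅ := by
    ext w
    simp [Finset.nonempty_iff_ne_empty]
  -- The term of the empty set is the mean of `G ∅`, which is the integral being estimated.
  rw [hsum, hI, hfil, ← Finset.add_sum_erase _ _ (Finset.mem_univ (∅ : Finset (Fin s)))]
  simp [errTerm]

end representation

section bounds

variable {φ : ℝ → ℝ} {c κ a α : ℝ} {s : ℕ} {θ : Fin s → ℝ}

theorem prod_errBound {w v : Finset (Fin s)} (hv : v ⊆ w) (y : Fin s → ℝ) :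
    ∏ j ∈ w, errBound φ c κ a α θ v j (y j)
      = (∏ j ∈ v, c * θ j ^ (-(κ * (1 + α)) / 2)) * (∏ j ∈ w \ v, √(32 * θ j ^ (1 - α))) *
        ∏ j ∈ v, tail φ (y j) ^ (-a) := by
  rw [← Finset.prod_sdiff hv, mul_comm, mul_right_comm, ← Finset.prod_mul_distrib]
  congr 1
  · refine Finset.prod_congr rfl fun j hj => ?_
    rw [errBound, if_pos hj, mul_assoc]
  · refine Finset.prod_congr rfl fun j hj => ?_
    rw [errBound, if_neg (Finset.mem_sdiff.1 hj).2]

theorem integrable_prod_errBound_mul (hφ : IsLightTailedDensity φ) {q q' : ℝ}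
    (hq : q.HolderConjugate q') (ha : a * q' < 1) {G : Finset (Fin s) → (Fin s → ℝ) → ℝ}
    (hGm : ∀ v, Measurable (G v)) (hGl : ∀ v, MemLp (G v) (ENNReal.ofReal q) (prodMeasure φ s))
    (w v : Finset (Fin s)) (hv : v ⊆ w) :
    Integrable (fun y => (∏ j ∈ w, errBound φ c κ a α θ v j (y j)) * |G v y|)
      (prodMeasure φ s) := by
  have h := (admissible_of_memLp hφ hq ha (v := v) (hGm v) (hGl v)).2.abs.const_mul
    ((∏ j ∈ v, c * θ j ^ (-(κ * (1 + α)) / 2)) * (∏ j ∈ w \ v, √(32 * θ j ^ (1 - α))))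
  refine h.congr (ae_of_all _ fun y => ?_)
  simp only
  rw [prod_errBound hv, abs_mul, abs_of_nonneg (Finset.prod_nonneg fun j _ =>
    Real.rpow_nonneg (hφ.tail_pos (y j)).le _), ← mul_assoc]

/-- Hölder in `y`. All constants are products over coordinates, so the sum over subsets can later be
factorised. -/
theorem integral_prod_errBound_mul_le (hφ : IsLightTailedDensity φ) {q q' : ℝ}
    (hq : q.HolderConjugate q') (ha : a * q' < 1) (hc : 0 ≤ c) (hθ : ∀ j, 0 < θ j)
    {D : (Fin s → ℝ) → ℝ} (hD : MemLp D (ENNReal.ofReal q) (prodMeasure φ s))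
    {w v : Finset (Fin s)} (hv : v ⊆ w) :
    ∫ y, (∏ j ∈ w, errBound φ c κ a α θ v j (y j)) * |D y| ∂prodMeasure φ s
      ≤ (∏ j ∈ v, c * (∫ y, tail φ y ^ (-(a * q')) ∂nuOf φ) ^ (1 / q') *
          θ j ^ (-(κ * (1 + α)) / 2)) * (∏ j ∈ w \ v, √(32 * θ j ^ (1 - α))) *
        (∫ y, |D y| ^ q ∂prodMeasure φ s) ^ (1 / q) := by
  set L := (∫ y, tail φ y ^ (-(a * q')) ∂nuOf φ) ^ (1 / q') with hL
  have e : ∀ y, (∏ j ∈ w, errBound φ c κ a α θ v j (y j)) * |D y|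
      = ((∏ j ∈ v, c * θ j ^ (-(κ * (1 + α)) / 2)) * (∏ j ∈ w \ v, √(32 * θ j ^ (1 - α)))) *
        ((∏ j ∈ v, tail φ (y j) ^ (-a)) * |D y|) := fun y => by
    rw [prod_errBound hv]; ring
  simp only [e]
  rw [integral_const_mul]
  have hpos : 0 ≤ (∏ j ∈ v, c * θ j ^ (-(κ * (1 + α)) / 2)) *
      (∏ j ∈ w \ v, √(32 * θ j ^ (1 - α))) :=
    mul_nonneg (Finset.prod_nonneg fun j _ => mul_nonneg hc (Real.rpow_nonneg (hθ j).le _))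
      (Finset.prod_nonneg fun j _ => Real.sqrt_nonneg _)
  refine (mul_le_mul_of_nonneg_left (integral_prod_tail_mul_le hφ hq ha v hD) hpos).trans_eq ?_
  rw [← hL, ← Finset.prod_const]
  have : ∏ j ∈ v, c * L * θ j ^ (-(κ * (1 + α)) / 2)
      = (∏ j ∈ v, c * θ j ^ (-(κ * (1 + α)) / 2)) * ∏ _j ∈ v, L := by
    rw [← Finset.prod_mul_distrib]
    exact Finset.prod_congr rfl fun j _ => by ring
  rw [this]
  ring

end bounds

end BDIS

/-! ### Summation over sets of coordinates, constants and exponents -/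

namespace BDIS

/-- From `(1+x)^λ ≤ 1 + x^λ ≤ exp(x^λ)`; this is where `1/λ` arises. -/
theorem one_add_le_exp_rpow {x lam : ℝ} (hx : 0 ≤ x) (h0 : 0 < lam) (h1 : lam ≤ 1) :
    1 + x ≤ Real.exp (x ^ lam / lam) := by
  have h : (1 + x) ^ lam ≤ Real.exp (x ^ lam) := by
    have h2 := Real.rpow_add_le_add_rpow zero_le_one hx h0.le h1
    rw [Real.one_rpow] at h2
    have h3 := Real.add_one_le_exp (x ^ lam)
    linarith
  have h4 := Real.rpow_le_rpow (by positivity) h (inv_nonneg.2 h0.le)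
  rwa [Real.rpow_rpow_inv (by positivity) h0.ne', ← Real.exp_mul, ← div_eq_mul_inv] at h4

/-- The sum over all subsets is `∏ (1 + y j)`, so no factor depends on the number of coordinates. -/
theorem sum_nonempty_prod_le_exp {ι : Type*} [Fintype ι] [DecidableEq ι] {y : ι → ℝ}
    (hy : ∀ j, 0 ≤ y j) {lam : ℝ} (h0 : 0 < lam) (h1 : lam ≤ 1) :
    ∑ w : Finset ι with w.Nonempty, ∏ j ∈ w, y j ≤ Real.exp ((∑ j, y j ^ lam) / lam) := by
  calc ∑ w : Finset ι with w.Nonempty, ∏ j ∈ w, y j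
      ≤ ∑ w ∈ Finset.univ.powerset, ∏ j ∈ w, y j := by
        rw [Finset.powerset_univ]
        exact Finset.sum_le_sum_of_subset_of_nonneg (Finset.filter_subset _ _)
          fun w _ _ => Finset.prod_nonneg fun j _ => hy j
    _ = ∏ j, (1 + y j) := (Finset.prod_one_add _).symm
    _ ≤ ∏ j, Real.exp (y j ^ lam / lam) :=
        Finset.prod_le_prod (fun j _ => by linarith [hy j])
          fun j _ => one_add_le_exp_rpow (hy j) h0 h1
    _ = _ := by rw [← Real.exp_sum, Finset.sum_div]

/-- Cauchy–Schwarz over the `2^|w|` subsets; the sum of squares is the expansion of a product, and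
the power of 2 is shared among the coordinates. -/
theorem sq_sum_powerset_le {ι : Type*} [DecidableEq ι] {w : Finset ι} {X g : Finset ι → ℝ}
    {A B Γ : ι → ℝ} {N : ℝ} (hX0 : ∀ v ∈ w.powerset, 0 ≤ X v)
    (hX : ∀ v ∈ w.powerset, X v ≤ (∏ j ∈ v, A j) * (∏ j ∈ w \ v, B j) * g v)
    (hg : ∀ v, g v ^ 2 ≤ N ^ 2 * ∏ j ∈ v, Γ j ^ 2) :
    (∑ v ∈ w.powerset, X v) ^ 2 ≤ N ^ 2 * ∏ j ∈ w, 2 * (A j ^ 2 * Γ j ^ 2 + B j ^ 2) := by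
  have h1 : (∑ v ∈ w.powerset, X v) ^ 2 ≤ 2 ^ w.card * ∑ v ∈ w.powerset, X v ^ 2 := by
    have := sq_sum_le_card_mul_sum_sq (s := w.powerset) (f := X)
    rwa [Finset.card_powerset, Nat.cast_pow, Nat.cast_ofNat] at this
  have h2 (v) (hv : v ∈ w.powerset) :
      X v ^ 2 ≤ N ^ 2 * ((∏ j ∈ v, A j ^ 2 * Γ j ^ 2) * ∏ j ∈ w \ v, B j ^ 2) := by
    refine (pow_le_pow_left₀ (hX0 v hv) (hX v hv) 2).trans ?_
    rw [mul_pow, mul_pow, Finset.prod_mul_distrib]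
    simp only [Finset.prod_pow]
    have := mul_le_mul_of_nonneg_left (hg v)
      (mul_nonneg (sq_nonneg (∏ j ∈ v, A j)) (sq_nonneg (∏ j ∈ w \ v, B j)))
    rw [Finset.prod_pow] at this
    linarith
  refine h1.trans ((mul_le_mul_of_nonneg_left (Finset.sum_le_sum h2) (by positivity)).trans_eq ?_)
  rw [← Finset.mul_sum, ← Finset.prod_add, Finset.prod_mul_distrib, Finset.prod_const]
  ring

/-- `m + 1 ≤ 2m`, and the additive bound on `t` spreads the power of `b` over the coordinates of
`w`. -/
theorem netFactor_le {b m t : ℕ} {α : ℝ} (hb : 1 ≤ b) (hm : 1 ≤ m) (hα : 0 ≤ α) {ι : Type*}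
    {w : Finset ι} {τ : ι → ℝ} (ht : (t : ℝ) ≤ ∑ j ∈ w, τ j) :
    netFactor b m t w.card α ≤ ((b : ℝ) ^ m) ^ 2 / ((b : ℝ) ^ m) ^ (1 + α) *
      ∏ j ∈ w, (2 * m * (b : ℝ) ^ (1 + α) * (b : ℝ) ^ ((1 + α) * τ j)) := by
  have hb0 : (0 : ℝ) < b := by exact_mod_cast hb
  have hb1 : (1 : ℝ) ≤ b := by exact_mod_cast hb
  have hm1 : (1 : ℝ) ≤ m := by exact_mod_cast hm
  have e1 : netFactor b m t w.card α = ((b : ℝ) ^ m) ^ 2 / ((b : ℝ) ^ m) ^ (1 + α) *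
      (((m : ℝ) + 1) ^ w.card * ((b : ℝ) ^ (1 + α)) ^ w.card * (b : ℝ) ^ ((1 + α) * t)) := by
    have hpow (k : ℕ) (x : ℝ) : ((b : ℝ) ^ k) ^ x = (b : ℝ) ^ (k * x) := by
      rw [← Real.rpow_natCast, ← Real.rpow_mul hb0.le]
    have hpow' (k : ℕ) (x : ℝ) : ((b : ℝ) ^ x) ^ k = (b : ℝ) ^ (x * k) := by
      rw [← Real.rpow_natCast, ← Real.rpow_mul hb0.le]
    rw [netFactor, hpow, hpow', ← pow_mul, div_eq_mul_inv, ← Real.rpow_neg hb0.le]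
    simp only [← Real.rpow_natCast (b : ℝ)]
    have key : (b : ℝ) ^ ((m : ℕ) : ℝ) * (b : ℝ) ^ (((t + w.card : ℕ)) : ℝ) *
        ((b : ℝ) ^ (α * ((t : ℝ) + w.card)) * (b : ℝ) ^ (-α * (m : ℝ)))
        = (b : ℝ) ^ (((m * 2 : ℕ)) : ℝ) * (b : ℝ) ^ (-(m * (1 + α))) *
          ((b : ℝ) ^ ((1 + α) * w.card) * (b : ℝ) ^ ((1 + α) * t)) := by
      simp only [← Real.rpow_add hb0]
      congr 1
      push_cast
      ring
    linear_combination ((m : ℝ) + 1) ^ w.card * key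
  rw [e1]
  refine mul_le_mul_of_nonneg_left ?_ (by positivity)
  rw [Finset.prod_mul_distrib, Finset.prod_mul_distrib, Finset.prod_const, Finset.prod_const,
    ← Real.rpow_sum_of_pos hb0, ← Finset.mul_sum]
  gcongr
  linarith

/-- This fixes the constant in `Γ̃`: the 4 combines the 2 from `m + 1 ≤ 2m` with the 2 from the sum
over subsets, and the maximum covers both the kernel term and the weight term. -/
theorem gammaTilde_bound {b : ℕ} {α q ε c κ τ Γ θ m : ℝ} (hm : 0 ≤ m)
    (hθ : 0 < θ) (hθ1 : θ ≤ 1) (hκ : κ ≤ nu α q + ε) :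
    2 * m * (b : ℝ) ^ (1 + α) * (b : ℝ) ^ ((1 + α) * τ) *
      (2 * ((c * θ ^ (-κ / 2)) ^ 2 * Γ ^ 2 + √(32 * θ ^ (1 - α)) ^ 2))
      ≤ m * gammaTilde (4 * (b : ℝ) ^ (1 + α) * max (c ^ 2) 32) b α q ε τ Γ θ := by
  have h1 : (θ ^ (-κ / 2)) ^ 2 ≤ θ ^ (-nu α q - ε) := by
    rw [← Real.rpow_natCast, ← Real.rpow_mul hθ.le]
    refine Real.rpow_le_rpow_of_exponent_ge hθ hθ1 ?_
    push_cast
    linarith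
  have h2 : √(32 * θ ^ (1 - α)) ^ 2 = 32 * θ ^ (1 - α) := Real.sq_sqrt (by positivity)
  have h3 : (c * θ ^ (-κ / 2)) ^ 2 * Γ ^ 2 ≤ max (c ^ 2) 32 * (Γ ^ 2 * θ ^ (-nu α q - ε)) := by
    rw [mul_pow]
    calc c ^ 2 * (θ ^ (-κ / 2)) ^ 2 * Γ ^ 2
        ≤ max (c ^ 2) 32 * θ ^ (-nu α q - ε) * Γ ^ 2 := by
          gcongr
          exact le_max_left _ _
      _ = _ := by ring
  have h4 : 32 * θ ^ (1 - α) ≤ max (c ^ 2) 32 * θ ^ (1 - α) := by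
    gcongr
    exact le_max_right _ _
  rw [h2, gammaTilde]
  have h5 : 0 ≤ m * (b : ℝ) ^ (1 + α) * (b : ℝ) ^ ((1 + α) * τ) := by positivity
  have := mul_le_mul_of_nonneg_left (add_le_add h3 h4) h5
  linarith

theorem gammaTilde_nonneg {C : ℝ} (hC : 0 ≤ C) (b : ℕ) (α q ε τ Γ : ℝ) {θ : ℝ} (hθ : 0 < θ) :
    0 ≤ gammaTilde C b α q ε τ Γ θ := by
  unfold gammaTilde; positivity

theorem normWmix_nonneg {φ : ℝ → ℝ} {q : ℝ} {s : ℕ} (f : (Fin s → ℝ) → ℝ) :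
    0 ≤ normWmix φ q f :=
  Real.rpow_nonneg (Finset.sum_nonneg fun _ _ => integral_nonneg fun _ =>
    Real.rpow_nonneg (abs_nonneg _) _) _

/-- Squares remove any question about the signs of the `Γ j`. If `‖f‖_q = 0`, all terms vanish and
the conventional value of `γ_v` plays no role. -/
theorem normWmix_anova_sq_le {φ : ℝ → ℝ} {q : ℝ} {s : ℕ} {f : (Fin s → ℝ) → ℝ} {Γ : Fin s → ℝ}
    (hΓ : ∀ v : Finset (Fin s), gammaCoef φ q f v ≤ ∏ j ∈ v, Γ j) (v : Finset (Fin s)) :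
    normWmix φ q (anova φ f v) ^ 2 ≤ normQ φ q f ^ 2 * ∏ j ∈ v, Γ j ^ 2 := by
  have h0 := normWmix_nonneg (φ := φ) (q := q) (anova φ f v)
  rw [Finset.prod_pow, ← mul_pow]
  refine pow_le_pow_left₀ h0 ?_ 2
  have hle : normWmix φ q (anova φ f v) ≤ normQ φ q f :=
    le_ciSup (f := fun v => normWmix φ q (anova φ f v)) (Set.finite_range _).bddAbove v
  have h := hΓ v
  unfold gammaCoef at h
  split_ifs at h with hN
  · rwa [inv_mul_le_iff₀ hN] at h
  · have : normQ φ q f = 0 := le_antisymm (not_lt.1 hN) (h0.trans hle)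
    rw [this] at hle ⊢
    linarith

/-- A power of `m` with exponent below one is eventually dominated by `m`. -/
theorem mul_rpow_le_add {C δ lam m : ℝ} (hC : 0 < C) (hδ : 0 < δ) (h0 : 0 < lam) (h1 : lam < 1)
    (hm : 0 ≤ m) : C * m ^ lam ≤ δ * m + C * ((C / δ) ^ (1 / (1 - lam))) ^ lam := by
  set R := (C / δ) ^ (1 / (1 - lam)) with hR
  have hR0 : 0 < R := by positivity
  rcases le_total m R with h | h
  · have := Real.rpow_le_rpow hm h h0.le
    nlinarith [mul_nonneg hδ.le hm]
  · have hm0 : 0 < m := hR0.trans_le h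
    have h2 : C / δ ≤ m ^ (1 - lam) := by
      have := Real.rpow_le_rpow hR0.le h (by linarith : 0 ≤ 1 - lam)
      rwa [hR, ← Real.rpow_mul (by positivity), one_div, inv_mul_cancel₀ (by linarith),
        Real.rpow_one] at this
    have h3 : m ^ (1 - lam) * m ^ lam = m := by
      rw [← Real.rpow_add hm0]; simp
    have h4 := mul_le_mul_of_nonneg_right ((div_le_iff₀ hδ).1 h2) (Real.rpow_nonneg hm lam)
    have : 0 ≤ C * R ^ lam := by positivity
    nlinarith

/-- The exponents used in the proof of the error bound. -/
theorem exists_exponents {α q ε : ℝ} (hq : 1 < q) (hα0 : 0 < α) (hα1 : α < 1) (hε : 0 < ε) :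
    ∃ κ a q' : ℝ, 0 ≤ κ ∧ κ < 1 ∧ κ * (1 + α) ≤ nu α q + ε ∧ 0 < a ∧
      (1 + α) * (1 - κ) < 2 * a ∧ q.HolderConjugate q' ∧ a * q' < 1 := by
  have hq0 : 0 < q := by linarith
  have hqi : q⁻¹ < 1 := inv_lt_one_of_one_lt₀ hq
  have hqi0 : 0 < q⁻¹ := inv_pos.2 hq0
  have hn1 : 0 < nu α q := lt_of_lt_of_le (by positivity) (le_max_left _ _)
  have hn2 : 2 * q⁻¹ + α - 1 ≤ nu α q := by
    have := le_max_right (2 * α / q) (2 / q + α - 1)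
    rwa [div_eq_mul_inv] at this
  -- Here `k = κ(1+α)`. Exceeding `2/q + α - 1` leaves room for `a` between `(1+α-k)/2` and `1 -
  -- 1/q`, and `k < 1 + α` means `κ < 1`. Of the first entry of `ν` only the positivity matters.
  obtain ⟨k, hk1, hk2⟩ : ∃ k, max 0 (2 * q⁻¹ + α - 1) < k ∧ k < min (nu α q + ε) (1 + α) :=
    exists_between (by
      refine max_lt (lt_min ?_ ?_) (lt_min ?_ ?_) <;> linarith)
  rw [max_lt_iff] at hk1
  rw [lt_min_iff] at hk2
  have hα' : 0 < 1 + α := by linarith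
  obtain ⟨a, ha1, ha2⟩ := exists_between (a₁ := (1 + α - k) / 2) (a₂ := 1 - q⁻¹) (by linarith)
  have hk : k / (1 + α) * (1 + α) = k := div_mul_cancel₀ _ hα'.ne'
  refine ⟨k / (1 + α), a, Real.conjExponent q, by have := hk1.1; positivity, ?_, ?_, ?_, ?_,
    Real.HolderConjugate.conjExponent hq, ?_⟩
  · rw [div_lt_one hα']; exact hk2.2
  · rw [hk]; exact hk2.1.le
  · linarith
  · linarith
  · have hc := Real.HolderConjugate.conjExponent hq
    have h2 := hc.symm.pos
    have h3 : 1 - q⁻¹ = (Real.conjExponent q)⁻¹ := hc.one_sub_inv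
    rw [h3] at ha2
    calc a * Real.conjExponent q < (Real.conjExponent q)⁻¹ * Real.conjExponent q := by gcongr
      _ = 1 := inv_mul_cancel₀ h2.ne'

end BDIS

/-! ### The mean squared error and the theorem -/

namespace BDIS

section meanSquare

variable {φ : ℝ → ℝ} (hφ : IsLightTailedDensity φ) {p : ℝ} (hp : 1 ≤ p) {s b m : ℕ} [NeZero b]
  (hb : 2 ≤ b) {Ω : Type*} [MeasurableSpace Ω] {P : Measure Ω} [IsProbabilityMeasure P]
  {perm : Fin s × List (Fin b) → Ω → Equiv.Perm (Fin b)} (hS : IsScrambling P perm)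
  {θ : Fin s → ℝ} (hθ : ∀ j, 0 < θ j ∧ θ j ≤ 1 / 2) {f : (Fin s → ℝ) → ℝ}
  {G : Finset (Fin s) → (Fin s → ℝ) → ℝ} {cζ ζ : ℝ → ℝ} (hk : KernBound φ cζ ζ)
  (hadm : ∀ v, Admissible φ ζ v (G v)) (hf : ∀ᵐ x, f x = ∑ v, rep φ v (G v) x)
  {α M : ℝ} {A : Finset (Fin s) → Fin s → ℝ → ℝ}
  (hK : IsErrKernel b α M (errKernel φ p θ) A)
  (hG : ∀ w v, v ⊆ w → Integrable (fun y => (∏ j ∈ w, A v j (y j)) * |G v y|) (prodMeasure φ s))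
include hφ hp hb hS hθ hk hadm hf hK hG

/-- The expansion of the integrand holds for almost every point of the cube, and each scrambled net
point is uniformly distributed, so almost surely it holds at all of them at once. -/
theorem sqError_ae_eq (x : Fin (b ^ m) → Fin s → ℝ) :
    (fun o => sqError φ p θ f x fun i => perm i o) =ᵐ[P]
      fun o => (((b : ℝ) ^ m) ^ 2)⁻¹ * (∑ i, ∑ w : Finset (Fin s) with w.Nonempty,
        ∑ v ∈ w.powerset, errTerm (prodMeasure φ s) (errKernel φ p θ) G w v
          (scramble (fun l => perm l o) (x i))) ^ 2 := by
  have h (i : Fin (b ^ m)) := ae_of_ae_map (measurable_scramble hS (x i)).aemeasurable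
    ((map_scramble hS hb (x i)).symm ▸ fW_sub_integral_eq hφ hk hadm hf hp hθ hK hG)
  filter_upwards [ae_all_iff.2 h] with o ho
  have hb0 : (b : ℝ) ^ m ≠ 0 := pow_ne_zero _ (by exact_mod_cast NeZero.ne b)
  simp only [← ho, Finset.sum_sub_distrib, Finset.sum_const, Finset.card_univ, Fintype.card_fin,
    nsmul_eq_mul, Nat.cast_pow]
  rw [sqError, sq_abs, estimator, ← inv_pow (_ ^ m) 2, ← mul_pow, mul_sub, inv_mul_cancel_left₀ hb0]

theorem integrable_sqError (x : Fin (b ^ m) → Fin s → ℝ) :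
    Integrable (fun o => sqError φ p θ f x fun i => perm i o) P := by
  have := hφ.isProbabilityMeasure_prodMeasure s
  have hGm : ∀ v, Measurable (G v) := fun v => (hadm v).1
  refine Integrable.congr ?_ (sqError_ae_eq hφ hp hb hS hθ hk hadm hf hK hG x).symm
  refine (MemLp.integrable_sq ?_).const_mul _
  refine memLp_finsetSum _ fun i _ => memLp_finsetSum _ fun w _ => memLp_finsetSum _ fun v hv => ?_
  have hm := measurable_scramble hS (x i)
  have hc := fun o => scramble_mem (fun l => perm l o) (x i)
  exact MemLp.of_bound ((hK.measurable_errTerm hGm w v).comp hm).aestronglyMeasurable _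
    (ae_of_all _ fun o => hK.abs_errTerm_le hG (Finset.mem_powerset.1 hv) (hc o))

theorem integral_sqError_le (hα : 0 ≤ α) {t : Finset (Fin s) → ℕ} {x : Fin (b ^ m) → Fin s → ℝ}
    (hx : ∀ w : Finset (Fin s), w.Nonempty → IsNet b (t w) m fun i (j : w) => x i j) :
    ∫ o, sqError φ p θ f x (fun i => perm i o) ∂P ≤ (((b : ℝ) ^ m) ^ 2)⁻¹ *
      ∑ w : Finset (Fin s) with w.Nonempty, netFactor b m (t w) w.card α *
        (∑ v ∈ w.powerset, ∫ y, (∏ j ∈ w, A v j (y j)) * |G v y| ∂prodMeasure φ s) ^ 2 := by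
  have := hφ.isProbabilityMeasure_prodMeasure s
  rw [integral_congr_ae (sqError_ae_eq hφ hp hb hS hθ hk hadm hf hK hG x), integral_const_mul]
  exact mul_le_mul_of_nonneg_left
    (hK.integral_sq_sum_le (fun v => (hadm v).1) hG hS hb hα hx) (by positivity)

end meanSquare

/-- The mean squared error is finite and bounded by a sum of products of the `Γ̃_j`. -/
theorem exists_mean_sqError_le {φ : ℝ → ℝ} (hφ : IsLightTailedDensity φ) {p q α ε : ℝ} (hp : 1 ≤ p)
    (hq : 1 < q) (hα0 : 0 < α) (hα1 : α < 1) (hε : 0 < ε) {b : ℕ} [NeZero b] (hb : 2 ≤ b) :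
    ∃ Cstar : ℝ, 0 < Cstar ∧ ∀ (s m : ℕ), 1 ≤ m →
      ∀ (x : Fin (b ^ m) → Fin s → ℝ) (t : Finset (Fin s) → ℕ),
      (∀ w : Finset (Fin s), w.Nonempty → IsNet b (t w) m fun i (j : w) => x i j) →
      ∀ (Ω : Type*) [MeasurableSpace Ω] (P : Measure Ω) [IsProbabilityMeasure P]
        (perm : Fin s × List (Fin b) → Ω → Equiv.Perm (Fin b)), IsScrambling P perm →
      ∀ f : (Fin s → ℝ) → ℝ, MemWmix φ q f →
      ∀ θ : Fin s → ℝ, (∀ j, 0 < θ j ∧ θ j ≤ 1 / 2) →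
      ∀ tj : Fin s → ℝ, (∀ w : Finset (Fin s), w.Nonempty → (t w : ℝ) ≤ ∑ j ∈ w, tj j) →
      ∀ Γ : Fin s → ℝ, (∀ v : Finset (Fin s), gammaCoef φ q f v ≤ ∏ j ∈ v, Γ j) →
      Integrable (fun y => f y * ∏ j, φ (y j)) ∧
      Integrable (fun o => sqError φ p θ f x fun i => perm i o) P ∧
      ∫ o, sqError φ p θ f x (fun i => perm i o) ∂P ≤
        normQ φ q f ^ 2 / ((b : ℝ) ^ m) ^ (1 + α) * ∑ w : Finset (Fin s) with w.Nonempty,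
          ∏ j ∈ w, (m : ℝ) * gammaTilde Cstar b α q ε (tj j) (Γ j) (θ j) := by
  obtain ⟨κ, a, q', hκ0, hκ1, hκ, ha0, ha, hqq, haq⟩ := exists_exponents hq hα0 hα1 hε
  obtain ⟨c, hc, hker⟩ := exists_isErrKernel hφ hp hκ0 hκ1 hα0.le hα1.le ha0 ha
  set L := (∫ y, tail φ y ^ (-(a * q')) ∂nuOf φ) ^ (1 / q') with hL
  refine ⟨4 * (b : ℝ) ^ (1 + α) * max ((c * L) ^ 2) 32, ?_, ?_⟩
  · have : (0 : ℝ) < b := by exact_mod_cast (by omega : 0 < b)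
    have := lt_of_lt_of_le (by norm_num : (0 : ℝ) < 32) (le_max_right ((c * L) ^ 2) 32)
    positivity
  intro s m hm x t hx Ω _ P _ perm hS f hf θ hθ tj htj Γ hΓ
  have ha1 : a < 1 := by nlinarith [hqq.symm.lt]
  obtain ⟨cζ, hk⟩ := hφ.exists_kernBound ha0 ha1
  obtain ⟨G, hGm, hGl, hGn, hfG⟩ := exists_anova_rep hφ hqq ha0 haq hf
  have hadm (v : Finset (Fin s)) : Admissible φ (fun y => tail φ y ^ (-a)) v (G v) :=
    admissible_of_memLp hφ hqq haq (hGm v) (hGl v)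
  obtain ⟨M, hK⟩ := hker b s θ (by omega) hθ
  have hG := integrable_prod_errBound_mul (c := c) (κ := κ) (α := α) (θ := θ) hφ hqq haq hGm hGl
  refine ⟨integrable_mul_prod_density hφ hk hadm hfG,
    integrable_sqError hφ hp hb hS hθ hk hadm hfG hK hG x,
    (integral_sqError_le hφ hp hb hS hθ hk hadm hfG hK hG hα0.le hx).trans ?_⟩
  rw [Finset.mul_sum, Finset.mul_sum]
  refine Finset.sum_le_sum fun w hw => ?_
  have hwn : w.Nonempty := (Finset.mem_filter.1 hw).2
  have hX := sq_sum_powerset_le (w := w)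
    (X := fun v => ∫ y, (∏ j ∈ w, errBound φ c κ a α θ v j (y j)) * |G v y| ∂prodMeasure φ s)
    (g := fun v => normWmix φ q (anova φ f v)) (A := fun j => c * L * θ j ^ (-(κ * (1 + α)) / 2))
    (B := fun j => √(32 * θ j ^ (1 - α))) (Γ := Γ) (N := normQ φ q f) ?_ ?_
    (normWmix_anova_sq_le hΓ)
  · have hb0 : (0 : ℝ) < (b : ℝ) ^ m := pow_pos (by exact_mod_cast (by omega : 0 < b)) _
    calc (((b : ℝ) ^ m) ^ 2)⁻¹ * (netFactor b m (t w) w.card α * _)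
        ≤ (((b : ℝ) ^ m) ^ 2)⁻¹ * ((((b : ℝ) ^ m) ^ 2 / ((b : ℝ) ^ m) ^ (1 + α) *
          ∏ j ∈ w, (2 * m * (b : ℝ) ^ (1 + α) * (b : ℝ) ^ ((1 + α) * tj j))) *
          (normQ φ q f ^ 2 * ∏ j ∈ w, 2 * ((c * L * θ j ^ (-(κ * (1 + α)) / 2)) ^ 2 * Γ j ^ 2 +
            √(32 * θ j ^ (1 - α)) ^ 2))) := by
          -- The net factor carries `n²`, which cancels the normalisation of the average and leaves
          -- `n^(-1-α)`.
          refine mul_le_mul_of_nonneg_left (mul_le_mul (netFactor_le (by omega) hm hα0.le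
            (htj w hwn)) hX (sq_nonneg _) ?_) (by positivity)
          positivity
      _ = normQ φ q f ^ 2 / ((b : ℝ) ^ m) ^ (1 + α) *
          ∏ j ∈ w, (2 * m * (b : ℝ) ^ (1 + α) * (b : ℝ) ^ ((1 + α) * tj j) *
            (2 * ((c * L * θ j ^ (-(κ * (1 + α)) / 2)) ^ 2 * Γ j ^ 2 +
            √(32 * θ j ^ (1 - α)) ^ 2))) := by
          rw [Finset.prod_mul_distrib (s := w) (f := fun j => 2 * m * (b : ℝ) ^ (1 + α) *
            (b : ℝ) ^ ((1 + α) * tj j))]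
          field_simp
      _ ≤ _ := by
          refine mul_le_mul_of_nonneg_left (Finset.prod_le_prod (fun j _ => ?_) fun j _ => ?_)
            (by positivity)
          · positivity
          · exact gammaTilde_bound (by positivity) (hθ j).1 (by linarith [(hθ j).2]) hκ
  · intro v _
    refine integral_nonneg fun y => mul_nonneg (Finset.prod_nonneg fun j _ => ?_) (abs_nonneg _)
    rw [errBound]
    have h1 := (hθ j).1
    have h2 := hφ.tail_pos (y j)
    split_ifs <;> positivity
  · intro v hv
    have hpos : 0 ≤ (∏ j ∈ v, c * L * θ j ^ (-(κ * (1 + α)) / 2)) *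
        (∏ j ∈ w \ v, √(32 * θ j ^ (1 - α))) :=
      mul_nonneg (Finset.prod_nonneg fun j _ => mul_nonneg (mul_nonneg hc.le
        (Real.rpow_nonneg (integral_nonneg fun y => Real.rpow_nonneg (hφ.tail_pos y).le _) _))
        (Real.rpow_nonneg (hθ j).1.le _)) (Finset.prod_nonneg fun j _ => Real.sqrt_nonneg _)
    exact (integral_prod_errBound_mul_le hφ hqq haq hc.le (fun j => (hθ j).1) (hGl v)
      (Finset.mem_powerset.1 hv)).trans (mul_le_mul_of_nonneg_left (hGn v) hpos)

end BDIS

/-- In the statement `Clam lam` depends on `lam` only, `Cstar` only on `φ, p, q, b, α, ε`, and `K`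
only on the latter, `lam`, the bound `B` on `S_λ`, and `δ`; none depends on the dimension `s`. -/
theorem mainTheorem2 :
    ∃ Clam : ℝ → ℝ, (∀ lam, 0 < lam → lam < 1 → 0 < Clam lam) ∧
    ∀ φ : ℝ → ℝ, BDIS.IsLightTailedDensity φ →
    ∀ (p q α ε : ℝ) (b : ℕ) [NeZero b], 1 ≤ p → 1 < q → 0 < α → α < 1 → 0 < ε → 2 ≤ b →
    ∃ Cstar : ℝ, 0 < Cstar ∧ ∃ K : ℝ → ℝ → ℝ → ℝ,
    ∀ (s m : ℕ), 1 ≤ m →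
    -- the net, with its `t`-quality parameters `t w`
    ∀ (x : Fin (b ^ m) → Fin s → ℝ) (t : Finset (Fin s) → ℕ),
      (∀ w : Finset (Fin s), w.Nonempty → BDIS.IsNet b (t w) m fun i (j : w) => x i j) →
    -- its scrambling
    ∀ (Ω : Type*) [MeasurableSpace Ω] (P : Measure Ω) [IsProbabilityMeasure P]
      (perm : Fin s × List (Fin b) → Ω → Equiv.Perm (Fin b)), BDIS.IsScrambling P perm →
    ∀ (f : (Fin s → ℝ) → ℝ), BDIS.MemWmix φ q f →
    ∀ (θ : Fin s → ℝ), (∀ j, 0 < θ j ∧ θ j ≤ 1 / 2) →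
    ∀ (tj : Fin s → ℝ), (∀ w : Finset (Fin s), w.Nonempty → (t w : ℝ) ≤ ∑ j ∈ w, tj j) →
    ∀ (Γ : Fin s → ℝ), (∀ v : Finset (Fin s), BDIS.gammaCoef φ q f v ≤ ∏ j ∈ v, Γ j) →
    Integrable (fun y => f y * ∏ j, φ (y j)) ∧
    Integrable (fun o => BDIS.sqError φ p θ f x fun i => perm i o) P ∧
    ∀ lam : ℝ, 0 < lam → lam < 1 →
      ∫ o, BDIS.sqError φ p θ f x (fun i => perm i o) ∂P ≤
        BDIS.normQ φ q f ^ 2 / ((b : ℝ) ^ m) ^ (1 + α) *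
          Real.exp (Clam lam * BDIS.sumS Cstar b α q ε tj Γ θ lam * (m : ℝ) ^ lam) ∧
      ∀ B δ : ℝ, 0 < δ → BDIS.sumS Cstar b α q ε tj Γ θ lam ≤ B →
        ∫ o, BDIS.sqError φ p θ f x (fun i => perm i o) ∂P ≤
          K lam B δ * BDIS.normQ φ q f ^ 2 * ((b : ℝ) ^ m) ^ (-(1 + α) + δ) := by
  -- `C_λ = 1/λ`, from `one_add_le_exp_rpow`.
  refine ⟨fun lam => lam⁻¹, fun lam h _ => inv_pos.2 h, ?_⟩
  intro φ hφ p q α ε b _ hp hq hα0 hα1 hε hb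
  obtain ⟨Cstar, hC, hmain⟩ := BDIS.exists_mean_sqError_le hφ hp hq hα0 hα1 hε hb
  -- The exponential of what remains after `mul_rpow_le_add` absorbs `(B/λ) m^λ` into `δ m log b`,
  -- where `exp(δ m log b) = n^δ`. Replacing `B` by `max B 1` provides the positivity that lemma
  -- needs.
  refine ⟨Cstar, hC, fun lam B δ => Real.exp ((max B 1 / lam) *
    ((max B 1 / lam / (δ * Real.log b)) ^ (1 / (1 - lam))) ^ lam), ?_⟩
  intro s m hm x t hx Ω _ P _ perm hS f hf θ hθ tj htj Γ hΓ
  obtain ⟨h1, h2, h3⟩ := hmain s m hm x t hx Ω P perm hS f hf θ hθ tj htj Γ hΓ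
  refine ⟨h1, h2, fun lam hl0 hl1 => ?_⟩
  have hb1 : (1 : ℝ) < b := by exact_mod_cast (by omega : 1 < b)
  have hbm : (0 : ℝ) < (b : ℝ) ^ m := pow_pos (by linarith) _
  have hγ (j : Fin s) : 0 ≤ BDIS.gammaTilde Cstar b α q ε (tj j) (Γ j) (θ j) :=
    BDIS.gammaTilde_nonneg hC.le b α q ε (tj j) (Γ j) (hθ j).1
  have hfirst : ∫ o, BDIS.sqError φ p θ f x (fun i => perm i o) ∂P ≤
      BDIS.normQ φ q f ^ 2 / ((b : ℝ) ^ m) ^ (1 + α) *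
        Real.exp (lam⁻¹ * BDIS.sumS Cstar b α q ε tj Γ θ lam * (m : ℝ) ^ lam) := by
    refine h3.trans (mul_le_mul_of_nonneg_left ((BDIS.sum_nonempty_prod_le_exp
      (fun j => mul_nonneg (Nat.cast_nonneg m) (hγ j)) hl0 hl1.le).trans_eq ?_) (by positivity))
    have e (j : Fin s) := Real.mul_rpow (z := lam) (Nat.cast_nonneg (α := ℝ) m) (hγ j)
    simp only [e, ← Finset.mul_sum]
    rw [BDIS.sumS]
    congr 1
    field_simp
  refine ⟨hfirst, fun B δ hδ hB => hfirst.trans ?_⟩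
  have hlog : 0 < Real.log b := Real.log_pos hb1
  have hexp : lam⁻¹ * BDIS.sumS Cstar b α q ε tj Γ θ lam * (m : ℝ) ^ lam
      ≤ δ * Real.log b * m + max B 1 / lam *
        ((max B 1 / lam / (δ * Real.log b)) ^ (1 / (1 - lam))) ^ lam := by
    refine le_trans ?_ (BDIS.mul_rpow_le_add (by positivity) (by positivity) hl0 hl1
      (Nat.cast_nonneg m))
    rw [inv_mul_eq_div]
    gcongr
    exact hB.trans (le_max_left _ _)
  have hpow : Real.exp (δ * Real.log b * m) = ((b : ℝ) ^ m) ^ δ := by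
    rw [Real.rpow_def_of_pos hbm, Real.log_pow]
    ring_nf
  calc BDIS.normQ φ q f ^ 2 / ((b : ℝ) ^ m) ^ (1 + α) *
        Real.exp (lam⁻¹ * BDIS.sumS Cstar b α q ε tj Γ θ lam * (m : ℝ) ^ lam)
      ≤ BDIS.normQ φ q f ^ 2 / ((b : ℝ) ^ m) ^ (1 + α) * (((b : ℝ) ^ m) ^ δ *
        Real.exp (max B 1 / lam *
          ((max B 1 / lam / (δ * Real.log b)) ^ (1 / (1 - lam))) ^ lam)) := by
        rw [← hpow, ← Real.exp_add]
        gcongr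
    _ = _ := by
        rw [Real.rpow_add hbm (-(1 + α)) δ, Real.rpow_neg hbm.le]
        ring
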